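/- **Setting.** In two space dimensions consider the plasma-vacuum problem with interface $x_2=\zeta(t,x_1)$. In the plasma $\{x_2>\zeta\}$ the unknown $U=({\bf v},{\bf B},q)$ solves incompressible MHD, $$\partial_t{\bf v}+({\bf v}\cdot\nabla){\bf v}-({\bf B}\cdot\nabla){\bf B}+\nabla q=0,\quad \partial_t{\bf B}+({\bf v}\cdot\nabla){\bf B}-({\bf B}\cdot\nabla){\bf v}=0,\quad \operatorname{div}{\bf v}=\operatorname{div}{\bf B}=0;$$ in the vacuum $\{x_2<\zeta\}$ the unknown $V=(H_1,H_2,E)$ solves the Maxwell equations $$\nu\partial_tH_1+\partial_2E=0,\quad \nu\partial_tH_2-\partial_1E=0,\quad \nu\partial_tE-\partial_1H_2+\partial_2H_1=0,\quad \partial_1H_1+\partial_2H_2=0;$$ and on $x_2=\zeta$, with $N=(-\partial_1\zeta,1)$, $$\partial_t\zeta={\bf v}\cdot N,\quad q=\tfrac12(H_1^2+H_2^2-E^2),\quad {\bf B}\cdot N={\bf H}\cdot N=0,\quad E=\nu\,\partial_t\zeta\,H_1 .$$ Let $U^0=(v^0_1,0,B^0_1,0,\tfrac12(H^0_1)^2)$,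 $V^0=(H^0_1,0,0)$ with $\nu>0$, $H_1^0\neq0$; require $U\to U^0$ as $x_2\to+\infty$ and $V\to V^0$ as $x_2\to-\infty$. Put $w=\lambda-v_1^0$, $d=w^2-(B^0_1)^2$, $\sigma=\sqrt{1-\nu^2\lambda^2}$ and let $\lambda$ be a real root of the dispersion relation $d=(H_1^0)^2\sigma$ with $\nu|\lambda|<1$ (then $d>0$ and $w\ne0$). Put $c=2w/d+\nu^2\lambda/\sigma^2$; it vanishes exactly when $\lambda$ is a double root. Let $\theta=x_1-\lambda t$, $\tau=\varepsilon t$, $\eta=x_2-\varepsilon\varphi(\theta,\tau;\varepsilon)$ and $\zeta(t,x_1)=\varepsilon\varphi(x_1-\lambda t,\varepsilon t;\varepsilon)$. Let $\tau$ range over a bounded open interval $S$. An *expansion* consists of real functions $\varphi^{(1)},\varphi^{(2)}$ of $(\theta,\tau)$, and $U^{(1)},U^{(2)}$ of $(\theta,\eta,\tau)$ for $\eta\ge0$, $V^{(1)},V^{(2)}$ for $\eta\le0$, each written as $f=\int_{\mathbb R}\hat f(k,\cdot)e^{ik\theta}\,dk$. Here, for a.e. $k$, $\hat\varphi^{(j)}$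 is $C^2$ in $\tau$, and for all $m$ and all $n\le2$, $|k|^m|\partial_\tau^n\hat\varphi^{(j)}|$ is dominated, uniformly in $\tau$, by an integrable function of $k$; and $\hat U^{(j)},\hat V^{(j)}$ are continuous in $(\eta,\tau)$, $C^1$ for $\eta\ne0$, with $(1+|k|)|\hat f|$, $|\partial_\eta\hat f|$, $|\partial_\tau\hat f|$ dominated, uniformly in $(\eta,\tau)$, by an integrable function of $k$. Families $U,V,\varphi$ depending on small $\varepsilon>0$ *have this expansion* if $$U=U^0+\varepsilon U^{(1)}+\varepsilon^2U^{(2)}+O(\varepsilon^3),\quad V=V^0+\varepsilon V^{(1)}+\varepsilon^2V^{(2)}+O(\varepsilon^3),\quad \varphi=\varphi^{(1)}+\varepsilon\varphi^{(2)}+O(\varepsilon^2)$$ uniformly, with their first derivatives in $(\theta,\eta,\tau)$. They *solve the problem up to $O(\varepsilon^3)$* if for small $\varepsilon$ and $\varepsilon t\in S$ they are, in the variables $(t,x_1,x_2)$, continuous up to the interface, differentiable inside, have the limits $U^0,V^0$, and satisfy every equation and every interface condition with an error at most $C\varepsilon^3$ (exact solutions are included). *Formulas.* Write $\hat\varphi=\hat\varphi^{(1)}$,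 $\hat\psi=\hat\varphi^{(2)}$, and $$\langle K\rangle=\int_{\mathbb R}K(k,\ell)\,\hat\varphi(k-\ell,\tau)\hat\varphi(\ell,\tau)\,d\ell,\qquad {\bf R}=(w,iw,-B^0_1,-iB^0_1,d),\qquad {\bf L}=-\tfrac{1}{2idw}{\bf R}.$$ First order, for a.e. $k$: $$\hat U^{(1)}=-|k|\hat\varphi\,e^{-|k|\eta}\,{\bf R}\ (k>0),\quad -|k|\hat\varphi\,e^{-|k|\eta}\,\overline{\bf R}\ (k<0),\qquad \hat V^{(1)}=H^0_1\hat\varphi\,e^{\sigma|k|\eta}\,(-\sigma|k|,\,ik,\,-i\nu\lambda k).$$ Let $\hat p=(\hat p_{11},\hat p_{12},\hat p_{21},\hat p_{22},\hat p_3)$ with $$\hat p_{11}=-w|k|e^{-|k|\eta}\hat\varphi_\tau-id\,\langle|k-\ell|\,\ell\,(|k-\ell|-|\ell|)e^{-(|k-\ell|+|\ell|)\eta}\rangle,$$ $$\hat p_{12}=-iwke^{-|k|\eta}\hat\varphi_\tau+d\,\langle(k-\ell)\ell|\ell|(e^{-(|k-\ell|+|\ell|)\eta}-e^{-|\ell|\eta})\rangle-d\,\langle|k-\ell|\ell^2e^{-(|k-\ell|+|\ell|)\eta}\rangle,$$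 $$\hat p_{21}=B^0_1|k|e^{-|k|\eta}\hat\varphi_\tau,\quad \hat p_{22}=iB^0_1ke^{-|k|\eta}\hat\varphi_\tau,\quad \hat p_3=-iw\,\langle(k-\ell)\ell^2e^{-|\ell|\eta}\rangle.$$ Second order in the plasma: with ${\bf L}_1=\frac1d(-iw,0,iB^0_1,0,0)$, ${\bf L}_3=\frac1d(iB^0_1,0,-iw,0,0)$, ${\bf L}_4=(0,0,0,-\frac iw,0)$, $$\hat U^{(2)}=\tfrac1k({\bf L}_1\!\cdot\hat p,\,0,\,{\bf L}_3\!\cdot\hat p,\,{\bf L}_4\!\cdot\hat p,\,0)+a{\bf R}+b\overline{\bf R},$$ $$a=e^{-k\eta}\Big(a_0+\int_0^\eta{\bf L}\cdot\hat p(k,y,\tau)\,e^{ky}dy\Big),\qquad b=e^{k\eta}\Big(b_0+\int_0^\eta\overline{\bf L}\cdot\hat p(k,y,\tau)\,e^{-ky}dy\Big),$$ where, with $\hat r_1=\hat\varphi_\tau-iw\langle|k-\ell|\ell\rangle$: for $k>0$, $b_0=-\int_0^\infty\overline{\bf L}\cdot\hat p\,e^{-ky}dy$ and $a_0=\frac{\hat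 r_1}{iw}+b_0-k\hat\psi$; for $k<0$, $a_0=-\int_0^\infty{\bf L}\cdot\hat p\,e^{ky}dy$ and $b_0=k\hat\psi-\frac{\hat r_1}{iw}+a_0$. Second order in vacuum: with $$Q(k,y,\tau)=2\nu^2\lambda H^0_1k^2e^{\sigma|k|y}\hat\varphi_\tau-i\sigma^3H^0_1\langle(k^2-\ell^2)\ell|\ell|e^{\sigma|\ell|y}\rangle,\qquad G[F](\eta)=\int_{-\infty}^0e^{-\sigma|k||\eta-y|}F(y)\,dy,$$ $$A=i\sigma H^0_1\langle|k-\ell|\ell\rangle-\frac{G[Q](0)}{2|k|\sigma}-iH^0_1k\hat\psi,$$ $$\hat H_1^{(2)}=-i\sigma\,\mathrm{sgn}(k)Ae^{\sigma|k|\eta}+\frac{G[\partial_yQ](\eta)-e^{\sigma|k|\eta}Q(k,0,\tau)}{2ik|k|\sigma}-\frac{\sigma^2H_1^0}{k}\langle(k-\ell)\ell^2e^{\sigma|\ell|\eta}\rangle,$$ $$\hat H_2^{(2)}=-Ae^{\sigma|k|\eta}-\frac{G[Q](\eta)}{2|k|\sigma},\qquad \hat E^{(2)}=(\nu\lambda A+\nu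 H^0_1\hat\varphi_\tau)e^{\sigma|k|\eta}+\nu\lambda\frac{G[Q](\eta)}{2|k|\sigma}.$$ **Theorem 5.1.** 1. If families $U,V,\varphi$ have an expansion as above and solve the problem up to $O(\varepsilon^3)$ (in particular, if they solve it exactly), then $\hat U^{(1)},\hat V^{(1)},\hat U^{(2)},\hat V^{(2)}$ are given by the formulas above; the interface is $x_2=\varepsilon\varphi^{(1)}(x_1-\lambda t,\varepsilon t)+O(\varepsilon^2)$, uniformly for $\varepsilon t\in S$; and for every $\tau\in S$ and a.e. $k$ the leading profile satisfies the amplitude equation $$c\,\hat\varphi^{(1)}_\tau(k,\tau)-i(1+\sigma)\,\mathrm{sgn}(k)\int_{\mathbb R}\Lambda(k-\ell,\ell)\,\hat\varphi^{(1)}(k-\ell,\tau)\,\hat\varphi^{(1)}(\ell,\tau)\,d\ell=0,\qquad \Lambda(k,\ell)=\frac{2|k+\ell||k||\ell|}{|k+\ell|+|k|+|\ell|}.\tag{$*$}$$ 2. Conversely, let $\varphi^{(1)},\varphi^{(2)}$ be as above, with $\varphi^{(1)}$ a solution of $(*)$ and $\varphi^{(2)}$ arbitrary. Then the formulas define the terms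 of an expansion, with the stated regularity, and the truncated sums $U^0+\varepsilon U^{(1)}+\varepsilon^2U^{(2)}$, $V^0+\varepsilon V^{(1)}+\varepsilon^2V^{(2)}$, $\varphi^{(1)}+\varepsilon\varphi^{(2)}$ solve the problem up to $O(\varepsilon^3)$. 3. Let $c\ne0$ and let $\varphi^{(1)}$ be as above. Then $(*)$ is equivalent to each of the following, on the corresponding intervals of $s$. With $\hat\phi(k,s)=\hat\varphi^{(1)}(k,-\tfrac{c}{1+\sigma}s)$: $$\hat\phi_s(k,s)+i\,\mathrm{sgn}(k)\int_{\mathbb R}\Lambda(k-\ell,\ell)\hat\phi(k-\ell,s)\hat\phi(\ell,s)\,d\ell=0\quad\text{for a.e. }k.$$ With $\phi(x,s)=\varphi^{(1)}(x,\tfrac{c}{1+\sigma}s)$: $$\phi_s+\tfrac12\mathbb H[\Phi^2]_{xx}+\Phi\phi_{xx}=0,\qquad \Phi=\mathbb H[\phi],\qquad \mathbb H[f](x)=\frac1\pi\,\mathrm{p.v.}\!\int_{-\infty}^{\infty}\frac{f(y)}{x-y}\,dy .$$ -/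

import Mathlib

open MeasureTheory Filter Topology Set

noncomputable section

namespace PlasmaVacuum

/-! ## The free boundary problem in physical variables

Points of space-time are triples `(t, x₁, x₂)`; an interface is the graph `x₂ = ζ (t, x₁)`, with
plasma above and vacuum below it.
A plasma state is `u = (v₁, v₂, B₁, B₂, q)`, a vacuum state is `w = (H₁, H₂, E)`. -/

/-- Partial derivative in `t`. -/
def dt (f : ℝ × ℝ × ℝ → ℝ) (x : ℝ × ℝ × ℝ) : ℝ := fderiv ℝ f x (1, 0, 0)

/-- Partial derivative in `x₁`. -/
def dx (f : ℝ × ℝ × ℝ → ℝ) (x : ℝ × ℝ × ℝ) : ℝ := fderiv ℝ f x (0, 1, 0)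

/-- Partial derivative in `x₂`. -/
def dy (f : ℝ × ℝ × ℝ → ℝ) (x : ℝ × ℝ × ℝ) : ℝ := fderiv ℝ f x (0, 0, 1)

/-- `a₁ ∂₁ f + a₂ ∂₂ f`. -/
def advect (a₁ a₂ f : ℝ × ℝ × ℝ → ℝ) (x : ℝ × ℝ × ℝ) : ℝ := a₁ x * dx f x + a₂ x * dy f x

/-- Left-hand sides of the incompressible MHD system, with both divergence constraints:
momentum (two components), induction (two components), `div v`, `div B`. -/
def mhd (u : Fin 5 → ℝ × ℝ × ℝ → ℝ) (x : ℝ × ℝ × ℝ) : Fin 6 → ℝ :=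
  ![dt (u 0) x + advect (u 0) (u 1) (u 0) x - advect (u 2) (u 3) (u 2) x + dx (u 4) x,
    dt (u 1) x + advect (u 0) (u 1) (u 1) x - advect (u 2) (u 3) (u 3) x + dy (u 4) x,
    dt (u 2) x + advect (u 0) (u 1) (u 2) x - advect (u 2) (u 3) (u 0) x,
    dt (u 3) x + advect (u 0) (u 1) (u 3) x - advect (u 2) (u 3) (u 1) x,
    dx (u 0) x + dy (u 1) x,
    dx (u 2) x + dy (u 3) x]

/-- Left-hand sides of the two-dimensional Maxwell system, with the constraint `div H = 0`. -/
def maxwell (ν : ℝ) (w : Fin 3 → ℝ × ℝ × ℝ → ℝ) (x : ℝ × ℝ × ℝ) : Fin 4 → ℝ :=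
  ![ν * dt (w 0) x + dy (w 2) x,
    ν * dt (w 1) x - dx (w 2) x,
    ν * dt (w 2) x - dx (w 1) x + dy (w 0) x,
    dx (w 0) x + dy (w 1) x]

/-- Differences of the two sides of the interface conditions
`∂ₜζ = v·N`, `q = (H₁² + H₂² - E²)/2`, `B·N = 0`, `H·N = 0`, `E = ν ∂ₜζ H₁`, where
`N = (-∂₁ζ, 1)`, at the point of the interface over `y = (t, x₁)`. -/
def jump (ν : ℝ) (u : Fin 5 → ℝ × ℝ × ℝ → ℝ) (w : Fin 3 → ℝ × ℝ × ℝ → ℝ) (ζ : ℝ × ℝ → ℝ)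
    (y : ℝ × ℝ) : Fin 5 → ℝ :=
  let x : ℝ × ℝ × ℝ := (y.1, y.2, ζ y)
  let ζt : ℝ := fderiv ℝ ζ y (1, 0)
  let ζx : ℝ := fderiv ℝ ζ y (0, 1)
  ![ζt - (u 1 x - ζx * u 0 x),
    u 4 x - (w 0 x ^ 2 + w 1 x ^ 2 - w 2 x ^ 2) / 2,
    u 3 x - ζx * u 2 x,
    w 1 x - ζx * w 0 x,
    w 2 x - ν * ζt * w 0 x]

/-- `(u, w, ζ)` is a classical solution, up to an error of size at most `δ` in every equation and
every interface condition, of the plasma-vacuum problem for times in `J`, with limits `U₀`, `V₀` as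
`x₂ → ±∞`. For `δ = 0` this is an exact solution. -/
structure SolvesUpTo (δ ν : ℝ) (J : Set ℝ) (U₀ : Fin 5 → ℝ) (V₀ : Fin 3 → ℝ)
    (u : Fin 5 → ℝ × ℝ × ℝ → ℝ) (w : Fin 3 → ℝ × ℝ × ℝ → ℝ) (ζ : ℝ × ℝ → ℝ) : Prop where
  interface_diff : DifferentiableOn ℝ ζ {y | y.1 ∈ J}
  plasma_cont : ∀ i, ContinuousOn (u i) {x | x.1 ∈ J ∧ ζ (x.1, x.2.1) ≤ x.2.2}
  plasma_diff : ∀ i, DifferentiableOn ℝ (u i) {x | x.1 ∈ J ∧ ζ (x.1, x.2.1) < x.2.2}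
  vacuum_cont : ∀ i, ContinuousOn (w i) {x | x.1 ∈ J ∧ x.2.2 ≤ ζ (x.1, x.2.1)}
  vacuum_diff : ∀ i, DifferentiableOn ℝ (w i) {x | x.1 ∈ J ∧ x.2.2 < ζ (x.1, x.2.1)}
  plasma_eq : ∀ x : ℝ × ℝ × ℝ, x.1 ∈ J → ζ (x.1, x.2.1) < x.2.2 → ∀ j, |mhd u x j| ≤ δ
  vacuum_eq : ∀ x : ℝ × ℝ × ℝ, x.1 ∈ J → x.2.2 < ζ (x.1, x.2.1) → ∀ j, |maxwell ν w x j| ≤ δ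
  interface_eq : ∀ y : ℝ × ℝ, y.1 ∈ J → ∀ j, |jump ν u w ζ y j| ≤ δ
  plasma_lim : ∀ i, ∀ t ∈ J, ∀ x₁ : ℝ,
    Tendsto (fun x₂ : ℝ => u i (t, x₁, x₂)) atTop (𝓝 (U₀ i))
  vacuum_lim : ∀ i, ∀ t ∈ J, ∀ x₁ : ℝ,
    Tendsto (fun x₂ : ℝ => w i (t, x₁, x₂)) atBot (𝓝 (V₀ i))

/-! ## Basic state and dispersion relation -/

/-- The parameter `ν`, the constants `v₁⁰, B₁⁰, H₁⁰` of the basic state, the phase velocity. -/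
structure Params where
  nu : ℝ
  v0 : ℝ
  B0 : ℝ
  H0 : ℝ
  lam : ℝ

namespace Params
variable (p : Params)

/-- The basic plasma state. -/
def U0 : Fin 5 → ℝ := ![p.v0, 0, p.B0, 0, p.H0 ^ 2 / 2]

/-- The basic vacuum state. -/
def V0 : Fin 3 → ℝ := ![p.H0, 0, 0]

/-- `λ - v₁⁰`. -/
def w : ℝ := p.lam - p.v0

/-- `d = (λ - v₁⁰)² - (B₁⁰)²`. -/
def d : ℝ := p.w ^ 2 - p.B0 ^ 2

/-- `σ(λ) = √(1 - ν²λ²)`. -/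
def sigma : ℝ := Real.sqrt (1 - p.nu ^ 2 * p.lam ^ 2)

/-- The coefficient `2 (λ - v₁⁰)/d + ν²λ/σ(λ)²` of the time derivative in the amplitude equation.
It vanishes precisely when `λ` is a double root of the dispersion relation. -/
def c : ℝ := 2 * p.w / p.d + p.nu ^ 2 * p.lam / p.sigma ^ 2

end Params

/-! ## Asymptotic expansions

Straightened variables are `(θ, η, τ) = (x₁ - λt, x₂ - εφ, εt)`. -/

/-- A function of the straightened variables, in physical variables. -/
def toPhysical (lam ε : ℝ) (φ : ℝ × ℝ → ℝ) (f : ℝ × ℝ × ℝ → ℝ) (x : ℝ × ℝ × ℝ) : ℝ :=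
  f (x.2.1 - lam * x.1, x.2.2 - ε * φ (x.2.1 - lam * x.1, ε * x.1), ε * x.1)

/-- The interface `ζ (t, x₁) = ε φ (x₁ - λt, εt)`. -/
def interface (lam ε : ℝ) (φ : ℝ × ℝ → ℝ) (y : ℝ × ℝ) : ℝ :=
  ε * φ (y.2 - lam * y.1, ε * y.1)

/-- The real function `φ (θ, τ)`, `τ ∈ S`, is smooth in the following sense: it has the Fourier
representation `φ (θ, τ) = ∫ φh k τ e^{ikθ} dk`, where `φh` is twice continuously differentiable in
`τ`, rapidly decreasing in `k` in the sense of `L¹`, uniformly in `τ`. (The normalization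
is that of `φh k τ = (2π)⁻¹ ∫ φ (θ, τ) e^{-ikθ} dθ`.) -/
structure IsProfile (S : Set ℝ) (φ : ℝ × ℝ → ℝ) (φh : ℝ → ℝ → ℂ) : Prop where
  repr : ∀ θ : ℝ, ∀ τ ∈ S,
    (φ (θ, τ) : ℂ) = ∫ k : ℝ, φh k τ * Complex.exp (Complex.I * k * θ)
  meas : ∀ τ ∈ S, AEStronglyMeasurable (fun k => φh k τ) volume
  smooth : ∀ᵐ k : ℝ, ContDiffOn ℝ 2 (φh k) S
  bound : ∀ m n : ℕ, n ≤ 2 → ∃ g : ℝ → ℝ, Integrable g ∧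
    ∀ᵐ k : ℝ, ∀ τ ∈ S, |k| ^ m * ‖iteratedDeriv n (φh k) τ‖ ≤ g k

/-- The real function `f (θ, η, τ)`, `η ∈ D`, `τ ∈ S`, has the Fourier representation
`f (θ, η, τ) = ∫ fh k η τ e^{ikθ} dk`, where `fh` is continuous in `(η, τ)`, is continuously
differentiable at interior points, and `(1 + |k|) fh`, `∂_η fh`, `∂_τ fh` are dominated by an
integrable function of `k`. -/
structure IsWaveField (D S : Set ℝ) (f : ℝ × ℝ × ℝ → ℝ) (fh : ℝ → ℝ → ℝ → ℂ) : Prop where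
  repr : ∀ θ : ℝ, ∀ η ∈ D, ∀ τ ∈ S,
    (f (θ, η, τ) : ℂ) = ∫ k : ℝ, fh k η τ * Complex.exp (Complex.I * k * θ)
  meas : ∀ η ∈ D, ∀ τ ∈ S, AEStronglyMeasurable (fun k => fh k η τ) volume
  cont : ∀ᵐ k : ℝ, ContinuousOn (fun z : ℝ × ℝ => fh k z.1 z.2) (D ×ˢ S)
  smooth : ∀ᵐ k : ℝ, ContDiffOn ℝ 1 (fun z : ℝ × ℝ => fh k z.1 z.2) (interior D ×ˢ S)
  bound : ∃ g : ℝ → ℝ, Integrable g ∧ ∀ᵐ k : ℝ,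
    (∀ η ∈ D, ∀ τ ∈ S, (1 + |k|) * ‖fh k η τ‖ ≤ g k) ∧
    (∀ η ∈ interior D, ∀ τ ∈ S,
      ‖deriv (fun y => fh k y τ) η‖ ≤ g k ∧ ‖deriv (fun s => fh k η s) τ‖ ≤ g k)

/-- The terms of a two-term expansion, with their Fourier transforms in `θ`. -/
structure Terms where
  phi1 : ℝ × ℝ → ℝ
  phi2 : ℝ × ℝ → ℝ
  U1 : Fin 5 → ℝ × ℝ × ℝ → ℝ
  U2 : Fin 5 → ℝ × ℝ × ℝ → ℝ
  V1 : Fin 3 → ℝ × ℝ × ℝ → ℝ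
  V2 : Fin 3 → ℝ × ℝ × ℝ → ℝ
  phi1h : ℝ → ℝ → ℂ
  phi2h : ℝ → ℝ → ℂ
  U1h : Fin 5 → ℝ → ℝ → ℝ → ℂ
  U2h : Fin 5 → ℝ → ℝ → ℝ → ℂ
  V1h : Fin 3 → ℝ → ℝ → ℝ → ℂ
  V2h : Fin 3 → ℝ → ℝ → ℝ → ℂ

/-- Regularity of the terms for slow times in `S`. -/
structure Terms.Regular (X : Terms) (S : Set ℝ) : Prop where
  phi1 : IsProfile S X.phi1 X.phi1h
  phi2 : IsProfile S X.phi2 X.phi2h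
  U1 : ∀ i, IsWaveField (Ici 0) S (X.U1 i) (X.U1h i)
  U2 : ∀ i, IsWaveField (Ici 0) S (X.U2 i) (X.U2h i)
  V1 : ∀ i, IsWaveField (Iic 0) S (X.V1 i) (X.V1h i)
  V2 : ∀ i, IsWaveField (Iic 0) S (X.V2 i) (X.V2h i)

/-- The truncated expansion of `U`. -/
def Terms.truncU (X : Terms) (p : Params) (ε : ℝ) (i : Fin 5) (z : ℝ × ℝ × ℝ) : ℝ :=
  p.U0 i + ε * X.U1 i z + ε ^ 2 * X.U2 i z

/-- The truncated expansion of `V`. -/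
def Terms.truncV (X : Terms) (p : Params) (ε : ℝ) (i : Fin 3) (z : ℝ × ℝ × ℝ) : ℝ :=
  p.V0 i + ε * X.V1 i z + ε ^ 2 * X.V2 i z

/-- The truncated expansion of `φ`. -/
def Terms.truncPhi (X : Terms) (ε : ℝ) (z : ℝ × ℝ) : ℝ :=
  X.phi1 z + ε * X.phi2 z

/-- `|f| ≤ δ` on `D`, and `f` is differentiable with `‖Df‖ ≤ δ` in the interior of `D`. -/
def C1Small {E : Type*} [NormedAddCommGroup E] [NormedSpace ℝ E] (D : Set E) (δ : ℝ)
    (f : E → ℝ) : Prop :=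
  (∀ z ∈ D, |f z| ≤ δ) ∧ ∀ z ∈ interior D, DifferentiableAt ℝ f z ∧ ‖fderiv ℝ f z‖ ≤ δ

/-- The families `U`, `V`, `φ` (indexed by `ε`; functions of the straightened variables) have the
expansions `U = U⁰ + εU⁽¹⁾ + ε²U⁽²⁾ + O(ε³)`, `V = V⁰ + εV⁽¹⁾ + ε²V⁽²⁾ + O(ε³)`,
`φ = φ⁽¹⁾ + εφ⁽²⁾ + O(ε²)`, together with their first derivatives. -/
def HasExpansion (p : Params) (S : Set ℝ) (U : ℝ → Fin 5 → ℝ × ℝ × ℝ → ℝ)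
    (V : ℝ → Fin 3 → ℝ × ℝ × ℝ → ℝ) (φ : ℝ → ℝ × ℝ → ℝ) (X : Terms) : Prop :=
  ∃ C : ℝ, ∃ ε₀ > 0, ∀ ε : ℝ, 0 < ε → ε < ε₀ →
    (∀ i, C1Small {z : ℝ × ℝ × ℝ | 0 ≤ z.2.1 ∧ z.2.2 ∈ S} (C * ε ^ 3)
      (fun z => U ε i z - X.truncU p ε i z)) ∧
    (∀ i, C1Small {z : ℝ × ℝ × ℝ | z.2.1 ≤ 0 ∧ z.2.2 ∈ S} (C * ε ^ 3)
      (fun z => V ε i z - X.truncV p ε i z)) ∧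
    C1Small {z : ℝ × ℝ | z.2 ∈ S} (C * ε ^ 2) (fun z => φ ε z - X.truncPhi ε z)

/-- The families `U`, `V`, `φ` solve the plasma-vacuum problem up to `O(ε³)`, for slow times
`εt ∈ S`. -/
def SolvesAsymptotically (p : Params) (S : Set ℝ) (U : ℝ → Fin 5 → ℝ × ℝ × ℝ → ℝ)
    (V : ℝ → Fin 3 → ℝ × ℝ × ℝ → ℝ) (φ : ℝ → ℝ × ℝ → ℝ) : Prop :=
  ∃ C : ℝ, ∃ ε₀ > 0, ∀ ε : ℝ, 0 < ε → ε < ε₀ →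
    SolvesUpTo (C * ε ^ 3) p.nu {t | ε * t ∈ S} p.U0 p.V0
      (fun i => toPhysical p.lam ε (φ ε) (U ε i)) (fun i => toPhysical p.lam ε (φ ε) (V ε i))
      (interface p.lam ε (φ ε))

/-! ## Fourier transforms of the terms of the expansion

Below, `φ = φ̂⁽¹⁾` and `ψ = φ̂⁽²⁾` are functions of `(k, τ)`. -/

section Formulas
open Complex (I exp)
variable (p : Params) (φ ψ : ℝ → ℝ → ℂ)

/-- The vector `R`, with `(i𝒜 - ℬ) R = 0`. -/
def R : Fin 5 → ℂ := ![(p.w : ℂ), I * p.w, -(p.B0 : ℂ), -(I * p.B0), (p.d : ℂ)]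

/-- The complex conjugate of `R`. -/
def Rbar : Fin 5 → ℂ := fun i => starRingEnd ℂ (R p i)

/-- The left eigenvector `L`, normalized by `L · ℬR = 1`. -/
def L : Fin 5 → ℂ := fun i => -(1 / (2 * I * p.d * p.w)) * R p i

/-- The complex conjugate of `L`. -/
def Lbar : Fin 5 → ℂ := fun i => starRingEnd ℂ (L p i)

/-- The vector `L₁`. -/
def L1 : Fin 5 → ℂ := ![-(I * p.w) / p.d, 0, I * p.B0 / p.d, 0, 0]

/-- The vector `L₃`. -/
def L3 : Fin 5 → ℂ := ![I * p.B0 / p.d, 0, -(I * p.w) / p.d, 0, 0]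

/-- The vector `L₄`. -/
def L4 : Fin 5 → ℂ := ![0, 0, 0, -(I / p.w), 0]

/-- The first order plasma term. -/
def U1hat (i : Fin 5) (k η τ : ℝ) : ℂ :=
  -|k| * φ k τ * exp (-|k| * η) * (if 0 < k then R p i else Rbar p i)

/-- The first order vacuum term. -/
def V1hat (i : Fin 3) (k η τ : ℝ) : ℂ :=
  p.H0 * φ k τ * exp (p.sigma * |k| * η) *
    (![-(p.sigma * |k| : ℂ), I * k, -(I * p.nu * p.lam * k)] : Fin 3 → ℂ) i

/-- The quadratic convolution `∫ K ℓ φ̂(k - ℓ) φ̂(ℓ) dℓ`. -/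
def quad (K : ℝ → ℂ) (k τ : ℝ) : ℂ := ∫ l : ℝ, K l * φ (k - l) τ * φ l τ

/-- The Fourier transform of the right-hand side `(p₁, p₂, p₃)` of the second order equations in the
plasma. -/
def phat (k η τ : ℝ) : Fin 5 → ℂ :=
  ![-(p.w * |k| * exp (-|k| * η) * deriv (φ k) τ)
      - I * p.d * quad φ (fun l =>
          |k - l| * l * (|k - l| - |l|) * exp (-(|k - l| + |l|) * η)) k τ,
    -(I * p.w * k * exp (-|k| * η) * deriv (φ k) τ)
      + p.d * quad φ (fun l =>
          (k - l) * l * |l| * (exp (-(|k - l| + |l|) * η) - exp (-|l| * η))) k τ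
      - p.d * quad φ (fun l => |k - l| * l ^ 2 * exp (-(|k - l| + |l|) * η)) k τ,
    p.B0 * |k| * exp (-|k| * η) * deriv (φ k) τ,
    I * p.B0 * k * exp (-|k| * η) * deriv (φ k) τ,
    -(I * p.w * quad φ (fun l => (k - l) * l ^ 2 * exp (-|l| * η)) k τ)]

/-- The Fourier transform of `r₁ = (∂_τ + v₁⁽¹⁾ ∂_θ) φ⁽¹⁾` at `η = 0`. -/
def r1hat (k τ : ℝ) : ℂ :=
  deriv (φ k) τ - I * p.w * quad φ (fun l => |k - l| * l) k τ

/-- The Fourier transform of `r₃ = -H₁⁽¹⁾ ∂_θ φ⁽¹⁾` at `η = 0`. -/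
def r3hat (k τ : ℝ) : ℂ :=
  I * p.sigma * p.H0 * quad φ (fun l => |k - l| * l) k τ

/-- The value of `a₀` for which `a` decays, when `k < 0`. -/
def decayA (k τ : ℝ) : ℂ :=
  -∫ y in Ioi (0 : ℝ), dotProduct (L p) (phat p φ k y τ) * exp (k * y)

/-- The value of `b₀` for which `b` decays, when `k > 0`. -/
def decayB (k τ : ℝ) : ℂ :=
  -∫ y in Ioi (0 : ℝ), dotProduct (Lbar p) (phat p φ k y τ) * exp (-k * y)

/-- The coefficient `a₀`: for `k < 0` it is fixed by decay, and for `k > 0` by the second order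
kinematic condition `a₀ + kφ̂⁽²⁾ = r̂₁/(i(λ - v₁⁰)) + b₀`. -/
def a0 (k τ : ℝ) : ℂ :=
  if 0 < k then r1hat p φ k τ / (I * p.w) + decayB p φ k τ - k * ψ k τ else decayA p φ k τ

/-- The coefficient `b₀`: for `k > 0` it is fixed by decay, and for `k < 0` by the second order
kinematic condition `-b₀ + kφ̂⁽²⁾ = r̂₁/(i(λ - v₁⁰)) - a₀`. -/
def b0 (k τ : ℝ) : ℂ :=
  if 0 < k then decayB p φ k τ else k * ψ k τ - r1hat p φ k τ / (I * p.w) + decayA p φ k τ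

/-- The coefficient `a` of `R`. -/
def acoef (k η τ : ℝ) : ℂ :=
  exp (-k * η) *
    (a0 p φ ψ k τ + ∫ y in (0 : ℝ)..η, dotProduct (L p) (phat p φ k y τ) * exp (k * y))

/-- The coefficient `b` of the conjugate of `R`. -/
def bcoef (k η τ : ℝ) : ℂ :=
  exp (k * η) *
    (b0 p φ ψ k τ + ∫ y in (0 : ℝ)..η, dotProduct (Lbar p) (phat p φ k y τ) * exp (-k * y))

/-- The vector `S = k⁻¹ (L₁·p̂, 0, L₃·p̂, L₄·p̂, 0)`. -/
def Svec (k η τ : ℝ) : Fin 5 → ℂ :=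
  ![dotProduct (L1 p) (phat p φ k η τ) / k, 0, dotProduct (L3 p) (phat p φ k η τ) / k,
    dotProduct (L4 p) (phat p φ k η τ) / k, 0]

/-- The second order plasma term `S + a R + b R̄`. -/
def U2hat (i : Fin 5) (k η τ : ℝ) : ℂ :=
  Svec p φ k η τ i + acoef p φ ψ k η τ * R p i + bcoef p φ ψ k η τ * Rbar p i

/-- `Q = P/(νλ)`, where `-P` is the source in the equation
`∂_η² Ê⁽²⁾ + k² (ν²λ² - 1) Ê⁽²⁾ = -P` for the second order electric field. -/
def Q (k y τ : ℝ) : ℂ :=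
  2 * p.nu ^ 2 * p.lam * p.H0 * k ^ 2 * exp (p.sigma * |k| * y) * deriv (φ k) τ
    - I * p.sigma ^ 3 * p.H0 *
      quad φ (fun l => (k ^ 2 - l ^ 2) * l * |l| * exp (p.sigma * |l| * y)) k τ

/-- The derivative of `Q` in the normal variable. -/
def dQ (k y τ : ℝ) : ℂ :=
  2 * p.nu ^ 2 * p.lam * p.sigma * p.H0 * k ^ 2 * |k| * exp (p.sigma * |k| * y) * deriv (φ k) τ
    - I * p.sigma ^ 4 * p.H0 *
      quad φ (fun l => (k ^ 2 - l ^ 2) * l ^ 3 * exp (p.sigma * |l| * y)) k τ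

/-- `∫_{-∞}^0 e^{-σ|k||η - y|} F y dy`. -/
def green (F : ℝ → ℂ) (k η : ℝ) : ℂ :=
  ∫ y in Iio (0 : ℝ), exp (-p.sigma * |k| * |η - y|) * F y

/-- The coefficient of the homogeneous solution in vacuum, fixed by the second order condition
`H·N = 0`. (In terms of the coefficient `α'` of `e^{σ|k|η}(∓iσ/(νλ), -1/(νλ), 1)`, it is
`(α' - νH₁⁰ ∂_τ φ̂⁽¹⁾)/(νλ)`, which has no singularity at `λ = 0`.) -/
def Acoef (k τ : ℝ) : ℂ :=
  r3hat p φ k τ - green p (fun y => Q p φ k y τ) k 0 / (2 * |k| * p.sigma) - I * p.H0 * k * ψ k τ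

/-- The second order vacuum term. -/
def V2hat (i : Fin 3) (k η τ : ℝ) : ℂ :=
  (![-(I * p.sigma * Real.sign k * Acoef p φ ψ k τ * exp (p.sigma * |k| * η))
      + (green p (fun y => dQ p φ k y τ) k η - exp (p.sigma * |k| * η) * Q p φ k 0 τ)
          / (2 * I * k * |k| * p.sigma)
      - p.sigma ^ 2 * p.H0 / k *
          quad φ (fun l => (k - l) * l ^ 2 * exp (p.sigma * |l| * η)) k τ,
    -(Acoef p φ ψ k τ * exp (p.sigma * |k| * η))
      - green p (fun y => Q p φ k y τ) k η / (2 * |k| * p.sigma),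
    (p.nu * p.lam * Acoef p φ ψ k τ + p.nu * p.H0 * deriv (φ k) τ) * exp (p.sigma * |k| * η)
      + p.nu * p.lam * green p (fun y => Q p φ k y τ) k η / (2 * |k| * p.sigma)]
    : Fin 3 → ℂ) i

/-- The kernel `Λ(k, ℓ) = 2|k + ℓ||k||ℓ| / (|k + ℓ| + |k| + |ℓ|)`. -/
def kernel (k l : ℝ) : ℝ := 2 * |k + l| * |k| * |l| / (|k + l| + |k| + |l|)

/-- The amplitude equation
`c φ̂_τ(k, τ) + i κ sgn(k) ∫ Λ(k - ℓ, ℓ) φ̂(k - ℓ, τ) φ̂(ℓ, τ) dℓ = 0`, for `τ ∈ S`. -/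
def AmplitudeEq (c κ : ℝ) (S : Set ℝ) (φ : ℝ → ℝ → ℂ) : Prop :=
  ∀ τ ∈ S, ∀ᵐ k : ℝ, c * deriv (φ k) τ
    + I * κ * Real.sign k * quad φ (fun l => (kernel (k - l) l : ℂ)) k τ = 0

end Formulas

/-- The Fourier transforms of the first and second order terms are given by the formulas above. -/
def Terms.HasForm (X : Terms) (p : Params) (S : Set ℝ) : Prop :=
  ∀ τ ∈ S,
    (∀ η : ℝ, 0 ≤ η → ∀ᵐ k : ℝ, ∀ i,
      X.U1h i k η τ = U1hat p X.phi1h i k η τ ∧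
      X.U2h i k η τ = U2hat p X.phi1h X.phi2h i k η τ) ∧
    (∀ η : ℝ, η ≤ 0 → ∀ᵐ k : ℝ, ∀ i,
      X.V1h i k η τ = V1hat p X.phi1h i k η τ ∧
      X.V2h i k η τ = V2hat p X.phi1h X.phi2h i k η τ)

/-! ## The amplitude equation in the space variable -/

/-- `g` is the Hilbert transform `π⁻¹ p.v. ∫ f y / (x - y) dy` of `f`: the symmetric truncations
converge to `g x` at every `x`. -/
def IsHilbertTransform (f g : ℝ → ℝ) : Prop :=
  ∀ x : ℝ, Tendsto
    (fun r : ℝ × ℝ => Real.pi⁻¹ * ∫ y in {y : ℝ | r.1 < |x - y| ∧ |x - y| < r.2}, f y / (x - y))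
    (𝓝[>] 0 ×ˢ atTop) (𝓝 (g x))

/-- `φ_s + ½ ℍ[Φ²]_xx + Φ φ_xx = 0` with `Φ = ℍ[φ]`, for `x ∈ ℝ`, `s ∈ S`. -/
def HilbertEq (S : Set ℝ) (φ : ℝ × ℝ → ℝ) : Prop :=
  ∃ Φ Ψ : ℝ × ℝ → ℝ, ∀ s ∈ S,
    IsHilbertTransform (fun x => φ (x, s)) (fun x => Φ (x, s)) ∧
    IsHilbertTransform (fun x => Φ (x, s) ^ 2) (fun x => Ψ (x, s)) ∧
    ContDiff ℝ 2 (fun x => φ (x, s)) ∧ ContDiff ℝ 2 (fun x => Ψ (x, s)) ∧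
    ∀ x : ℝ, DifferentiableAt ℝ (fun r => φ (x, r)) s ∧
      deriv (fun r => φ (x, r)) s + 1 / 2 * iteratedDeriv 2 (fun y => Ψ (y, s)) x
        + Φ (x, s) * iteratedDeriv 2 (fun y => φ (y, s)) x = 0

end PlasmaVacuum

end

open PlasmaVacuum

/-! In straightened variables each order in `ε` is a linear boundary value problem with constant
coefficients at every frequency `k`. In the plasma a bounded solution is determined by its normal
velocity on the interface, in vacuum by its normal magnetic field. The conditions on `B·N` and `E`
then hold by themselves, and continuity of the pressure remains as one scalar constraint. At order
`ε` this constraint is the dispersion relation; at order `ε²` it is the amplitude equation.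

The second order problem is solved in closed form, by `model`. Let `h` be the extension of `φ⁽¹⁾`
with transform `e^{-|k|η}φ̂` in the plasma and `e^{σ|k|η}φ̂` in vacuum. At first order the velocity
and the magnetic field of the plasma are multiples of `(∂_η h, -∂_θ h)` and the pressure is `d ∂_η
h`. At second order there are four contributions: `φ⁽¹⁾` times the normal derivative of the first
order term, which is the Taylor expansion of the shift `x₂ = η + εφ`; the same surface mode driven
by `ω = φ⁽²⁾ + cφ⁽¹⁾|D|φ⁽¹⁾`, where `c = 1` in the plasma and `c = -σ` in vacuum makes the quadratic
terms in the normal conditions cancel; the response to `φ_τ`, with a resonant factor `η` in vacuum;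
and, in the plasma, the Bernoulli pressure `-(d/2)|∇h|²`. `model_plasma2`, `model_vacuum2` and
`model_jump2` show that, whatever the profiles, every second order equation holds except the
pressure condition.

Conversely, matching powers of `ε` at a fixed straightened point (`vanish_of_solves`) gives the
equations of both orders for any expansion of an approximate solution. The uniqueness results
`plasma_unique` and `vacuum_unique`, which rest on the bounded solutions of a two-dimensional linear
system, force its terms to be those of `model` (`terms_unique`). The transform of the pressure jump
of `model` is `-i sgn(k) d` times the left side of the amplitude equation (`pressureHat_model`), so
this equation is both necessary and sufficient (`jump_pressure_iff`). The kernel `Λ` appears when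
convolution kernels are symmetrized under `ℓ ↦ k - ℓ` (`kernel_symm`, `quad_kernel`).

The closed form is the one in the formulas, because both solve the same scalar equations with the
same boundary data: Duhamel's formula in the plasma (`coef_eq`), Green's representation in vacuum
(`green_eq`).

For the normal forms, time is rescaled, and the principal value Hilbert transform is shown to have
the symbol `-i sgn k` by means of the sine integral (`isHilbertTransform_of_fourier`); the sign
identity `sign_kernel` then compares the two nonlinearities.

The analysis takes place on the Fourier side: transforms with integrable weighted bounds are stable
under products (`IsField.mul`) and multipliers (`IsField.lift`), and `ae_eq_zero_of_fourier` passes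
from identities between functions to identities at almost every `k`. -/

namespace PlasmaVacuum

open Complex (I exp)
open scoped ContDiff

/-! ## Fourier integrals -/

lemma norm_exp_I_mul (k θ : ℝ) : ‖exp (I * k * θ)‖ = 1 := by
  rw [show I * (k : ℂ) * θ = ((k * θ : ℝ) : ℂ) * I by push_cast; ring]
  exact Complex.norm_exp_ofReal_mul_I _

/-- An integrable function is determined by its Fourier integral. -/
lemma ae_eq_zero_of_fourier {f : ℝ → ℂ} (hf : Integrable f)
    (h : ∀ θ : ℝ, ∫ k : ℝ, f k * exp (I * k * θ) = 0) : ∀ᵐ k : ℝ, f k = 0 := by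
  have h0 : FourierTransform.fourier f = 0 := by
    funext ξ
    rw [Real.fourier_eq']
    rw [Pi.zero_apply, ← h (-2 * Real.pi * ξ)]
    congr 1
    funext k
    rw [smul_eq_mul, mul_comm]
    congr 2
    simp
    ring
  -- It suffices to test `f` against smooth compactly supported `g`. Such a `g` is the Fourier
  -- transform of a Schwartz function `H`, and the transform can be moved from `H` onto `f`, where
  -- it vanishes.
  refine ae_eq_zero_of_integral_contDiff_smul_eq_zero hf.locallyIntegrable fun g hg hgs => ?_
  have hG : HasCompactSupport (fun x => (g x : ℂ)) := hgs.comp_left (g := fun x : ℝ => (x : ℂ)) (by simp)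
  have hG' : ContDiff ℝ ∞ (fun x => (g x : ℂ)) := Complex.ofRealCLM.contDiff.comp hg
  set G : SchwartzMap ℝ ℂ := hG.toSchwartzMap hG'
  set H : SchwartzMap ℝ ℂ := FourierTransform.fourierInv G
  have hGH : FourierTransform.fourier H = G := FourierTransform.fourier_fourierInv_eq G
  have key := VectorFourier.integral_fourierIntegral_smul_eq_flip (L := innerₗ ℝ)
      (μ := volume) (ν := volume) Real.continuous_fourierChar continuous_inner H.integrable hf
  have e1 : ∀ x, VectorFourier.fourierIntegral Real.fourierChar volume (innerₗ ℝ) (⇑H) x = (g x : ℂ) := by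
    intro x
    have := congrArg (fun F : SchwartzMap ℝ ℂ => F x) hGH
    simpa [SchwartzMap.fourier_coe] using! this
  have e2 : ∀ x, VectorFourier.fourierIntegral Real.fourierChar volume (innerₗ ℝ).flip f x = 0 := by
    intro x
    have := congrFun h0 x
    rw [flip_innerₗ]
    exact this
  simp only [e1, e2, smul_zero, integral_zero] at key
  rw [← key]
  congr 1

/-! ## Parametric integrals -/

section Parametric
variable {E : Type*} [NormedAddCommGroup E] [NormedSpace ℝ E]

/-- The directional derivative is the limit of difference quotients with steps `1/(n+1)`, each
measurable in `k`. The sequence starts at an index `N` beyond which the displaced points lie in `O`.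
-/
lemma aestronglyMeasurable_fderiv_apply {O : Set E} (hO : IsOpen O) {F : ℝ → E → ℂ}
    (meas : ∀ z ∈ O, AEStronglyMeasurable (fun k => F k z) volume)
    {z : E} (hz : z ∈ O) (diff : ∀ᵐ k : ℝ, DifferentiableAt ℝ (F k) z) (v : E) :
    AEStronglyMeasurable (fun k => fderiv ℝ (F k) z v) volume := by
  have hev : ∀ᶠ n : ℕ in atTop, z + ((n : ℝ) + 1)⁻¹ • v ∈ O := by
    have : Tendsto (fun n : ℕ => z + ((n : ℝ) + 1)⁻¹ • v) atTop (𝓝 (z + (0 : ℝ) • v)) := by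
      refine tendsto_const_nhds.add (Tendsto.smul_const ?_ v)
      simpa [one_div] using tendsto_one_div_add_atTop_nhds_zero_nat (𝕜 := ℝ)
    refine this.eventually (hO.mem_nhds ?_)
    simpa using hz
  obtain ⟨N, hN⟩ := eventually_atTop.1 hev
  have hT : Tendsto (fun n : ℕ => ((n + N : ℕ) : ℝ) + 1) atTop atTop :=
    tendsto_atTop_add_const_right _ _ (tendsto_natCast_atTop_atTop.comp (tendsto_add_atTop_nat N))
  refine aestronglyMeasurable_of_tendsto_ae atTop
    (f := fun n k => ((((n + N : ℕ) : ℝ) + 1)) • (F k (z + (((n + N : ℕ) : ℝ) + 1)⁻¹ • v) - F k z))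
    (fun n => AEStronglyMeasurable.fun_const_smul
      ((meas _ (hN (n + N) (by omega))).sub (meas _ hz)) (((n + N : ℕ) : ℝ) + 1)) ?_
  filter_upwards [diff] with k hk
  exact (hk.hasFDerivAt.lim_real v).comp hT

variable [FiniteDimensional ℝ E]

/-- In finite dimension a continuous linear map is a fixed linear combination of its values on a
basis, so directional derivatives suffice. -/
lemma aestronglyMeasurable_fderiv {O : Set E} (hO : IsOpen O) {F : ℝ → E → ℂ}
    (meas : ∀ z ∈ O, AEStronglyMeasurable (fun k => F k z) volume)
    {z : E} (hz : z ∈ O) (diff : ∀ᵐ k : ℝ, DifferentiableAt ℝ (F k) z) :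
    AEStronglyMeasurable (fun k => fderiv ℝ (F k) z) volume := by
  let b := Module.finBasis ℝ E
  have h : ∀ A : E →L[ℝ] ℂ, A = ∑ i, (LinearMap.toContinuousLinearMap (b.coord i)).smulRight (A (b i)) := by
    intro A
    ext x
    conv_lhs => rw [← b.sum_repr x]
    rw [map_sum]
    simp
  have : (fun k => fderiv ℝ (F k) z) = fun k => ∑ i, (ContinuousLinearMap.smulRightL ℝ E ℂ (LinearMap.toContinuousLinearMap (b.coord i))) (fderiv ℝ (F k) z (b i)) := by
    funext k
    exact h _
  rw [this]
  refine Finset.aestronglyMeasurable_fun_sum _ fun i _ => ?_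
  exact (ContinuousLinearMap.continuous _).comp_aestronglyMeasurable
    (aestronglyMeasurable_fderiv_apply hO meas hz diff (b i))

/-- Differentiation under the integral sign for dominated `C¹` families. -/
lemma hasFDerivAt_integral {O : Set E} (hO : IsOpen O) {F : ℝ → E → ℂ} {g : ℝ → ℝ}
    (meas : ∀ z ∈ O, AEStronglyMeasurable (fun k => F k z) volume)
    (smooth : ∀ᵐ k : ℝ, ContDiffOn ℝ 1 (F k) O) (hg : Integrable g)
    (bd : ∀ᵐ k : ℝ, ∀ z ∈ O, ‖F k z‖ ≤ g k ∧ ‖fderiv ℝ (F k) z‖ ≤ g k) {z : E} (hz : z ∈ O) :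
    HasFDerivAt (fun z => ∫ k, F k z) (∫ k, fderiv ℝ (F k) z) z := by
  have diff : ∀ z ∈ O, ∀ᵐ k : ℝ, DifferentiableAt ℝ (F k) z := fun z hz => by
    filter_upwards [smooth] with k hk
    exact (hk.differentiableOn one_ne_zero).differentiableAt (hO.mem_nhds hz)
  refine hasFDerivAt_integral_of_dominated_of_fderiv_le (F := fun z k => F k z)
    (F' := fun z k => fderiv ℝ (F k) z) (bound := g) (hO.mem_nhds hz) ?_ ?_ ?_ ?_ hg ?_
  · filter_upwards [hO.mem_nhds hz] with y hy using meas y hy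
  · exact hg.mono' (meas z hz) (bd.mono fun k hk => (hk z hz).1)
  · exact aestronglyMeasurable_fderiv hO meas hz (diff z hz)
  · exact bd.mono fun k hk z hz => (hk z hz).2
  · filter_upwards [smooth] with k hk z hz
    exact ((hk.differentiableOn one_ne_zero).differentiableAt (hO.mem_nhds hz)).hasFDerivAt

/-- The derivative is itself a dominated integral of continuous functions, hence continuous. This is
how convolutions inherit `C¹` regularity in `(η, τ)`. -/
lemma contDiffOn_integral {O : Set E} (hO : IsOpen O) {F : ℝ → E → ℂ} {g : ℝ → ℝ}
    (meas : ∀ z ∈ O, AEStronglyMeasurable (fun k => F k z) volume)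
    (smooth : ∀ᵐ k : ℝ, ContDiffOn ℝ 1 (F k) O) (hg : Integrable g)
    (bd : ∀ᵐ k : ℝ, ∀ z ∈ O, ‖F k z‖ ≤ g k ∧ ‖fderiv ℝ (F k) z‖ ≤ g k) :
    ContDiffOn ℝ 1 (fun z => ∫ k, F k z) O := by
  have hd := fun z hz => hasFDerivAt_integral hO meas smooth hg bd (z := z) hz
  have diff : ∀ z ∈ O, ∀ᵐ k : ℝ, DifferentiableAt ℝ (F k) z := fun z hz => by
    filter_upwards [smooth] with k hk
    exact (hk.differentiableOn one_ne_zero).differentiableAt (hO.mem_nhds hz)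
  rw [show (1 : WithTop ℕ∞) = 0 + 1 by rfl, contDiffOn_succ_iff_fderiv_of_isOpen hO]
  refine ⟨fun z hz => (hd z hz).differentiableAt.differentiableWithinAt, by simp, ?_⟩
  rw [contDiffOn_zero]
  refine ContinuousOn.congr (f := fun z => ∫ k, fderiv ℝ (F k) z) ?_ fun z hz => (hd z hz).fderiv
  refine continuousOn_of_dominated (bound := g)
    (fun z hz => aestronglyMeasurable_fderiv hO meas hz (diff z hz)) (fun z hz => bd.mono fun k hk => (hk z hz).2) hg ?_
  filter_upwards [smooth] with k hk
  exact hk.continuousOn_fderiv_of_isOpen hO le_rfl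

end Parametric

/-! ## Calculus of wave fields -/

/-- The derivative of a function of `(θ, η, τ)` in `θ`. -/
noncomputable def dTh (f : ℝ × ℝ × ℝ → ℝ) (z : ℝ × ℝ × ℝ) : ℝ := fderiv ℝ f z (1, 0, 0)

/-- The derivative of a function of `(θ, η, τ)` in `η`. -/
noncomputable def dEt (f : ℝ × ℝ × ℝ → ℝ) (z : ℝ × ℝ × ℝ) : ℝ := fderiv ℝ f z (0, 1, 0)

/-- The derivative of a function of `(θ, η, τ)` in `τ`. -/
noncomputable def dTa (f : ℝ × ℝ × ℝ → ℝ) (z : ℝ × ℝ × ℝ) : ℝ := fderiv ℝ f z (0, 0, 1)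

section Linear
variable {F : Type*} [NormedAddCommGroup F] [NormedSpace ℝ F]

lemma clm_apply_prod3 (A : ℝ × ℝ × ℝ →L[ℝ] F) (v : ℝ × ℝ × ℝ) :
    A v = v.1 • A (1, 0, 0) + v.2.1 • A (0, 1, 0) + v.2.2 • A (0, 0, 1) := by
  rw [← map_smul, ← map_smul, ← map_smul, ← map_add, ← map_add]
  congr 1
  ext <;> simp

lemma clm_apply_prod2 (A : ℝ × ℝ →L[ℝ] F) (v : ℝ × ℝ) :
    A v = v.1 • A (1, 0) + v.2 • A (0, 1) := by
  rw [← map_smul, ← map_smul, ← map_add]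
  congr 1
  ext <;> simp

lemma clm_norm_le_prod3 (A : ℝ × ℝ × ℝ →L[ℝ] F) :
    ‖A‖ ≤ ‖A (1, 0, 0)‖ + ‖A (0, 1, 0)‖ + ‖A (0, 0, 1)‖ := by
  refine A.opNorm_le_bound (by positivity) fun v => ?_
  rw [clm_apply_prod3 A v]
  have h1 : ‖v.1‖ ≤ ‖v‖ := norm_fst_le v
  have h2 : ‖v.2.1‖ ≤ ‖v‖ := (norm_fst_le v.2).trans (norm_snd_le v)
  have h3 : ‖v.2.2‖ ≤ ‖v‖ := (norm_snd_le v.2).trans (norm_snd_le v)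
  refine (norm_add₃_le).trans ?_
  rw [norm_smul, norm_smul, norm_smul]
  have := mul_le_mul_of_nonneg_right h1 (norm_nonneg (A (1, 0, 0)))
  have := mul_le_mul_of_nonneg_right h2 (norm_nonneg (A (0, 1, 0)))
  have := mul_le_mul_of_nonneg_right h3 (norm_nonneg (A (0, 0, 1)))
  linarith

lemma clm_norm_le_prod2 (A : ℝ × ℝ →L[ℝ] F) : ‖A‖ ≤ ‖A (1, 0)‖ + ‖A (0, 1)‖ := by
  refine A.opNorm_le_bound (by positivity) fun v => ?_
  rw [clm_apply_prod2 A v]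
  refine (norm_add_le _ _).trans ?_
  rw [norm_smul, norm_smul]
  have := mul_le_mul_of_nonneg_right (norm_fst_le v) (norm_nonneg (A (1, 0)))
  have := mul_le_mul_of_nonneg_right (norm_snd_le v) (norm_nonneg (A (0, 1)))
  linarith

/-- Partial derivatives of a function of two variables. -/
lemma deriv_fst_eq {h : ℝ × ℝ → F} {η τ : ℝ} (hd : DifferentiableAt ℝ h (η, τ)) :
    HasDerivAt (fun y => h (y, τ)) (fderiv ℝ h (η, τ) (1, 0)) η := by
  have := hd.hasFDerivAt.comp_hasDerivAt η ((hasDerivAt_id η).prodMk (hasDerivAt_const η τ))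
  simpa using! this

lemma deriv_snd_eq {h : ℝ × ℝ → F} {η τ : ℝ} (hd : DifferentiableAt ℝ h (η, τ)) :
    HasDerivAt (fun s => h (η, s)) (fderiv ℝ h (η, τ) (0, 1)) τ := by
  have := hd.hasFDerivAt.comp_hasDerivAt τ ((hasDerivAt_const τ η).prodMk (hasDerivAt_id τ))
  simpa using! this

end Linear

/-- The integrand of a Fourier representation. -/
noncomputable def waveIntegrand (fh : ℝ → ℝ → ℝ → ℂ) (k : ℝ) (z : ℝ × ℝ × ℝ) : ℂ :=
  fh k z.2.1 z.2.2 * exp (I * k * z.1)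

lemma norm_waveIntegrand (fh : ℝ → ℝ → ℝ → ℂ) (k : ℝ) (z : ℝ × ℝ × ℝ) :
    ‖waveIntegrand fh k z‖ = ‖fh k z.2.1 z.2.2‖ := by
  rw [waveIntegrand, norm_mul, norm_exp_I_mul, mul_one]

lemma hasFDerivAt_waveIntegrand {fh : ℝ → ℝ → ℝ → ℂ} {k θ η τ : ℝ}
    (h : DifferentiableAt ℝ (fun y : ℝ × ℝ => fh k y.1 y.2) (η, τ)) :
    DifferentiableAt ℝ (waveIntegrand fh k) (θ, η, τ) ∧
    fderiv ℝ (waveIntegrand fh k) (θ, η, τ) (1, 0, 0) = I * k * fh k η τ * exp (I * k * θ) ∧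
    fderiv ℝ (waveIntegrand fh k) (θ, η, τ) (0, 1, 0)
      = deriv (fun y => fh k y τ) η * exp (I * k * θ) ∧
    fderiv ℝ (waveIntegrand fh k) (θ, η, τ) (0, 0, 1)
      = deriv (fun s => fh k η s) τ * exp (I * k * θ) := by
  have h1 : HasFDerivAt (fun z : ℝ × ℝ × ℝ => fh k z.2.1 z.2.2)
      ((fderiv ℝ (fun y : ℝ × ℝ => fh k y.1 y.2) (η, τ)).comp (ContinuousLinearMap.snd ℝ ℝ (ℝ × ℝ)))
      (θ, η, τ) :=
    HasFDerivAt.comp (g := fun y : ℝ × ℝ => fh k y.1 y.2) (θ, η, τ) h.hasFDerivAt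
      (hasFDerivAt_snd (𝕜 := ℝ) (p := (θ, η, τ)))
  have h2 : HasFDerivAt (fun z : ℝ × ℝ × ℝ => exp (I * k * z.1))
      ((ContinuousLinearMap.fst ℝ ℝ (ℝ × ℝ)).smulRight (I * k * exp (I * k * θ))) (θ, η, τ) := by
    have e : HasDerivAt (fun t : ℝ => exp (I * k * t)) (I * k * exp (I * k * θ)) θ := by
      have h : HasDerivAt (fun t : ℝ => exp (I * k * t)) (exp (I * k * θ) * (I * k * ((1 : ℝ) : ℂ))) θ :=
        ((Complex.ofRealCLM.hasDerivAt (x := θ)).const_mul (I * (k : ℂ))).cexp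
      rw [Complex.ofReal_one, mul_one] at h
      rwa [mul_comm (I * (k : ℂ)) (exp _)]
    exact HasFDerivAt.comp (θ, η, τ) e.hasFDerivAt (hasFDerivAt_fst (𝕜 := ℝ) (p := (θ, η, τ)))
  have h3 := h1.mul h2
  have e1 := (deriv_fst_eq h).deriv
  have e2 := (deriv_snd_eq h).deriv
  refine ⟨h3.differentiableAt, ?_, ?_, ?_⟩
  · rw [show fderiv ℝ (waveIntegrand fh k) (θ, η, τ) = _ from h3.fderiv]
    have e0 : ((0 : ℝ), (0 : ℝ)) = 0 := rfl
    simp [e0]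
    ring
  · rw [show fderiv ℝ (waveIntegrand fh k) (θ, η, τ) = _ from h3.fderiv, e1]
    simp
    ring
  · rw [show fderiv ℝ (waveIntegrand fh k) (θ, η, τ) = _ from h3.fderiv, e2]
    simp
    ring

namespace IsWaveField
variable {D S : Set ℝ} {f g : ℝ × ℝ × ℝ → ℝ} {fh gh : ℝ → ℝ → ℝ → ℂ}

lemma ae_bound (hf : IsWaveField D S f fh) : ∃ g : ℝ → ℝ, Integrable g ∧ ∀ᵐ k : ℝ,
    (∀ η ∈ D, ∀ τ ∈ S, (1 + |k|) * ‖fh k η τ‖ ≤ g k) ∧ (∀ η ∈ D, ∀ τ ∈ S, ‖fh k η τ‖ ≤ g k) ∧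
    (∀ η ∈ interior D, ∀ τ ∈ S,
      ‖deriv (fun y => fh k y τ) η‖ ≤ g k ∧ ‖deriv (fun s => fh k η s) τ‖ ≤ g k) := by
  obtain ⟨g, hg, h⟩ := hf.bound
  refine ⟨g, hg, h.mono fun k hk => ⟨hk.1, fun η hη τ hτ => ?_, hk.2⟩⟩
  have := hk.1 η hη τ hτ
  nlinarith [norm_nonneg (fh k η τ), abs_nonneg k]

lemma integrable (hf : IsWaveField D S f fh) {η τ : ℝ} (hη : η ∈ D) (hτ : τ ∈ S) :
    Integrable (fun k => fh k η τ) := by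
  obtain ⟨g, hg, h⟩ := hf.ae_bound
  exact hg.mono' (hf.meas η hη τ hτ) (h.mono fun k hk => hk.2.1 η hη τ hτ)

lemma integrable_mul (hf : IsWaveField D S f fh) {η τ : ℝ} (hη : η ∈ D) (hτ : τ ∈ S) :
    Integrable (fun k => I * k * fh k η τ) := by
  obtain ⟨g, hg, h⟩ := hf.ae_bound
  refine hg.mono' (AEStronglyMeasurable.mul (by fun_prop) (hf.meas η hη τ hτ))
    (h.mono fun k hk => ?_)
  rw [norm_mul, norm_mul, Complex.norm_I, one_mul, Complex.norm_real, Real.norm_eq_abs]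
  have := hk.1 η hη τ hτ
  nlinarith [norm_nonneg (fh k η τ), abs_nonneg k]

lemma isOpen_interior_prod (hS : IsOpen S) : IsOpen (interior D ×ˢ S) := isOpen_interior.prod hS

lemma ae_diff (hf : IsWaveField D S f fh) (hS : IsOpen S) : ∀ᵐ k : ℝ, ∀ η ∈ interior D, ∀ τ ∈ S,
    DifferentiableAt ℝ (fun y : ℝ × ℝ => fh k y.1 y.2) (η, τ) := by
  filter_upwards [hf.smooth] with k hk η hη τ hτ
  exact (hk.differentiableOn one_ne_zero).differentiableAt
    ((isOpen_interior_prod hS).mem_nhds ⟨hη, hτ⟩)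

lemma meas_deriv_fst (hf : IsWaveField D S f fh) (hS : IsOpen S) {η τ : ℝ} (hη : η ∈ interior D)
    (hτ : τ ∈ S) : AEStronglyMeasurable (fun k => deriv (fun y => fh k y τ) η) volume := by
  have := aestronglyMeasurable_fderiv_apply (isOpen_interior_prod (D := D) hS)
    (F := fun k y => fh k y.1 y.2) (fun z hz => hf.meas z.1 (interior_subset hz.1) z.2 hz.2)
    (z := (η, τ)) ⟨hη, hτ⟩ ((hf.ae_diff hS).mono fun k hk => hk η hη τ hτ) (1, 0)
  exact this.congr ((hf.ae_diff hS).mono fun k hk => (deriv_fst_eq (hk η hη τ hτ)).deriv.symm)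

lemma meas_deriv_snd (hf : IsWaveField D S f fh) (hS : IsOpen S) {η τ : ℝ} (hη : η ∈ interior D)
    (hτ : τ ∈ S) : AEStronglyMeasurable (fun k => deriv (fun s => fh k η s) τ) volume := by
  have := aestronglyMeasurable_fderiv_apply (isOpen_interior_prod (D := D) hS)
    (F := fun k y => fh k y.1 y.2) (fun z hz => hf.meas z.1 (interior_subset hz.1) z.2 hz.2)
    (z := (η, τ)) ⟨hη, hτ⟩ ((hf.ae_diff hS).mono fun k hk => hk η hη τ hτ) (0, 1)
  exact this.congr ((hf.ae_diff hS).mono fun k hk => (deriv_snd_eq (hk η hη τ hτ)).deriv.symm)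

lemma integrable_deriv_fst (hf : IsWaveField D S f fh) (hS : IsOpen S) {η τ : ℝ}
    (hη : η ∈ interior D) (hτ : τ ∈ S) : Integrable (fun k => deriv (fun y => fh k y τ) η) := by
  obtain ⟨g, hg, h⟩ := hf.ae_bound
  exact hg.mono' (hf.meas_deriv_fst hS hη hτ) (h.mono fun k hk => (hk.2.2 η hη τ hτ).1)

/-- The Fourier representation is an identity in `ℂ`, so it is differentiated for complex values;
the real derivative is identified afterwards by uniqueness of derivatives. -/
lemma hasFDerivAt_complex (hf : IsWaveField D S f fh) (hS : IsOpen S) {θ η τ : ℝ}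
    (hη : η ∈ interior D) (hτ : τ ∈ S) :
    Integrable (fun k => fderiv ℝ (waveIntegrand fh k) (θ, η, τ)) ∧
    HasFDerivAt (fun z => (f z : ℂ)) (∫ k, fderiv ℝ (waveIntegrand fh k) (θ, η, τ)) (θ, η, τ) := by
  obtain ⟨g, hg, h⟩ := hf.ae_bound
  set O : Set (ℝ × ℝ × ℝ) := univ ×ˢ (interior D ×ˢ S) with hO'
  have hO : IsOpen O := isOpen_univ.prod (isOpen_interior_prod hS)
  have meas : ∀ z ∈ O, AEStronglyMeasurable (fun k => waveIntegrand fh k z) volume :=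
    fun z hz => (hf.meas _ (interior_subset hz.2.1) _ hz.2.2).mul (by fun_prop)
  have smooth : ∀ᵐ k : ℝ, ContDiffOn ℝ 1 (waveIntegrand fh k) O := by
    filter_upwards [hf.smooth] with k hk
    refine ContDiffOn.mul (hk.comp (g := fun y : ℝ × ℝ => fh k y.1 y.2)
      contDiff_snd.contDiffOn (fun z hz => hz.2)) ?_
    refine (ContDiff.cexp (contDiff_const.mul ?_)).contDiffOn
    exact Complex.ofRealCLM.contDiff.comp contDiff_fst
  -- Each of the three partial derivatives is at most `g k`, the one in `θ` thanks to the weight `1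
  -- + |k|`, and their sum bounds the operator norm.
  have bd : ∀ᵐ k : ℝ, ∀ z ∈ O, ‖waveIntegrand fh k z‖ ≤ 3 * g k ∧
      ‖fderiv ℝ (waveIntegrand fh k) z‖ ≤ 3 * g k := by
    filter_upwards [h, hf.ae_diff hS] with k hk hd
    rintro ⟨t, y, s⟩ ⟨-, hy, hs⟩
    have h1 := hk.1 y (interior_subset hy) s hs
    have h2 := hk.2.1 y (interior_subset hy) s hs
    have h3 := hk.2.2 y hy s hs
    obtain ⟨-, e1, e2, e3⟩ := hasFDerivAt_waveIntegrand (θ := t) (hd y hy s hs)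
    have h0 := norm_nonneg (fh k y s)
    constructor
    · rw [norm_waveIntegrand]; dsimp only; linarith
    · refine (clm_norm_le_prod3 _).trans ?_
      rw [e1, e2, e3]
      simp only [norm_mul, norm_exp_I_mul, Complex.norm_I, Complex.norm_real, Real.norm_eq_abs]
      nlinarith [abs_nonneg k]
  have hz : (θ, η, τ) ∈ O := ⟨trivial, hη, hτ⟩
  have key := hasFDerivAt_integral hO meas smooth (hg.const_mul 3) bd hz
  constructor
  · refine (hg.const_mul 3).mono' (aestronglyMeasurable_fderiv hO meas hz ?_)
      (bd.mono fun k hk => (hk _ hz).2)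
    filter_upwards [hf.ae_diff hS] with k hk using (hasFDerivAt_waveIntegrand (hk η hη τ hτ)).1
  · refine key.congr_of_eventuallyEq ?_
    filter_upwards [hO.mem_nhds hz] with z hz
    exact hf.repr z.1 z.2.1 (interior_subset hz.2.1) z.2.2 hz.2.2

lemma differentiableAt (hf : IsWaveField D S f fh) (hS : IsOpen S) {z : ℝ × ℝ × ℝ}
    (hη : z.2.1 ∈ interior D) (hτ : z.2.2 ∈ S) : DifferentiableAt ℝ f z := by
  have := (hf.hasFDerivAt_complex hS (θ := z.1) hη hτ).2
  exact (Complex.reCLM.hasFDerivAt.comp z this).differentiableAt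

lemma fderiv_eq (hf : IsWaveField D S f fh) (hS : IsOpen S) {θ η τ : ℝ}
    (hη : η ∈ interior D) (hτ : τ ∈ S) (v : ℝ × ℝ × ℝ) :
    ((fderiv ℝ f (θ, η, τ) v : ℝ) : ℂ) = ∫ k, fderiv ℝ (waveIntegrand fh k) (θ, η, τ) v := by
  have h := hf.hasFDerivAt_complex hS (θ := θ) hη hτ
  have h1 := (hf.differentiableAt hS (z := (θ, η, τ)) hη hτ).hasFDerivAt
  have h2 := Complex.ofRealCLM.hasFDerivAt.comp (θ, η, τ) h1
  have h3 := h2.unique h.2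
  rw [← ContinuousLinearMap.integral_apply h.1, ← h3]
  rfl

lemma dTh_eq (hf : IsWaveField D S f fh) (hS : IsOpen S) {θ η τ : ℝ}
    (hη : η ∈ interior D) (hτ : τ ∈ S) :
    (dTh f (θ, η, τ) : ℂ) = ∫ k : ℝ, I * k * fh k η τ * exp (I * k * θ) := by
  rw [dTh, hf.fderiv_eq hS hη hτ]
  refine integral_congr_ae ((hf.ae_diff hS).mono fun k hk => ?_)
  exact (hasFDerivAt_waveIntegrand (hk η hη τ hτ)).2.1

lemma dEt_eq (hf : IsWaveField D S f fh) (hS : IsOpen S) {θ η τ : ℝ}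
    (hη : η ∈ interior D) (hτ : τ ∈ S) :
    (dEt f (θ, η, τ) : ℂ) = ∫ k : ℝ, deriv (fun y => fh k y τ) η * exp (I * k * θ) := by
  rw [dEt, hf.fderiv_eq hS hη hτ]
  refine integral_congr_ae ((hf.ae_diff hS).mono fun k hk => ?_)
  exact (hasFDerivAt_waveIntegrand (hk η hη τ hτ)).2.2.1

lemma dTa_eq (hf : IsWaveField D S f fh) (hS : IsOpen S) {θ η τ : ℝ}
    (hη : η ∈ interior D) (hτ : τ ∈ S) :
    (dTa f (θ, η, τ) : ℂ) = ∫ k : ℝ, deriv (fun s => fh k η s) τ * exp (I * k * θ) := by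
  rw [dTa, hf.fderiv_eq hS hη hτ]
  refine integral_congr_ae ((hf.ae_diff hS).mono fun k hk => ?_)
  exact (hasFDerivAt_waveIntegrand (hk η hη τ hτ)).2.2.2

lemma exists_bound (hf : IsWaveField D S f fh) (hS : IsOpen S) : ∃ C, 0 ≤ C ∧
    (∀ z : ℝ × ℝ × ℝ, z.2.1 ∈ D → z.2.2 ∈ S → |f z| ≤ C) ∧
    ∀ z : ℝ × ℝ × ℝ, z.2.1 ∈ interior D → z.2.2 ∈ S →
      |dTh f z| ≤ C ∧ |dEt f z| ≤ C ∧ |dTa f z| ≤ C := by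
  obtain ⟨g, hg, h⟩ := hf.ae_bound
  have key : ∀ (r : ℝ) (F : ℝ → ℂ), (r : ℂ) = ∫ k, F k → (∀ᵐ k, ‖F k‖ ≤ g k) → |r| ≤ ∫ k, |g k| := by
    intro r F e hF
    rw [← Real.norm_eq_abs, ← Complex.norm_real, e]
    exact norm_integral_le_of_norm_le hg.abs (hF.mono fun k hk => hk.trans (le_abs_self _))
  refine ⟨∫ k, |g k|, integral_nonneg fun k => abs_nonneg _, ?_, ?_⟩
  · rintro ⟨θ, η, τ⟩ hη hτ
    refine key _ _ (hf.repr θ η hη τ hτ) (h.mono fun k hk => ?_)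
    rw [norm_mul, norm_exp_I_mul, mul_one]
    exact hk.2.1 η hη τ hτ
  · rintro ⟨θ, η, τ⟩ hη hτ
    refine ⟨key _ _ (hf.dTh_eq hS hη hτ) ?_, key _ _ (hf.dEt_eq hS hη hτ) ?_,
      key _ _ (hf.dTa_eq hS hη hτ) ?_⟩ <;> refine h.mono fun k hk => ?_
    · simp only [norm_mul, norm_exp_I_mul, Complex.norm_I, Complex.norm_real, Real.norm_eq_abs]
      have := hk.1 η (interior_subset hη) τ hτ
      nlinarith [norm_nonneg (fh k η τ), abs_nonneg k]
    · simpa only [norm_mul, norm_exp_I_mul, mul_one] using (hk.2.2 η hη τ hτ).1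
    · simpa only [norm_mul, norm_exp_I_mul, mul_one] using (hk.2.2 η hη τ hτ).2

lemma continuousOn (hf : IsWaveField D S f fh) :
    ContinuousOn f {z | z.2.1 ∈ D ∧ z.2.2 ∈ S} := by
  obtain ⟨g, hg, h⟩ := hf.ae_bound
  have : ContinuousOn (fun z => ∫ k, waveIntegrand fh k z) {z | z.2.1 ∈ D ∧ z.2.2 ∈ S} := by
    refine continuousOn_of_dominated (bound := g)
      (fun z hz => (hf.meas _ hz.1 _ hz.2).mul (by fun_prop))
      (fun z hz => h.mono fun k hk => ?_) hg ?_
    · rw [norm_waveIntegrand]; exact hk.2.1 _ hz.1 _ hz.2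
    · filter_upwards [hf.cont] with k hk
      refine ContinuousOn.mul (hk.comp (g := fun y : ℝ × ℝ => fh k y.1 y.2)
        continuous_snd.continuousOn (fun z hz => hz)) ?_
      exact Continuous.continuousOn (by fun_prop)
  refine (Complex.continuous_re.comp_continuousOn this).congr fun z hz => ?_
  have := hf.repr z.1 z.2.1 hz.1 z.2.2 hz.2
  exact (Complex.ofReal_re (f z)).symm.trans (congrArg Complex.re this)

/-- Decay at almost every frequency passes to the field by dominated convergence, since the
dominating function does not depend on `η`. -/
lemma tendsto_zero (hf : IsWaveField D S f fh) {l : Filter ℝ} [l.IsCountablyGenerated]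
    (hl : ∀ᶠ η in l, η ∈ D) {τ : ℝ} (hτ : τ ∈ S)
    (h0 : ∀ᵐ k : ℝ, Tendsto (fun η => fh k η τ) l (𝓝 0)) (θ : ℝ) :
    Tendsto (fun η => f (θ, η, τ)) l (𝓝 0) := by
  obtain ⟨g, hg, h⟩ := hf.ae_bound
  have : Tendsto (fun η => ∫ k, fh k η τ * exp (I * k * θ)) l (𝓝 (∫ k : ℝ, (0 : ℂ))) := by
    refine tendsto_integral_filter_of_dominated_convergence g ?_ ?_ hg ?_
    · filter_upwards [hl] with η hη using (hf.meas _ hη _ hτ).mul (by fun_prop)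
    · filter_upwards [hl] with η hη
      filter_upwards [h] with k hk
      rw [norm_mul, norm_exp_I_mul, mul_one]
      exact hk.2.1 _ hη _ hτ
    · filter_upwards [h0] with k hk
      simpa using hk.mul_const (exp (I * k * θ))
  rw [integral_zero] at this
  have h2 := (Complex.continuous_re.tendsto _).comp this
  rw [Complex.zero_re] at h2
  refine h2.congr' ?_
  filter_upwards [hl] with η hη
  exact ((Complex.ofReal_re (f _)).symm.trans (congrArg Complex.re (hf.repr θ η hη τ hτ))).symm

lemma add (hf : IsWaveField D S f fh) (hg : IsWaveField D S g gh) (hS : IsOpen S) :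
    IsWaveField D S (fun z => f z + g z) (fun k η τ => fh k η τ + gh k η τ) where
  repr θ η hη τ hτ := by
    simp only [add_mul]
    rw [integral_add, ← hf.repr θ η hη τ hτ, ← hg.repr θ η hη τ hτ, Complex.ofReal_add]
    · exact (hf.integrable hη hτ).mul_bdd (c := 1) (by fun_prop) (by simp [norm_exp_I_mul])
    · exact (hg.integrable hη hτ).mul_bdd (c := 1) (by fun_prop) (by simp [norm_exp_I_mul])
  meas η hη τ hτ := (hf.meas η hη τ hτ).add (hg.meas η hη τ hτ)
  cont := by filter_upwards [hf.cont, hg.cont] with k h1 h2 using h1.add h2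
  smooth := by filter_upwards [hf.smooth, hg.smooth] with k h1 h2 using h1.add h2
  bound := by
    obtain ⟨a, ha, h⟩ := hf.bound
    obtain ⟨b, hb, h'⟩ := hg.bound
    refine ⟨fun k => a k + b k, ha.add hb, ?_⟩
    filter_upwards [h, h', hf.ae_diff hS, hg.ae_diff hS] with k h1 h2 d1 d2
    refine ⟨fun η hη τ hτ => ?_, fun η hη τ hτ => ⟨?_, ?_⟩⟩
    · have := norm_add_le (fh k η τ) (gh k η τ)
      nlinarith [h1.1 η hη τ hτ, h2.1 η hη τ hτ, abs_nonneg k]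
    · have := deriv_fun_add (deriv_fst_eq (d1 η hη τ hτ)).differentiableAt
        (deriv_fst_eq (d2 η hη τ hτ)).differentiableAt
      dsimp only at this
      rw [this]
      exact (norm_add_le _ _).trans (add_le_add (h1.2 η hη τ hτ).1 (h2.2 η hη τ hτ).1)
    · have := deriv_fun_add (deriv_snd_eq (d1 η hη τ hτ)).differentiableAt
        (deriv_snd_eq (d2 η hη τ hτ)).differentiableAt
      dsimp only at this
      rw [this]
      exact (norm_add_le _ _).trans (add_le_add (h1.2 η hη τ hτ).2 (h2.2 η hη τ hτ).2)

lemma const_mul (hf : IsWaveField D S f fh) (c : ℝ) :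
    IsWaveField D S (fun z => c * f z) (fun k η τ => c * fh k η τ) where
  repr θ η hη τ hτ := by
    rw [Complex.ofReal_mul, hf.repr θ η hη τ hτ, ← integral_const_mul]
    simp only [mul_assoc]
  meas η hη τ hτ := (hf.meas η hη τ hτ).const_mul _
  cont := by filter_upwards [hf.cont] with k h1 using continuousOn_const.mul h1
  smooth := by filter_upwards [hf.smooth] with k h1 using contDiffOn_const.mul h1
  bound := by
    obtain ⟨a, ha, h⟩ := hf.bound
    refine ⟨fun k => |c| * a k, ha.const_mul _, ?_⟩
    filter_upwards [h] with k h1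
    refine ⟨fun η hη τ hτ => ?_, fun η hη τ hτ => ⟨?_, ?_⟩⟩
    · rw [norm_mul, Complex.norm_real, Real.norm_eq_abs, mul_left_comm]
      exact mul_le_mul_of_nonneg_left (h1.1 η hη τ hτ) (abs_nonneg c)
    · rw [deriv_const_mul_field, norm_mul, Complex.norm_real, Real.norm_eq_abs]
      exact mul_le_mul_of_nonneg_left (h1.2 η hη τ hτ).1 (abs_nonneg c)
    · rw [deriv_const_mul_field, norm_mul, Complex.norm_real, Real.norm_eq_abs]
      exact mul_le_mul_of_nonneg_left (h1.2 η hη τ hτ).2 (abs_nonneg c)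

end IsWaveField

/-! ## Fields with rapidly decreasing transforms -/

/-- A wave field whose transform decreases rapidly in `k`, with its first derivatives. -/
structure IsField (D S : Set ℝ) (f : ℝ × ℝ × ℝ → ℝ) (fh : ℝ → ℝ → ℝ → ℂ) : Prop where
  repr : ∀ θ : ℝ, ∀ η ∈ D, ∀ τ ∈ S,
    (f (θ, η, τ) : ℂ) = ∫ k : ℝ, fh k η τ * Complex.exp (Complex.I * k * θ)
  meas : ∀ η ∈ D, ∀ τ ∈ S, AEStronglyMeasurable (fun k => fh k η τ) volume
  cont : ∀ᵐ k : ℝ, ContinuousOn (fun z : ℝ × ℝ => fh k z.1 z.2) (D ×ˢ S)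
  smooth : ∀ᵐ k : ℝ, ContDiffOn ℝ 1 (fun z : ℝ × ℝ => fh k z.1 z.2) (interior D ×ˢ S)
  bound : ∀ m : ℕ, ∃ g : ℝ → ℝ, Integrable g ∧ ∀ᵐ k : ℝ,
    (∀ η ∈ D, ∀ τ ∈ S, (1 + |k|) ^ m * ‖fh k η τ‖ ≤ g k) ∧
    (∀ η ∈ interior D, ∀ τ ∈ S,
      (1 + |k|) ^ m * ‖deriv (fun y => fh k y τ) η‖ ≤ g k ∧
      (1 + |k|) ^ m * ‖deriv (fun s => fh k η s) τ‖ ≤ g k)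

/-- The transform of a product. -/
noncomputable def conv (fh gh : ℝ → ℝ → ℝ → ℂ) (k η τ : ℝ) : ℂ :=
  ∫ l : ℝ, fh (k - l) η τ * gh l η τ

lemma convolution_integrable {a b : ℝ → ℝ} (ha : Integrable a) (hb : Integrable b) :
    (∀ᵐ k : ℝ, Integrable (fun l => a (k - l) * b l)) ∧
      Integrable (fun k => ∫ l, a (k - l) * b l) := by
  have h := hb.convolution_integrand (ContinuousLinearMap.mul ℝ ℝ) ha (μ := volume) (ν := volume)
  have h' : Integrable (fun p : ℝ × ℝ => a (p.1 - p.2) * b p.2) (volume.prod volume) := by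
    refine h.congr (ae_of_all _ fun p => ?_)
    simp [mul_comm]
  exact ⟨h'.prod_right_ae, h'.integral_prod_left⟩

/-- The factor `c` will be the weight at the output frequency of a convolution; under the integral
it can be distributed over the two factors. -/
lemma mul_norm_integral_le {F : ℝ → ℂ} {b : ℝ → ℝ} {c : ℝ} (hc : 0 ≤ c)
    (h : ∀ᵐ l, c * ‖F l‖ ≤ b l) (hb : Integrable b) : c * ‖∫ l, F l‖ ≤ ∫ l, b l := by
  have : c * ‖∫ l, F l‖ = ‖∫ l, (c : ℂ) * F l‖ := by
    rw [integral_const_mul, norm_mul, Complex.norm_real, Real.norm_eq_abs, abs_of_nonneg hc]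
  rw [this]
  refine norm_integral_le_of_norm_le hb (h.mono fun l hl => ?_)
  rwa [norm_mul, Complex.norm_real, Real.norm_eq_abs, abs_of_nonneg hc]

lemma ae_sub_left {P : ℝ → Prop} (h : ∀ᵐ k, P k) (k : ℝ) : ∀ᵐ l : ℝ, P (k - l) :=
  (quasiMeasurePreserving_sub_left volume k).ae h

/-- Submultiplicativity of the weight, from `|k| ≤ |k - l| + |l|`: it makes weighted `L¹` a
convolution algebra. -/
lemma one_add_abs_pow_le (k l : ℝ) (m : ℕ) :
    (1 + |k|) ^ m ≤ (1 + |k - l|) ^ m * (1 + |l|) ^ m := by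
  rw [← mul_pow]
  refine pow_le_pow_left₀ (by positivity) ?_ m
  have h : |k| ≤ |k - l| + |l| := by
    calc |k| = |k - l + l| := by ring_nf
      _ ≤ _ := abs_add_le _ _
  nlinarith [abs_nonneg (k - l), abs_nonneg l]

lemma ae_neg {P : ℝ → Prop} (h : ∀ᵐ k, P k) : ∀ᵐ k : ℝ, P (-k) := by
  simpa using ae_sub_left h 0

namespace IsField
variable {D D' S : Set ℝ} {f g : ℝ × ℝ × ℝ → ℝ} {fh gh : ℝ → ℝ → ℝ → ℂ}

lemma toWave (hf : IsField D S f fh) : IsWaveField D S f fh where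
  repr := hf.repr
  meas := hf.meas
  cont := hf.cont
  smooth := hf.smooth
  bound := by
    obtain ⟨g, hg, h⟩ := hf.bound 1
    refine ⟨g, hg, h.mono fun k hk => ⟨fun η hη τ hτ => ?_, fun η hη τ hτ => ⟨?_, ?_⟩⟩⟩
    · simpa using hk.1 η hη τ hτ
    · have := (hk.2 η hη τ hτ).1
      nlinarith [norm_nonneg (deriv (fun y => fh k y τ) η), abs_nonneg k]
    · have := (hk.2 η hη τ hτ).2
      nlinarith [norm_nonneg (deriv (fun s => fh k η s) τ), abs_nonneg k]

lemma mono (hf : IsField D S f fh) (h : D' ⊆ D) : IsField D' S f fh where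
  repr θ η hη := hf.repr θ η (h hη)
  meas η hη := hf.meas η (h hη)
  cont := hf.cont.mono fun k hk => hk.mono (prod_mono_left h)
  smooth := hf.smooth.mono fun k hk => hk.mono (prod_mono_left (interior_mono h))
  bound m := by
    obtain ⟨g, hg, hb⟩ := hf.bound m
    exact ⟨g, hg, hb.mono fun k hk =>
      ⟨fun η hη => hk.1 η (h hη), fun η hη => hk.2 η (interior_mono h hη)⟩⟩

lemma congr_fun {f' : ℝ × ℝ × ℝ → ℝ} (hf : IsField D S f fh)
    (h : ∀ θ, ∀ η ∈ D, ∀ τ ∈ S, f' (θ, η, τ) = f (θ, η, τ)) : IsField D S f' fh where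
  repr θ η hη τ hτ := by rw [h θ η hη τ hτ]; exact hf.repr θ η hη τ hτ
  meas := hf.meas
  cont := hf.cont
  smooth := hf.smooth
  bound := hf.bound

lemma add (hf : IsField D S f fh) (hg : IsField D S g gh) (hS : IsOpen S) :
    IsField D S (fun z => f z + g z) (fun k η τ => fh k η τ + gh k η τ) where
  repr := (hf.toWave.add hg.toWave hS).repr
  meas := (hf.toWave.add hg.toWave hS).meas
  cont := (hf.toWave.add hg.toWave hS).cont
  smooth := (hf.toWave.add hg.toWave hS).smooth
  bound m := by
    obtain ⟨a, ha, h⟩ := hf.bound m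
    obtain ⟨b, hb, h'⟩ := hg.bound m
    refine ⟨fun k => a k + b k, ha.add hb, ?_⟩
    filter_upwards [h, h', hf.toWave.ae_diff hS, hg.toWave.ae_diff hS] with k h1 h2 d1 d2
    have key : ∀ x y : ℂ, (1 + |k|) ^ m * ‖x‖ ≤ a k → (1 + |k|) ^ m * ‖y‖ ≤ b k →
        (1 + |k|) ^ m * ‖x + y‖ ≤ a k + b k := fun x y hx hy =>
      (mul_le_mul_of_nonneg_left (norm_add_le x y) (by positivity)).trans
        (by rw [mul_add]; exact add_le_add hx hy)
    refine ⟨fun η hη τ hτ => key _ _ (h1.1 η hη τ hτ) (h2.1 η hη τ hτ), fun η hη τ hτ => ⟨?_, ?_⟩⟩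
    · have := deriv_fun_add (deriv_fst_eq (d1 η hη τ hτ)).differentiableAt
        (deriv_fst_eq (d2 η hη τ hτ)).differentiableAt
      dsimp only at this
      rw [this]
      exact key _ _ (h1.2 η hη τ hτ).1 (h2.2 η hη τ hτ).1
    · have := deriv_fun_add (deriv_snd_eq (d1 η hη τ hτ)).differentiableAt
        (deriv_snd_eq (d2 η hη τ hτ)).differentiableAt
      dsimp only at this
      rw [this]
      exact key _ _ (h1.2 η hη τ hτ).2 (h2.2 η hη τ hτ).2

lemma const_mul (hf : IsField D S f fh) (c : ℝ) :
    IsField D S (fun z => c * f z) (fun k η τ => c * fh k η τ) where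
  repr := (hf.toWave.const_mul c).repr
  meas := (hf.toWave.const_mul c).meas
  cont := (hf.toWave.const_mul c).cont
  smooth := (hf.toWave.const_mul c).smooth
  bound m := by
    obtain ⟨a, ha, h⟩ := hf.bound m
    refine ⟨fun k => |c| * a k, ha.const_mul _, ?_⟩
    filter_upwards [h] with k h1
    refine ⟨fun η hη τ hτ => ?_, fun η hη τ hτ => ⟨?_, ?_⟩⟩
    · rw [norm_mul, Complex.norm_real, Real.norm_eq_abs, mul_left_comm]
      exact mul_le_mul_of_nonneg_left (h1.1 η hη τ hτ) (abs_nonneg c)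
    · rw [deriv_const_mul_field, norm_mul, Complex.norm_real, Real.norm_eq_abs, mul_left_comm]
      exact mul_le_mul_of_nonneg_left (h1.2 η hη τ hτ).1 (abs_nonneg c)
    · rw [deriv_const_mul_field, norm_mul, Complex.norm_real, Real.norm_eq_abs, mul_left_comm]
      exact mul_le_mul_of_nonneg_left (h1.2 η hη τ hτ).2 (abs_nonneg c)

lemma conv_meas (hf : IsField D S f fh) (hg : IsField D S g gh) {η τ : ℝ} (hη : η ∈ D)
    (hτ : τ ∈ S) : AEStronglyMeasurable (fun k => conv fh gh k η τ) volume := by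
  have h := AEStronglyMeasurable.convolution_integrand (ContinuousLinearMap.mul ℝ ℂ)
    (μ := volume) (ν := volume) (hg.meas η hη τ hτ) (hf.meas η hη τ hτ)
  refine h.integral_prod_right'.congr (ae_of_all _ fun k => ?_)
  simp [conv, mul_comm]

lemma conv_repr (hf : IsField D S f fh) (hg : IsField D S g gh) (θ : ℝ) {η τ : ℝ} (hη : η ∈ D)
    (hτ : τ ∈ S) : ((f (θ, η, τ) * g (θ, η, τ) : ℝ) : ℂ)
      = ∫ k : ℝ, conv fh gh k η τ * exp (I * k * θ) := by
  have h1 : Integrable (fun k => fh k η τ * exp (I * k * θ)) :=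
    (hf.toWave.integrable hη hτ).mul_bdd (c := 1) (by fun_prop) (by simp [norm_exp_I_mul])
  have h2 : Integrable (fun k => gh k η τ * exp (I * k * θ)) :=
    (hg.toWave.integrable hη hτ).mul_bdd (c := 1) (by fun_prop) (by simp [norm_exp_I_mul])
  have h := integral_convolution (ContinuousLinearMap.mul ℝ ℂ) h2 h1 (μ := volume) (ν := volume)
  rw [Complex.ofReal_mul, hf.repr θ η hη τ hτ, hg.repr θ η hη τ hτ, mul_comm]
  refine Eq.trans h.symm (integral_congr_ae (ae_of_all _ fun k => ?_))
  simp only [convolution_def, conv, ContinuousLinearMap.mul_apply']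
  rw [← integral_mul_const]
  refine integral_congr_ae (ae_of_all _ fun l => ?_)
  have : exp (I * k * θ) = exp (I * l * θ) * exp (I * (k - l : ℝ) * θ) := by
    rw [← Complex.exp_add]; congr 1; push_cast; ring
  simp only [this]
  ring

/-- A product of functions has the convolution as its transform, and the convolution algebra
property of weighted `L¹` carries every bound over, with the same weight on both factors. Continuity
and differentiability in `(η, τ)` follow by domination at almost every output frequency. -/
lemma mul (hf : IsField D S f fh) (hg : IsField D S g gh) (hS : IsOpen S) :
    IsField D S (fun z => f z * g z) (conv fh gh) := by
  have hO := IsWaveField.isOpen_interior_prod (D := D) hS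
  have main : ∀ m : ℕ, ∃ b : ℝ → ℝ, Integrable b ∧ ∀ᵐ k : ℝ,
      (∀ η ∈ D, ∀ τ ∈ S, (1 + |k|) ^ m * ‖conv fh gh k η τ‖ ≤ b k) ∧
      (∀ η ∈ interior D, ∀ τ ∈ S,
        (1 + |k|) ^ m * ‖deriv (fun y => conv fh gh k y τ) η‖ ≤ b k ∧
        (1 + |k|) ^ m * ‖deriv (fun s => conv fh gh k η s) τ‖ ≤ b k) ∧
      ContinuousOn (fun z : ℝ × ℝ => conv fh gh k z.1 z.2) (D ×ˢ S) ∧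
      ContDiffOn ℝ 1 (fun z : ℝ × ℝ => conv fh gh k z.1 z.2) (interior D ×ˢ S) := by
    intro m
    obtain ⟨a, ha, h⟩ := hf.bound m
    obtain ⟨b, hb, h'⟩ := hg.bound m
    obtain ⟨c1, c2⟩ := convolution_integrable ha.abs hb.abs
    -- The factor `2` covers the two terms of the product rule.
    refine ⟨fun k => ∫ l, 2 * (|a (k - l)| * |b l|), ?_, ?_⟩
    · simp only [integral_const_mul]; exact c2.const_mul 2
    filter_upwards [c1] with k hk
    have hk2 := hk.const_mul 2
    have hF := ae_sub_left (h.and (hf.cont.and (hf.smooth.and (hf.toWave.ae_diff hS)))) k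
    have hG := h'.and (hg.cont.and (hg.smooth.and (hg.toWave.ae_diff hS)))
    have wt : ∀ (l : ℝ) (x y : ℂ), (1 + |k - l|) ^ m * ‖x‖ ≤ a (k - l) → (1 + |l|) ^ m * ‖y‖ ≤ b l →
        (1 + |k|) ^ m * ‖x * y‖ ≤ |a (k - l)| * |b l| := by
      intro l x y hx hy
      rw [norm_mul]
      calc (1 + |k|) ^ m * (‖x‖ * ‖y‖)
          ≤ ((1 + |k - l|) ^ m * (1 + |l|) ^ m) * (‖x‖ * ‖y‖) :=
            mul_le_mul_of_nonneg_right (one_add_abs_pow_le k l m) (by positivity)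
        _ = ((1 + |k - l|) ^ m * ‖x‖) * ((1 + |l|) ^ m * ‖y‖) := by ring
        _ ≤ _ := mul_le_mul (hx.trans (le_abs_self _)) (hy.trans (le_abs_self _)) (by positivity)
            (abs_nonneg _)
    have one_le : ∀ (x : ℂ) (c : ℝ), (1 + |k|) ^ m * ‖x‖ ≤ c → ‖x‖ ≤ c := by
      intro x c hx
      have : (1 : ℝ) ≤ (1 + |k|) ^ m := one_le_pow₀ (by linarith [abs_nonneg k])
      nlinarith [norm_nonneg x]
    have meas : ∀ η ∈ D, ∀ τ ∈ S,
        AEStronglyMeasurable (fun l => fh (k - l) η τ * gh l η τ) volume := fun η hη τ hτ =>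
      ((hf.meas η hη τ hτ).comp_quasiMeasurePreserving
        (quasiMeasurePreserving_sub_left volume k)).mul (hg.meas η hη τ hτ)
    set F : ℝ → ℝ × ℝ → ℂ := fun l z => fh (k - l) z.1 z.2 * gh l z.1 z.2 with hFdef
    have smooth : ∀ᵐ l, ContDiffOn ℝ 1 (F l) (interior D ×ˢ S) := by
      filter_upwards [hF, hG] with l h1 h2 using h1.2.2.1.mul h2.2.2.1
    have bd : ∀ᵐ l, ∀ z ∈ interior D ×ˢ S, (1 + |k|) ^ m * ‖F l z‖ ≤ |a (k - l)| * |b l| ∧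
        (1 + |k|) ^ m * ‖fderiv ℝ (F l) z (1, 0)‖ ≤ 2 * (|a (k - l)| * |b l|) ∧
        (1 + |k|) ^ m * ‖fderiv ℝ (F l) z (0, 1)‖ ≤ 2 * (|a (k - l)| * |b l|) := by
      filter_upwards [hF, hG] with l h1 h2
      rintro ⟨η, τ⟩ ⟨hη, hτ⟩
      have d1 := h1.2.2.2 η hη τ hτ
      have d2 := h2.2.2.2 η hη τ hτ
      have hη' := interior_subset hη
      have dF : DifferentiableAt ℝ (F l) (η, τ) := d1.mul d2
      have e1 : fderiv ℝ (F l) (η, τ) (1, 0) = deriv (fun y => fh (k - l) y τ) η * gh l η τ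
          + fh (k - l) η τ * deriv (fun y => gh l y τ) η := by
        rw [← (deriv_fst_eq dF).deriv]
        exact deriv_fun_mul (deriv_fst_eq d1).differentiableAt (deriv_fst_eq d2).differentiableAt
      have e2 : fderiv ℝ (F l) (η, τ) (0, 1) = deriv (fun s => fh (k - l) η s) τ * gh l η τ
          + fh (k - l) η τ * deriv (fun s => gh l η s) τ := by
        rw [← (deriv_snd_eq dF).deriv]
        exact deriv_fun_mul (deriv_snd_eq d1).differentiableAt (deriv_snd_eq d2).differentiableAt
      have two : ∀ x y : ℂ, (1 + |k|) ^ m * ‖x‖ ≤ |a (k - l)| * |b l| →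
          (1 + |k|) ^ m * ‖y‖ ≤ |a (k - l)| * |b l| →
          (1 + |k|) ^ m * ‖x + y‖ ≤ 2 * (|a (k - l)| * |b l|) := fun x y hx hy =>
        (mul_le_mul_of_nonneg_left (norm_add_le x y) (by positivity)).trans
          (by rw [mul_add]; linarith)
      have b1 := h1.1.1 η hη' τ hτ
      have b2 := h2.1.1 η hη' τ hτ
      refine ⟨wt l _ _ b1 b2, ?_, ?_⟩
      · rw [e1]
        exact two _ _ (wt l _ _ (h1.1.2 η hη τ hτ).1 b2) (wt l _ _ b1 (h2.1.2 η hη τ hτ).1)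
      · rw [e2]
        exact two _ _ (wt l _ _ (h1.1.2 η hη τ hτ).2 b2) (wt l _ _ b1 (h2.1.2 η hη τ hτ).2)
    -- The norm of the derivative is at most the sum of two partial derivatives, each bounded with a
    -- factor `2`.
    have bd' : ∀ᵐ l, ∀ z ∈ interior D ×ˢ S, ‖F l z‖ ≤ 4 * (|a (k - l)| * |b l|) ∧
        ‖fderiv ℝ (F l) z‖ ≤ 4 * (|a (k - l)| * |b l|) := by
      filter_upwards [bd] with l hl z hz
      obtain ⟨h1, h2, h3⟩ := hl z hz
      have h0 : 0 ≤ |a (k - l)| * |b l| := by positivity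
      have := one_le _ _ h1
      have := one_le _ _ h2
      have := one_le _ _ h3
      exact ⟨by linarith, (clm_norm_le_prod2 _).trans (by linarith)⟩
    have measO : ∀ z ∈ interior D ×ˢ S, AEStronglyMeasurable (fun l => F l z) volume :=
      fun z hz => meas z.1 (interior_subset hz.1) z.2 hz.2
    have hd : ∀ z ∈ interior D ×ˢ S,
        HasFDerivAt (fun z : ℝ × ℝ => conv fh gh k z.1 z.2) (∫ l, fderiv ℝ (F l) z) z :=
      fun z hz => hasFDerivAt_integral hO measO smooth (hk.const_mul 4) bd' hz
    have hint : ∀ z ∈ interior D ×ˢ S, Integrable (fun l => fderiv ℝ (F l) z) := fun z hz => by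
      refine (hk.const_mul 4).mono' (aestronglyMeasurable_fderiv hO measO hz ?_)
        (bd'.mono fun l hl => (hl z hz).2)
      filter_upwards [smooth] with l hl
      exact (hl.differentiableOn one_ne_zero).differentiableAt (hO.mem_nhds hz)
    refine ⟨fun η hη τ hτ => ?_, fun η hη τ hτ => ⟨?_, ?_⟩, ?_, ?_⟩
    · refine mul_norm_integral_le (by positivity) ?_ hk2
      filter_upwards [hF, hG] with l h1 h2
      have := wt l _ _ (h1.1.1 η hη τ hτ) (h2.1.1 η hη τ hτ)
      have h0 : 0 ≤ |a (k - l)| * |b l| := by positivity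
      linarith
    · have := (deriv_fst_eq (hd (η, τ) ⟨hη, hτ⟩).differentiableAt).deriv
      dsimp only at this
      rw [this, (hd (η, τ) ⟨hη, hτ⟩).fderiv, ContinuousLinearMap.integral_apply (hint _ ⟨hη, hτ⟩)]
      exact mul_norm_integral_le (by positivity) (bd.mono fun l hl => (hl _ ⟨hη, hτ⟩).2.1) hk2
    · have := (deriv_snd_eq (hd (η, τ) ⟨hη, hτ⟩).differentiableAt).deriv
      dsimp only at this
      rw [this, (hd (η, τ) ⟨hη, hτ⟩).fderiv, ContinuousLinearMap.integral_apply (hint _ ⟨hη, hτ⟩)]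
      exact mul_norm_integral_le (by positivity) (bd.mono fun l hl => (hl _ ⟨hη, hτ⟩).2.2) hk2
    · refine continuousOn_of_dominated (bound := fun l => |a (k - l)| * |b l|)
        (fun z hz => meas z.1 hz.1 z.2 hz.2) (fun z hz => ?_) hk ?_
      · filter_upwards [hF, hG] with l h1 h2
        exact one_le _ _ (wt l _ _ (h1.1.1 _ hz.1 _ hz.2) (h2.1.1 _ hz.1 _ hz.2))
      · filter_upwards [hF, hG] with l h1 h2 using h1.2.1.mul h2.2.1
    · exact contDiffOn_integral hO measO smooth (hk.const_mul 4) bd'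
  refine ⟨fun θ η hη τ hτ => conv_repr hf hg θ hη hτ, fun η hη τ hτ => conv_meas hf hg hη hτ, ?_, ?_,
    fun m => ?_⟩
  · obtain ⟨_, _, h⟩ := main 0
    exact h.mono fun k hk => hk.2.2.1
  · obtain ⟨_, _, h⟩ := main 0
    exact h.mono fun k hk => hk.2.2.2
  · obtain ⟨b, hb, h⟩ := main m
    exact ⟨b, hb, h.mono fun k hk => ⟨hk.1, hk.2.1⟩⟩

end IsField

/-! ### Reality of transforms and Fourier multipliers -/

/-- Reality of a wave field in terms of its transform. -/
lemma IsWaveField.ae_hermitian {D S : Set ℝ} {f : ℝ × ℝ × ℝ → ℝ} {fh : ℝ → ℝ → ℝ → ℂ}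
    (hf : IsWaveField D S f fh) {η τ : ℝ} (hη : η ∈ D) (hτ : τ ∈ S) :
    ∀ᵐ k : ℝ, fh (-k) η τ = starRingEnd ℂ (fh k η τ) := by
  have hi := hf.integrable hη hτ
  have hi' : Integrable (fun k => starRingEnd ℂ (fh k η τ)) :=
    (Complex.conjCLE : ℂ →L[ℝ] ℂ).integrable_comp hi
  have conj_exp : ∀ k θ : ℝ, exp (I * k * θ) = starRingEnd ℂ (exp (I * k * (-θ : ℝ))) := by
    intro k θ
    rw [← Complex.exp_conj]
    simp
  -- Both transforms have the same Fourier integral: reflection in `k` produces `f` at `-θ`,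
  -- conjugation produces its conjugate, and `f` is real.
  have key := ae_eq_zero_of_fourier (f := fun k => fh (-k) η τ - starRingEnd ℂ (fh k η τ))
    (hi.comp_neg.sub hi') fun θ => by
      simp only [sub_mul]
      rw [integral_sub, sub_eq_zero]
      · have e1 : ∫ k : ℝ, fh (-k) η τ * exp (I * k * θ) = (f (-θ, η, τ) : ℂ) := by
          rw [hf.repr (-θ) η hη τ hτ, ← integral_neg_eq_self]
          simp
        have e2 : ∫ k : ℝ, starRingEnd ℂ (fh k η τ) * exp (I * k * θ)
            = starRingEnd ℂ (f (-θ, η, τ) : ℂ) := by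
          rw [hf.repr (-θ) η hη τ hτ, ← integral_conj]
          refine integral_congr_ae (ae_of_all _ fun k => ?_)
          simp only [map_mul]
          rw [conj_exp k θ]
        rw [e1, e2, Complex.conj_ofReal]
      · exact hi.comp_neg.mul_bdd (c := 1) (by fun_prop) (by simp [norm_exp_I_mul])
      · exact hi'.mul_bdd (c := 1) (by fun_prop) (by simp [norm_exp_I_mul])
  exact key.mono fun k hk => sub_eq_zero.1 hk

/-- A Fourier multiplier depending on `η`, of polynomial growth in `k`, mapping real functions to
real functions. -/
structure IsMultiplier (D : Set ℝ) (m : ℝ → ℝ → ℂ) : Prop where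
  meas : ∀ η ∈ D, Measurable (fun k => m k η)
  herm : ∀ k, ∀ η ∈ D, m (-k) η = starRingEnd ℂ (m k η)
  cont : ∀ k, ContinuousOn (m k) D
  smooth : ∀ k, ContDiffOn ℝ 1 (m k) (interior D)
  bound : ∃ (C : ℝ) (n : ℕ), 0 ≤ C ∧ ∀ k, (∀ η ∈ D, ‖m k η‖ ≤ C * (1 + |k|) ^ n) ∧
    ∀ η ∈ interior D, ‖deriv (m k) η‖ ≤ C * (1 + |k|) ^ n

/-- The field obtained from a field with transform `fh` by means of the multiplier `m`. -/
noncomputable def lift (m : ℝ → ℝ → ℂ) (fh : ℝ → ℝ → ℝ → ℂ) (z : ℝ × ℝ × ℝ) : ℝ :=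
  (∫ k : ℝ, m k z.2.1 * fh k z.2.1 z.2.2 * exp (I * k * z.1)).re

/-- The real part in the definition of `lift` loses nothing: multiplier and transform are both
Hermitian, so the integral is real. A multiplier of growth `N` costs `N` powers of the weight, which
is why `IsField` demands all powers. -/
lemma IsField.lift {D S : Set ℝ} {f : ℝ × ℝ × ℝ → ℝ} {fh : ℝ → ℝ → ℝ → ℂ} {m : ℝ → ℝ → ℂ}
    (hf : IsField D S f fh) (hS : IsOpen S) (hm : IsMultiplier D m) :
    IsField D S (lift m fh) (fun k η τ => m k η * fh k η τ) := by
  refine ⟨fun θ η hη τ hτ => ?_, fun η hη τ hτ => ?_, ?_, ?_, fun n => ?_⟩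
  · refine Complex.conj_eq_iff_re.1 ?_
    dsimp only
    rw [← integral_conj, ← integral_neg_eq_self]
    refine integral_congr_ae ?_
    filter_upwards [ae_neg (hf.toWave.ae_hermitian hη hτ)] with k hk
    rw [neg_neg] at hk
    have := hm.herm (-k) η hη
    rw [neg_neg] at this
    rw [map_mul, map_mul, ← hk, ← this, ← Complex.exp_conj]
    simp
  · exact (hm.meas η hη).aestronglyMeasurable.mul (hf.meas η hη τ hτ)
  · filter_upwards [hf.cont] with k hk
    exact ((hm.cont k).comp continuous_fst.continuousOn fun z hz => hz.1).mul hk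
  · filter_upwards [hf.smooth] with k hk
    exact ((hm.smooth k).comp contDiff_fst.contDiffOn fun z hz => hz.1).mul hk
  · obtain ⟨C, N, hC, hb⟩ := hm.bound
    obtain ⟨g, hg, h⟩ := hf.bound (n + N)
    refine ⟨fun k => 2 * C * g k, hg.const_mul _, ?_⟩
    filter_upwards [h, hf.toWave.ae_diff hS] with k hk hd
    have key : ∀ x y : ℂ, ‖x‖ ≤ C * (1 + |k|) ^ N → (1 + |k|) ^ (n + N) * ‖y‖ ≤ g k →
        (1 + |k|) ^ n * ‖x * y‖ ≤ C * g k := by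
      intro x y hx hy
      rw [norm_mul]
      calc (1 + |k|) ^ n * (‖x‖ * ‖y‖) ≤ (1 + |k|) ^ n * ((C * (1 + |k|) ^ N) * ‖y‖) := by gcongr
        _ = C * ((1 + |k|) ^ (n + N) * ‖y‖) := by ring
        _ ≤ _ := by gcongr
    refine ⟨fun η hη τ hτ => ?_, fun η hη τ hτ => ?_⟩
    · have := key _ _ ((hb k).1 η hη) (hk.1 η hη τ hτ)
      have h0 : 0 ≤ (1 + |k|) ^ n * ‖m k η * fh k η τ‖ := by positivity
      linarith
    · have k1 := key _ _ ((hb k).1 η (interior_subset hη)) (hk.2 η hη τ hτ).1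
      have k2 := key _ _ ((hb k).2 η hη) (hk.1 η (interior_subset hη) τ hτ)
      have k3 := key _ _ ((hb k).1 η (interior_subset hη)) (hk.2 η hη τ hτ).2
      have dm : DifferentiableAt ℝ (m k) η :=
        ((hm.smooth k).differentiableOn one_ne_zero).differentiableAt (isOpen_interior.mem_nhds hη)
      constructor
      · have := deriv_fun_mul dm (deriv_fst_eq (hd η hη τ hτ)).differentiableAt
        dsimp only at this
        rw [this]
        refine (mul_le_mul_of_nonneg_left (norm_add_le _ _) (by positivity)).trans ?_
        rw [mul_add]
        linarith
      · have := deriv_const_mul (m k η) (deriv_snd_eq (hd η hη τ hτ)).differentiableAt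
        dsimp only at this
        rw [this]
        have h0 : 0 ≤ (1 + |k|) ^ n * ‖m k η * deriv (fun s => fh k η s) τ‖ := by positivity
        linarith

namespace IsProfile
variable {S : Set ℝ} {φ : ℝ × ℝ → ℝ} {φh : ℝ → ℝ → ℂ}

lemma weighted_bound (h : IsProfile S φ φh) (m n : ℕ) (hn : n ≤ 2) : ∃ g : ℝ → ℝ, Integrable g ∧
    ∀ᵐ k : ℝ, ∀ τ ∈ S, (1 + |k|) ^ m * ‖iteratedDeriv n (φh k) τ‖ ≤ g k := by
  obtain ⟨a, ha, h1⟩ := h.bound 0 n hn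
  obtain ⟨b, hb, h2⟩ := h.bound m n hn
  refine ⟨fun k => 2 ^ m * (a k + b k), (ha.add hb).const_mul _, ?_⟩
  filter_upwards [h1, h2] with k h1 h2 τ hτ
  have e1 := h1 τ hτ
  have e2 := h2 τ hτ
  rw [pow_zero, one_mul] at e1
  -- Convexity of the power; the constant `2 ^ (m - 1)` is rounded up to `2 ^ m`, which also covers
  -- `m = 0`.
  have e3 : (1 + |k|) ^ m ≤ 2 ^ m * (1 + |k| ^ m) := by
    have := add_pow_le (zero_le_one) (abs_nonneg k) m
    rw [one_pow] at this
    refine this.trans ?_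
    gcongr
    · norm_num
    · omega
  calc (1 + |k|) ^ m * ‖iteratedDeriv n (φh k) τ‖
      ≤ (2 ^ m * (1 + |k| ^ m)) * ‖iteratedDeriv n (φh k) τ‖ := by gcongr
    _ = 2 ^ m * (‖iteratedDeriv n (φh k) τ‖ + |k| ^ m * ‖iteratedDeriv n (φh k) τ‖) := by ring
    _ ≤ _ := by gcongr

/-- A profile as a field independent of `η`. -/
lemma isField (h : IsProfile S φ φh) :
    IsField univ S (fun z => φ (z.1, z.2.2)) (fun k _ τ => φh k τ) where
  repr θ η _ τ hτ := h.repr θ τ hτ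
  meas η _ τ hτ := h.meas τ hτ
  cont := by
    filter_upwards [h.smooth] with k hk
    exact hk.continuousOn.comp continuous_snd.continuousOn fun z hz => hz.2
  smooth := by
    filter_upwards [h.smooth] with k hk
    exact (hk.of_le one_le_two).comp contDiff_snd.contDiffOn fun z hz => hz.2
  bound m := by
    obtain ⟨a, ha, h1⟩ := h.weighted_bound m 0 (by norm_num)
    obtain ⟨b, hb, h2⟩ := h.weighted_bound m 1 (by norm_num)
    refine ⟨fun k => |a k| + |b k|, ha.abs.add hb.abs, ?_⟩
    filter_upwards [h1, h2] with k h1 h2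
    refine ⟨fun η _ τ hτ => ?_, fun η _ τ hτ => ⟨?_, ?_⟩⟩
    · have := h1 τ hτ
      rw [iteratedDeriv_zero] at this
      linarith [le_abs_self (a k), abs_nonneg (b k)]
    · rw [deriv_const, norm_zero, mul_zero]
      positivity
    · have := h2 τ hτ
      rw [iteratedDeriv_one] at this
      linarith [le_abs_self (b k), abs_nonneg (a k)]

/-- The time derivative of a profile as a field independent of `η`. -/
lemma isField_deriv (h : IsProfile S φ φh) (hS : IsOpen S) :
    IsField univ S (dTa fun z => φ (z.1, z.2.2)) (fun k _ τ => deriv (φh k) τ) where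
  repr θ η _ τ hτ := h.isField.toWave.dTa_eq hS (by simp) hτ
  meas η _ τ hτ := h.isField.toWave.meas_deriv_snd hS (η := η) (by simp) hτ
  cont := by
    filter_upwards [h.smooth] with k hk
    exact (hk.continuousOn_deriv_of_isOpen hS one_le_two).comp continuous_snd.continuousOn
      fun z hz => hz.2
  smooth := by
    filter_upwards [h.smooth] with k hk
    exact (hk.deriv_of_isOpen hS (m := 1) (by norm_num)).comp contDiff_snd.contDiffOn
      fun z hz => hz.2
  bound m := by
    obtain ⟨a, ha, h1⟩ := h.weighted_bound m 1 (by norm_num)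
    obtain ⟨b, hb, h2⟩ := h.weighted_bound m 2 (by norm_num)
    refine ⟨fun k => |a k| + |b k|, ha.abs.add hb.abs, ?_⟩
    filter_upwards [h1, h2] with k h1 h2
    refine ⟨fun η _ τ hτ => ?_, fun η _ τ hτ => ⟨?_, ?_⟩⟩
    · have := h1 τ hτ
      rw [iteratedDeriv_one] at this
      linarith [le_abs_self (a k), abs_nonneg (b k)]
    · rw [deriv_const, norm_zero, mul_zero]
      positivity
    · have := h2 τ hτ
      rw [iteratedDeriv_succ, iteratedDeriv_one] at this
      change (1 + |k|) ^ m * ‖deriv (deriv (φh k)) τ‖ ≤ _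
      linarith [le_abs_self (b k), abs_nonneg (a k)]

end IsProfile

/-! ## Exponentially decaying multipliers -/

/-- The multiplier `(-i sgn k)^s (ik)^a (-κ|k|)^b e^{-κ|k|η}`. -/
noncomputable def hker (κ : ℝ) (s a b : ℕ) (k η : ℝ) : ℂ :=
  (-(I * Real.sign k)) ^ s * (I * k) ^ a * ((-κ * |k| : ℝ) : ℂ) ^ b * exp ((-κ * |k| * η : ℝ) : ℂ)

lemma measurable_sign : Measurable Real.sign := by
  unfold Real.sign
  exact Measurable.ite measurableSet_Iio measurable_const
    (Measurable.ite measurableSet_Ioi measurable_const measurable_const)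

lemma abs_sign_le (k : ℝ) : |Real.sign k| ≤ 1 := by
  rcases Real.sign_apply_eq k with h | h | h <;> simp [h]

/-- The exponents count operations: `b` derivatives in `η`, `a` derivatives in `θ`, `s` Hilbert
transforms. The family is thus closed under differentiation, and later calculus becomes arithmetic
of indices. -/
lemma hasDerivAt_hker (κ : ℝ) (s a b : ℕ) (k η : ℝ) :
    HasDerivAt (hker κ s a b k) (hker κ s a (b + 1) k η) η := by
  have h : HasDerivAt (fun y : ℝ => exp ((-κ * |k| * y : ℝ) : ℂ))
      (exp ((-κ * |k| * η : ℝ) : ℂ) * ((-κ * |k| * 1 : ℝ) : ℂ)) η :=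
    (((hasDerivAt_id η).const_mul (-κ * |k|)).ofReal_comp).cexp
  have := h.const_mul ((-(I * Real.sign k)) ^ s * (I * k) ^ a * ((-κ * |k| : ℝ) : ℂ) ^ b)
  refine HasDerivAt.congr_deriv (f := hker κ s a b k) this ?_
  rw [hker, mul_one]
  ring

lemma contDiff_hker (κ : ℝ) (s a b : ℕ) (k : ℝ) : ContDiff ℝ 1 (hker κ s a b k) := by
  rw [contDiff_one_iff_deriv]
  have h : deriv (hker κ s a b k) = hker κ s a (b + 1) k :=
    funext fun η => (hasDerivAt_hker κ s a b k η).deriv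
  refine ⟨fun η => (hasDerivAt_hker κ s a b k η).differentiableAt, ?_⟩
  rw [h, continuous_iff_continuousAt]
  exact fun η => (hasDerivAt_hker κ s a (b + 1) k η).continuousAt

lemma norm_hker (κ : ℝ) (s a b : ℕ) (k η : ℝ) : ‖hker κ s a b k η‖
    = |Real.sign k| ^ s * |k| ^ (a + b) * |κ| ^ b * Real.exp (-κ * |k| * η) := by
  rw [hker, norm_mul, norm_mul, norm_mul, norm_pow, norm_pow, norm_pow, Complex.norm_exp_ofReal,
    norm_neg, norm_mul, norm_mul, Complex.norm_I, Complex.norm_real, Complex.norm_real,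
    Complex.norm_real, Real.norm_eq_abs, Real.norm_eq_abs, Real.norm_eq_abs, abs_mul, abs_neg,
    abs_abs, one_mul, one_mul, mul_pow, pow_add]
  ring

lemma norm_hker_le {κ η : ℝ} (h : 0 ≤ κ * η) (s a b : ℕ) (k : ℝ) :
    ‖hker κ s a b k η‖ ≤ |κ| ^ b * (1 + |k|) ^ (a + b) := by
  rw [norm_hker]
  have h1 : |Real.sign k| ^ s ≤ 1 := pow_le_one₀ (abs_nonneg _) (abs_sign_le k)
  have h2 : Real.exp (-κ * |k| * η) ≤ 1 := by
    rw [Real.exp_le_one_iff]; nlinarith [abs_nonneg k]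
  have h3 : |k| ^ (a + b) ≤ (1 + |k|) ^ (a + b) :=
    pow_le_pow_left₀ (abs_nonneg k) (by linarith) _
  calc _ ≤ 1 * (1 + |k|) ^ (a + b) * |κ| ^ b * 1 := by gcongr
    _ = _ := by ring

lemma measurable_hker (κ : ℝ) (s a b : ℕ) (η : ℝ) : Measurable (fun k => hker κ s a b k η) := by
  unfold hker
  have := measurable_sign
  fun_prop

lemma hker_neg (κ : ℝ) (s a b : ℕ) (k η : ℝ) :
    hker κ s a b (-k) η = starRingEnd ℂ (hker κ s a b k η) := by
  simp only [hker, map_mul, map_pow, map_neg, Complex.conj_I, Complex.conj_ofReal, Real.sign_neg,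
    abs_neg, ← Complex.exp_conj]
  push_cast
  ring

lemma isMultiplier_hker {κ : ℝ} {D : Set ℝ} (hD : ∀ η ∈ D, 0 ≤ κ * η) (s a b : ℕ) :
    IsMultiplier D (hker κ s a b) where
  meas η _ := measurable_hker κ s a b η
  herm k η _ := hker_neg κ s a b k η
  cont k := (contDiff_hker κ s a b k).continuous.continuousOn
  smooth k := (contDiff_hker κ s a b k).contDiffOn
  bound := by
    have key : ∀ {k : ℝ} (m n : ℕ), m ≤ b + 1 → n ≤ a + b + 1 →
        |κ| ^ m * (1 + |k|) ^ n ≤ (1 + |κ|) ^ (b + 1) * (1 + |k|) ^ (a + b + 1) := by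
      intro k m n hm hn
      refine mul_le_mul ?_ (pow_le_pow_right₀ (by linarith [abs_nonneg k]) hn) (by positivity)
        (by positivity)
      exact (pow_le_pow_left₀ (abs_nonneg κ) (by linarith) _).trans
        (pow_le_pow_right₀ (by linarith [abs_nonneg κ]) hm)
    refine ⟨(1 + |κ|) ^ (b + 1), a + b + 1, by positivity, fun k => ⟨fun η hη => ?_, fun η hη => ?_⟩⟩
    · exact (norm_hker_le (hD η hη) s a b k).trans (key b (a + b) (by omega) (by omega))
    · rw [(hasDerivAt_hker κ s a b k η).deriv]
      exact (norm_hker_le (hD η (interior_subset hη)) s a (b + 1) k).trans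
        (key (b + 1) (a + (b + 1)) le_rfl (by omega))

/-- The factor `η` is paid for by one power of `|k|`, because `x e^{-x} ≤ 1` for `x = κ|k|η`. Such a
power is present exactly when `1 ≤ a + b`. -/
lemma norm_eta_hker_le {κ η : ℝ} (hκ : κ ≠ 0) (h : 0 ≤ κ * η) (s a b : ℕ) (k : ℝ)
    (hab : 1 ≤ a + b) :
    ‖(η : ℂ) * hker κ s a b k η‖ ≤ |κ|⁻¹ * |κ| ^ b * (1 + |k|) ^ (a + b) := by
  rw [norm_mul, norm_hker, Complex.norm_real, Real.norm_eq_abs]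
  have h1 : |Real.sign k| ^ s ≤ 1 := pow_le_one₀ (abs_nonneg _) (abs_sign_le k)
  have hκ' : 0 < |κ| := abs_pos.2 hκ
  have h2 : |η| * |k| * Real.exp (-κ * |k| * η) ≤ |κ|⁻¹ := by
    have e : κ * η = |κ| * |η| := by rw [← abs_mul, abs_of_nonneg h]
    have e' : -κ * |k| * η = -(|κ| * |η| * |k|) := by rw [← e]; ring
    rw [e', Real.exp_neg, ← div_eq_mul_inv, div_le_iff₀ (Real.exp_pos _)]
    have := Real.add_one_le_exp (|κ| * |η| * |k|)
    rw [← div_eq_inv_mul, le_div_iff₀ hκ']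
    nlinarith
  obtain ⟨n, hn⟩ : ∃ n, a + b = n + 1 := ⟨a + b - 1, by omega⟩
  rw [hn]
  have h3 : |k| ^ n ≤ (1 + |k|) ^ (n + 1) :=
    (pow_le_pow_left₀ (abs_nonneg k) (by linarith) _).trans
      (pow_le_pow_right₀ (by linarith [abs_nonneg k]) (by omega))
  calc _ = |Real.sign k| ^ s * |k| ^ n * |κ| ^ b * (|η| * |k| * Real.exp (-κ * |k| * η)) := by ring
    _ ≤ 1 * (1 + |k|) ^ (n + 1) * |κ| ^ b * |κ|⁻¹ := by gcongr
    _ = _ := by ring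

lemma isMultiplier_eta_hker {κ : ℝ} {D : Set ℝ} (hκ : κ ≠ 0) (hD : ∀ η ∈ D, 0 ≤ κ * η)
    (s a b : ℕ) (hab : 1 ≤ a + b) : IsMultiplier D (fun k η => (η : ℂ) * hker κ s a b k η) where
  meas η _ := (measurable_hker κ s a b η).const_mul _
  herm k η _ := by rw [hker_neg, map_mul, Complex.conj_ofReal]
  cont k := by
    have := (contDiff_hker κ s a b k).continuous
    exact Continuous.continuousOn (by fun_prop)
  smooth k := (Complex.ofRealCLM.contDiff.mul (contDiff_hker κ s a b k)).contDiffOn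
  bound := by
    refine ⟨|κ|⁻¹ * |κ| ^ b + |κ| ^ b + |κ|⁻¹ * |κ| ^ (b + 1), a + b + 1, by positivity,
      fun k => ⟨fun η hη => ?_, fun η hη => ?_⟩⟩
    · refine (norm_eta_hker_le hκ (hD η hη) s a b k hab).trans ?_
      have h1 : (1 + |k|) ^ (a + b) ≤ (1 + |k|) ^ (a + b + 1) :=
        pow_le_pow_right₀ (by linarith [abs_nonneg k]) (by omega)
      gcongr
      have : 0 ≤ |κ| ^ b + |κ|⁻¹ * |κ| ^ (b + 1) := by positivity
      linarith
    · have hη' := hD η (interior_subset hη)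
      have hd : HasDerivAt (fun y : ℝ => (y : ℂ) * hker κ s a b k y)
          (((1 : ℝ) : ℂ) * hker κ s a b k η + (η : ℂ) * hker κ s a (b + 1) k η) η :=
        ((hasDerivAt_id η).ofReal_comp).mul (hasDerivAt_hker κ s a b k η)
      rw [hd.deriv, Complex.ofReal_one, one_mul]
      have e1 := norm_hker_le hη' s a b k
      have e2 := norm_eta_hker_le hκ hη' s a (b + 1) k (by omega)
      have h1 : (1 + |k|) ^ (a + b) ≤ (1 + |k|) ^ (a + b + 1) :=
        pow_le_pow_right₀ (by linarith [abs_nonneg k]) (by omega)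
      refine (norm_add_le _ _).trans ?_
      have h2 : |κ| ^ b * (1 + |k|) ^ (a + b) ≤ |κ| ^ b * (1 + |k|) ^ (a + b + 1) := by gcongr
      have h3 : 0 ≤ |κ|⁻¹ * |κ| ^ b * (1 + |k|) ^ (a + b + 1) := by positivity
      rw [← add_assoc] at e2
      linarith

/-- The field with transform `hker κ s a b * X`. -/
noncomputable def harm (κ : ℝ) (s a b : ℕ) (X : ℝ → ℝ → ℂ) : ℝ × ℝ × ℝ → ℝ :=
  lift (hker κ s a b) (fun k _ τ => X k τ)

/-! ### Extensions of profiles away from the interface -/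

section Harm
variable {κ : ℝ} {D S : Set ℝ} {χ : ℝ × ℝ × ℝ → ℝ} {X : ℝ → ℝ → ℂ}

lemma isField_harm (hD : ∀ η ∈ D, 0 ≤ κ * η) (hS : IsOpen S)
    (hX : IsField univ S χ (fun k _ τ => X k τ)) (s a b : ℕ) :
    IsField D S (harm κ s a b X) (fun k η τ => hker κ s a b k η * X k τ) :=
  (hX.mono (subset_univ D)).lift hS (isMultiplier_hker hD s a b)

/-- `harm κ s a b X` multiplied by `η`. -/
lemma isField_eta_harm (hκ : κ ≠ 0) (hD : ∀ η ∈ D, 0 ≤ κ * η) (hS : IsOpen S)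
    (hX : IsField univ S χ (fun k _ τ => X k τ)) (s a b : ℕ) (hab : 1 ≤ a + b) :
    IsField D S (fun z => z.2.1 * harm κ s a b X z)
      (fun k η τ => (η : ℂ) * hker κ s a b k η * X k τ) := by
  refine ((hX.mono (subset_univ D)).lift hS (isMultiplier_eta_hker hκ hD s a b hab)).congr_fun
    fun θ η _ τ _ => ?_
  simp only [harm, lift, mul_assoc]
  rw [integral_const_mul, Complex.re_ofReal_mul]

/-- `f` is differentiable at `z`, with the partial derivatives `a, b, c`. -/
def HasPd (f : ℝ × ℝ × ℝ → ℝ) (a b c : ℝ) (z : ℝ × ℝ × ℝ) : Prop :=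
  DifferentiableAt ℝ f z ∧ dTh f z = a ∧ dEt f z = b ∧ dTa f z = c

namespace HasPd
variable {f g : ℝ × ℝ × ℝ → ℝ} {a b c a' b' c' : ℝ} {z : ℝ × ℝ × ℝ}

lemma add (hf : HasPd f a b c z) (hg : HasPd g a' b' c' z) :
    HasPd (fun z => f z + g z) (a + a') (b + b') (c + c') z := by
  obtain ⟨h, rfl, rfl, rfl⟩ := hf
  obtain ⟨h', rfl, rfl, rfl⟩ := hg
  refine ⟨h.add h', ?_, ?_, ?_⟩ <;> simp [dTh, dEt, dTa, fderiv_fun_add h h']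

lemma mul (hf : HasPd f a b c z) (hg : HasPd g a' b' c' z) :
    HasPd (fun z => f z * g z) (a * g z + f z * a') (b * g z + f z * b') (c * g z + f z * c') z := by
  obtain ⟨h, rfl, rfl, rfl⟩ := hf
  obtain ⟨h', rfl, rfl, rfl⟩ := hg
  refine ⟨h.mul h', ?_, ?_, ?_⟩ <;> simp [dTh, dEt, dTa, fderiv_fun_mul h h'] <;> ring

lemma const_mul (hf : HasPd f a b c z) (r : ℝ) :
    HasPd (fun z => r * f z) (r * a) (r * b) (r * c) z := by
  obtain ⟨h, rfl, rfl, rfl⟩ := hf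
  refine ⟨h.const_mul r, ?_, ?_, ?_⟩ <;> simp [dTh, dEt, dTa, fderiv_const_mul h r]

lemma eta (z : ℝ × ℝ × ℝ) : HasPd (fun z => z.2.1) 0 1 0 z := by
  have h : HasFDerivAt (fun z : ℝ × ℝ × ℝ => z.2.1)
      ((ContinuousLinearMap.fst ℝ ℝ ℝ).comp (ContinuousLinearMap.snd ℝ ℝ (ℝ × ℝ))) z :=
    ((ContinuousLinearMap.fst ℝ ℝ ℝ).comp (ContinuousLinearMap.snd ℝ ℝ (ℝ × ℝ))).hasFDerivAt
  refine ⟨h.differentiableAt, ?_, ?_, ?_⟩ <;> simp [dTh, dEt, dTa, h.fderiv]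

end HasPd

lemma re_eq_of_integral {r : ℝ} {F G : ℝ → ℂ} (h : (r : ℂ) = ∫ k, F k) (hFG : ∀ᵐ k, F k = G k) :
    r = (∫ k, G k).re := by
  rw [← integral_congr_ae hFG, ← h, Complex.ofReal_re]

lemma hasPd_harm (hD : ∀ η ∈ D, 0 ≤ κ * η) (hS : IsOpen S)
    (hX : IsField univ S χ (fun k _ τ => X k τ)) (s a b : ℕ) {z : ℝ × ℝ × ℝ}
    (hz : z.2.1 ∈ interior D) (hτ : z.2.2 ∈ S) :
    HasPd (harm κ s a b X) (harm κ s (a + 1) b X z) (harm κ s a (b + 1) X z)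
      (harm κ s a b (fun k τ => deriv (X k) τ) z) z := by
  have h := (isField_harm hD hS hX s a b).toWave
  obtain ⟨θ, η, τ⟩ := z
  refine ⟨h.differentiableAt hS hz hτ, re_eq_of_integral (h.dTh_eq hS hz hτ) ?_,
    re_eq_of_integral (h.dEt_eq hS hz hτ) ?_, re_eq_of_integral (h.dTa_eq hS hz hτ) ?_⟩
  · refine ae_of_all _ fun k => ?_
    dsimp only
    rw [hker, hker]
    ring
  · refine ae_of_all _ fun k => ?_
    have := ((hasDerivAt_hker κ s a b k η).mul_const (X k τ)).deriv
    dsimp only at this ⊢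
    rw [this]
  · filter_upwards [hX.toWave.ae_diff hS] with k hk
    have := deriv_const_mul (hker κ s a b k η) (deriv_snd_eq (hk η (by simp) τ hτ)).differentiableAt
    dsimp only at this ⊢
    rw [this]

/-- Linear relations between multipliers. -/
lemma harm_eq_mul {s a b s' a' b' : ℕ} {r : ℝ} {κ : ℝ} {z : ℝ × ℝ × ℝ}
    (h : ∀ k : ℝ, hker κ s a b k z.2.1 = r * hker κ s' a' b' k z.2.1) :
    harm κ s a b X z = r * harm κ s' a' b' X z := by
  simp only [harm, lift, h, mul_assoc]
  rw [integral_const_mul, Complex.re_ofReal_mul]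

lemma sign_mul_self (k : ℝ) : Real.sign k * k = |k| := by
  rcases lt_trichotomy k 0 with h | rfl | h
  · rw [Real.sign_of_neg h, abs_of_neg h]; ring
  · simp
  · rw [Real.sign_of_pos h, abs_of_pos h]; ring

lemma sign_mul_abs (k : ℝ) : Real.sign k * |k| = k := by
  rcases lt_trichotomy k 0 with h | rfl | h
  · rw [Real.sign_of_neg h, abs_of_neg h]; ring
  · simp
  · rw [Real.sign_of_pos h, abs_of_pos h]; ring

/-- Since `(-κ|k|)² = -κ²(ik)²`, the extension solves `∂_η²h + κ²∂_θ²h = 0`; for `κ = 1` it is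
harmonic. -/
lemma harm_laplace (κ : ℝ) (s a b : ℕ) (X : ℝ → ℝ → ℂ) (z : ℝ × ℝ × ℝ) :
    harm κ s a (b + 2) X z = -κ ^ 2 * harm κ s (a + 2) b X z := by
  refine harm_eq_mul fun k => ?_
  have h : ((|k| : ℝ) : ℂ) ^ 2 = (k : ℂ) ^ 2 := by rw [← Complex.ofReal_pow, sq_abs, Complex.ofReal_pow]
  rw [hker, hker, pow_add _ b 2, pow_add _ a 2]
  push_cast
  rw [mul_pow I (k : ℂ) 2, Complex.I_sq, mul_pow _ ((|k| : ℝ) : ℂ) 2, h]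
  ring

/-- One of the two Cauchy-Riemann equations for the extension and its conjugate (`s = 1`); it comes
from `sgn(k) k = |k|`. -/
lemma harm_conj_theta (κ : ℝ) (hκ : κ ≠ 0) (a b : ℕ) (X : ℝ → ℝ → ℂ) (z : ℝ × ℝ × ℝ) :
    harm κ 1 (a + 1) b X z = -κ⁻¹ * harm κ 0 a (b + 1) X z := by
  refine harm_eq_mul fun k => ?_
  have h : ((Real.sign k : ℝ) : ℂ) * k = (|k| : ℝ) := by rw [← Complex.ofReal_mul, sign_mul_self]
  have hκ' : (κ : ℂ) ≠ 0 := by exact_mod_cast hκ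
  rw [hker, hker, pow_succ _ a, pow_succ _ b, pow_one, pow_zero,
    show -(I * (Real.sign k : ℂ)) * ((I * k) ^ a * (I * k))
      = (I * k) ^ a * ((Real.sign k : ℂ) * k) * (-(I * I)) by ring, Complex.I_mul_I, h]
  push_cast
  field_simp

/-- The companion Cauchy-Riemann equation, from `sgn(k)|k| = k`. -/
lemma harm_conj_eta (κ : ℝ) (a b : ℕ) (X : ℝ → ℝ → ℂ) (z : ℝ × ℝ × ℝ) :
    harm κ 1 a (b + 1) X z = κ * harm κ 0 (a + 1) b X z := by
  refine harm_eq_mul fun k => ?_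
  have h : ((Real.sign k : ℝ) : ℂ) * (|k| : ℝ) = k := by rw [← Complex.ofReal_mul, sign_mul_abs]
  rw [hker, hker, pow_succ _ a, pow_succ _ b, pow_one, pow_zero]
  push_cast
  linear_combination (I * (I * (k : ℂ)) ^ a * (-κ * ((|k| : ℝ) : ℂ)) ^ b * exp (-κ * ((|k| : ℝ) : ℂ) * z.2.1) * κ) * h

/-- Boundary values. -/
lemma harm_boundary (hX : IsField univ S χ (fun k _ τ => X k τ)) {θ τ : ℝ} (hτ : τ ∈ S) :
    harm κ 0 0 0 X (θ, 0, τ) = χ (θ, 0, τ) := by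
  refine (re_eq_of_integral (hX.repr θ 0 trivial τ hτ) (ae_of_all _ fun k => ?_)).symm
  simp [hker]

lemma harm_boundary_theta (hS : IsOpen S) (hX : IsField univ S χ (fun k _ τ => X k τ)) {θ τ : ℝ}
    (hτ : τ ∈ S) : harm κ 0 1 0 X (θ, 0, τ) = dTh χ (θ, 0, τ) := by
  refine (re_eq_of_integral (hX.toWave.dTh_eq hS (η := 0) (by simp) hτ) (ae_of_all _ fun k => ?_)).symm
  simp [hker]

end Harm

/-! ## The equations at first and second order -/

/-- The derivative of a function of `(θ, τ)` in `θ`. -/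
noncomputable def pTh (φ : ℝ × ℝ → ℝ) (y : ℝ × ℝ) : ℝ := fderiv ℝ φ y (1, 0)

/-- The derivative of a function of `(θ, τ)` in `τ`. -/
noncomputable def pTa (φ : ℝ × ℝ → ℝ) (y : ℝ × ℝ) : ℝ := fderiv ℝ φ y (0, 1)

/-- The linearized MHD operator, in terms of the derivatives in `t`, `x₁`, `x₂`. -/
def mhdLin (p : Params) (ft fx fy : Fin 5 → ℝ) : Fin 6 → ℝ :=
  ![ft 0 + p.v0 * fx 0 - p.B0 * fx 2 + fx 4,
    ft 1 + p.v0 * fx 1 - p.B0 * fx 3 + fy 4,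
    ft 2 + p.v0 * fx 2 - p.B0 * fx 0,
    ft 3 + p.v0 * fx 3 - p.B0 * fx 1,
    fx 0 + fy 1,
    fx 2 + fy 3]

/-- The quadratic part of the MHD operator. -/
def mhdQuad (f fx fy : Fin 5 → ℝ) : Fin 6 → ℝ :=
  ![f 0 * fx 0 + f 1 * fy 0 - (f 2 * fx 2 + f 3 * fy 2),
    f 0 * fx 1 + f 1 * fy 1 - (f 2 * fx 3 + f 3 * fy 3),
    f 0 * fx 2 + f 1 * fy 2 - (f 2 * fx 0 + f 3 * fy 0),
    f 0 * fx 3 + f 1 * fy 3 - (f 2 * fx 1 + f 3 * fy 1),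
    0,
    0]

/-- The Maxwell operator, in terms of the derivatives in `t`, `x₁`, `x₂`. -/
def maxwellLin (ν : ℝ) (ft fx fy : Fin 3 → ℝ) : Fin 4 → ℝ :=
  ![ν * ft 0 + fy 2, ν * ft 1 - fx 2, ν * ft 2 - fx 1 + fy 0, fx 0 + fy 1]

namespace Terms
variable (X : Terms) (p : Params)

/-- The MHD equations at order `ε`. -/
noncomputable def plasma1 (z : ℝ × ℝ × ℝ) : Fin 6 → ℝ :=
  mhdLin p (fun i => -p.lam * dTh (X.U1 i) z) (fun i => dTh (X.U1 i) z) (fun i => dEt (X.U1 i) z)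

/-- The MHD equations at order `ε²`. -/
noncomputable def plasma2 (z : ℝ × ℝ × ℝ) : Fin 6 → ℝ :=
  mhdLin p
    (fun i => -p.lam * dTh (X.U2 i) z + dTa (X.U1 i) z
      + p.lam * pTh X.phi1 (z.1, z.2.2) * dEt (X.U1 i) z)
    (fun i => dTh (X.U2 i) z - pTh X.phi1 (z.1, z.2.2) * dEt (X.U1 i) z)
    (fun i => dEt (X.U2 i) z)
  + mhdQuad (fun i => X.U1 i z) (fun i => dTh (X.U1 i) z) (fun i => dEt (X.U1 i) z)

/-- The Maxwell equations at order `ε`. -/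
noncomputable def vacuum1 (z : ℝ × ℝ × ℝ) : Fin 4 → ℝ :=
  maxwellLin p.nu (fun i => -p.lam * dTh (X.V1 i) z) (fun i => dTh (X.V1 i) z)
    (fun i => dEt (X.V1 i) z)

/-- The Maxwell equations at order `ε²`. -/
noncomputable def vacuum2 (z : ℝ × ℝ × ℝ) : Fin 4 → ℝ :=
  maxwellLin p.nu
    (fun i => -p.lam * dTh (X.V2 i) z + dTa (X.V1 i) z
      + p.lam * pTh X.phi1 (z.1, z.2.2) * dEt (X.V1 i) z)
    (fun i => dTh (X.V2 i) z - pTh X.phi1 (z.1, z.2.2) * dEt (X.V1 i) z)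
    (fun i => dEt (X.V2 i) z)

/-- The interface conditions at order `ε`. -/
noncomputable def jump1 (y : ℝ × ℝ) : Fin 5 → ℝ :=
  let z : ℝ × ℝ × ℝ := (y.1, 0, y.2)
  ![-p.lam * pTh X.phi1 y - (X.U1 1 z - pTh X.phi1 y * p.v0),
    X.U1 4 z - p.H0 * X.V1 0 z,
    X.U1 3 z - pTh X.phi1 y * p.B0,
    X.V1 1 z - pTh X.phi1 y * p.H0,
    X.V1 2 z + p.nu * p.lam * pTh X.phi1 y * p.H0]

/-- The interface conditions at order `ε²`. -/
noncomputable def jump2 (y : ℝ × ℝ) : Fin 5 → ℝ :=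
  let z : ℝ × ℝ × ℝ := (y.1, 0, y.2)
  ![-p.lam * pTh X.phi2 y + pTa X.phi1 y
      - (X.U2 1 z - pTh X.phi2 y * p.v0 - pTh X.phi1 y * X.U1 0 z),
    X.U2 4 z - p.H0 * X.V2 0 z - (X.V1 0 z ^ 2 + X.V1 1 z ^ 2 - X.V1 2 z ^ 2) / 2,
    X.U2 3 z - pTh X.phi2 y * p.B0 - pTh X.phi1 y * X.U1 2 z,
    X.V2 1 z - pTh X.phi2 y * p.H0 - pTh X.phi1 y * X.V1 0 z,
    X.V2 2 z - p.nu * (-p.lam * pTh X.phi2 y + pTa X.phi1 y) * p.H0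
      + p.nu * p.lam * pTh X.phi1 y * X.V1 0 z]

end Terms

lemma IsProfile.differentiableAt {S : Set ℝ} {φ : ℝ × ℝ → ℝ} {φh : ℝ → ℝ → ℂ}
    (h : IsProfile S φ φh) (hS : IsOpen S) {y : ℝ × ℝ} (hy : y.2 ∈ S) : DifferentiableAt ℝ φ y := by
  have h1 := h.isField.toWave.differentiableAt hS (z := (y.1, 0, y.2)) (by simp) hy
  have h2 : DifferentiableAt ℝ (fun y : ℝ × ℝ => (y.1, (0 : ℝ), y.2)) y :=
    differentiableAt_fst.prodMk ((differentiableAt_const _).prodMk differentiableAt_snd)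
  exact h1.comp (g := fun z : ℝ × ℝ × ℝ => φ (z.1, z.2.2)) y h2

lemma IsProfile.hasPd {S : Set ℝ} {φ : ℝ × ℝ → ℝ} {φh : ℝ → ℝ → ℂ}
    (h : IsProfile S φ φh) (hS : IsOpen S) {z : ℝ × ℝ × ℝ} (hz : z.2.2 ∈ S) :
    HasPd (fun z => φ (z.1, z.2.2)) (pTh φ (z.1, z.2.2)) 0 (pTa φ (z.1, z.2.2)) z := by
  have h1 := (h.differentiableAt hS (y := (z.1, z.2.2)) hz).hasFDerivAt
  set A : ℝ × ℝ × ℝ →L[ℝ] ℝ × ℝ := (ContinuousLinearMap.fst ℝ ℝ (ℝ × ℝ)).prod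
    ((ContinuousLinearMap.snd ℝ ℝ ℝ).comp (ContinuousLinearMap.snd ℝ ℝ (ℝ × ℝ)))
  have h2 : HasFDerivAt (fun z : ℝ × ℝ × ℝ => (z.1, z.2.2)) A z := A.hasFDerivAt
  have h3 := h1.comp z h2
  refine ⟨h3.differentiableAt, ?_, ?_, ?_⟩
  · rw [dTh, show fderiv ℝ (fun z : ℝ × ℝ × ℝ => φ (z.1, z.2.2)) z = _ from h3.fderiv]; rfl
  · rw [dEt, show fderiv ℝ (fun z : ℝ × ℝ × ℝ => φ (z.1, z.2.2)) z = _ from h3.fderiv]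
    exact (fderiv ℝ φ (z.1, z.2.2)).map_zero
  · rw [dTa, show fderiv ℝ (fun z : ℝ × ℝ × ℝ => φ (z.1, z.2.2)) z = _ from h3.fderiv]; rfl

/-! ## The expansion in closed form -/

/-- A surface mode. -/
noncomputable def mode (κ a b : ℝ) (X : ℝ → ℝ → ℂ) (z : ℝ × ℝ × ℝ) : ℝ :=
  a * harm κ 0 0 1 X z + b * harm κ 0 1 0 X z

/-- The normal derivative of a surface mode. -/
noncomputable def modeN (κ a b : ℝ) (X : ℝ → ℝ → ℂ) (z : ℝ × ℝ × ℝ) : ℝ :=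
  a * harm κ 0 0 2 X z + b * harm κ 0 1 1 X z

/-- The transform of a surface mode. -/
noncomputable def modeHat (κ a b : ℝ) (X : ℝ → ℝ → ℂ) (k η τ : ℝ) : ℂ :=
  a * (hker κ 0 0 1 k η * X k τ) + b * (hker κ 0 1 0 k η * X k τ)

/-- The transform of the normal derivative of a surface mode. -/
noncomputable def modeNHat (κ a b : ℝ) (X : ℝ → ℝ → ℂ) (k η τ : ℝ) : ℂ :=
  a * (hker κ 0 0 2 k η * X k τ) + b * (hker κ 0 1 1 k η * X k τ)

/-- The time derivative of a transform. -/
noncomputable def tauHat (φ : ℝ → ℝ → ℂ) (k τ : ℝ) : ℂ := deriv (φ k) τ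

/-- The function `|D| φ`. -/
noncomputable def absD (φ : ℝ → ℝ → ℂ) : ℝ × ℝ × ℝ → ℝ :=
  lift (fun k _ => (|k| : ℝ)) (fun k _ τ => φ k τ)

/-- The function `φ₂ + c φ₁ |D| φ₁`. -/
noncomputable def omega (c : ℝ) (φ₁ φ₂ : ℝ × ℝ → ℝ) (φh : ℝ → ℝ → ℂ) (z : ℝ × ℝ × ℝ) : ℝ :=
  φ₂ (z.1, z.2.2) + c * (φ₁ (z.1, z.2.2) * absD φh z)

/-- The transform of `φ₂ + c φ₁ |D| φ₁`. -/
noncomputable def omegaHat (c : ℝ) (φ ψ : ℝ → ℝ → ℂ) (k τ : ℝ) : ℂ :=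
  ψ k τ + c * ∫ l : ℝ, φ (k - l) τ * ((|l| : ℝ) * φ l τ)

lemma isMultiplier_abs : IsMultiplier univ (fun k _ => ((|k| : ℝ) : ℂ)) where
  meas _ _ := by fun_prop
  herm k _ _ := by rw [abs_neg, Complex.conj_ofReal]
  cont _ := continuousOn_const
  smooth _ := contDiffOn_const
  bound := by
    refine ⟨1, 1, zero_le_one, fun k => ⟨fun _ _ => ?_, fun _ _ => ?_⟩⟩
    · rw [Complex.norm_real, Real.norm_eq_abs, abs_abs]
      linarith
    · rw [deriv_const, norm_zero]
      positivity

section Omega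
variable {S : Set ℝ} {φ₁ φ₂ : ℝ × ℝ → ℝ} {φh ψh : ℝ → ℝ → ℂ}

lemma isField_absD (h : IsProfile S φ₁ φh) (hS : IsOpen S) :
    IsField univ S (absD φh) (fun k _ τ => (|k| : ℝ) * φh k τ) :=
  h.isField.lift hS isMultiplier_abs

lemma isField_omega (h₁ : IsProfile S φ₁ φh) (h₂ : IsProfile S φ₂ ψh) (hS : IsOpen S) (c : ℝ) :
    IsField univ S (omega c φ₁ φ₂ φh) (fun k _ τ => omegaHat c φh ψh k τ) :=
  h₂.isField.add ((h₁.isField.mul (isField_absD h₁ hS) hS).const_mul c) hS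

/-- The normal derivative of the extension at `η = 0` is the Dirichlet-to-Neumann operator `-κ|D|`.
This is how `|D|` enters the interface conditions. -/
lemma absD_boundary (κ θ τ : ℝ) : harm κ 0 0 1 φh (θ, 0, τ) = -κ * absD φh (θ, 0, τ) := by
  simp only [harm, lift, absD, hker]
  rw [← Complex.re_ofReal_mul, ← integral_const_mul]
  congr 2
  funext k
  simp
  ring

/-- The left side does not depend on `κ`. The parameter selects the extension, plasma (`1`) or
vacuum (`-σ`), whose mixed derivative occurs at the interface. -/
lemma dTh_absD (κ : ℝ) (hκ : κ ≠ 0) (h : IsProfile S φ₁ φh) (hS : IsOpen S) {θ τ : ℝ} (hτ : τ ∈ S) :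
    dTh (absD φh) (θ, 0, τ) = -κ⁻¹ * harm κ 0 1 1 φh (θ, 0, τ) := by
  rw [re_eq_of_integral ((isField_absD h hS).toWave.dTh_eq hS (by simp) hτ) (ae_of_all _ fun k => rfl)]
  simp only [harm, lift, hker]
  rw [← Complex.re_ofReal_mul, ← integral_const_mul]
  congr 2
  funext k
  have : (κ : ℂ) ≠ 0 := by exact_mod_cast hκ
  simp
  field_simp

lemma hasPd_omega (h₁ : IsProfile S φ₁ φh) (h₂ : IsProfile S φ₂ ψh) (hS : IsOpen S) (c : ℝ)
    {z : ℝ × ℝ × ℝ} (hz : z.2.2 ∈ S) :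
    dTh (omega c φ₁ φ₂ φh) z = pTh φ₂ (z.1, z.2.2)
      + c * (pTh φ₁ (z.1, z.2.2) * absD φh z + φ₁ (z.1, z.2.2) * dTh (absD φh) z) := by
  have hN : HasPd (absD φh) _ _ _ z :=
    ⟨(isField_absD h₁ hS).toWave.differentiableAt hS (by simp) hz, rfl, rfl, rfl⟩
  exact ((h₂.hasPd hS hz).add (((h₁.hasPd hS hz).mul hN).const_mul c)).2.1

end Omega

namespace Params
variable (p : Params)

/-- Coefficients of the surface mode in the plasma. -/
def plasmaEta : Fin 5 → ℝ := ![p.w, 0, -p.B0, 0, p.d]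

/-- Coefficients of the surface mode in the plasma. -/
def plasmaTheta : Fin 5 → ℝ := ![0, -p.w, 0, p.B0, 0]

/-- Coefficients of the surface mode in vacuum. -/
def vacuumEta : Fin 3 → ℝ := ![-p.H0, 0, 0]

/-- Coefficients of the surface mode in vacuum. -/
def vacuumTheta : Fin 3 → ℝ := ![0, p.H0, -(p.nu * p.lam * p.H0)]

/-- Coefficients of the response of the plasma to the slow motion of the interface. -/
noncomputable def slow1 : Fin 5 → ℝ := ![1, 0, 0, 0, 2 * p.w]

/-- Coefficients of the response of the plasma to the slow motion of the interface. -/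
noncomputable def slow2 : Fin 5 → ℝ := ![0, 1, 0, 0, 0]

/-- Coefficients of the second order pressure. -/
noncomputable def pressure : Fin 5 → ℝ := ![0, 0, 0, 0, -(p.d / 2)]

/-- Coefficients of the response of the vacuum to the slow motion of the interface. -/
noncomputable def slowV1 : Fin 3 → ℝ := ![-(p.nu ^ 2 * p.lam * p.H0 / p.sigma), 0, 0]

/-- Coefficients of the response of the vacuum to the slow motion of the interface. -/
noncomputable def slowV2 : Fin 3 → ℝ := ![p.nu ^ 2 * p.lam * p.H0, 0, 0]

/-- Coefficients of the response of the vacuum to the slow motion of the interface. -/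
noncomputable def slowV3 : Fin 3 → ℝ :=
  ![0, p.nu ^ 2 * p.lam * p.H0 / p.sigma ^ 2, -(p.nu ^ 3 * p.lam ^ 2 * p.H0 / p.sigma ^ 2)]

/-- Coefficients of the response of the vacuum to the slow motion of the interface. -/
noncomputable def slowV4 : Fin 3 → ℝ := ![0, 0, p.nu * p.H0]

end Params

/-- The expansion determined by the profiles. -/
noncomputable def model (p : Params) (φ₁ φ₂ : ℝ × ℝ → ℝ) (φh ψh : ℝ → ℝ → ℂ) : Terms where
  phi1 := φ₁
  phi2 := φ₂
  phi1h := φh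
  phi2h := ψh
  U1 i := mode 1 (p.plasmaEta i) (p.plasmaTheta i) φh
  U1h i := modeHat 1 (p.plasmaEta i) (p.plasmaTheta i) φh
  V1 i := mode (-p.sigma) (p.vacuumEta i) (p.vacuumTheta i) φh
  V1h i := modeHat (-p.sigma) (p.vacuumEta i) (p.vacuumTheta i) φh
  U2 i z := φ₁ (z.1, z.2.2) * modeN 1 (p.plasmaEta i) (p.plasmaTheta i) φh z
    + mode 1 (p.plasmaEta i) (p.plasmaTheta i) (omegaHat 1 φh ψh) z
    + (p.slow1 i * harm 1 1 0 0 (tauHat φh) z + Params.slow2 i * harm 1 0 0 0 (tauHat φh) z)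
    + p.pressure i * (harm 1 0 0 1 φh z * harm 1 0 0 1 φh z + harm 1 0 1 0 φh z * harm 1 0 1 0 φh z)
  U2h i k η τ :=
    conv (fun k _ τ => φh k τ) (modeNHat 1 (p.plasmaEta i) (p.plasmaTheta i) φh) k η τ
    + modeHat 1 (p.plasmaEta i) (p.plasmaTheta i) (omegaHat 1 φh ψh) k η τ
    + (p.slow1 i * (hker 1 1 0 0 k η * tauHat φh k τ)
      + Params.slow2 i * (hker 1 0 0 0 k η * tauHat φh k τ))
    + p.pressure i *
      (conv (fun k η τ => hker 1 0 0 1 k η * φh k τ) (fun k η τ => hker 1 0 0 1 k η * φh k τ) k η τ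
      + conv (fun k η τ => hker 1 0 1 0 k η * φh k τ) (fun k η τ => hker 1 0 1 0 k η * φh k τ) k η τ)
  V2 i z := φ₁ (z.1, z.2.2) * modeN (-p.sigma) (p.vacuumEta i) (p.vacuumTheta i) φh z
    + mode (-p.sigma) (p.vacuumEta i) (p.vacuumTheta i) (omegaHat (-p.sigma) φh ψh) z
    + (p.slowV1 i * harm (-p.sigma) 1 0 0 (tauHat φh) z
      + p.slowV2 i * (z.2.1 * harm (-p.sigma) 0 1 0 (tauHat φh) z)
      + p.slowV3 i * (z.2.1 * harm (-p.sigma) 0 0 1 (tauHat φh) z)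
      + p.slowV4 i * harm (-p.sigma) 0 0 0 (tauHat φh) z)
  V2h i k η τ :=
    conv (fun k _ τ => φh k τ) (modeNHat (-p.sigma) (p.vacuumEta i) (p.vacuumTheta i) φh) k η τ
    + modeHat (-p.sigma) (p.vacuumEta i) (p.vacuumTheta i) (omegaHat (-p.sigma) φh ψh) k η τ
    + (p.slowV1 i * (hker (-p.sigma) 1 0 0 k η * tauHat φh k τ)
      + p.slowV2 i * (η * hker (-p.sigma) 0 1 0 k η * tauHat φh k τ)
      + p.slowV3 i * (η * hker (-p.sigma) 0 0 1 k η * tauHat φh k τ)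
      + p.slowV4 i * (hker (-p.sigma) 0 0 0 k η * tauHat φh k τ))

/-! ### Surface modes and their partial derivatives -/

section Modes
variable {κ : ℝ} {D S : Set ℝ} {χ : ℝ × ℝ × ℝ → ℝ} {X : ℝ → ℝ → ℂ}

lemma isField_mode (hD : ∀ η ∈ D, 0 ≤ κ * η) (hS : IsOpen S)
    (hX : IsField univ S χ (fun k _ τ => X k τ)) (a b : ℝ) :
    IsField D S (mode κ a b X) (modeHat κ a b X) :=
  ((isField_harm hD hS hX 0 0 1).const_mul a).add ((isField_harm hD hS hX 0 1 0).const_mul b) hS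

lemma isField_modeN (hD : ∀ η ∈ D, 0 ≤ κ * η) (hS : IsOpen S)
    (hX : IsField univ S χ (fun k _ τ => X k τ)) (a b : ℝ) :
    IsField D S (modeN κ a b X) (modeNHat κ a b X) :=
  ((isField_harm hD hS hX 0 0 2).const_mul a).add ((isField_harm hD hS hX 0 1 1).const_mul b) hS

lemma hasPd_mode (hD : ∀ η ∈ D, 0 ≤ κ * η) (hS : IsOpen S)
    (hX : IsField univ S χ (fun k _ τ => X k τ)) (a b : ℝ) {z : ℝ × ℝ × ℝ}
    (hz : z.2.1 ∈ interior D) (hτ : z.2.2 ∈ S) :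
    HasPd (mode κ a b X) (a * harm κ 0 1 1 X z + b * harm κ 0 2 0 X z)
      (a * harm κ 0 0 2 X z + b * harm κ 0 1 1 X z)
      (a * harm κ 0 0 1 (tauHat X) z + b * harm κ 0 1 0 (tauHat X) z) z :=
  ((hasPd_harm hD hS hX 0 0 1 hz hτ).const_mul a).add ((hasPd_harm hD hS hX 0 1 0 hz hτ).const_mul b)

lemma hasPd_modeN (hD : ∀ η ∈ D, 0 ≤ κ * η) (hS : IsOpen S)
    (hX : IsField univ S χ (fun k _ τ => X k τ)) (a b : ℝ) {z : ℝ × ℝ × ℝ}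
    (hz : z.2.1 ∈ interior D) (hτ : z.2.2 ∈ S) :
    HasPd (modeN κ a b X) (a * harm κ 0 1 2 X z + b * harm κ 0 2 1 X z)
      (a * harm κ 0 0 3 X z + b * harm κ 0 1 2 X z)
      (a * harm κ 0 0 2 (tauHat X) z + b * harm κ 0 1 1 (tauHat X) z) z :=
  ((hasPd_harm hD hS hX 0 0 2 hz hτ).const_mul a).add ((hasPd_harm hD hS hX 0 1 1 hz hτ).const_mul b)

end Modes

lemma plasma_domain : ∀ η ∈ Ici (0 : ℝ), 0 ≤ 1 * η := fun η hη => by rw [one_mul]; exact hη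

lemma vacuum_domain {s : ℝ} (hs : 0 < s) : ∀ η ∈ Iic (0 : ℝ), 0 ≤ -s * η := fun η hη => by
  have : η ≤ 0 := hη
  nlinarith

/-! ### The closed form satisfies every equation except the second order pressure condition -/

section Model
variable {p : Params} {S : Set ℝ} {φ₁ φ₂ : ℝ × ℝ → ℝ} {φh ψh : ℝ → ℝ → ℂ}

lemma isField_model_U2 (hS : IsOpen S) (h₁ : IsProfile S φ₁ φh) (h₂ : IsProfile S φ₂ ψh) (i : Fin 5) :
    IsField (Ici 0) S ((model p φ₁ φ₂ φh ψh).U2 i) ((model p φ₁ φ₂ φh ψh).U2h i) := by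
  have f1 := h₁.isField
  have ft : IsField univ S _ (fun k _ τ => tauHat φh k τ) := h₁.isField_deriv hS
  have fo := isField_omega h₁ h₂ hS 1
  have P := plasma_domain
  have a1 := isField_harm P hS f1 0 0 1
  have a2 := isField_harm P hS f1 0 1 0
  exact (((((f1.mono (subset_univ _)).mul (isField_modeN P hS f1 _ _) hS).add
    (isField_mode P hS fo _ _) hS).add
    (((isField_harm P hS ft 1 0 0).const_mul _).add ((isField_harm P hS ft 0 0 0).const_mul _) hS) hS).add
    (((a1.mul a1 hS).add (a2.mul a2 hS) hS).const_mul _) hS)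

lemma isField_model_V2 (hσ : 0 < p.sigma) (hS : IsOpen S) (h₁ : IsProfile S φ₁ φh)
    (h₂ : IsProfile S φ₂ ψh) (i : Fin 3) :
    IsField (Iic 0) S ((model p φ₁ φ₂ φh ψh).V2 i) ((model p φ₁ φ₂ φh ψh).V2h i) := by
  have f1 := h₁.isField
  have ft : IsField univ S _ (fun k _ τ => tauHat φh k τ) := h₁.isField_deriv hS
  have fo := isField_omega h₁ h₂ hS (-p.sigma)
  have P := vacuum_domain hσ
  have ne : -p.sigma ≠ 0 := neg_ne_zero.2 hσ.ne'
  exact ((((f1.mono (subset_univ _)).mul (isField_modeN P hS f1 _ _) hS).add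
    (isField_mode P hS fo _ _) hS).add
    (((((isField_harm P hS ft 1 0 0).const_mul _).add
      ((isField_eta_harm ne P hS ft 0 1 0 (by norm_num)).const_mul _) hS).add
      ((isField_eta_harm ne P hS ft 0 0 1 (by norm_num)).const_mul _) hS).add
      ((isField_harm P hS ft 0 0 0).const_mul _) hS) hS)

lemma regular_model (hσ : 0 < p.sigma) (hS : IsOpen S) (h₁ : IsProfile S φ₁ φh)
    (h₂ : IsProfile S φ₂ ψh) : (model p φ₁ φ₂ φh ψh).Regular S where
  phi1 := h₁
  phi2 := h₂
  U1 _ := (isField_mode plasma_domain hS h₁.isField _ _).toWave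
  V1 _ := (isField_mode (vacuum_domain hσ) hS h₁.isField _ _).toWave
  U2 i := (isField_model_U2 hS h₁ h₂ i).toWave
  V2 i := (isField_model_V2 hσ hS h₁ h₂ i).toWave

lemma d_eq (p : Params) : p.d = p.w ^ 2 - p.B0 ^ 2 := rfl

lemma lam_eq (p : Params) : p.lam = p.w + p.v0 := by rw [Params.w]; ring

/-- With `h` the harmonic extension of `φ₁`, velocity and magnetic field are `w` and `-B₀` times
`(∂_η h, -∂_θ h)`, and the pressure is `d ∂_η h`. The divergences and the induction terms cancel
identically; the momentum equations reduce to `d = w² - B₀²` and `∂_η²h + ∂_θ²h = 0`. -/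
lemma model_plasma1 (hS : IsOpen S) (h₁ : IsProfile S φ₁ φh) {z : ℝ × ℝ × ℝ} (hη : 0 < z.2.1)
    (hτ : z.2.2 ∈ S) : (model p φ₁ φ₂ φh ψh).plasma1 p z = 0 := by
  have hz : z.2.1 ∈ interior (Ici (0 : ℝ)) := by rwa [interior_Ici]
  have J := fun i => hasPd_mode plasma_domain hS h₁.isField (p.plasmaEta i) (p.plasmaTheta i) hz hτ
  have e1 : ∀ i, dTh ((model p φ₁ φ₂ φh ψh).U1 i) z = _ := fun i => (J i).2.1
  have e2 : ∀ i, dEt ((model p φ₁ φ₂ φh ψh).U1 i) z = _ := fun i => (J i).2.2.1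
  have L0 := harm_laplace 1 0 0 0 φh z
  funext j
  simp only [Terms.plasma1, e1, e2, mhdLin, Params.plasmaEta, Params.plasmaTheta, L0, zero_add]
  fin_cases j <;> simp [d_eq, lam_eq p] <;> ring

/-- Here `h` satisfies `∂_η²h + σ²∂_θ²h = 0`, which for `σ² = 1 - ν²λ²` is the wave equation for
functions travelling with velocity `λ`. -/
lemma model_vacuum1 (hσ : 0 < p.sigma) (hσ2 : p.sigma ^ 2 = 1 - p.nu ^ 2 * p.lam ^ 2)
    (hS : IsOpen S) (h₁ : IsProfile S φ₁ φh) {z : ℝ × ℝ × ℝ}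
    (hη : z.2.1 < 0) (hτ : z.2.2 ∈ S) : (model p φ₁ φ₂ φh ψh).vacuum1 p z = 0 := by
  have hz : z.2.1 ∈ interior (Iic (0 : ℝ)) := by rwa [interior_Iic]
  have J := fun i => hasPd_mode (vacuum_domain hσ) hS h₁.isField (p.vacuumEta i) (p.vacuumTheta i) hz hτ
  have e1 : ∀ i, dTh ((model p φ₁ φ₂ φh ψh).V1 i) z = _ := fun i => (J i).2.1
  have e2 : ∀ i, dEt ((model p φ₁ φ₂ φh ψh).V1 i) z = _ := fun i => (J i).2.2.1
  have L0 := harm_laplace (-p.sigma) 0 0 0 φh z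
  have s2 : (-p.sigma) ^ 2 = 1 - p.nu ^ 2 * p.lam ^ 2 := by rw [neg_sq, hσ2]
  funext j
  simp only [Terms.vacuum1, e1, e2, maxwellLin, Params.vacuumEta, Params.vacuumTheta, L0, zero_add, s2]
  fin_cases j <;> simp <;> ring

/-- The term `φ₁ ∂_η U⁽¹⁾` absorbs the commutators produced by straightening. For harmonic `h` the
convective derivative of `(∂_η h, -∂_θ h)` along itself is the gradient of `|∇h|²/2`; velocity and
magnetic parts add up to the factor `d`, and the term with `pressure` cancels the result. In the
induction equations the quadratic terms cancel because `v` and `B` are parallel. The remaining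
source `φ_τ` is balanced by a conjugate pair of harmonic functions. -/
lemma model_plasma2 (hS : IsOpen S) (h₁ : IsProfile S φ₁ φh) (h₂ : IsProfile S φ₂ ψh)
    {z : ℝ × ℝ × ℝ} (hη : 0 < z.2.1)
    (hτ : z.2.2 ∈ S) : (model p φ₁ φ₂ φh ψh).plasma2 p z = 0 := by
  have hz : z.2.1 ∈ interior (Ici (0 : ℝ)) := by rwa [interior_Ici]
  have P := plasma_domain
  have f1 := h₁.isField
  have ft : IsField univ S _ (fun k _ τ => tauHat φh k τ) := h₁.isField_deriv hS
  have fo := isField_omega h₁ h₂ hS 1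
  have J := fun i => hasPd_mode P hS f1 (p.plasmaEta i) (p.plasmaTheta i) hz hτ
  have J1 := hasPd_harm P hS f1 0 0 1 hz hτ
  have J2 := hasPd_harm P hS f1 0 1 0 hz hτ
  have K := fun i => ((((h₁.hasPd hS hτ).mul
    (hasPd_modeN P hS f1 (p.plasmaEta i) (p.plasmaTheta i) hz hτ)).add
    (hasPd_mode P hS fo (p.plasmaEta i) (p.plasmaTheta i) hz hτ)).add
    (((hasPd_harm P hS ft 1 0 0 hz hτ).const_mul (p.slow1 i)).add
    ((hasPd_harm P hS ft 0 0 0 hz hτ).const_mul (Params.slow2 i)))).add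
    (((J1.mul J1).add (J2.mul J2)).const_mul (p.pressure i))
  have e1 : ∀ i, dTh ((model p φ₁ φ₂ φh ψh).U1 i) z = _ := fun i => (J i).2.1
  have e2 : ∀ i, dEt ((model p φ₁ φ₂ φh ψh).U1 i) z = _ := fun i => (J i).2.2.1
  have e3 : ∀ i, dTa ((model p φ₁ φ₂ φh ψh).U1 i) z = _ := fun i => (J i).2.2.2
  have e4 : ∀ i, dTh ((model p φ₁ φ₂ φh ψh).U2 i) z = _ := fun i => (K i).2.1
  have e5 : ∀ i, dEt ((model p φ₁ φ₂ φh ψh).U2 i) z = _ := fun i => (K i).2.2.1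
  have e6 : ∀ i, (model p φ₁ φ₂ φh ψh).U1 i z = mode 1 (p.plasmaEta i) (p.plasmaTheta i) φh z :=
    fun i => rfl
  have e7 : (model p φ₁ φ₂ φh ψh).phi1 = φ₁ := rfl
  have L0 := harm_laplace 1 0 0 0 φh z
  have L1 := harm_laplace 1 0 0 1 φh z
  have L2 := harm_laplace 1 0 1 0 φh z
  have L3 := harm_laplace 1 0 0 0 (omegaHat 1 φh ψh) z
  have C1 := harm_conj_theta 1 one_ne_zero 0 0 (tauHat φh) z
  have C2 := harm_conj_eta 1 0 0 (tauHat φh) z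
  norm_num at L0 L1 L2 L3 C1 C2
  funext j
  simp only [Terms.plasma2, e1, e2, e3, e4, e5, e6, e7, mode, modeN, mhdLin, mhdQuad,
    Params.plasmaEta, Params.plasmaTheta, Params.slow1, Params.slow2, Params.pressure,
    L0, L1, L2, L3, zero_add, C1, C2, Pi.add_apply]
  fin_cases j <;> simp [d_eq, lam_eq p] <;> ring

/-- The source due to slow time has the same exponential `e^{σ|k|η}` as the homogeneous solution. It
is resonant, whence the terms with the factor `η` and the coefficients `slowV2`, `slowV3`. -/
lemma model_vacuum2 (hσ : 0 < p.sigma) (hσ2 : p.sigma ^ 2 = 1 - p.nu ^ 2 * p.lam ^ 2)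
    (hS : IsOpen S) (h₁ : IsProfile S φ₁ φh) (h₂ : IsProfile S φ₂ ψh)
    {z : ℝ × ℝ × ℝ} (hη : z.2.1 < 0)
    (hτ : z.2.2 ∈ S) : (model p φ₁ φ₂ φh ψh).vacuum2 p z = 0 := by
  have hz : z.2.1 ∈ interior (Iic (0 : ℝ)) := by rwa [interior_Iic]
  have P := vacuum_domain hσ
  have ne : -p.sigma ≠ 0 := neg_ne_zero.2 hσ.ne'
  have f1 := h₁.isField
  have ft : IsField univ S _ (fun k _ τ => tauHat φh k τ) := h₁.isField_deriv hS
  have fo := isField_omega h₁ h₂ hS (-p.sigma)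
  have J := fun i => hasPd_mode P hS f1 (p.vacuumEta i) (p.vacuumTheta i) hz hτ
  have K := fun i => (((h₁.hasPd hS hτ).mul
    (hasPd_modeN P hS f1 (p.vacuumEta i) (p.vacuumTheta i) hz hτ)).add
    (hasPd_mode P hS fo (p.vacuumEta i) (p.vacuumTheta i) hz hτ)).add
    (((((hasPd_harm P hS ft 1 0 0 hz hτ).const_mul (p.slowV1 i)).add
    (((HasPd.eta z).mul (hasPd_harm P hS ft 0 1 0 hz hτ)).const_mul (p.slowV2 i))).add
    (((HasPd.eta z).mul (hasPd_harm P hS ft 0 0 1 hz hτ)).const_mul (p.slowV3 i))).add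
    ((hasPd_harm P hS ft 0 0 0 hz hτ).const_mul (p.slowV4 i)))
  have e1 : ∀ i, dTh ((model p φ₁ φ₂ φh ψh).V1 i) z = _ := fun i => (J i).2.1
  have e2 : ∀ i, dEt ((model p φ₁ φ₂ φh ψh).V1 i) z = _ := fun i => (J i).2.2.1
  have e3 : ∀ i, dTa ((model p φ₁ φ₂ φh ψh).V1 i) z = _ := fun i => (J i).2.2.2
  have e4 : ∀ i, dTh ((model p φ₁ φ₂ φh ψh).V2 i) z = _ := fun i => (K i).2.1
  have e5 : ∀ i, dEt ((model p φ₁ φ₂ φh ψh).V2 i) z = _ := fun i => (K i).2.2.1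
  have e7 : (model p φ₁ φ₂ φh ψh).phi1 = φ₁ := rfl
  have L0 := harm_laplace (-p.sigma) 0 0 0 φh z
  have L1 := harm_laplace (-p.sigma) 0 0 1 φh z
  have L2 := harm_laplace (-p.sigma) 0 1 0 φh z
  have L3 := harm_laplace (-p.sigma) 0 0 0 (omegaHat (-p.sigma) φh ψh) z
  have L4 := harm_laplace (-p.sigma) 0 0 0 (tauHat φh) z
  have C1 := harm_conj_theta (-p.sigma) ne 0 0 (tauHat φh) z
  have C2 := harm_conj_eta (-p.sigma) 0 0 (tauHat φh) z
  norm_num at L0 L1 L2 L3 L4 C1 C2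
  have hs := hσ.ne'
  funext j
  simp only [Terms.vacuum2, e2, e3, e4, e5, e7, maxwellLin, modeN,
    Params.vacuumEta, Params.vacuumTheta, Params.slowV1, Params.slowV2, Params.slowV3, Params.slowV4,
    L0, L1, L2, L3, L4, zero_add, C1, C2]
  fin_cases j <;> simp <;> field_simp
  · ring
  · ring
  -- The third Maxwell equation is the one that needs `σ² = 1 - ν²λ²`.
  · linear_combination (p.nu ^ 2 * p.lam * p.H0 * z.2.1 * harm (-p.sigma) 0 1 1 (tauHat φh) z
      + p.sigma ^ 2 * p.H0 * φ₁ (z.1, z.2.2) * harm (-p.sigma) 0 2 1 φh z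
      + p.sigma ^ 2 * p.H0 * harm (-p.sigma) 0 2 0 (omegaHat (-p.sigma) φh ψh) z) * hσ2
  · ring

lemma boundary_theta (κ : ℝ) (hS : IsOpen S) (h₁ : IsProfile S φ₁ φh) {θ τ : ℝ} (hτ : τ ∈ S) :
    harm κ 0 1 0 φh (θ, 0, τ) = pTh φ₁ (θ, τ) := by
  rw [harm_boundary_theta hS h₁.isField hτ]
  exact (h₁.hasPd hS (z := (θ, 0, τ)) hτ).2.1

lemma boundary_tau (κ : ℝ) (hS : IsOpen S) (h₁ : IsProfile S φ₁ φh) {θ τ : ℝ} (hτ : τ ∈ S) :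
    harm κ 0 0 0 (tauHat φh) (θ, 0, τ) = pTa φ₁ (θ, τ) := by
  have ft : IsField univ S _ (fun k _ τ => tauHat φh k τ) := h₁.isField_deriv hS
  rw [harm_boundary ft hτ]
  exact (h₁.hasPd hS (z := (θ, 0, τ)) hτ).2.2.2

lemma boundary_omega (κ c : ℝ) (hS : IsOpen S) (h₁ : IsProfile S φ₁ φh) (h₂ : IsProfile S φ₂ ψh)
    {θ τ : ℝ} (hτ : τ ∈ S) :
    harm κ 0 1 0 (omegaHat c φh ψh) (θ, 0, τ) = pTh φ₂ (θ, τ)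
      + c * (pTh φ₁ (θ, τ) * absD φh (θ, 0, τ) + φ₁ (θ, τ) * dTh (absD φh) (θ, 0, τ)) := by
  rw [harm_boundary_theta hS (isField_omega h₁ h₂ hS c) hτ, hasPd_omega h₁ h₂ hS c hτ]

lemma model_jump1 (hroot : p.d = p.H0 ^ 2 * p.sigma) (hS : IsOpen S)
    (h₁ : IsProfile S φ₁ φh) {y : ℝ × ℝ} (hy : y.2 ∈ S) :
    (model p φ₁ φ₂ φh ψh).jump1 p y = 0 := by
  obtain ⟨θ, τ⟩ := y
  have e1 : ∀ i, (model p φ₁ φ₂ φh ψh).U1 i (θ, 0, τ)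
      = mode 1 (p.plasmaEta i) (p.plasmaTheta i) φh (θ, 0, τ) := fun _ => rfl
  have e2 : ∀ i, (model p φ₁ φ₂ φh ψh).V1 i (θ, 0, τ)
      = mode (-p.sigma) (p.vacuumEta i) (p.vacuumTheta i) φh (θ, 0, τ) := fun _ => rfl
  have e3 : (model p φ₁ φ₂ φh ψh).phi1 = φ₁ := rfl
  have t1 := boundary_theta 1 hS h₁ (θ := θ) hy
  have t2 := boundary_theta (-p.sigma) hS h₁ (θ := θ) hy
  have t3 := absD_boundary (φh := φh) 1 θ τ
  have t4 := absD_boundary (φh := φh) (-p.sigma) θ τ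
  dsimp only at hy t1 t2
  funext j
  simp only [Terms.jump1, e1, e2, e3, mode, t1, t2, t3, t4, Params.plasmaEta, Params.plasmaTheta,
    Params.vacuumEta, Params.vacuumTheta]
  fin_cases j <;> simp
  · rw [lam_eq p]; ring
  -- Continuity of the pressure reads `-(d - H₀²σ)|D|φ₁ = 0`: this is the dispersion relation.
  · linear_combination (-absD φh (θ, 0, τ)) * hroot
  · ring
  · ring
  · ring

/-- The quadratic terms of the conditions on the normal components combine to `∂_θ(φ₁|D|φ₁)`, up to
a constant, and the correction inside `omega` cancels exactly this. The pressure condition `j = 1`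
cannot be met for arbitrary profiles and is left out; it becomes the amplitude equation. -/
lemma model_jump2 (hσ : 0 < p.sigma) (hS : IsOpen S)
    (h₁ : IsProfile S φ₁ φh) (h₂ : IsProfile S φ₂ ψh) {y : ℝ × ℝ} (hy : y.2 ∈ S) (j : Fin 5)
    (hj : j ≠ 1) : (model p φ₁ φ₂ φh ψh).jump2 p y j = 0 := by
  obtain ⟨θ, τ⟩ := y
  dsimp only at hy
  have ne : -p.sigma ≠ 0 := neg_ne_zero.2 hσ.ne'
  have hs := hσ.ne'
  have e1 : ∀ i, (model p φ₁ φ₂ φh ψh).U1 i (θ, 0, τ)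
      = mode 1 (p.plasmaEta i) (p.plasmaTheta i) φh (θ, 0, τ) := fun _ => rfl
  have e2 : ∀ i, (model p φ₁ φ₂ φh ψh).V1 i (θ, 0, τ)
      = mode (-p.sigma) (p.vacuumEta i) (p.vacuumTheta i) φh (θ, 0, τ) := fun _ => rfl
  have e3 : (model p φ₁ φ₂ φh ψh).phi1 = φ₁ := rfl
  have e3' : (model p φ₁ φ₂ φh ψh).phi2 = φ₂ := rfl
  have e4 : ∀ i, (model p φ₁ φ₂ φh ψh).U2 i (θ, 0, τ) =
    φ₁ (θ, τ) * modeN 1 (p.plasmaEta i) (p.plasmaTheta i) φh (θ, 0, τ)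
    + mode 1 (p.plasmaEta i) (p.plasmaTheta i) (omegaHat 1 φh ψh) (θ, 0, τ)
    + (p.slow1 i * harm 1 1 0 0 (tauHat φh) (θ, 0, τ)
      + Params.slow2 i * harm 1 0 0 0 (tauHat φh) (θ, 0, τ))
    + p.pressure i * (harm 1 0 0 1 φh (θ, 0, τ) * harm 1 0 0 1 φh (θ, 0, τ)
      + harm 1 0 1 0 φh (θ, 0, τ) * harm 1 0 1 0 φh (θ, 0, τ)) := fun _ => rfl
  -- On the interface the resonant terms carry the factor `η = 0`.
  have e5 : ∀ i, (model p φ₁ φ₂ φh ψh).V2 i (θ, 0, τ) =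
    φ₁ (θ, τ) * modeN (-p.sigma) (p.vacuumEta i) (p.vacuumTheta i) φh (θ, 0, τ)
    + mode (-p.sigma) (p.vacuumEta i) (p.vacuumTheta i) (omegaHat (-p.sigma) φh ψh) (θ, 0, τ)
    + (p.slowV1 i * harm (-p.sigma) 1 0 0 (tauHat φh) (θ, 0, τ)
      + p.slowV2 i * (0 * harm (-p.sigma) 0 1 0 (tauHat φh) (θ, 0, τ))
      + p.slowV3 i * (0 * harm (-p.sigma) 0 0 1 (tauHat φh) (θ, 0, τ))
      + p.slowV4 i * harm (-p.sigma) 0 0 0 (tauHat φh) (θ, 0, τ)) := fun _ => rfl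
  have t1 := boundary_theta 1 hS h₁ (θ := θ) hy
  have t2 := boundary_theta (-p.sigma) hS h₁ (θ := θ) hy
  have t3 := absD_boundary (φh := φh) 1 θ τ
  have t4 := absD_boundary (φh := φh) (-p.sigma) θ τ
  have t5 := boundary_tau 1 hS h₁ (θ := θ) hy
  have t6 := boundary_tau (-p.sigma) hS h₁ (θ := θ) hy
  have t7 := boundary_omega 1 1 hS h₁ h₂ (θ := θ) hy
  have t8 := boundary_omega (-p.sigma) (-p.sigma) hS h₁ h₂ (θ := θ) hy
  rw [dTh_absD 1 one_ne_zero h₁ hS hy] at t7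
  rw [dTh_absD (-p.sigma) ne h₁ hS hy] at t8
  simp only [Terms.jump2, e1, e2, e3, e3', e4, e5, mode, modeN, t1, t2, t3, t4, t5, t6, t7, t8,
    Params.plasmaEta, Params.plasmaTheta, Params.slow1, Params.slow2, Params.pressure,
    Params.slowV1, Params.slowV2, Params.slowV3, Params.slowV4,
    Params.vacuumEta, Params.vacuumTheta]
  fin_cases j
  · simp; rw [lam_eq p]; ring
  · exact absurd rfl hj
  · simp; ring
  · simp; field_simp; ring
  · simp; field_simp; ring

end Model

section
open Asymptotics

/-! ## Change of variables -/

/-- The straightened variables. -/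
noncomputable def straight (lam ε : ℝ) (φ : ℝ × ℝ → ℝ) (x : ℝ × ℝ × ℝ) : ℝ × ℝ × ℝ :=
  (x.2.1 - lam * x.1, x.2.2 - ε * φ (x.2.1 - lam * x.1, ε * x.1), ε * x.1)

section Chain
variable {lam ε : ℝ} {φ : ℝ × ℝ → ℝ} {f : ℝ × ℝ × ℝ → ℝ} {x : ℝ × ℝ × ℝ}

lemma toPhysical_eq : toPhysical lam ε φ f x = f (straight lam ε φ x) := rfl

lemma hasFDerivAt_straight
    (hφ : DifferentiableAt ℝ φ (x.2.1 - lam * x.1, ε * x.1)) :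
    ∃ A : ℝ × ℝ × ℝ →L[ℝ] ℝ × ℝ × ℝ, HasFDerivAt (straight lam ε φ) A x ∧
      A (1, 0, 0) = (-lam, -(ε * (-lam * pTh φ (x.2.1 - lam * x.1, ε * x.1)
        + ε * pTa φ (x.2.1 - lam * x.1, ε * x.1))), ε) ∧
      A (0, 1, 0) = (1, -(ε * pTh φ (x.2.1 - lam * x.1, ε * x.1)), 0) ∧
      A (0, 0, 1) = (0, 1, 0) := by
  let pt : ℝ × ℝ × ℝ →L[ℝ] ℝ := ContinuousLinearMap.fst ℝ ℝ (ℝ × ℝ)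
  let p1 : ℝ × ℝ × ℝ →L[ℝ] ℝ :=
    (ContinuousLinearMap.fst ℝ ℝ ℝ).comp (ContinuousLinearMap.snd ℝ ℝ (ℝ × ℝ))
  let p2 : ℝ × ℝ × ℝ →L[ℝ] ℝ :=
    (ContinuousLinearMap.snd ℝ ℝ ℝ).comp (ContinuousLinearMap.snd ℝ ℝ (ℝ × ℝ))
  let B : ℝ × ℝ × ℝ →L[ℝ] ℝ × ℝ := (p1 - lam • pt).prod (ε • pt)
  have hB : HasFDerivAt (fun x : ℝ × ℝ × ℝ => (x.2.1 - lam * x.1, ε * x.1)) B x := B.hasFDerivAt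
  have h1 : HasFDerivAt (fun x : ℝ × ℝ × ℝ => φ (x.2.1 - lam * x.1, ε * x.1)) _ x :=
    HasFDerivAt.comp (g := φ) x hφ.hasFDerivAt hB
  have h2 := (p2.hasFDerivAt (x := x)).sub (h1.const_mul ε)
  refine ⟨_, ((p1 - lam • pt).hasFDerivAt (x := x)).prodMk
    (h2.prodMk ((ε • pt).hasFDerivAt (x := x))), ?_, ?_, ?_⟩
  · have := clm_apply_prod2 (fderiv ℝ φ (x.2.1 - lam * x.1, ε * x.1)) (-lam, ε)
    simp [pt, p1, p2, B, this, pTh, pTa]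
  · simp [pt, p1, p2, B, pTh]
  · have := (fderiv ℝ φ (x.2.1 - lam * x.1, ε * x.1)).map_zero
    rw [← Prod.mk_zero_zero] at this
    simp [pt, p1, p2, B, this]

lemma differentiableAt_toPhysical (hφ : DifferentiableAt ℝ φ (x.2.1 - lam * x.1, ε * x.1))
    (hf : DifferentiableAt ℝ f (straight lam ε φ x)) :
    DifferentiableAt ℝ (toPhysical lam ε φ f) x := by
  obtain ⟨A, hA, -⟩ := hasFDerivAt_straight hφ
  exact hf.comp x hA.differentiableAt

lemma deriv_toPhysical (hφ : DifferentiableAt ℝ φ (x.2.1 - lam * x.1, ε * x.1))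
    (hf : DifferentiableAt ℝ f (straight lam ε φ x)) :
    dt (toPhysical lam ε φ f) x = -lam * dTh f (straight lam ε φ x)
      + ε * dTa f (straight lam ε φ x) - ε * (-lam * pTh φ (x.2.1 - lam * x.1, ε * x.1)
        + ε * pTa φ (x.2.1 - lam * x.1, ε * x.1)) * dEt f (straight lam ε φ x) ∧
    dx (toPhysical lam ε φ f) x = dTh f (straight lam ε φ x)
      - ε * pTh φ (x.2.1 - lam * x.1, ε * x.1) * dEt f (straight lam ε φ x) ∧
    dy (toPhysical lam ε φ f) x = dEt f (straight lam ε φ x) := by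
  obtain ⟨A, hA, e1, e2, e3⟩ := hasFDerivAt_straight hφ
  have h : fderiv ℝ (toPhysical lam ε φ f) x = (fderiv ℝ f (straight lam ε φ x)).comp A :=
    (HasFDerivAt.comp (g := f) x hf.hasFDerivAt hA).fderiv
  refine ⟨?_, ?_, ?_⟩
  · rw [dt, h, ContinuousLinearMap.comp_apply, e1, clm_apply_prod3]
    simp [dTh, dEt, dTa]
    ring
  · rw [dx, h, ContinuousLinearMap.comp_apply, e2, clm_apply_prod3]
    simp [dTh, dEt]
    ring
  · rw [dy, h, ContinuousLinearMap.comp_apply, e3]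
    rfl

lemma hasFDerivAt_interface {y : ℝ × ℝ} (hφ : DifferentiableAt ℝ φ (y.2 - lam * y.1, ε * y.1)) :
    DifferentiableAt ℝ (interface lam ε φ) y ∧
    fderiv ℝ (interface lam ε φ) y (1, 0) = ε * (-lam * pTh φ (y.2 - lam * y.1, ε * y.1)
      + ε * pTa φ (y.2 - lam * y.1, ε * y.1)) ∧
    fderiv ℝ (interface lam ε φ) y (0, 1) = ε * pTh φ (y.2 - lam * y.1, ε * y.1) := by
  let p1 : ℝ × ℝ →L[ℝ] ℝ := ContinuousLinearMap.fst ℝ ℝ ℝ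
  let p2 : ℝ × ℝ →L[ℝ] ℝ := ContinuousLinearMap.snd ℝ ℝ ℝ
  let B : ℝ × ℝ →L[ℝ] ℝ × ℝ := (p2 - lam • p1).prod (ε • p1)
  have hB : HasFDerivAt (fun y : ℝ × ℝ => (y.2 - lam * y.1, ε * y.1)) B y := B.hasFDerivAt
  have h1 : HasFDerivAt (fun y : ℝ × ℝ => φ (y.2 - lam * y.1, ε * y.1)) _ y :=
    HasFDerivAt.comp (g := φ) y hφ.hasFDerivAt hB
  have h2 : HasFDerivAt (interface lam ε φ) _ y := h1.const_mul ε
  refine ⟨h2.differentiableAt, ?_, ?_⟩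
  · have := clm_apply_prod2 (fderiv ℝ φ (y.2 - lam * y.1, ε * y.1)) (-lam, ε)
    rw [h2.fderiv]
    simp [p1, p2, B, this, pTh, pTa]
  · rw [h2.fderiv]
    simp [p1, p2, B, pTh]

end Chain

/-! ## The equations in straightened variables -/

/-- The MHD operator in straightened variables. -/
noncomputable def plasmaRes (p : Params) (ε : ℝ) (φ : ℝ × ℝ → ℝ) (u : Fin 5 → ℝ × ℝ × ℝ → ℝ)
    (z : ℝ × ℝ × ℝ) : Fin 6 → ℝ :=
  mhdLin p
    (fun i => -p.lam * dTh (u i) z + ε * dTa (u i) z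
      - ε * (-p.lam * pTh φ (z.1, z.2.2) + ε * pTa φ (z.1, z.2.2)) * dEt (u i) z)
    (fun i => dTh (u i) z - ε * pTh φ (z.1, z.2.2) * dEt (u i) z)
    (fun i => dEt (u i) z)
  + mhdQuad (fun i => u i z - p.U0 i)
    (fun i => dTh (u i) z - ε * pTh φ (z.1, z.2.2) * dEt (u i) z) (fun i => dEt (u i) z)

/-- The Maxwell operator in straightened variables. -/
noncomputable def vacuumRes (p : Params) (ε : ℝ) (φ : ℝ × ℝ → ℝ) (w : Fin 3 → ℝ × ℝ × ℝ → ℝ)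
    (z : ℝ × ℝ × ℝ) : Fin 4 → ℝ :=
  maxwellLin p.nu
    (fun i => -p.lam * dTh (w i) z + ε * dTa (w i) z
      - ε * (-p.lam * pTh φ (z.1, z.2.2) + ε * pTa φ (z.1, z.2.2)) * dEt (w i) z)
    (fun i => dTh (w i) z - ε * pTh φ (z.1, z.2.2) * dEt (w i) z)
    (fun i => dEt (w i) z)

/-- The interface conditions in straightened variables. -/
noncomputable def jumpRes (p : Params) (ε : ℝ) (φ : ℝ × ℝ → ℝ) (u : Fin 5 → ℝ × ℝ × ℝ → ℝ)
    (w : Fin 3 → ℝ × ℝ × ℝ → ℝ) (y : ℝ × ℝ) : Fin 5 → ℝ :=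
  let z : ℝ × ℝ × ℝ := (y.1, 0, y.2)
  let ζt : ℝ := ε * (-p.lam * pTh φ y + ε * pTa φ y)
  let ζx : ℝ := ε * pTh φ y
  ![ζt - (u 1 z - ζx * u 0 z),
    u 4 z - (w 0 z ^ 2 + w 1 z ^ 2 - w 2 z ^ 2) / 2,
    u 3 z - ζx * u 2 z,
    w 1 z - ζx * w 0 z,
    w 2 z - p.nu * ζt * w 0 z]

section Residuals
variable {p : Params} {ε : ℝ} {φ : ℝ × ℝ → ℝ} {u : Fin 5 → ℝ × ℝ × ℝ → ℝ}
  {w : Fin 3 → ℝ × ℝ × ℝ → ℝ} {x : ℝ × ℝ × ℝ}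

/-- The basic state is constant and has no normal velocity or magnetic field. Writing `u = U⁰ + (u -
U⁰)` in the convective terms therefore yields `mhdLin` and `mhdQuad` without any remainder. -/
lemma mhd_toPhysical (hφ : DifferentiableAt ℝ φ (x.2.1 - p.lam * x.1, ε * x.1))
    (hu : ∀ i, DifferentiableAt ℝ (u i) (straight p.lam ε φ x)) :
    mhd (fun i => toPhysical p.lam ε φ (u i)) x = plasmaRes p ε φ u (straight p.lam ε φ x) := by
  have h1 := fun i => (deriv_toPhysical hφ (hu i)).1
  have h2 := fun i => (deriv_toPhysical hφ (hu i)).2.1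
  have h3 := fun i => (deriv_toPhysical hφ (hu i)).2.2
  funext j
  simp only [mhd, advect, h1, h2, h3, toPhysical_eq, plasmaRes, mhdLin, mhdQuad, Params.U0,
    Pi.add_apply]
  fin_cases j <;> simp [straight] <;> ring

lemma maxwell_toPhysical (hφ : DifferentiableAt ℝ φ (x.2.1 - p.lam * x.1, ε * x.1))
    (hw : ∀ i, DifferentiableAt ℝ (w i) (straight p.lam ε φ x)) :
    maxwell p.nu (fun i => toPhysical p.lam ε φ (w i)) x
      = vacuumRes p ε φ w (straight p.lam ε φ x) := by
  have h1 := fun i => (deriv_toPhysical hφ (hw i)).1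
  have h2 := fun i => (deriv_toPhysical hφ (hw i)).2.1
  have h3 := fun i => (deriv_toPhysical hφ (hw i)).2.2
  funext j
  simp only [maxwell, h1, h2, h3, vacuumRes, maxwellLin]
  rfl

/-- Over a point of the interface the straightened normal variable is exactly zero. -/
lemma jump_toPhysical {y : ℝ × ℝ} (hφ : DifferentiableAt ℝ φ (y.2 - p.lam * y.1, ε * y.1)) :
    jump p.nu (fun i => toPhysical p.lam ε φ (u i)) (fun i => toPhysical p.lam ε φ (w i))
      (interface p.lam ε φ) y = jumpRes p ε φ u w (y.2 - p.lam * y.1, ε * y.1) := by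
  obtain ⟨-, h1, h2⟩ := hasFDerivAt_interface hφ
  have h3 : straight p.lam ε φ (y.1, y.2, interface p.lam ε φ y)
      = (y.2 - p.lam * y.1, 0, ε * y.1) := by
    simp [straight, interface]
  simp only [jump, jumpRes, h1, h2, toPhysical_eq, h3]

end Residuals

/-! ## Expansions in powers of `ε` -/

/-- `f = a₀ + e a₁ + e² a₂ + O(e³)` with bounded coefficients. -/
structure Exp3 {T : Type*} (l : Filter T) (e f a₀ a₁ a₂ : T → ℝ) : Prop where
  b₀ : a₀ =O[l] (1 : T → ℝ)
  b₁ : a₁ =O[l] (1 : T → ℝ)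
  b₂ : a₂ =O[l] (1 : T → ℝ)
  rem : (fun t => f t - (a₀ t + e t * a₁ t + e t ^ 2 * a₂ t)) =O[l] (fun t => e t ^ 3)

namespace Exp3
variable {T : Type*} {l : Filter T} {e f g a₀ a₁ a₂ b₀ b₁ b₂ : T → ℝ}

lemma isBigO_one_mul {a b : T → ℝ} (ha : a =O[l] (1 : T → ℝ)) (hb : b =O[l] (1 : T → ℝ)) :
    (fun t => a t * b t) =O[l] (1 : T → ℝ) :=
  (ha.mul hb).congr_right fun _ => mul_one _

lemma const (c : ℝ) : Exp3 l e (fun _ => c) (fun _ => c) (fun _ => 0) (fun _ => 0) where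
  b₀ := isBigO_const_const _ one_ne_zero _
  b₁ := isBigO_const_const _ one_ne_zero _
  b₂ := isBigO_const_const _ one_ne_zero _
  rem := by simpa using isBigO_zero _ _

lemma self : Exp3 l e e (fun _ => 0) (fun _ => 1) (fun _ => 0) where
  b₀ := isBigO_const_const _ one_ne_zero _
  b₁ := isBigO_const_const _ one_ne_zero _
  b₂ := isBigO_const_const _ one_ne_zero _
  rem := by simpa using isBigO_zero _ _

lemma add (hf : Exp3 l e f a₀ a₁ a₂) (hg : Exp3 l e g b₀ b₁ b₂) :
    Exp3 l e (fun t => f t + g t) (fun t => a₀ t + b₀ t) (fun t => a₁ t + b₁ t)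
      (fun t => a₂ t + b₂ t) where
  b₀ := hf.b₀.add hg.b₀
  b₁ := hf.b₁.add hg.b₁
  b₂ := hf.b₂.add hg.b₂
  rem := (hf.rem.add hg.rem).congr_left fun t => by ring

lemma mul (he : e =O[l] (1 : T → ℝ)) (hf : Exp3 l e f a₀ a₁ a₂) (hg : Exp3 l e g b₀ b₁ b₂) :
    Exp3 l e (fun t => f t * g t) (fun t => a₀ t * b₀ t) (fun t => a₀ t * b₁ t + a₁ t * b₀ t)
      (fun t => a₀ t * b₂ t + a₁ t * b₁ t + a₂ t * b₀ t) where
  b₀ := isBigO_one_mul hf.b₀ hg.b₀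
  b₁ := (isBigO_one_mul hf.b₀ hg.b₁).add (isBigO_one_mul hf.b₁ hg.b₀)
  b₂ := ((isBigO_one_mul hf.b₀ hg.b₂).add (isBigO_one_mul hf.b₁ hg.b₁)).add
    (isBigO_one_mul hf.b₂ hg.b₀)
  rem := by
    have he2 : (fun t => e t ^ 2) =O[l] (1 : T → ℝ) :=
      (isBigO_one_mul he he).congr_left fun t => by ring
    have he3 : (fun t => e t ^ 3) =O[l] (1 : T → ℝ) :=
      (isBigO_one_mul he2 he).congr_left fun t => by ring
    have hA : (fun t => a₀ t + e t * a₁ t + e t ^ 2 * a₂ t) =O[l] (1 : T → ℝ) :=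
      (hf.b₀.add (isBigO_one_mul he hf.b₁)).add (isBigO_one_mul he2 hf.b₂)
    have hG : g =O[l] (1 : T → ℝ) := by
      have := (((hg.b₀.add (isBigO_one_mul he hg.b₁)).add (isBigO_one_mul he2 hg.b₂)).add
        (hg.rem.trans he3))
      exact this.congr_left fun t => by ring
    have h1 : (fun t => (f t - (a₀ t + e t * a₁ t + e t ^ 2 * a₂ t)) * g t)
        =O[l] (fun t => e t ^ 3) := by simpa using hf.rem.mul hG
    have h2 : (fun t => (a₀ t + e t * a₁ t + e t ^ 2 * a₂ t)
        * (g t - (b₀ t + e t * b₁ t + e t ^ 2 * b₂ t))) =O[l] (fun t => e t ^ 3) := by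
      simpa using hA.mul hg.rem
    have h3 : (fun t => e t ^ 3 * (a₁ t * b₂ t + a₂ t * b₁ t + e t * (a₂ t * b₂ t)))
        =O[l] (fun t => e t ^ 3) := by
      simpa using (isBigO_refl (fun t => e t ^ 3) l).mul (((isBigO_one_mul hf.b₁ hg.b₂).add
        (isBigO_one_mul hf.b₂ hg.b₁)).add (isBigO_one_mul he (isBigO_one_mul hf.b₂ hg.b₂)))
    exact ((h1.add h2).add h3).congr_left fun t => by ring

lemma const_mul (c : ℝ) (hf : Exp3 l e f a₀ a₁ a₂) :
    Exp3 l e (fun t => c * f t) (fun t => c * a₀ t) (fun t => c * a₁ t) (fun t => c * a₂ t) where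
  b₀ := hf.b₀.const_mul_left c
  b₁ := hf.b₁.const_mul_left c
  b₂ := hf.b₂.const_mul_left c
  rem := (hf.rem.const_mul_left c).congr_left fun t => by ring

lemma sub (hf : Exp3 l e f a₀ a₁ a₂) (hg : Exp3 l e g b₀ b₁ b₂) :
    Exp3 l e (fun t => f t - g t) (fun t => a₀ t - b₀ t) (fun t => a₁ t - b₁ t)
      (fun t => a₂ t - b₂ t) where
  b₀ := hf.b₀.sub hg.b₀
  b₁ := hf.b₁.sub hg.b₁
  b₂ := hf.b₂.sub hg.b₂
  rem := (hf.rem.sub hg.rem).congr_left fun t => by ring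

lemma congr {f' a₀' a₁' a₂' : T → ℝ} (hf : Exp3 l e f a₀ a₁ a₂) (h : ∀ t, f t = f' t)
    (h₀ : ∀ t, a₀ t = a₀' t) (h₁ : ∀ t, a₁ t = a₁' t) (h₂ : ∀ t, a₂ t = a₂' t) :
    Exp3 l e f' a₀' a₁' a₂' := by
  rw [← funext h, ← funext h₀, ← funext h₁, ← funext h₂]
  exact hf

/-- When both factors start at order `e`, the product only sees their first coefficients. Hence the
quadratic terms at order `ε²` involve the first order terms alone. -/
lemma mul_small (he : e =O[l] (1 : T → ℝ)) (hf : Exp3 l e f (fun _ => 0) a₁ a₂)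
    (hg : Exp3 l e g (fun _ => 0) b₁ b₂) :
    Exp3 l e (fun t => f t * g t) (fun _ => 0) (fun _ => 0) (fun t => a₁ t * b₁ t) :=
  (hf.mul he hg).congr (fun _ => rfl) (fun _ => by ring) (fun _ => by ring) (fun _ => by ring)

lemma mhdLin (p : Params) {ft fx fy x₁ x₂ y₁ y₂ t₁ t₂ : Fin 5 → T → ℝ}
    (ht : ∀ i, Exp3 l e (ft i) (fun _ => 0) (t₁ i) (t₂ i))
    (hx : ∀ i, Exp3 l e (fx i) (fun _ => 0) (x₁ i) (x₂ i))
    (hy : ∀ i, Exp3 l e (fy i) (fun _ => 0) (y₁ i) (y₂ i)) (j : Fin 6) :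
    Exp3 l e (fun t => mhdLin p (fun i => ft i t) (fun i => fx i t) (fun i => fy i t) j)
      (fun _ => 0) (fun t => PlasmaVacuum.mhdLin p (fun i => t₁ i t) (fun i => x₁ i t) (fun i => y₁ i t) j)
      (fun t => PlasmaVacuum.mhdLin p (fun i => t₂ i t) (fun i => x₂ i t) (fun i => y₂ i t) j) := by
  fin_cases j
  · exact ((((ht 0).add ((hx 0).const_mul p.v0)).sub ((hx 2).const_mul p.B0)).add (hx 4)).congr
      (fun _ => rfl) (fun _ => by ring) (fun _ => rfl) (fun _ => rfl)
  · exact ((((ht 1).add ((hx 1).const_mul p.v0)).sub ((hx 3).const_mul p.B0)).add (hy 4)).congr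
      (fun _ => rfl) (fun _ => by ring) (fun _ => rfl) (fun _ => rfl)
  · exact (((ht 2).add ((hx 2).const_mul p.v0)).sub ((hx 0).const_mul p.B0)).congr
      (fun _ => rfl) (fun _ => by ring) (fun _ => rfl) (fun _ => rfl)
  · exact (((ht 3).add ((hx 3).const_mul p.v0)).sub ((hx 1).const_mul p.B0)).congr
      (fun _ => rfl) (fun _ => by ring) (fun _ => rfl) (fun _ => rfl)
  · exact ((hx 0).add (hy 1)).congr (fun _ => rfl) (fun _ => by ring) (fun _ => rfl) (fun _ => rfl)
  · exact ((hx 2).add (hy 3)).congr (fun _ => rfl) (fun _ => by ring) (fun _ => rfl) (fun _ => rfl)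

lemma mhdQuad (he : e =O[l] (1 : T → ℝ)) {ft fx fy x₁ x₂ y₁ y₂ t₁ t₂ : Fin 5 → T → ℝ}
    (ht : ∀ i, Exp3 l e (ft i) (fun _ => 0) (t₁ i) (t₂ i))
    (hx : ∀ i, Exp3 l e (fx i) (fun _ => 0) (x₁ i) (x₂ i))
    (hy : ∀ i, Exp3 l e (fy i) (fun _ => 0) (y₁ i) (y₂ i)) (j : Fin 6) :
    Exp3 l e (fun t => mhdQuad (fun i => ft i t) (fun i => fx i t) (fun i => fy i t) j)
      (fun _ => 0) (fun _ => 0)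
      (fun t => PlasmaVacuum.mhdQuad (fun i => t₁ i t) (fun i => x₁ i t) (fun i => y₁ i t) j) := by
  have key : ∀ i₀ i₁ i₂ i₃ i₄ i₅ i₆ i₇ : Fin 5, Exp3 l e
      (fun t => ft i₀ t * fx i₁ t + ft i₂ t * fy i₃ t - (ft i₄ t * fx i₅ t + ft i₆ t * fy i₇ t))
      (fun _ => 0) (fun _ => 0) (fun t => t₁ i₀ t * x₁ i₁ t + t₁ i₂ t * y₁ i₃ t
        - (t₁ i₄ t * x₁ i₅ t + t₁ i₆ t * y₁ i₇ t)) := fun i₀ i₁ i₂ i₃ i₄ i₅ i₆ i₇ =>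
    ((((ht i₀).mul_small he (hx i₁)).add ((ht i₂).mul_small he (hy i₃))).sub
      (((ht i₄).mul_small he (hx i₅)).add ((ht i₆).mul_small he (hy i₇)))).congr
      (fun _ => rfl) (fun _ => by ring) (fun _ => by ring) (fun _ => rfl)
  fin_cases j
  · exact key 0 0 1 0 2 2 3 2
  · exact key 0 1 1 1 2 3 3 3
  · exact key 0 2 1 2 2 0 3 0
  · exact key 0 3 1 3 2 1 3 1
  · exact const 0
  · exact const 0

lemma maxwellLin (ν : ℝ) {ft fx fy x₁ x₂ y₁ y₂ t₁ t₂ : Fin 3 → T → ℝ}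
    (ht : ∀ i, Exp3 l e (ft i) (fun _ => 0) (t₁ i) (t₂ i))
    (hx : ∀ i, Exp3 l e (fx i) (fun _ => 0) (x₁ i) (x₂ i))
    (hy : ∀ i, Exp3 l e (fy i) (fun _ => 0) (y₁ i) (y₂ i)) (j : Fin 4) :
    Exp3 l e (fun t => maxwellLin ν (fun i => ft i t) (fun i => fx i t) (fun i => fy i t) j)
      (fun _ => 0)
      (fun t => PlasmaVacuum.maxwellLin ν (fun i => t₁ i t) (fun i => x₁ i t) (fun i => y₁ i t) j)
      (fun t => PlasmaVacuum.maxwellLin ν (fun i => t₂ i t) (fun i => x₂ i t) (fun i => y₂ i t) j) := by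
  fin_cases j
  · exact (((ht 0).const_mul ν).add (hy 2)).congr
      (fun _ => rfl) (fun _ => by ring) (fun _ => rfl) (fun _ => rfl)
  · exact (((ht 1).const_mul ν).sub (hx 2)).congr
      (fun _ => rfl) (fun _ => by ring) (fun _ => rfl) (fun _ => rfl)
  · exact ((((ht 2).const_mul ν).sub (hx 1)).add (hy 0)).congr
      (fun _ => rfl) (fun _ => by ring) (fun _ => rfl) (fun _ => rfl)
  · exact ((hx 0).add (hy 1)).congr (fun _ => rfl) (fun _ => by ring) (fun _ => rfl) (fun _ => rfl)

end Exp3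

/-! ### Uniform estimates as Landau relations on a product filter -/

section Uniform
variable {P : Type*} {Z : Set P} {F : ℝ → P → ℝ}

/-- On `𝓝[>] 0 ×ˢ 𝓟 Z` the parameter `ε` tends to zero while the point ranges freely over `Z`, so
one Landau symbol expresses an estimate uniform on `Z`. `bound_of_isBigO` translates back. -/
lemma isBigO_of_bound {C ε₀ : ℝ} {n : ℕ} (hε : 0 < ε₀)
    (h : ∀ ε, 0 < ε → ε < ε₀ → ∀ z ∈ Z, |F ε z| ≤ C * ε ^ n) :
    (fun q : ℝ × P => F q.1 q.2) =O[𝓝[>] 0 ×ˢ 𝓟 Z] (fun q => q.1 ^ n) := by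
  refine IsBigO.of_bound C ?_
  rw [eventually_prod_principal_iff]
  filter_upwards [Ioo_mem_nhdsGT hε] with ε h1 z hz
  rw [Real.norm_eq_abs, Real.norm_eq_abs, abs_of_pos (pow_pos h1.1 n)]
  exact h ε h1.1 h1.2 z hz

lemma bound_of_isBigO {n : ℕ}
    (h : (fun q : ℝ × P => F q.1 q.2) =O[𝓝[>] 0 ×ˢ 𝓟 Z] (fun q => q.1 ^ n)) :
    ∃ C, 0 ≤ C ∧ ∃ ε₀ > 0, ∀ ε, 0 < ε → ε < ε₀ → ∀ z ∈ Z, |F ε z| ≤ C * ε ^ n := by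
  obtain ⟨C, hC, h⟩ := h.exists_nonneg
  have := h.bound
  rw [eventually_prod_principal_iff] at this
  obtain ⟨ε₀, h0, h1⟩ := mem_nhdsGT_iff_exists_Ioo_subset.1 this
  refine ⟨C, hC, ε₀, h0, fun ε h2 h3 z hz => ?_⟩
  have := h1 ⟨h2, h3⟩ z hz
  rwa [Real.norm_eq_abs, Real.norm_eq_abs, abs_of_pos (pow_pos h2 n)] at this

lemma isBigO_one_of_bound {C : ℝ} {f : P → ℝ} (h : ∀ z ∈ Z, |f z| ≤ C) :
    (fun q : ℝ × P => f q.2) =O[𝓝[>] (0 : ℝ) ×ˢ 𝓟 Z] (1 : ℝ × P → ℝ) :=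
  (isBigO_of_bound (n := 0) (F := fun _ => f) (C := C) one_pos
    fun ε _ _ z hz => by simpa using h z hz).congr_right fun _ => pow_zero _

lemma isBigO_fst_one : (fun q : ℝ × P => q.1) =O[𝓝[>] (0 : ℝ) ×ˢ 𝓟 Z] (1 : ℝ × P → ℝ) :=
  (isBigO_of_bound (n := 0) (F := fun ε (_ : P) => ε) (C := 1) one_pos
    fun ε h h' z hz => by rw [abs_of_pos h]; linarith [pow_zero ε]).congr_right fun _ => pow_zero _

end Uniform

/-! ### Values and derivatives of families with an expansion -/

section Jets
variable {D S : Set ℝ} {F : ℝ → ℝ × ℝ × ℝ → ℝ} {f₁ f₂ : ℝ × ℝ × ℝ → ℝ}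
  {f₁h f₂h : ℝ → ℝ → ℝ → ℂ} {c C ε₀ : ℝ}

lemma mem_interior_slab (hS : IsOpen S) {z : ℝ × ℝ × ℝ} (hη : z.2.1 ∈ interior D) (hτ : z.2.2 ∈ S) :
    z ∈ interior {z : ℝ × ℝ × ℝ | z.2.1 ∈ D ∧ z.2.2 ∈ S} := by
  refine mem_interior.2 ⟨{z | z.2.1 ∈ interior D ∧ z.2.2 ∈ S}, fun y hy =>
    ⟨interior_subset hy.1, hy.2⟩, ?_, hη, hτ⟩
  exact (isOpen_interior.preimage (by fun_prop)).inter (hS.preimage (by fun_prop))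

lemma differentiableAt_of_expansion (hS : IsOpen S) (h₁ : IsWaveField D S f₁ f₁h)
    (h₂ : IsWaveField D S f₂ f₂h) {g : ℝ × ℝ × ℝ → ℝ} {ε δ : ℝ}
    (h : C1Small {z : ℝ × ℝ × ℝ | z.2.1 ∈ D ∧ z.2.2 ∈ S} δ
      (fun z => g z - (c + ε * f₁ z + ε ^ 2 * f₂ z)))
    {z : ℝ × ℝ × ℝ} (hη : z.2.1 ∈ interior D) (hτ : z.2.2 ∈ S) :
    DifferentiableAt ℝ g z ∧ ∀ v, |fderiv ℝ g z v - (ε * fderiv ℝ f₁ z v + ε ^ 2 * fderiv ℝ f₂ z v)|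
      ≤ δ * ‖v‖ := by
  obtain ⟨h3, h4⟩ := h.2 z (mem_interior_slab hS hη hτ)
  have d1 := (h₁.differentiableAt hS hη hτ).hasFDerivAt.const_mul ε
  have d2 := (h₂.differentiableAt hS hη hτ).hasFDerivAt.const_mul (ε ^ 2)
  have d3 := h3.hasFDerivAt.add ((d1.const_add c).add d2)
  have e : g = (fun z => g z - (c + ε * f₁ z + ε ^ 2 * f₂ z))
      + ((fun z => c + ε * f₁ z) + fun z => ε ^ 2 * f₂ z) := by
    funext z; simp
  rw [← e] at d3
  refine ⟨d3.differentiableAt, fun v => ?_⟩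
  rw [d3.fderiv]
  have := (fderiv ℝ (fun z => g z - (c + ε * f₁ z + ε ^ 2 * f₂ z)) z).le_of_opNorm_le h4 v
  rw [Real.norm_eq_abs] at this
  convert this using 2
  simp

/-- Values are controlled up to `η = 0`, derivatives only in the interior, so the two are expanded
separately. The map `r` permits evaluation on the interface. -/
lemma exp3_value (hS : IsOpen S) (h₁ : IsWaveField D S f₁ f₁h) (h₂ : IsWaveField D S f₂ f₂h)
    (hε : 0 < ε₀) (h : ∀ ε, 0 < ε → ε < ε₀ → C1Small {z : ℝ × ℝ × ℝ | z.2.1 ∈ D ∧ z.2.2 ∈ S}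
      (C * ε ^ 3) (fun z => F ε z - (c + ε * f₁ z + ε ^ 2 * f₂ z)))
    {P : Type*} {Z : Set P} (r : P → ℝ × ℝ × ℝ) (hr : ∀ y ∈ Z, (r y).2.1 ∈ D ∧ (r y).2.2 ∈ S) :
    Exp3 (𝓝[>] (0 : ℝ) ×ˢ 𝓟 Z) Prod.fst (fun q => F q.1 (r q.2)) (fun _ => c)
      (fun q => f₁ (r q.2)) (fun q => f₂ (r q.2)) := by
  obtain ⟨C₁, -, b₁, -⟩ := h₁.exists_bound hS
  obtain ⟨C₂, -, b₂, -⟩ := h₂.exists_bound hS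
  exact ⟨isBigO_const_const _ one_ne_zero _,
    isBigO_one_of_bound (f := fun y => f₁ (r y)) fun y hy => b₁ _ (hr y hy).1 (hr y hy).2,
    isBigO_one_of_bound (f := fun y => f₂ (r y)) fun y hy => b₂ _ (hr y hy).1 (hr y hy).2,
    isBigO_of_bound (F := fun ε y => F ε (r y) - (c + ε * f₁ (r y) + ε ^ 2 * f₂ (r y))) hε
      fun ε h1 h2 y hy => (h ε h1 h2).1 (r y) (hr y hy)⟩

lemma exp3_deriv (hS : IsOpen S) (h₁ : IsWaveField D S f₁ f₁h) (h₂ : IsWaveField D S f₂ f₂h)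
    (hε : 0 < ε₀) (h : ∀ ε, 0 < ε → ε < ε₀ → C1Small {z : ℝ × ℝ × ℝ | z.2.1 ∈ D ∧ z.2.2 ∈ S}
      (C * ε ^ 3) (fun z => F ε z - (c + ε * f₁ z + ε ^ 2 * f₂ z))) (v : ℝ × ℝ × ℝ) :
    Exp3 (𝓝[>] (0 : ℝ) ×ˢ 𝓟 {z : ℝ × ℝ × ℝ | z.2.1 ∈ interior D ∧ z.2.2 ∈ S}) Prod.fst
      (fun q => fderiv ℝ (F q.1) q.2 v) (fun _ => 0)
      (fun q => fderiv ℝ f₁ q.2 v) (fun q => fderiv ℝ f₂ q.2 v) := by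
  have key : ∀ {f : ℝ × ℝ × ℝ → ℝ} {fh : ℝ → ℝ → ℝ → ℂ}, IsWaveField D S f fh →
      (fun q : ℝ × (ℝ × ℝ × ℝ) => fderiv ℝ f q.2 v)
      =O[𝓝[>] (0 : ℝ) ×ˢ 𝓟 {z : ℝ × ℝ × ℝ | z.2.1 ∈ interior D ∧ z.2.2 ∈ S}]
      (1 : ℝ × (ℝ × ℝ × ℝ) → ℝ) := by
    intro f fh hf
    obtain ⟨C₁, h0, -, b₁⟩ := hf.exists_bound hS
    refine isBigO_one_of_bound (f := fun z => fderiv ℝ f z v) (C := (C₁ + C₁ + C₁) * ‖v‖) fun z hz => ?_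
    obtain ⟨b1, b2, b3⟩ := b₁ z hz.1 hz.2
    refine (fderiv ℝ f z).le_of_opNorm_le ((clm_norm_le_prod3 _).trans ?_) v
    exact add_le_add (add_le_add b1 b2) b3
  refine ⟨isBigO_const_const _ one_ne_zero _, key h₁, key h₂, ?_⟩
  refine isBigO_of_bound (F := fun ε z => fderiv ℝ (F ε) z v
    - (0 + ε * fderiv ℝ f₁ z v + ε ^ 2 * fderiv ℝ f₂ z v)) (C := C * ‖v‖) hε fun ε h1 h2 z hz => ?_
  have := (differentiableAt_of_expansion hS h₁ h₂ (h ε h1 h2) hz.1 hz.2).2 v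
  rw [zero_add]
  linarith

end Jets

section Profiles
variable {S : Set ℝ} {F : ℝ → ℝ × ℝ → ℝ} {φ₁ φ₂ : ℝ × ℝ → ℝ} {φh ψh : ℝ → ℝ → ℂ} {C ε₀ : ℝ}

lemma IsProfile.bound_fderiv (h : IsProfile S φ₁ φh) (hS : IsOpen S) :
    ∃ C, 0 ≤ C ∧ ∀ y : ℝ × ℝ, y.2 ∈ S → |φ₁ y| ≤ C ∧ |pTh φ₁ y| ≤ C ∧ |pTa φ₁ y| ≤ C := by
  obtain ⟨C, hC, h0, h1⟩ := h.isField.toWave.exists_bound hS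
  refine ⟨C, hC, fun y hy => ⟨h0 (y.1, 0, y.2) trivial hy, ?_⟩⟩
  obtain ⟨-, e1, -, e3⟩ := h.hasPd hS (z := (y.1, 0, y.2)) hy
  obtain ⟨b1, -, b3⟩ := h1 (y.1, 0, y.2) (by simp) hy
  rw [e1] at b1
  rw [e3] at b3
  exact ⟨b1, b3⟩

lemma differentiableAt_profile_of_expansion (hS : IsOpen S) (h₁ : IsProfile S φ₁ φh)
    (h₂ : IsProfile S φ₂ ψh) {g : ℝ × ℝ → ℝ} {ε δ : ℝ}
    (h : C1Small {z : ℝ × ℝ | z.2 ∈ S} δ (fun z => g z - (φ₁ z + ε * φ₂ z))) {y : ℝ × ℝ}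
    (hy : y.2 ∈ S) : DifferentiableAt ℝ g y ∧
    ∀ v, |fderiv ℝ g y v - (fderiv ℝ φ₁ y v + ε * fderiv ℝ φ₂ y v)| ≤ δ * ‖v‖ := by
  obtain ⟨h3, h4⟩ := h.2 y ((IsOpen.mem_nhds (hS.preimage continuous_snd) hy :
    {z : ℝ × ℝ | z.2 ∈ S} ∈ 𝓝 y) |> mem_interior_iff_mem_nhds.2)
  have d1 := (h₁.differentiableAt hS hy).hasFDerivAt
  have d2 := (h₂.differentiableAt hS hy).hasFDerivAt.const_mul ε
  have d3 := h3.hasFDerivAt.add (d1.add d2)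
  have e : g = (fun z => g z - (φ₁ z + ε * φ₂ z)) + (φ₁ + fun z => ε * φ₂ z) := by
    funext z; simp
  rw [← e] at d3
  refine ⟨d3.differentiableAt, fun v => ?_⟩
  rw [d3.fderiv]
  have := (fderiv ℝ (fun z => g z - (φ₁ z + ε * φ₂ z)) y).le_of_opNorm_le h4 v
  rw [Real.norm_eq_abs] at this
  convert this using 2
  simp

/-- Derivatives of the interface always occur with a factor `ε`, so an expansion of the profile up
to `O(ε²)` gives precision `O(ε³)`. -/
lemma exp3_profile (hS : IsOpen S) (h₁ : IsProfile S φ₁ φh) (h₂ : IsProfile S φ₂ ψh) (hε : 0 < ε₀)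
    (h : ∀ ε, 0 < ε → ε < ε₀ → C1Small {z : ℝ × ℝ | z.2 ∈ S} (C * ε ^ 2)
      (fun z => F ε z - (φ₁ z + ε * φ₂ z))) {P : Type*} {Z : Set P} (r : P → ℝ × ℝ)
    (hr : ∀ y ∈ Z, (r y).2 ∈ S) (v : ℝ × ℝ) :
    Exp3 (𝓝[>] (0 : ℝ) ×ˢ 𝓟 Z) Prod.fst (fun q => q.1 * fderiv ℝ (F q.1) (r q.2) v) (fun _ => 0)
      (fun q => fderiv ℝ φ₁ (r q.2) v) (fun q => fderiv ℝ φ₂ (r q.2) v) := by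
  have key : ∀ {f : ℝ × ℝ → ℝ} {fh : ℝ → ℝ → ℂ}, IsProfile S f fh →
      (fun q : ℝ × P => fderiv ℝ f (r q.2) v) =O[𝓝[>] (0 : ℝ) ×ˢ 𝓟 Z] (1 : ℝ × P → ℝ) := by
    intro f fh hf
    obtain ⟨C₁, h0, b₁⟩ := hf.bound_fderiv hS
    refine isBigO_one_of_bound (f := fun z => fderiv ℝ f (r z) v) (C := (C₁ + C₁) * ‖v‖) fun z hz => ?_
    obtain ⟨-, b1, b2⟩ := b₁ _ (hr z hz)
    exact (fderiv ℝ f (r z)).le_of_opNorm_le ((clm_norm_le_prod2 _).trans (add_le_add b1 b2)) v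
  refine ⟨isBigO_const_const _ one_ne_zero _, key h₁, key h₂, ?_⟩
  refine isBigO_of_bound (F := fun ε z => ε * fderiv ℝ (F ε) (r z) v
    - (0 + ε * fderiv ℝ φ₁ (r z) v + ε ^ 2 * fderiv ℝ φ₂ (r z) v)) (C := C * ‖v‖) hε
    fun ε h1 h2 z hz => ?_
  have := (differentiableAt_profile_of_expansion hS h₁ h₂ (h ε h1 h2) (hr z hz)).2 v
  rw [show ε * fderiv ℝ (F ε) (r z) v - (0 + ε * fderiv ℝ φ₁ (r z) v + ε ^ 2 * fderiv ℝ φ₂ (r z) v)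
    = ε * (fderiv ℝ (F ε) (r z) v - (fderiv ℝ φ₁ (r z) v + ε * fderiv ℝ φ₂ (r z) v)) by ring,
    abs_mul, abs_of_pos h1]
  have := mul_le_mul_of_nonneg_left this h1.le
  linarith

end Profiles

/-! ### Expansion of the equations and interface conditions -/

section Residual
variable {p : Params} {S : Set ℝ} {U : ℝ → Fin 5 → ℝ × ℝ × ℝ → ℝ} {V : ℝ → Fin 3 → ℝ × ℝ × ℝ → ℝ}
  {φ : ℝ → ℝ × ℝ → ℝ} {X : Terms}

/-- The derivatives in `t` and `x₁` of a family with an expansion. -/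
lemma exp3_physical {D : Set ℝ} {F : ℝ → ℝ × ℝ × ℝ → ℝ} {f₁ f₂ : ℝ × ℝ × ℝ → ℝ}
    {f₁h f₂h : ℝ → ℝ → ℝ → ℂ} {c C ε₀ : ℝ} (lam : ℝ) (hS : IsOpen S)
    (hφ₁ : IsProfile S X.phi1 X.phi1h) (hφ₂ : IsProfile S X.phi2 X.phi2h)
    (h₁ : IsWaveField D S f₁ f₁h) (h₂ : IsWaveField D S f₂ f₂h) (hε : 0 < ε₀)
    (h : ∀ ε, 0 < ε → ε < ε₀ → C1Small {z : ℝ × ℝ × ℝ | z.2.1 ∈ D ∧ z.2.2 ∈ S}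
      (C * ε ^ 3) (fun z => F ε z - (c + ε * f₁ z + ε ^ 2 * f₂ z)))
    (hφ : ∀ ε, 0 < ε → ε < ε₀ → C1Small {z : ℝ × ℝ | z.2 ∈ S} (C * ε ^ 2)
      (fun z => φ ε z - (X.phi1 z + ε * X.phi2 z))) :
    Exp3 (𝓝[>] (0 : ℝ) ×ˢ 𝓟 {z : ℝ × ℝ × ℝ | z.2.1 ∈ interior D ∧ z.2.2 ∈ S}) Prod.fst
      (fun q => -lam * dTh (F q.1) q.2 + q.1 * dTa (F q.1) q.2
        - q.1 * (-lam * pTh (φ q.1) (q.2.1, q.2.2.2) + q.1 * pTa (φ q.1) (q.2.1, q.2.2.2))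
          * dEt (F q.1) q.2) (fun _ => 0)
      (fun q => -lam * dTh f₁ q.2)
      (fun q => -lam * dTh f₂ q.2 + dTa f₁ q.2 + lam * pTh X.phi1 (q.2.1, q.2.2.2) * dEt f₁ q.2) ∧
    Exp3 (𝓝[>] (0 : ℝ) ×ˢ 𝓟 {z : ℝ × ℝ × ℝ | z.2.1 ∈ interior D ∧ z.2.2 ∈ S}) Prod.fst
      (fun q => dTh (F q.1) q.2 - q.1 * pTh (φ q.1) (q.2.1, q.2.2.2) * dEt (F q.1) q.2) (fun _ => 0)
      (fun q => dTh f₁ q.2)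
      (fun q => dTh f₂ q.2 - pTh X.phi1 (q.2.1, q.2.2.2) * dEt f₁ q.2) ∧
    Exp3 (𝓝[>] (0 : ℝ) ×ˢ 𝓟 {z : ℝ × ℝ × ℝ | z.2.1 ∈ interior D ∧ z.2.2 ∈ S}) Prod.fst
      (fun q => dEt (F q.1) q.2) (fun _ => 0) (fun q => dEt f₁ q.2) (fun q => dEt f₂ q.2) := by
  have he := isBigO_fst_one (Z := {z : ℝ × ℝ × ℝ | z.2.1 ∈ interior D ∧ z.2.2 ∈ S})
  have j := exp3_deriv hS h₁ h₂ hε h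
  have k := exp3_profile hS hφ₁ hφ₂ hε hφ (Z := {z : ℝ × ℝ × ℝ | z.2.1 ∈ interior D ∧ z.2.2 ∈ S})
    (fun z => (z.1, z.2.2)) (fun z hz => hz.2)
  refine ⟨?_, ?_, j (0, 1, 0)⟩
  · exact ((((j (1, 0, 0)).const_mul (-lam)).add (Exp3.self.mul_small he (j (0, 0, 1)))).sub
      ((((k (1, 0)).const_mul (-lam)).add ((Exp3.self.mul_small he (k (0, 1))).congr
        (fun _ => rfl) (fun _ => (mul_zero (-lam)).symm) (fun _ => rfl) (fun _ => rfl))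
        |>.congr (fun _ => rfl) (fun _ => by ring) (fun _ => rfl) (fun _ => rfl)).mul_small he
        (j (0, 1, 0)))).congr
      (fun _ => by simp only [dTh, dTa, dEt, pTh, pTa]; ring) (fun _ => by ring)
      (fun _ => by simp only [dTh]; ring)
      (fun _ => by simp only [dTh, dTa, dEt, pTh]; ring)
  · exact ((j (1, 0, 0)).sub ((k (1, 0)).mul_small he (j (0, 1, 0)))).congr
      (fun _ => rfl) (fun _ => by ring) (fun _ => by simp only [dTh]; ring) (fun _ => rfl)

lemma exp3_plasmaRes (hS : IsOpen S) (hX : X.Regular S) {C ε₀ : ℝ} (hε : 0 < ε₀)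
    (h : ∀ ε, 0 < ε → ε < ε₀ → ∀ i, C1Small {z : ℝ × ℝ × ℝ | z.2.1 ∈ Ici (0 : ℝ) ∧ z.2.2 ∈ S}
      (C * ε ^ 3) (fun z => U ε i z - X.truncU p ε i z))
    (hφ : ∀ ε, 0 < ε → ε < ε₀ → C1Small {z : ℝ × ℝ | z.2 ∈ S} (C * ε ^ 2)
      (fun z => φ ε z - X.truncPhi ε z)) (j : Fin 6) :
    Exp3 (𝓝[>] (0 : ℝ) ×ˢ 𝓟 {z : ℝ × ℝ × ℝ | z.2.1 ∈ interior (Ici (0 : ℝ)) ∧ z.2.2 ∈ S}) Prod.fst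
      (fun q => plasmaRes p q.1 (φ q.1) (U q.1) q.2 j) (fun _ => 0)
      (fun q => X.plasma1 p q.2 j) (fun q => X.plasma2 p q.2 j) := by
  have he := isBigO_fst_one (Z := {z : ℝ × ℝ × ℝ | z.2.1 ∈ interior (Ici (0 : ℝ)) ∧ z.2.2 ∈ S})
  have H := fun i => exp3_physical p.lam hS hX.phi1 hX.phi2 (hX.U1 i) (hX.U2 i) hε
    (fun ε h1 h2 => h ε h1 h2 i) hφ
  -- The basic state is subtracted so that the arguments of the quadratic part vanish at order zero.
  have K := fun i => ((exp3_value hS (hX.U1 i) (hX.U2 i) hε (fun ε h1 h2 => h ε h1 h2 i)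
    (Z := {z : ℝ × ℝ × ℝ | z.2.1 ∈ interior (Ici (0 : ℝ)) ∧ z.2.2 ∈ S}) id
    fun z hz => ⟨interior_subset hz.1, hz.2⟩).sub (Exp3.const (p.U0 i))).congr (fun _ => rfl)
    (fun _ => sub_self _) (fun _ => sub_zero _) (fun _ => sub_zero _)
  exact ((Exp3.mhdLin p (fun i => (H i).1) (fun i => (H i).2.1) (fun i => (H i).2.2) j).add
    (Exp3.mhdQuad he K (fun i => (H i).2.1) (fun i => (H i).2.2) j)).congr
    (fun _ => rfl) (fun _ => add_zero _) (fun _ => add_zero _) (fun _ => rfl)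

lemma exp3_vacuumRes (hS : IsOpen S) (hX : X.Regular S) {C ε₀ : ℝ} (hε : 0 < ε₀)
    (h : ∀ ε, 0 < ε → ε < ε₀ → ∀ i, C1Small {z : ℝ × ℝ × ℝ | z.2.1 ∈ Iic (0 : ℝ) ∧ z.2.2 ∈ S}
      (C * ε ^ 3) (fun z => V ε i z - X.truncV p ε i z))
    (hφ : ∀ ε, 0 < ε → ε < ε₀ → C1Small {z : ℝ × ℝ | z.2 ∈ S} (C * ε ^ 2)
      (fun z => φ ε z - X.truncPhi ε z)) (j : Fin 4) :
    Exp3 (𝓝[>] (0 : ℝ) ×ˢ 𝓟 {z : ℝ × ℝ × ℝ | z.2.1 ∈ interior (Iic (0 : ℝ)) ∧ z.2.2 ∈ S}) Prod.fst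
      (fun q => vacuumRes p q.1 (φ q.1) (V q.1) q.2 j) (fun _ => 0)
      (fun q => X.vacuum1 p q.2 j) (fun q => X.vacuum2 p q.2 j) := by
  have H := fun i => exp3_physical p.lam hS hX.phi1 hX.phi2 (hX.V1 i) (hX.V2 i) hε
    (fun ε h1 h2 => h ε h1 h2 i) hφ
  exact Exp3.maxwellLin p.nu (fun i => (H i).1) (fun i => (H i).2.1) (fun i => (H i).2.2) j

lemma exp3_jumpRes (hS : IsOpen S) (hX : X.Regular S) {C ε₀ : ℝ} (hε : 0 < ε₀)
    (hU : ∀ ε, 0 < ε → ε < ε₀ → ∀ i, C1Small {z : ℝ × ℝ × ℝ | z.2.1 ∈ Ici (0 : ℝ) ∧ z.2.2 ∈ S}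
      (C * ε ^ 3) (fun z => U ε i z - X.truncU p ε i z))
    (hV : ∀ ε, 0 < ε → ε < ε₀ → ∀ i, C1Small {z : ℝ × ℝ × ℝ | z.2.1 ∈ Iic (0 : ℝ) ∧ z.2.2 ∈ S}
      (C * ε ^ 3) (fun z => V ε i z - X.truncV p ε i z))
    (hφ : ∀ ε, 0 < ε → ε < ε₀ → C1Small {z : ℝ × ℝ | z.2 ∈ S} (C * ε ^ 2)
      (fun z => φ ε z - X.truncPhi ε z)) (j : Fin 5) :
    Exp3 (𝓝[>] (0 : ℝ) ×ˢ 𝓟 {y : ℝ × ℝ | y.2 ∈ S}) Prod.fst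
      (fun q => jumpRes p q.1 (φ q.1) (U q.1) (V q.1) q.2 j) (fun _ => 0)
      (fun q => X.jump1 p q.2 j) (fun q => X.jump2 p q.2 j) := by
  have he := isBigO_fst_one (Z := {y : ℝ × ℝ | y.2 ∈ S})
  have u := fun i => exp3_value hS (hX.U1 i) (hX.U2 i) hε (fun ε h1 h2 => hU ε h1 h2 i)
    (Z := {y : ℝ × ℝ | y.2 ∈ S}) (fun y => (y.1, 0, y.2)) fun y hy => ⟨self_mem_Ici, hy⟩
  have w := fun i => exp3_value hS (hX.V1 i) (hX.V2 i) hε (fun ε h1 h2 => hV ε h1 h2 i)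
    (Z := {y : ℝ × ℝ | y.2 ∈ S}) (fun y => (y.1, 0, y.2)) fun y hy => ⟨self_mem_Iic, hy⟩
  have k := exp3_profile hS hX.phi1 hX.phi2 hε hφ (Z := {y : ℝ × ℝ | y.2 ∈ S}) id fun y hy => hy
  have kx := k (1, 0)
  have kt := ((kx.const_mul (-p.lam)).congr (fun _ => rfl) (fun _ => mul_zero _) (fun _ => rfl)
    (fun _ => rfl)).add (Exp3.self.mul_small he (k (0, 1)))
  fin_cases j
  · exact (kt.sub ((u 1).sub (kx.mul he (u 0)))).congr
      (fun q => by simp [jumpRes, pTh, pTa]; ring) (fun q => by simp [Params.U0])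
      (fun q => by simp [Terms.jump1, pTh, Params.U0])
      (fun q => by simp [Terms.jump2, pTh, pTa, Params.U0]; ring)
  · exact ((u 4).sub (((((w 0).mul he (w 0)).add ((w 1).mul he (w 1))).sub
      ((w 2).mul he (w 2))).const_mul (1 / 2))).congr
      (fun q => by simp [jumpRes]; ring) (fun q => by simp [Params.U0, Params.V0]; ring)
      (fun q => by simp [Terms.jump1, Params.V0]; ring)
      (fun q => by simp [Terms.jump2, Params.V0]; ring)
  · exact ((u 3).sub (kx.mul he (u 2))).congr
      (fun q => by simp [jumpRes, pTh]) (fun q => by simp [Params.U0])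
      (fun q => by simp [Terms.jump1, pTh, Params.U0])
      (fun q => by simp [Terms.jump2, pTh, Params.U0]; ring)
  · exact ((w 1).sub (kx.mul he (w 0))).congr
      (fun q => by simp [jumpRes, pTh]) (fun q => by simp [Params.V0])
      (fun q => by simp [Terms.jump1, pTh, Params.V0])
      (fun q => by simp [Terms.jump2, pTh, Params.V0]; ring)
  · exact ((w 2).sub ((kt.mul he (w 0)).const_mul p.nu)).congr
      (fun q => by simp [jumpRes, pTh, pTa]; ring) (fun q => by simp [Params.V0])
      (fun q => by simp [Terms.jump1, pTh, Params.V0]; ring)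
      (fun q => by simp [Terms.jump2, pTh, pTa, Params.V0]; ring)

end Residual

end

/-! ### Comparison of powers of `ε` -/

section
open Asymptotics

/-- Divide by `ε` and let `ε` tend to zero; then do the same with `ε²`. -/
lemma eq_zero_of_expansion {a b C ε₀ : ℝ} (hε : 0 < ε₀)
    (h : ∀ ε, 0 < ε → ε < ε₀ → |ε * a + ε ^ 2 * b| ≤ C * ε ^ 3) : a = 0 ∧ b = 0 := by
  have ha : a = 0 := by
    have h1 : Tendsto (fun ε : ℝ => a + ε * b) (𝓝[>] 0) (𝓝 (a + 0 * b)) :=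
      ((continuous_const.add (continuous_id.mul continuous_const)).tendsto 0).mono_left
        nhdsWithin_le_nhds
    have h2 : Tendsto (fun ε : ℝ => C * ε ^ 2) (𝓝[>] 0) (𝓝 (C * 0 ^ 2)) :=
      ((continuous_const.mul (continuous_id.pow 2)).tendsto 0).mono_left nhdsWithin_le_nhds
    have h3 := le_of_tendsto_of_tendsto h1.abs h2 (by
      filter_upwards [Ioo_mem_nhdsGT hε] with ε h4
      have := h ε h4.1 h4.2
      rw [show ε * a + ε ^ 2 * b = ε * (a + ε * b) by ring, abs_mul, abs_of_pos h4.1] at this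
      nlinarith [h4.1])
    norm_num at h3
    exact h3
  refine ⟨ha, ?_⟩
  subst ha
  have h2 : Tendsto (fun ε : ℝ => C * ε) (𝓝[>] 0) (𝓝 (C * 0)) :=
    ((continuous_const.mul continuous_id).tendsto 0).mono_left nhdsWithin_le_nhds
  have h3 := le_of_tendsto_of_tendsto tendsto_const_nhds h2 (by
    filter_upwards [Ioo_mem_nhdsGT hε] with ε h4
    have := h ε h4.1 h4.2
    have h5 : 0 < ε ^ 2 := pow_pos h4.1 2
    rw [mul_zero, zero_add, abs_mul, abs_of_pos h5] at this
    show |b| ≤ C * ε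
    nlinarith)
  norm_num at h3
  exact h3

lemma Exp3.eq_zero {P : Type*} {Z : Set P} {F : ℝ → P → ℝ} {a b : P → ℝ} {C ε₀ : ℝ} (hε : 0 < ε₀)
    (h : Exp3 (𝓝[>] (0 : ℝ) ×ˢ 𝓟 Z) Prod.fst (fun q => F q.1 q.2) (fun _ => 0) (fun q => a q.2)
      (fun q => b q.2))
    (h0 : ∀ ε, 0 < ε → ε < ε₀ → ∀ z ∈ Z, |F ε z| ≤ C * ε ^ 3) {z : P} (hz : z ∈ Z) :
    a z = 0 ∧ b z = 0 := by
  obtain ⟨C', -, ε₁, h1, h2⟩ := bound_of_isBigO (F := fun ε z => F ε z - (0 + ε * a z + ε ^ 2 * b z))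
    h.rem
  refine eq_zero_of_expansion (C := C + C') (lt_min hε h1) fun ε h3 h4 => ?_
  have e1 := h0 ε h3 (h4.trans_le (min_le_left _ _)) z hz
  have e2 := h2 ε h3 (h4.trans_le (min_le_right _ _)) z hz
  have : ε * a z + ε ^ 2 * b z = F ε z - (F ε z - (0 + ε * a z + ε ^ 2 * b z)) := by ring
  rw [this]
  exact (abs_sub _ _).trans (by linarith)

lemma Exp3.bound_of_zero {P : Type*} {Z : Set P} {F : ℝ → P → ℝ} {a b : P → ℝ}
    (h : Exp3 (𝓝[>] (0 : ℝ) ×ˢ 𝓟 Z) Prod.fst (fun q => F q.1 q.2) (fun _ => 0) (fun q => a q.2)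
      (fun q => b q.2)) (ha : ∀ z ∈ Z, a z = 0) (hb : ∀ z ∈ Z, b z = 0) :
    ∃ C, 0 ≤ C ∧ ∃ ε₀ > 0, ∀ ε, 0 < ε → ε < ε₀ → ∀ z ∈ Z, |F ε z| ≤ C * ε ^ 3 := by
  obtain ⟨C', h', ε₁, h1, h2⟩ := bound_of_isBigO
    (F := fun ε z => F ε z - (0 + ε * a z + ε ^ 2 * b z)) h.rem
  refine ⟨C', h', ε₁, h1, fun ε h3 h4 z hz => ?_⟩
  have := h2 ε h3 h4 z hz
  rwa [ha z hz, hb z hz, mul_zero, mul_zero, add_zero, add_zero, sub_zero] at this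

/-- Nonnegative constants are summed and thresholds intersected; monotonicity in the constant makes
the sum admissible for each index. -/
lemma exists_uniform {n : ℕ} {P : Fin n → ℝ → ℝ → Prop}
    (hP : ∀ i C C' ε, 0 < ε → C ≤ C' → P i C ε → P i C' ε)
    (h : ∀ i, ∃ C, 0 ≤ C ∧ ∃ ε₀ > 0, ∀ ε, 0 < ε → ε < ε₀ → P i C ε) :
    ∃ C, 0 ≤ C ∧ ∃ ε₀ > 0, ∀ ε, 0 < ε → ε < ε₀ → ∀ i, P i C ε := by
  choose C hC ε₀ h0 h using h
  refine ⟨∑ i, C i, Finset.sum_nonneg fun i _ => hC i, ?_⟩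
  have : ∀ᶠ ε in 𝓝[>] (0 : ℝ), ∀ i, ε < ε₀ i :=
    eventually_all.2 fun i => Filter.mem_of_superset (Ioo_mem_nhdsGT (h0 i)) fun ε h => h.2
  obtain ⟨ε₁, h1, h2⟩ := mem_nhdsGT_iff_exists_Ioo_subset.1 this
  refine ⟨ε₁, h1, fun ε h3 h4 i => hP i (C i) _ ε h3 ?_ (h i ε h3 (h2 ⟨h3, h4⟩ i))⟩
  exact Finset.single_le_sum (f := C) (fun i _ => hC i) (Finset.mem_univ i)

/-- All terms up to the second order of the equations vanish. -/
structure Terms.Vanish (X : Terms) (p : Params) (S : Set ℝ) : Prop where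
  plasma : ∀ z : ℝ × ℝ × ℝ, 0 < z.2.1 → z.2.2 ∈ S → X.plasma1 p z = 0 ∧ X.plasma2 p z = 0
  vacuum : ∀ z : ℝ × ℝ × ℝ, z.2.1 < 0 → z.2.2 ∈ S → X.vacuum1 p z = 0 ∧ X.vacuum2 p z = 0
  jump : ∀ y : ℝ × ℝ, y.2 ∈ S → X.jump1 p y = 0 ∧ X.jump2 p y = 0

section Main
variable {p : Params} {S : Set ℝ} {X : Terms}

/-- A straightened point `(θ, η, τ)` is kept fixed. For each `ε` it is the image of a physical point
at time `τ/ε`, where the equations hold up to `Kε³`; the coefficients of `ε` and `ε²` at the fixed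
point must then vanish. -/
lemma vanish_of_solves (hS : IsOpen S) (hX : X.Regular S) {U : ℝ → Fin 5 → ℝ × ℝ × ℝ → ℝ}
    {V : ℝ → Fin 3 → ℝ × ℝ × ℝ → ℝ} {φ : ℝ → ℝ × ℝ → ℝ} (hE : HasExpansion p S U V φ X)
    (hs : SolvesAsymptotically p S U V φ) : X.Vanish p S := by
  obtain ⟨C, ε₁, h1, hE⟩ := hE
  obtain ⟨K, ε₂, h2, hs⟩ := hs
  set ε₀ := min ε₁ ε₂
  have h0 : 0 < ε₀ := lt_min h1 h2
  have hU : ∀ ε, 0 < ε → ε < ε₀ → ∀ i, C1Small {z : ℝ × ℝ × ℝ | z.2.1 ∈ Ici (0 : ℝ) ∧ z.2.2 ∈ S}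
      (C * ε ^ 3) (fun z => U ε i z - X.truncU p ε i z) :=
    fun ε h3 h4 => (hE ε h3 (h4.trans_le (min_le_left _ _))).1
  have hV : ∀ ε, 0 < ε → ε < ε₀ → ∀ i, C1Small {z : ℝ × ℝ × ℝ | z.2.1 ∈ Iic (0 : ℝ) ∧ z.2.2 ∈ S}
      (C * ε ^ 3) (fun z => V ε i z - X.truncV p ε i z) :=
    fun ε h3 h4 => (hE ε h3 (h4.trans_le (min_le_left _ _))).2.1
  have hφ : ∀ ε, 0 < ε → ε < ε₀ → C1Small {z : ℝ × ℝ | z.2 ∈ S}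
      (C * ε ^ 2) (fun z => φ ε z - X.truncPhi ε z) :=
    fun ε h3 h4 => (hE ε h3 (h4.trans_le (min_le_left _ _))).2.2
  have hs' := fun ε h3 h4 => hs ε h3 (lt_of_lt_of_le h4 (min_le_right ε₁ ε₂))
  -- The physical point lying over `z`.
  have hst : ∀ ε, 0 < ε → ∀ z : ℝ × ℝ × ℝ,
      straight p.lam ε (φ ε) (z.2.2 / ε, z.1 + p.lam * (z.2.2 / ε),
        z.2.1 + ε * φ ε (z.1, z.2.2)) = z := by
    intro ε h z
    have e : ε * (z.2.2 / ε) = z.2.2 := by field_simp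
    simp [straight, e]
  have eτ : ∀ ε, 0 < ε → ∀ τ : ℝ, ε * (τ / ε) = τ := fun ε h τ => by field_simp
  refine ⟨fun z hη hτ => ?_, fun z hη hτ => ?_, fun y hy => ?_⟩
  · have hz : z.2.1 ∈ interior (Ici (0 : ℝ)) := by rwa [interior_Ici]
    have key := fun j => (exp3_plasmaRes (p := p) hS hX h0 hU hφ j).eq_zero
      (Z := {z : ℝ × ℝ × ℝ | z.2.1 ∈ interior (Ici (0 : ℝ)) ∧ z.2.2 ∈ S})
      (a := fun z => X.plasma1 p z j) (b := fun z => X.plasma2 p z j)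
      (F := fun ε z => plasmaRes p ε (φ ε) (U ε) z j) (C := K) h0 (fun ε h3 h4 z hz => by
        have hS' := hs' ε h3 h4
        have := hS'.plasma_eq (z.2.2 / ε, z.1 + p.lam * (z.2.2 / ε), z.2.1 + ε * φ ε (z.1, z.2.2))
          (by show ε * (z.2.2 / ε) ∈ S; rw [eτ ε h3]; exact hz.2)
          (by
            have := hz.1
            rw [interior_Ici] at this
            simpa [interface, eτ ε h3] using this) j
        rw [mhd_toPhysical, hst ε h3] at this
        · exact this
        · refine (differentiableAt_profile_of_expansion hS hX.phi1 hX.phi2 (hφ ε h3 h4) ?_).1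
          show ε * (z.2.2 / ε) ∈ S; rw [eτ ε h3]; exact hz.2
        · intro i
          rw [hst ε h3]
          exact (differentiableAt_of_expansion hS (hX.U1 i) (hX.U2 i) (hU ε h3 h4 i) hz.1 hz.2).1)
      (z := z) ⟨hz, hτ⟩
    exact ⟨funext fun j => (key j).1, funext fun j => (key j).2⟩
  · have hz : z.2.1 ∈ interior (Iic (0 : ℝ)) := by rwa [interior_Iic]
    have key := fun j => (exp3_vacuumRes (p := p) hS hX h0 hV hφ j).eq_zero
      (Z := {z : ℝ × ℝ × ℝ | z.2.1 ∈ interior (Iic (0 : ℝ)) ∧ z.2.2 ∈ S})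
      (a := fun z => X.vacuum1 p z j) (b := fun z => X.vacuum2 p z j)
      (F := fun ε z => vacuumRes p ε (φ ε) (V ε) z j) (C := K) h0 (fun ε h3 h4 z hz => by
        have hS' := hs' ε h3 h4
        have := hS'.vacuum_eq (z.2.2 / ε, z.1 + p.lam * (z.2.2 / ε), z.2.1 + ε * φ ε (z.1, z.2.2))
          (by show ε * (z.2.2 / ε) ∈ S; rw [eτ ε h3]; exact hz.2)
          (by
            have := hz.1
            rw [interior_Iic] at this
            simpa [interface, eτ ε h3] using this) j
        rw [maxwell_toPhysical, hst ε h3] at this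
        · exact this
        · refine (differentiableAt_profile_of_expansion hS hX.phi1 hX.phi2 (hφ ε h3 h4) ?_).1
          show ε * (z.2.2 / ε) ∈ S; rw [eτ ε h3]; exact hz.2
        · intro i
          rw [hst ε h3]
          exact (differentiableAt_of_expansion hS (hX.V1 i) (hX.V2 i) (hV ε h3 h4 i) hz.1 hz.2).1)
      (z := z) ⟨hz, hτ⟩
    exact ⟨funext fun j => (key j).1, funext fun j => (key j).2⟩
  · have key := fun j => (exp3_jumpRes (p := p) hS hX h0 hU hV hφ j).eq_zero
      (Z := {y : ℝ × ℝ | y.2 ∈ S}) (a := fun z => X.jump1 p z j)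
      (b := fun z => X.jump2 p z j)
      (F := fun ε z => jumpRes p ε (φ ε) (U ε) (V ε) z j) (C := K) h0 (fun ε h3 h4 y hy => by
        have hS' := hs' ε h3 h4
        have := hS'.interface_eq (y.2 / ε, y.1 + p.lam * (y.2 / ε))
          (by show ε * (y.2 / ε) ∈ S; rw [eτ ε h3]; exact hy) j
        rw [jump_toPhysical] at this
        · simpa [eτ ε h3] using this
        · refine (differentiableAt_profile_of_expansion hS hX.phi1 hX.phi2 (hφ ε h3 h4) ?_).1
          show ε * (y.2 / ε) ∈ S; rw [eτ ε h3]; exact hy)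
      (z := y) hy
    exact ⟨funext fun j => (key j).1, funext fun j => (key j).2⟩

lemma c1Small_sub_self {E : Type*} [NormedAddCommGroup E] [NormedSpace ℝ E] (D : Set E) (f : E → ℝ)
    {δ : ℝ} (hδ : 0 ≤ δ) : C1Small D δ (fun z => f z - f z) := by
  simp only [sub_self]
  exact ⟨fun z _ => by simpa using hδ, fun z _ => ⟨differentiableAt_const _, by simpa using hδ⟩⟩

/-- The truncated sums are their own expansions with zero remainder, so the residuals consist of the
two vanishing orders and an error `O(ε³)`. The limits as `x₂ → ±∞` come from the decay of the
transforms. -/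
lemma solves_of_vanish (hS : IsOpen S) (hX : X.Regular S) (hv : X.Vanish p S)
    (hU1 : ∀ i, ∀ τ ∈ S, ∀ᵐ k : ℝ, Tendsto (fun η => X.U1h i k η τ) atTop (𝓝 0))
    (hU2 : ∀ i, ∀ τ ∈ S, ∀ᵐ k : ℝ, Tendsto (fun η => X.U2h i k η τ) atTop (𝓝 0))
    (hV1 : ∀ i, ∀ τ ∈ S, ∀ᵐ k : ℝ, Tendsto (fun η => X.V1h i k η τ) atBot (𝓝 0))
    (hV2 : ∀ i, ∀ τ ∈ S, ∀ᵐ k : ℝ, Tendsto (fun η => X.V2h i k η τ) atBot (𝓝 0)) :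
    SolvesAsymptotically p S (X.truncU p) (X.truncV p) X.truncPhi := by
  have hU : ∀ ε : ℝ, 0 < ε → ε < 1 → ∀ i,
      C1Small {z : ℝ × ℝ × ℝ | z.2.1 ∈ Ici (0 : ℝ) ∧ z.2.2 ∈ S}
      (0 * ε ^ 3) (fun z => X.truncU p ε i z - X.truncU p ε i z) :=
    fun ε h3 h4 i => c1Small_sub_self _ _ (by rw [zero_mul])
  have hV : ∀ ε : ℝ, 0 < ε → ε < 1 → ∀ i,
      C1Small {z : ℝ × ℝ × ℝ | z.2.1 ∈ Iic (0 : ℝ) ∧ z.2.2 ∈ S}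
      (0 * ε ^ 3) (fun z => X.truncV p ε i z - X.truncV p ε i z) :=
    fun ε h3 h4 i => c1Small_sub_self _ _ (by rw [zero_mul])
  have hφ : ∀ ε : ℝ, 0 < ε → ε < 1 → C1Small {z : ℝ × ℝ | z.2 ∈ S}
      (0 * ε ^ 2) (fun z => X.truncPhi ε z - X.truncPhi ε z) :=
    fun ε h3 h4 => c1Small_sub_self _ _ (by rw [zero_mul])
  have mono : ∀ {r C C' ε : ℝ}, 0 < ε → C ≤ C' → r ≤ C * ε ^ 3 → r ≤ C' * ε ^ 3 :=
    fun h1 h2 h3 => h3.trans (mul_le_mul_of_nonneg_right h2 (pow_pos h1 3).le)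
  obtain ⟨C₁, c₁, ε₁, e₁, b₁⟩ := exists_uniform
    (P := fun j C ε => ∀ z ∈ {z : ℝ × ℝ × ℝ | z.2.1 ∈ interior (Ici (0 : ℝ)) ∧ z.2.2 ∈ S},
      |plasmaRes p ε (X.truncPhi ε) (X.truncU p ε) z j| ≤ C * ε ^ 3)
    (fun j C C' ε h1 h2 h3 z hz => mono h1 h2 (h3 z hz))
    (fun j => Exp3.bound_of_zero (a := fun z => X.plasma1 p z j)
      (b := fun z => X.plasma2 p z j) (exp3_plasmaRes (p := p) hS hX one_pos hU hφ j)
      (fun z hz => congrFun (hv.plasma z (by simpa using hz.1) hz.2).1 j)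
      (fun z hz => congrFun (hv.plasma z (by simpa using hz.1) hz.2).2 j))
  obtain ⟨C₂, c₂, ε₂, e₂, b₂⟩ := exists_uniform
    (P := fun j C ε => ∀ z ∈ {z : ℝ × ℝ × ℝ | z.2.1 ∈ interior (Iic (0 : ℝ)) ∧ z.2.2 ∈ S},
      |vacuumRes p ε (X.truncPhi ε) (X.truncV p ε) z j| ≤ C * ε ^ 3)
    (fun j C C' ε h1 h2 h3 z hz => mono h1 h2 (h3 z hz))
    (fun j => Exp3.bound_of_zero (a := fun z => X.vacuum1 p z j)
      (b := fun z => X.vacuum2 p z j) (exp3_vacuumRes (p := p) hS hX one_pos hV hφ j)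
      (fun z hz => congrFun (hv.vacuum z (by simpa using hz.1) hz.2).1 j)
      (fun z hz => congrFun (hv.vacuum z (by simpa using hz.1) hz.2).2 j))
  obtain ⟨C₃, c₃, ε₃, e₃, b₃⟩ := exists_uniform
    (P := fun j C ε => ∀ z ∈ {y : ℝ × ℝ | y.2 ∈ S},
      |jumpRes p ε (X.truncPhi ε) (X.truncU p ε) (X.truncV p ε) z j| ≤ C * ε ^ 3)
    (fun j C C' ε h1 h2 h3 z hz => mono h1 h2 (h3 z hz))
    (fun j => Exp3.bound_of_zero (a := fun z => X.jump1 p z j)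
      (b := fun z => X.jump2 p z j) (exp3_jumpRes (p := p) hS hX one_pos hU hV hφ j)
      (fun z hz => congrFun (hv.jump z hz).1 j) (fun z hz => congrFun (hv.jump z hz).2 j))
  refine ⟨C₁ + C₂ + C₃, min 1 (min ε₁ (min ε₂ ε₃)), by positivity, fun ε h1 h2 => ?_⟩
  obtain ⟨h3, h4, h5, h6⟩ : ε < 1 ∧ ε < ε₁ ∧ ε < ε₂ ∧ ε < ε₃ := by
    simpa [lt_min_iff] using h2
  have dφ : ∀ y : ℝ × ℝ, y.2 ∈ S → DifferentiableAt ℝ (X.truncPhi ε) y := fun y hy =>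
    (differentiableAt_profile_of_expansion hS hX.phi1 hX.phi2 (hφ ε h1 h3) hy).1
  have dU : ∀ i (z : ℝ × ℝ × ℝ), 0 < z.2.1 → z.2.2 ∈ S → DifferentiableAt ℝ (X.truncU p ε i) z :=
    fun i z hz hτ => (differentiableAt_of_expansion hS (hX.U1 i) (hX.U2 i) (hU ε h1 h3 i)
      (by rwa [interior_Ici]) hτ).1
  have dV : ∀ i (z : ℝ × ℝ × ℝ), z.2.1 < 0 → z.2.2 ∈ S → DifferentiableAt ℝ (X.truncV p ε i) z :=
    fun i z hz hτ => (differentiableAt_of_expansion hS (hX.V1 i) (hX.V2 i) (hV ε h1 h3 i)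
      (by rwa [interior_Iic]) hτ).1
  have cφ : ContinuousOn (X.truncPhi ε) {y | y.2 ∈ S} := fun y hy =>
    (dφ y hy).continuousAt.continuousWithinAt
  have cst : ContinuousOn (straight p.lam ε (X.truncPhi ε)) {x | ε * x.1 ∈ S} := by
    have : ContinuousOn (fun x : ℝ × ℝ × ℝ => X.truncPhi ε (x.2.1 - p.lam * x.1, ε * x.1))
        {x | ε * x.1 ∈ S} := cφ.comp (Continuous.continuousOn (by fun_prop)) fun x hx => hx
    unfold straight
    fun_prop
  have lim : ∀ {t x₁ : ℝ}, Tendsto (fun x₂ : ℝ => x₂ - ε * X.truncPhi ε (x₁ - p.lam * t, ε * t))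
      atTop atTop ∧ Tendsto (fun x₂ : ℝ => x₂ - ε * X.truncPhi ε (x₁ - p.lam * t, ε * t))
      atBot atBot := by
    intro t x₁
    simp only [sub_eq_add_neg (G := ℝ) _ (ε * X.truncPhi ε _)]
    exact ⟨tendsto_atTop_add_const_right _ _ tendsto_id, tendsto_atBot_add_const_right _ _ tendsto_id⟩
  have le₁ : C₁ ≤ C₁ + C₂ + C₃ := by linarith
  have le₂ : C₂ ≤ C₁ + C₂ + C₃ := by linarith
  have le₃ : C₃ ≤ C₁ + C₂ + C₃ := by linarith
  refine ⟨?_, ?_, ?_, ?_, ?_, ?_, ?_, ?_, ?_, ?_⟩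
  · intro y hy
    exact (hasFDerivAt_interface (dφ _ hy)).1.differentiableWithinAt
  · intro i
    have hc : ContinuousOn (X.truncU p ε i) {z | z.2.1 ∈ Ici (0 : ℝ) ∧ z.2.2 ∈ S} :=
      (continuousOn_const.add (continuousOn_const.mul (hX.U1 i).continuousOn)).add
        (continuousOn_const.mul (hX.U2 i).continuousOn)
    exact hc.comp (cst.mono fun x hx => hx.1) fun x hx => ⟨sub_nonneg.2 hx.2, hx.1⟩
  · intro i x hx
    exact (differentiableAt_toPhysical (dφ _ hx.1) (dU i _ (sub_pos.2 hx.2) hx.1)).differentiableWithinAt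
  · intro i
    have hc : ContinuousOn (X.truncV p ε i) {z | z.2.1 ∈ Iic (0 : ℝ) ∧ z.2.2 ∈ S} :=
      (continuousOn_const.add (continuousOn_const.mul (hX.V1 i).continuousOn)).add
        (continuousOn_const.mul (hX.V2 i).continuousOn)
    exact hc.comp (cst.mono fun x hx => hx.1) fun x hx => ⟨sub_nonpos.2 hx.2, hx.1⟩
  · intro i x hx
    exact (differentiableAt_toPhysical (dφ _ hx.1) (dV i _ (sub_neg.2 hx.2) hx.1)).differentiableWithinAt
  · intro x hx hx2 j
    rw [mhd_toPhysical (dφ _ hx) fun i => dU i _ (sub_pos.2 hx2) hx]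
    exact mono h1 le₁ (b₁ ε h1 h4 j _ ⟨by rw [interior_Ici]; exact sub_pos.2 hx2, hx⟩)
  · intro x hx hx2 j
    rw [maxwell_toPhysical (dφ _ hx) fun i => dV i _ (sub_neg.2 hx2) hx]
    exact mono h1 le₂ (b₂ ε h1 h5 j _ ⟨by rw [interior_Iic]; exact sub_neg.2 hx2, hx⟩)
  · intro y hy j
    rw [jump_toPhysical (dφ _ hy)]
    exact mono h1 le₃ (b₃ ε h1 h6 j _ hy)
  · intro i t ht x₁
    have a1 := (hX.U1 i).tendsto_zero (l := atTop) (eventually_ge_atTop 0) ht (hU1 i _ ht)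
      (x₁ - p.lam * t)
    have a2 := (hX.U2 i).tendsto_zero (l := atTop) (eventually_ge_atTop 0) ht (hU2 i _ ht)
      (x₁ - p.lam * t)
    have := ((tendsto_const_nhds (x := p.U0 i)).add (a1.const_mul ε)).add (a2.const_mul (ε ^ 2))
    rw [mul_zero, mul_zero, add_zero, add_zero] at this
    exact this.comp lim.1
  · intro i t ht x₁
    have a1 := (hX.V1 i).tendsto_zero (l := atBot) (eventually_le_atBot 0) ht (hV1 i _ ht)
      (x₁ - p.lam * t)
    have a2 := (hX.V2 i).tendsto_zero (l := atBot) (eventually_le_atBot 0) ht (hV2 i _ ht)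
      (x₁ - p.lam * t)
    have := ((tendsto_const_nhds (x := p.V0 i)).add (a1.const_mul ε)).add (a2.const_mul (ε ^ 2))
    rw [mul_zero, mul_zero, add_zero, add_zero] at this
    exact this.comp lim.2

end Main

end

/-! ## Uniqueness for the linearized problems -/

/-- The exceptional null set is made independent of `η`: the rational values of `η` share one null
set, and continuity reaches the others. Only then can differential equations in `η` be used at a
fixed frequency. -/
lemma ae_forall_of_forall_ae {G : ℝ → ℝ → ℂ} {O : Set ℝ} (hO : IsOpen O)
    (hc : ∀ᵐ k : ℝ, ContinuousOn (G k) O) (h : ∀ η ∈ O, ∀ᵐ k : ℝ, G k η = 0) :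
    ∀ᵐ k : ℝ, ∀ η ∈ O, G k η = 0 := by
  have h1 : ∀ᵐ k : ℝ, ∀ r : ℚ, (r : ℝ) ∈ O → G k r = 0 := by
    refine ae_all_iff.2 fun r => ?_
    by_cases hr : (r : ℝ) ∈ O
    · filter_upwards [h r hr] with k hk _ using hk
    · exact ae_of_all _ fun k h' => absurd h' hr
  filter_upwards [hc, h1] with k h2 h3 η hη
  by_contra hne
  have h4 : ∀ᶠ y in 𝓝 η, y ∈ O ∧ G k y ≠ 0 :=
    (hO.eventually_mem hη).and ((h2.continuousAt (hO.mem_nhds hη)).eventually_ne hne)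
  obtain ⟨V, hV, hVo, hηV⟩ := eventually_nhds_iff.1 h4
  obtain ⟨r, hr⟩ := Rat.denseRange_cast.exists_mem_open hVo ⟨η, hηV⟩
  exact (hV _ hr).2 (h3 r (hV _ hr).1)

/-- Derivatives exist only for `η > 0`; the boundary value is reached by continuity. -/
lemma eq_of_deriv_eq_zero {f : ℝ → ℂ} (hc : ContinuousOn f (Ici 0))
    (hd : ∀ η, 0 < η → HasDerivAt f 0 η) {η : ℝ} (hη : 0 ≤ η) : f η = f 0 := by
  rcases hη.eq_or_lt with rfl | hη
  · rfl
  have h1 : ∀ y, 0 < y → f y = f η := fun y hy =>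
    isOpen_Ioi.is_const_of_deriv_eq_zero isPreconnected_Ioi
      (fun z hz => (hd z hz).differentiableAt.differentiableWithinAt) (fun z hz => (hd z hz).deriv)
      hy hη
  have h2 : Tendsto f (𝓝[>] 0) (𝓝 (f 0)) := (hc 0 self_mem_Ici).mono Ioi_subset_Ici_self
  have h3 : Tendsto f (𝓝[>] 0) (𝓝 (f η)) := by
    refine tendsto_const_nhds.congr' ?_
    filter_upwards [self_mem_nhdsWithin] with y hy using (h1 y hy).symm
  exact tendsto_nhds_unique h3 h2

/-- Bounded solutions of `x' = iμy`, `y' = -iμx` with `y(0) = 0` vanish. -/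
lemma eq_zero_of_ode {x y : ℝ → ℂ} {μ C : ℝ} (hμ : μ ≠ 0) (hx : ContinuousOn x (Ici 0))
    (hy : ContinuousOn y (Ici 0)) (hx' : ∀ η, 0 < η → HasDerivAt x (I * μ * y η) η)
    (hy' : ∀ η, 0 < η → HasDerivAt y (-(I * μ * x η)) η) (h0 : y 0 = 0)
    (hb : ∀ η, 0 ≤ η → ‖x η‖ ≤ C ∧ ‖y η‖ ≤ C) {η : ℝ} (hη : 0 ≤ η) : x η = 0 ∧ y η = 0 := by
  have hexp : ∀ (c η : ℝ), HasDerivAt (fun η : ℝ => exp ((c * η : ℝ) : ℂ))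
      (exp ((c * η : ℝ) : ℂ) * ((c * 1 : ℝ) : ℂ)) η := fun c η =>
    (((hasDerivAt_id η).const_mul c).ofReal_comp).cexp
  have hce : ∀ c : ℝ, Continuous fun η : ℝ => exp ((c * η : ℝ) : ℂ) := fun c => by fun_prop
  -- The combinations `x + iy` and `x - iy` diagonalize the system with exponents `μ` and `-μ`, so
  -- the two products below are constant.
  have u := fun η (hη : 0 ≤ η) => eq_of_deriv_eq_zero (f := fun η => (x η + I * y η)
      * exp ((-μ * η : ℝ) : ℂ)) ((hx.add (continuousOn_const.mul hy)).mul (hce _).continuousOn)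
    (fun η hη => (((hx' η hη).add ((hy' η hη).const_mul I)).mul (hexp (-μ) η)).congr_deriv (by
      simp only [Pi.add_apply]
      push_cast; linear_combination (-(μ : ℂ) * x η * exp (-μ * η)) * Complex.I_sq)) hη
  have v := fun η (hη : 0 ≤ η) => eq_of_deriv_eq_zero (f := fun η => (x η - I * y η)
      * exp ((μ * η : ℝ) : ℂ)) ((hx.sub (continuousOn_const.mul hy)).mul (hce _).continuousOn)
    (fun η hη => (((hx' η hη).sub ((hy' η hη).const_mul I)).mul (hexp μ η)).congr_deriv (by
      simp only [Pi.sub_apply]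
      push_cast; linear_combination ((μ : ℂ) * x η * exp (μ * η)) * Complex.I_sq)) hη
  simp only [h0, mul_zero, Complex.ofReal_zero, Complex.exp_zero, mul_one, add_zero, sub_zero] at u v
  -- Since `y 0 = 0`, both constants equal `x 0`. One of the two combinations grows exponentially
  -- unless this value is zero.
  have hx0 : x 0 = 0 := by
    have lim : Tendsto (fun η : ℝ => (C + C) * Real.exp (-|μ| * η)) atTop (𝓝 0) := by
      have : Tendsto (fun η : ℝ => -|μ| * η) atTop atBot :=
        tendsto_id.const_mul_atTop_of_neg (neg_neg_of_pos (abs_pos.2 hμ))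
      simpa using (Real.tendsto_exp_atBot.comp this).const_mul (C + C)
    rw [← norm_le_zero_iff]
    refine ge_of_tendsto lim ?_
    filter_upwards [eventually_ge_atTop 0] with η hη
    obtain ⟨b1, b2⟩ := hb η hη
    have hI : ‖I * y η‖ ≤ C := by rwa [norm_mul, Complex.norm_I, one_mul]
    rcases lt_or_gt_of_ne hμ with h | h
    · rw [← v η hη, norm_mul, Complex.norm_exp_ofReal, abs_of_neg h, neg_neg]
      gcongr
      exact (norm_sub_le _ _).trans (add_le_add b1 hI)
    · rw [← u η hη, norm_mul, Complex.norm_exp_ofReal, abs_of_pos h]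
      gcongr
      exact (norm_add_le _ _).trans (add_le_add b1 hI)
  have u' := u η hη
  have v' := v η hη
  rw [hx0] at u' v'
  have u'' := (mul_eq_zero.1 u').resolve_right (Complex.exp_ne_zero _)
  have v'' := (mul_eq_zero.1 v').resolve_right (Complex.exp_ne_zero _)
  have h1 : x η = 0 := by linear_combination (u'' + v'') / 2
  refine ⟨h1, ?_⟩
  rw [h1, zero_add] at u''
  exact (mul_eq_zero.1 u'').resolve_left Complex.I_ne_zero

section Transform
variable {n : ℕ} {D S : Set ℝ} {f : Fin n → ℝ × ℝ × ℝ → ℝ} {fh : Fin n → ℝ → ℝ → ℝ → ℂ}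

lemma IsWaveField.sub {f g : ℝ × ℝ × ℝ → ℝ} {fh gh : ℝ → ℝ → ℝ → ℂ} (hf : IsWaveField D S f fh)
    (hg : IsWaveField D S g gh) (hS : IsOpen S) :
    IsWaveField D S (fun z => f z - g z) (fun k η τ => fh k η τ - gh k η τ) := by
  have := hf.add (hg.const_mul (-1)) hS
  simpa [sub_eq_add_neg] using this

lemma IsWaveField.ae_eq_zero {f : ℝ × ℝ × ℝ → ℝ} {fh : ℝ → ℝ → ℝ → ℂ} (hf : IsWaveField D S f fh)
    {η τ : ℝ} (hη : η ∈ D) (hτ : τ ∈ S) (h : ∀ θ, f (θ, η, τ) = 0) : ∀ᵐ k : ℝ, fh k η τ = 0 :=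
  ae_eq_zero_of_fourier (hf.integrable hη hτ) fun θ => by
    rw [← hf.repr θ η hη τ hτ, h θ, Complex.ofReal_zero]

/-- Linear differential relations between fields, in terms of transforms. -/
lemma ae_linear_relation (hS : IsOpen S) (hf : ∀ i, IsWaveField D S (f i) (fh i)) (α β : Fin n → ℝ)
    {τ : ℝ} (hτ : τ ∈ S)
    (h : ∀ θ, ∀ η ∈ interior D, ∑ i, (α i * dTh (f i) (θ, η, τ) + β i * dEt (f i) (θ, η, τ)) = 0) :
    ∀ᵐ k : ℝ, ∀ η ∈ interior D,
      ∑ i, (α i * (I * k * fh i k η τ) + β i * deriv (fun y => fh i k y τ) η) = 0 := by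
  refine ae_forall_of_forall_ae isOpen_interior ?_ fun η hη => ?_
  · filter_upwards [ae_all_iff.2 fun i => (hf i).smooth] with k hk
    refine continuousOn_finsetSum _ fun i _ => ?_
    have hline : ContDiffOn ℝ 1 (fun y => fh i k y τ) (interior D) :=
      (hk i).comp (contDiff_id.prodMk contDiff_const).contDiffOn fun y hy => ⟨hy, hτ⟩
    exact (continuousOn_const.mul (continuousOn_const.mul hline.continuousOn)).add
      (continuousOn_const.mul (hline.continuousOn_deriv_of_isOpen isOpen_interior le_rfl))
  · have i1 := fun i => (hf i).integrable_mul (interior_subset hη) hτ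
    have i2 := fun i => (hf i).integrable_deriv_fst hS hη hτ
    refine ae_eq_zero_of_fourier (integrable_finsetSum _ fun i _ =>
      ((i1 i).const_mul _).add ((i2 i).const_mul _)) fun θ => ?_
    have key := congrArg (fun r : ℝ => (r : ℂ)) (h θ η hη)
    simp only [Complex.ofReal_sum, Complex.ofReal_add, Complex.ofReal_mul, Complex.ofReal_zero] at key
    have j1 : ∀ i, Integrable fun k : ℝ => I * k * fh i k η τ * exp (I * k * θ) := fun i =>
      (i1 i).mul_bdd (c := 1) (by fun_prop) (by simp [norm_exp_I_mul])
    have j2 : ∀ i, Integrable fun k : ℝ => deriv (fun y => fh i k y τ) η * exp (I * k * θ) := fun i =>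
      (i2 i).mul_bdd (c := 1) (by fun_prop) (by simp [norm_exp_I_mul])
    rw [← key]
    simp only [Finset.sum_mul]
    rw [integral_finsetSum _ fun i _ => ?_]
    · refine Finset.sum_congr rfl fun i _ => ?_
      rw [(hf i).dTh_eq hS hη hτ, (hf i).dEt_eq hS hη hτ, ← integral_const_mul, ← integral_const_mul,
        ← integral_add ((j1 i).const_mul _) ((j2 i).const_mul _)]
      congr 1
      funext k
      ring
    · refine (((j1 i).const_mul (α i : ℂ)).add ((j2 i).const_mul (β i : ℂ))).congr
        (ae_of_all _ fun k => ?_)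
      simp only [Pi.add_apply]
      ring

end Transform

/-- At frequency `k ≠ 0` the induction equations give `B = -(B₀/w) v` and the first momentum
equation gives `q = (d/w) v₁`. The second momentum equation and `div v = 0` then form the system of
`eq_zero_of_ode` for the pair `(w/d) q`, `v₂`, with `μ = k` and `v₂ = 0` at the boundary. -/
lemma plasma_unique {p : Params} (hd : p.d ≠ 0) (hw : p.w ≠ 0) {S : Set ℝ} (hS : IsOpen S)
    {f : Fin 5 → ℝ × ℝ × ℝ → ℝ} {fh : Fin 5 → ℝ → ℝ → ℝ → ℂ}
    (hf : ∀ i, IsWaveField (Ici 0) S (f i) (fh i))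
    (h : ∀ z : ℝ × ℝ × ℝ, 0 < z.2.1 → z.2.2 ∈ S →
      mhdLin p (fun i => -p.lam * dTh (f i) z) (fun i => dTh (f i) z) (fun i => dEt (f i) z) = 0)
    (hb : ∀ θ, ∀ τ ∈ S, f 1 (θ, 0, τ) = 0) {τ : ℝ} (hτ : τ ∈ S) :
    ∀ᵐ k : ℝ, ∀ η, 0 ≤ η → ∀ i, fh i k η τ = 0 := by
  have hI : interior (Ici (0 : ℝ)) = Ioi 0 := interior_Ici
  have rel := fun (j : Fin 6) (α β : Fin 5 → ℝ)
    (hj : ∀ z : ℝ × ℝ × ℝ, ∑ i, (α i * dTh (f i) z + β i * dEt (f i) z) = mhdLin p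
      (fun i => -p.lam * dTh (f i) z) (fun i => dTh (f i) z) (fun i => dEt (f i) z) j) =>
    ae_linear_relation hS hf α β hτ fun θ η hη => by
      rw [hI] at hη
      rw [hj, h (θ, η, τ) hη hτ]; rfl
  have r0 := rel 0 ![-p.w, 0, -p.B0, 0, 1] 0 fun z => by
    simp [Fin.sum_univ_five, mhdLin, Params.w]; ring
  have r1 := rel 1 ![0, -p.w, 0, -p.B0, 0] ![0, 0, 0, 0, 1] fun z => by
    simp [Fin.sum_univ_five, mhdLin, Params.w]; ring
  have r2 := rel 2 ![-p.B0, 0, -p.w, 0, 0] 0 fun z => by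
    simp [Fin.sum_univ_five, mhdLin, Params.w]; ring
  have r3 := rel 3 ![0, -p.B0, 0, -p.w, 0] 0 fun z => by
    simp [Fin.sum_univ_five, mhdLin, Params.w]; ring
  have r4 := rel 4 ![1, 0, 0, 0, 0] ![0, 1, 0, 0, 0] fun z => by
    simp [Fin.sum_univ_five, mhdLin]
  have b1 := (hf 1).ae_eq_zero self_mem_Ici hτ fun θ => hb θ τ hτ
  have sm := ae_all_iff.2 fun i => (hf i).smooth
  have cn := ae_all_iff.2 fun i => (hf i).cont
  choose g hg hgb using fun i => (hf i).ae_bound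
  -- The algebraic relations carry a factor `ik` and say nothing at `k = 0`, a null set.
  have ne : ∀ᵐ k : ℝ, k ≠ 0 := by simp [ae_iff]
  filter_upwards [r0, r1, r2, r3, r4, b1, sm, cn, ae_all_iff.2 hgb, ne]
    with k r0 r1 r2 r3 r4 b1 sm cn hgb hk
  have hkc : (k : ℂ) ≠ 0 := by exact_mod_cast hk
  have hwc : (p.w : ℂ) ≠ 0 := by exact_mod_cast hw
  have hdc : (p.d : ℂ) ≠ 0 := by exact_mod_cast hd
  have hIk : I * (k : ℂ) ≠ 0 := mul_ne_zero Complex.I_ne_zero hkc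
  have edc : (p.d : ℂ) = p.w ^ 2 - p.B0 ^ 2 := by rw [Params.d]; push_cast; ring
  rw [hI] at r0 r1 r2 r3 r4 sm
  simp [Fin.sum_univ_five] at r0 r1 r2 r3 r4
  have C0 : ∀ i, ContinuousOn (fun η => fh i k η τ) (Ici 0) := fun i =>
    (cn i).comp (f := fun η : ℝ => (η, τ)) (Continuous.continuousOn (by fun_prop)) fun y hy => ⟨hy, hτ⟩
  have D0 : ∀ i η, 0 < η → HasDerivAt (fun η => fh i k η τ) (deriv (fun y => fh i k y τ) η) η :=
    fun i η hη => by
    have hline : ContDiffOn ℝ 1 (fun y => fh i k y τ) (Ioi 0) :=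
      (sm i).comp (contDiff_id.prodMk contDiff_const).contDiffOn fun y hy => ⟨hy, hτ⟩
    exact ((hline.differentiableOn one_ne_zero).differentiableAt (Ioi_mem_nhds hη)).hasDerivAt
  have e2 : ∀ η, 0 < η → fh 2 k η τ = -(p.B0 / p.w) * fh 0 k η τ := fun η hη => by
    have := r2 η hη
    field_simp
    refine mul_left_cancel₀ hIk ?_
    linear_combination -this
  have e3 : ∀ η, 0 < η → fh 3 k η τ = -(p.B0 / p.w) * fh 1 k η τ := fun η hη => by
    have := r3 η hη
    field_simp
    refine mul_left_cancel₀ hIk ?_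
    linear_combination -this
  have e4 : ∀ η, 0 < η → fh 4 k η τ = p.d / p.w * fh 0 k η τ := fun η hη => by
    have e : p.w * fh 2 k η τ = -p.B0 * fh 0 k η τ := by
      rw [e2 η hη]
      field_simp
    rw [div_mul_eq_mul_div, eq_div_iff hwc]
    refine mul_left_cancel₀ hIk ?_
    linear_combination (p.w : ℂ) * r0 η hη + I * k * p.B0 * e - I * k * fh 0 k η τ * edc
  have dx' : ∀ η, 0 < η → HasDerivAt (fun η => p.w / p.d * fh 4 k η τ) (I * k * fh 1 k η τ) η := by
    intro η hη
    refine ((D0 4 η hη).const_mul _).congr_deriv ?_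
    have := r1 η hη
    rw [e3 η hη] at this
    field_simp at this ⊢
    linear_combination this - I * k * fh 1 k η τ * edc
  have dy' : ∀ η, 0 < η → HasDerivAt (fun η => fh 1 k η τ) (-(I * k * (p.w / p.d * fh 4 k η τ))) η := by
    intro η hη
    refine (D0 1 η hη).congr_deriv ?_
    rw [e4 η hη]
    field_simp
    linear_combination r4 η hη
  have key : ∀ η, 0 ≤ η → p.w / p.d * fh 4 k η τ = 0 ∧ fh 1 k η τ = 0 := fun η hη =>
    eq_zero_of_ode (x := fun η => p.w / p.d * fh 4 k η τ) (C := ‖(p.w / p.d : ℂ)‖ * g 4 k + g 1 k) hk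
      (continuousOn_const.mul (C0 4)) (C0 1) dx' dy' b1 (fun η hη => by
        have h4 := (hgb 4).2.1 η hη τ hτ
        have h1 := (hgb 1).2.1 η hη τ hτ
        have := (norm_nonneg _).trans h4
        have := (norm_nonneg _).trans h1
        refine ⟨?_, h1.trans (le_add_of_nonneg_left (by positivity))⟩
        rw [norm_mul]
        exact (mul_le_mul_of_nonneg_left h4 (norm_nonneg _)).trans
          (le_add_of_nonneg_right (by assumption))) hη
  have pos : ∀ η, 0 < η → ∀ i, fh i k η τ = 0 := by
    intro η hη i
    obtain ⟨h4, h1⟩ := key η hη.le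
    have h0 : fh 0 k η τ = 0 := by
      rw [e4 η hη] at h4
      field_simp at h4
      exact h4
    fin_cases i
    · exact h0
    · exact h1
    · exact (e2 η hη).trans (by rw [h0, mul_zero])
    · exact (e3 η hη).trans (by rw [h1, mul_zero])
    · exact (e4 η hη).trans (by rw [h0, mul_zero])
  intro η hη i
  -- The relations hold for `η > 0`; the boundary value follows by continuity.
  rcases hη.eq_or_lt with rfl | hη
  · have h2 : Tendsto (fun η => fh i k η τ) (𝓝[>] 0) (𝓝 (fh i k 0 τ)) :=
      (C0 i 0 self_mem_Ici).mono Ioi_subset_Ici_self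
    refine tendsto_nhds_unique h2 (tendsto_const_nhds.congr' ?_)
    filter_upwards [self_mem_nhdsWithin] with y hy using (pos y hy i).symm
  · exact pos η hη i

/-- After the reflection `η ↦ -η` the half-line is the same as for the plasma. One Maxwell equation
gives `E = -νλH₂`, and the pair `H₁`, `σH₂` satisfies the system of `eq_zero_of_ode` with `μ = -σk`.
-/
lemma vacuum_unique {p : Params} (hσ : 0 < p.sigma) (hσ2 : p.sigma ^ 2 = 1 - p.nu ^ 2 * p.lam ^ 2)
    {S : Set ℝ} (hS : IsOpen S)
    {f : Fin 3 → ℝ × ℝ × ℝ → ℝ} {fh : Fin 3 → ℝ → ℝ → ℝ → ℂ}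
    (hf : ∀ i, IsWaveField (Iic 0) S (f i) (fh i))
    (h : ∀ z : ℝ × ℝ × ℝ, z.2.1 < 0 → z.2.2 ∈ S → maxwellLin p.nu (fun i => -p.lam * dTh (f i) z)
      (fun i => dTh (f i) z) (fun i => dEt (f i) z) = 0)
    (hb : ∀ θ, ∀ τ ∈ S, f 1 (θ, 0, τ) = 0) {τ : ℝ} (hτ : τ ∈ S) :
    ∀ᵐ k : ℝ, ∀ η, η ≤ 0 → ∀ i, fh i k η τ = 0 := by
  have hI : interior (Iic (0 : ℝ)) = Iio 0 := interior_Iic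
  have rel := fun (j : Fin 4) (α β : Fin 3 → ℝ)
    (hj : ∀ z : ℝ × ℝ × ℝ, ∑ i, (α i * dTh (f i) z + β i * dEt (f i) z) = maxwellLin p.nu
      (fun i => -p.lam * dTh (f i) z) (fun i => dTh (f i) z) (fun i => dEt (f i) z) j) =>
    ae_linear_relation hS hf α β hτ fun θ η hη => by
      rw [hI] at hη
      rw [hj, h (θ, η, τ) hη hτ]; rfl
  have r1 := rel 1 ![0, -(p.nu * p.lam), -1] 0 fun z => by
    simp [Fin.sum_univ_three, maxwellLin]; ring
  have r2 := rel 2 ![0, -1, -(p.nu * p.lam)] ![1, 0, 0] fun z => by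
    simp [Fin.sum_univ_three, maxwellLin]; ring
  have r3 := rel 3 ![1, 0, 0] ![0, 1, 0] fun z => by
    simp [Fin.sum_univ_three, maxwellLin]
  have b1 := (hf 1).ae_eq_zero self_mem_Iic hτ fun θ => hb θ τ hτ
  have sm := ae_all_iff.2 fun i => (hf i).smooth
  have cn := ae_all_iff.2 fun i => (hf i).cont
  choose g hg hgb using fun i => (hf i).ae_bound
  have ne : ∀ᵐ k : ℝ, k ≠ 0 := by simp [ae_iff]
  filter_upwards [r1, r2, r3, b1, sm, cn, ae_all_iff.2 hgb, ne] with k r1 r2 r3 b1 sm cn hgb hk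
  have hkc : (k : ℂ) ≠ 0 := by exact_mod_cast hk
  have hIk : I * (k : ℂ) ≠ 0 := mul_ne_zero Complex.I_ne_zero hkc
  have hsc : (p.sigma : ℂ) ^ 2 = 1 - p.nu ^ 2 * p.lam ^ 2 := by exact_mod_cast hσ2
  rw [hI] at r1 r2 r3 sm
  simp [Fin.sum_univ_three] at r1 r2 r3
  have C0 : ∀ i, ContinuousOn (fun η => fh i k (-η) τ) (Ici 0) := fun i =>
    (cn i).comp (f := fun η : ℝ => (-η, τ)) (Continuous.continuousOn (by fun_prop))
      fun y hy => ⟨by simpa using hy, hτ⟩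
  have D0 : ∀ i η, 0 < η → HasDerivAt (fun η => fh i k (-η) τ)
      (-deriv (fun y => fh i k y τ) (-η)) η :=
    fun i η hη => by
    have hline : ContDiffOn ℝ 1 (fun y => fh i k y τ) (Iio 0) :=
      (sm i).comp (contDiff_id.prodMk contDiff_const).contDiffOn fun y hy => ⟨hy, hτ⟩
    have h1 := ((hline.differentiableOn one_ne_zero).differentiableAt
      (Iio_mem_nhds (neg_neg_of_pos hη))).hasDerivAt
    have := HasDerivAt.scomp η h1 (hasDerivAt_neg η)
    rw [neg_one_smul] at this
    exact this
  have e2 : ∀ η, 0 < η → fh 2 k (-η) τ = -(p.nu * p.lam) * fh 1 k (-η) τ := fun η hη => by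
    refine mul_left_cancel₀ hIk ?_
    linear_combination -r1 (-η) (neg_neg_of_pos hη)
  have dx' : ∀ η, 0 < η → HasDerivAt (fun η => fh 0 k (-η) τ)
      (I * ((-(p.sigma * k) : ℝ) : ℂ) * (p.sigma * fh 1 k (-η) τ)) η := by
    intro η hη
    refine (D0 0 η hη).congr_deriv ?_
    have := r2 (-η) (neg_neg_of_pos hη)
    rw [e2 η hη] at this
    push_cast
    linear_combination -this + I * k * fh 1 k (-η) τ * hsc
  have dy' : ∀ η, 0 < η → HasDerivAt (fun η => p.sigma * fh 1 k (-η) τ)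
      (-(I * ((-(p.sigma * k) : ℝ) : ℂ) * fh 0 k (-η) τ)) η := by
    intro η hη
    refine ((D0 1 η hη).const_mul _).congr_deriv ?_
    have := r3 (-η) (neg_neg_of_pos hη)
    push_cast
    linear_combination -p.sigma * this
  have key : ∀ η, 0 ≤ η → fh 0 k (-η) τ = 0 ∧ p.sigma * fh 1 k (-η) τ = 0 := fun η hη =>
    eq_zero_of_ode (y := fun η => p.sigma * fh 1 k (-η) τ) (C := g 0 k + p.sigma * g 1 k)
      (neg_ne_zero.2 (mul_ne_zero hσ.ne' hk)) (C0 0) (continuousOn_const.mul (C0 1)) dx' dy'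
      (by simp [b1]) (fun η hη => by
        have h0 := (hgb 0).2.1 (-η) (neg_nonpos.2 hη) τ hτ
        have h1 := (hgb 1).2.1 (-η) (neg_nonpos.2 hη) τ hτ
        have := (norm_nonneg _).trans h0
        have := (norm_nonneg _).trans h1
        refine ⟨h0.trans (le_add_of_nonneg_right (by positivity)), ?_⟩
        rw [norm_mul, Complex.norm_real, Real.norm_of_nonneg hσ.le]
        exact (mul_le_mul_of_nonneg_left h1 hσ.le).trans
          (le_add_of_nonneg_left (by assumption))) hη
  have hs0 : (p.sigma : ℂ) ≠ 0 := by exact_mod_cast hσ.ne'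
  have pos : ∀ η, 0 < η → ∀ i, fh i k (-η) τ = 0 := by
    intro η hη i
    obtain ⟨h0, h1⟩ := key η hη.le
    have h1 := (mul_eq_zero.1 h1).resolve_left hs0
    fin_cases i
    · exact h0
    · exact h1
    · exact (e2 η hη).trans (by rw [h1, mul_zero])
  intro η hη i
  rcases hη.eq_or_lt with rfl | hη
  · have h2 : Tendsto (fun η => fh i k (-η) τ) (𝓝[>] 0) (𝓝 (fh i k (-0) τ)) :=
      (C0 i 0 self_mem_Ici).mono Ioi_subset_Ici_self
    rw [neg_zero] at h2
    refine tendsto_nhds_unique h2 (tendsto_const_nhds.congr' ?_)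
    filter_upwards [self_mem_nhdsWithin] with y hy using (pos y hy i).symm
  · simpa using pos (-η) (neg_pos.2 hη) i

/-! ### Uniqueness of the terms of an expansion -/

section Terms
variable {p : Params} {S : Set ℝ} {X Y : Terms}

lemma mhdLin_sub (p : Params) (a b c a' b' c' : Fin 5 → ℝ) :
    mhdLin p (fun i => a i - a' i) (fun i => b i - b' i) (fun i => c i - c' i)
      = mhdLin p a b c - mhdLin p a' b' c' := by
  funext j
  fin_cases j <;> simp [mhdLin] <;> ring

lemma maxwellLin_sub (ν : ℝ) (a b c a' b' c' : Fin 3 → ℝ) :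
    maxwellLin ν (fun i => a i - a' i) (fun i => b i - b' i) (fun i => c i - c' i)
      = maxwellLin ν a b c - maxwellLin ν a' b' c' := by
  funext j
  fin_cases j <;> simp [maxwellLin] <;> ring

lemma partial_sub {f g : ℝ × ℝ × ℝ → ℝ} {z : ℝ × ℝ × ℝ} (hf : DifferentiableAt ℝ f z)
    (hg : DifferentiableAt ℝ g z) : dTh (fun z => f z - g z) z = dTh f z - dTh g z ∧
    dEt (fun z => f z - g z) z = dEt f z - dEt g z := by
  simp [dTh, dEt, fderiv_fun_sub hf hg]

lemma fderiv_eq_of_eq_slab {D : Set ℝ} (hS : IsOpen S) {f g : ℝ × ℝ × ℝ → ℝ}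
    (h : ∀ z : ℝ × ℝ × ℝ, z.2.1 ∈ D → z.2.2 ∈ S → f z = g z) {z : ℝ × ℝ × ℝ}
    (hη : z.2.1 ∈ interior D) (hτ : z.2.2 ∈ S) : fderiv ℝ f z = fderiv ℝ g z := by
  refine Filter.EventuallyEq.fderiv_eq ?_
  filter_upwards [mem_interior_iff_mem_nhds.1 (mem_interior_slab hS hη hτ)] with y hy
  exact h y hy.1 hy.2

lemma eq_of_transform_eq {D : Set ℝ} {f g : ℝ × ℝ × ℝ → ℝ} {fh gh : ℝ → ℝ → ℝ → ℂ}
    (hf : IsWaveField D S f fh) (hg : IsWaveField D S g gh) {θ η τ : ℝ} (hη : η ∈ D) (hτ : τ ∈ S)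
    (h : ∀ᵐ k : ℝ, fh k η τ = gh k η τ) : f (θ, η, τ) = g (θ, η, τ) := by
  have h1 := hf.repr θ η hη τ hτ
  rw [integral_congr_ae (h.mono fun k hk => by rw [hk]), ← hg.repr θ η hη τ hτ] at h1
  exact_mod_cast h1

lemma plasma_unique_sub (hd : p.d ≠ 0) (hw : p.w ≠ 0) (hS : IsOpen S)
    {f g : Fin 5 → ℝ × ℝ × ℝ → ℝ} {fh gh : Fin 5 → ℝ → ℝ → ℝ → ℂ}
    (hf : ∀ i, IsWaveField (Ici 0) S (f i) (fh i)) (hg : ∀ i, IsWaveField (Ici 0) S (g i) (gh i))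
    (h : ∀ z : ℝ × ℝ × ℝ, 0 < z.2.1 → z.2.2 ∈ S → mhdLin p
      (fun i => -p.lam * (dTh (f i) z - dTh (g i) z)) (fun i => dTh (f i) z - dTh (g i) z)
      (fun i => dEt (f i) z - dEt (g i) z) = 0)
    (hb : ∀ θ, ∀ τ ∈ S, f 1 (θ, 0, τ) = g 1 (θ, 0, τ)) :
    (∀ τ ∈ S, ∀ᵐ k : ℝ, ∀ η, 0 ≤ η → ∀ i, fh i k η τ = gh i k η τ) ∧
    ∀ i (z : ℝ × ℝ × ℝ), z.2.1 ∈ Ici (0 : ℝ) → z.2.2 ∈ S → f i z = g i z := by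
  have key : ∀ τ ∈ S, ∀ᵐ k : ℝ, ∀ η, 0 ≤ η → ∀ i, fh i k η τ = gh i k η τ := by
    intro τ hτ
    have := plasma_unique hd hw hS (fun i => (hf i).sub (hg i) hS) (fun z hη hτ => by
      have hz : z.2.1 ∈ interior (Ici (0 : ℝ)) := by rwa [interior_Ici]
      have e := fun i => partial_sub ((hf i).differentiableAt hS hz hτ)
        ((hg i).differentiableAt hS hz hτ)
      simp only [fun i => (e i).1, fun i => (e i).2]
      exact h z hη hτ) (fun θ τ hτ => sub_eq_zero.2 (hb θ τ hτ)) hτ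
    filter_upwards [this] with k hk η hη i using sub_eq_zero.1 (hk η hη i)
  exact ⟨key, fun i z hη hτ => eq_of_transform_eq (hf i) (hg i) hη hτ
    ((key _ hτ).mono fun k hk => hk _ hη i)⟩

lemma vacuum_unique_sub (hσ : 0 < p.sigma) (hσ2 : p.sigma ^ 2 = 1 - p.nu ^ 2 * p.lam ^ 2)
    (hS : IsOpen S) {f g : Fin 3 → ℝ × ℝ × ℝ → ℝ} {fh gh : Fin 3 → ℝ → ℝ → ℝ → ℂ}
    (hf : ∀ i, IsWaveField (Iic 0) S (f i) (fh i)) (hg : ∀ i, IsWaveField (Iic 0) S (g i) (gh i))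
    (h : ∀ z : ℝ × ℝ × ℝ, z.2.1 < 0 → z.2.2 ∈ S → maxwellLin p.nu
      (fun i => -p.lam * (dTh (f i) z - dTh (g i) z)) (fun i => dTh (f i) z - dTh (g i) z)
      (fun i => dEt (f i) z - dEt (g i) z) = 0)
    (hb : ∀ θ, ∀ τ ∈ S, f 1 (θ, 0, τ) = g 1 (θ, 0, τ)) :
    (∀ τ ∈ S, ∀ᵐ k : ℝ, ∀ η, η ≤ 0 → ∀ i, fh i k η τ = gh i k η τ) ∧
    ∀ i (z : ℝ × ℝ × ℝ), z.2.1 ∈ Iic (0 : ℝ) → z.2.2 ∈ S → f i z = g i z := by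
  have key : ∀ τ ∈ S, ∀ᵐ k : ℝ, ∀ η, η ≤ 0 → ∀ i, fh i k η τ = gh i k η τ := by
    intro τ hτ
    have := vacuum_unique hσ hσ2 hS (fun i => (hf i).sub (hg i) hS) (fun z hη hτ => by
      have hz : z.2.1 ∈ interior (Iic (0 : ℝ)) := by rwa [interior_Iic]
      have e := fun i => partial_sub ((hf i).differentiableAt hS hz hτ)
        ((hg i).differentiableAt hS hz hτ)
      simp only [fun i => (e i).1, fun i => (e i).2]
      exact h z hη hτ) (fun θ τ hτ => sub_eq_zero.2 (hb θ τ hτ)) hτ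
    filter_upwards [this] with k hk η hη i using sub_eq_zero.1 (hk η hη i)
  exact ⟨key, fun i z hη hτ => eq_of_transform_eq (hf i) (hg i) hη hτ
    ((key _ hτ).mono fun k hk => hk _ hη i)⟩

/-- Two sets of terms with the same profiles, which satisfy the equations in the interior, the
kinematic condition and the condition on the magnetic field in vacuum, coincide. -/
lemma terms_unique (hσ : 0 < p.sigma) (hσ2 : p.sigma ^ 2 = 1 - p.nu ^ 2 * p.lam ^ 2) (hd : p.d ≠ 0)
    (hw : p.w ≠ 0) (hS : IsOpen S) (hX : X.Regular S) (hY : Y.Regular S) (h1 : X.phi1 = Y.phi1)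
    (h2 : X.phi2 = Y.phi2) (hXv : X.Vanish p S)
    (hP1 : ∀ z : ℝ × ℝ × ℝ, 0 < z.2.1 → z.2.2 ∈ S → Y.plasma1 p z = 0 ∧ Y.plasma2 p z = 0)
    (hV1 : ∀ z : ℝ × ℝ × ℝ, z.2.1 < 0 → z.2.2 ∈ S → Y.vacuum1 p z = 0 ∧ Y.vacuum2 p z = 0)
    (hJ : ∀ y : ℝ × ℝ, y.2 ∈ S → Y.jump1 p y = 0 ∧ ∀ j, j ≠ 1 → Y.jump2 p y j = 0) :
    (∀ τ ∈ S, (∀ᵐ k : ℝ, ∀ η, 0 ≤ η → ∀ i,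
        X.U1h i k η τ = Y.U1h i k η τ ∧ X.U2h i k η τ = Y.U2h i k η τ) ∧
      ∀ᵐ k : ℝ, ∀ η, η ≤ 0 → ∀ i,
        X.V1h i k η τ = Y.V1h i k η τ ∧ X.V2h i k η τ = Y.V2h i k η τ) ∧
    ∀ y : ℝ × ℝ, y.2 ∈ S → Y.jump2 p y = 0 := by
  obtain ⟨u1, u1'⟩ := plasma_unique_sub hd hw hS hX.U1 hY.U1 (fun z hη hτ => by
      have e1 := (hXv.plasma z hη hτ).1
      have e2 := (hP1 z hη hτ).1
      simp only [Terms.plasma1] at e1 e2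
      simp only [mul_sub]
      rw [mhdLin_sub, e1, e2, sub_zero]) (fun θ τ hτ => by
      have e1 := congrFun (hXv.jump (θ, τ) hτ).1 0
      have e2 := congrFun (hJ (θ, τ) hτ).1 0
      simp [Terms.jump1, h1] at e1 e2
      linarith)
  obtain ⟨v1, v1'⟩ := vacuum_unique_sub hσ hσ2 hS hX.V1 hY.V1 (fun z hη hτ => by
      have e1 := (hXv.vacuum z hη hτ).1
      have e2 := (hV1 z hη hτ).1
      simp only [Terms.vacuum1] at e1 e2
      simp only [mul_sub]
      rw [maxwellLin_sub, e1, e2, sub_zero]) (fun θ τ hτ => by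
      have e1 := congrFun (hXv.jump (θ, τ) hτ).1 3
      have e2 := congrFun (hJ (θ, τ) hτ).1 3
      simp [Terms.jump1, h1] at e1 e2
      linarith)
  have bU : ∀ i θ, ∀ τ ∈ S, X.U1 i (θ, 0, τ) = Y.U1 i (θ, 0, τ) := fun i θ τ hτ =>
    u1' i _ self_mem_Ici hτ
  have bV : ∀ i θ, ∀ τ ∈ S, X.V1 i (θ, 0, τ) = Y.V1 i (θ, 0, τ) := fun i θ τ hτ =>
    v1' i _ self_mem_Iic hτ
  -- The first order terms already agree, so the second order sources cancel in the difference and a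
  -- homogeneous linear problem remains.
  obtain ⟨u2, u2'⟩ := plasma_unique_sub hd hw hS hX.U2 hY.U2 (fun z hη hτ => by
      have hz : z.2.1 ∈ interior (Ici (0 : ℝ)) := by rwa [interior_Ici]
      have e1 := (hXv.plasma z hη hτ).2
      have e2 := (hP1 z hη hτ).2
      have f1 := fun i => u1' i z (le_of_lt hη) hτ
      have f2 := fun i => fderiv_eq_of_eq_slab hS (u1' i) hz hτ
      simp only [Terms.plasma2, f1, dTh, dEt, dTa, f2, h1] at e1 e2 ⊢
      rw [← sub_eq_zero.2 (e1.trans e2.symm), add_sub_add_right_eq_sub, ← mhdLin_sub]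
      congr 1 <;> funext i <;> ring) (fun θ τ hτ => by
      have e1 := congrFun (hXv.jump (θ, τ) hτ).2 0
      have e2 := (hJ (θ, τ) hτ).2 0 (by decide)
      simp [Terms.jump2, h1, h2, bU _ _ _ hτ] at e1 e2
      linarith)
  obtain ⟨v2, v2'⟩ := vacuum_unique_sub hσ hσ2 hS hX.V2 hY.V2 (fun z hη hτ => by
      have hz : z.2.1 ∈ interior (Iic (0 : ℝ)) := by rwa [interior_Iic]
      have e1 := (hXv.vacuum z hη hτ).2
      have e2 := (hV1 z hη hτ).2
      have f2 := fun i => fderiv_eq_of_eq_slab hS (v1' i) hz hτ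
      simp only [Terms.vacuum2, dTh, dEt, dTa, f2, h1] at e1 e2 ⊢
      rw [← sub_eq_zero.2 (e1.trans e2.symm), ← maxwellLin_sub]
      congr 1 <;> funext i <;> ring) (fun θ τ hτ => by
      have e1 := congrFun (hXv.jump (θ, τ) hτ).2 3
      have e2 := (hJ (θ, τ) hτ).2 3 (by decide)
      simp [Terms.jump2, h1, h2, bV _ _ _ hτ] at e1 e2
      linarith)
  refine ⟨fun τ hτ => ⟨?_, ?_⟩, fun y hy => ?_⟩
  · filter_upwards [u1 τ hτ, u2 τ hτ] with k a b η hη i using ⟨a η hη i, b η hη i⟩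
  · filter_upwards [v1 τ hτ, v2 τ hτ] with k a b η hη i using ⟨a η hη i, b η hη i⟩
  -- Everything entering `jump2` now coincides, so its remaining component, the pressure condition,
  -- passes from `X` to `Y`.
  · rw [← (hXv.jump y hy).2]
    simp only [Terms.jump2, h1, h2, bU _ _ _ hy, bV _ _ _ hy,
      fun i => u2' i (y.1, 0, y.2) self_mem_Ici hy, fun i => v2' i (y.1, 0, y.2) self_mem_Iic hy]

end Terms

/-! ## Quadratic convolutions with exponential kernels -/

/-- Measurable kernels of polynomial growth. -/
structure Adm (k : ℝ) (K : ℝ → ℂ) : Prop where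
  meas : Measurable K
  bound : ∃ (C : ℝ) (n : ℕ), 0 ≤ C ∧ ∀ l, ‖K l‖ ≤ C * ((1 + |k - l|) * (1 + |l|)) ^ n

lemma one_le_weight (k l : ℝ) : 1 ≤ (1 + |k - l|) * (1 + |l|) := by
  nlinarith [abs_nonneg (k - l), abs_nonneg l, mul_nonneg (abs_nonneg (k - l)) (abs_nonneg l)]

namespace Adm
variable {k : ℝ} {K K' : ℝ → ℂ}

lemma mul (h : Adm k K) (h' : Adm k K') : Adm k (fun l => K l * K' l) := by
  obtain ⟨C, n, hC, b⟩ := h.bound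
  obtain ⟨C', n', hC', b'⟩ := h'.bound
  refine ⟨h.meas.mul h'.meas, C * C', n + n', by positivity, fun l => ?_⟩
  rw [norm_mul]
  calc _ ≤ (C * ((1 + |k - l|) * (1 + |l|)) ^ n) * (C' * ((1 + |k - l|) * (1 + |l|)) ^ n') :=
        mul_le_mul (b l) (b' l) (norm_nonneg _) (by positivity)
    _ = _ := by rw [pow_add]; ring

lemma add (h : Adm k K) (h' : Adm k K') : Adm k (fun l => K l + K' l) := by
  obtain ⟨C, n, hC, b⟩ := h.bound
  obtain ⟨C', n', hC', b'⟩ := h'.bound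
  refine ⟨h.meas.add h'.meas, C + C', n + n', by positivity, fun l => (norm_add_le _ _).trans ?_⟩
  have h1 := pow_le_pow_right₀ (one_le_weight k l) (show n ≤ n + n' by omega)
  have h2 := pow_le_pow_right₀ (one_le_weight k l) (show n' ≤ n + n' by omega)
  rw [add_mul]
  exact add_le_add ((b l).trans (by gcongr)) ((b' l).trans (by gcongr))

lemma of_le (hm : Measurable K) (h : ∀ l, ‖K l‖ ≤ (1 + |k - l|) * (1 + |l|)) : Adm k K :=
  ⟨hm, 1, 1, zero_le_one, fun l => by rw [one_mul, pow_one]; exact h l⟩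

lemma const (c : ℂ) : Adm k (fun _ => c) :=
  ⟨measurable_const, ‖c‖, 0, norm_nonneg _, fun l => by rw [pow_zero, mul_one]⟩

lemma sub (h : Adm k K) (h' : Adm k K') : Adm k (fun l => K l - K' l) := by
  have := h.add ((const (k := k) (-1)).mul h')
  simpa [sub_eq_add_neg] using this

lemma pow (h : Adm k K) (n : ℕ) : Adm k (fun l => K l ^ n) := by
  induction n with
  | zero => simpa using const 1
  | succ n ih => simpa only [pow_succ] using ih.mul h

lemma abs_right : Adm k (fun l => ((|l| : ℝ) : ℂ)) := of_le (by fun_prop) fun l => by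
  rw [Complex.norm_real, Real.norm_eq_abs, abs_abs]
  nlinarith [abs_nonneg (k - l), abs_nonneg l, mul_nonneg (abs_nonneg (k - l)) (abs_nonneg l)]

lemma abs_left : Adm k (fun l => ((|k - l| : ℝ) : ℂ)) := of_le (by fun_prop) fun l => by
  rw [Complex.norm_real, Real.norm_eq_abs, abs_abs]
  nlinarith [abs_nonneg (k - l), abs_nonneg l, mul_nonneg (abs_nonneg (k - l)) (abs_nonneg l)]

lemma right : Adm k (fun l => (l : ℂ)) := of_le (by fun_prop) fun l => by
  rw [Complex.norm_real, Real.norm_eq_abs]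
  nlinarith [abs_nonneg (k - l), abs_nonneg l, mul_nonneg (abs_nonneg (k - l)) (abs_nonneg l)]

lemma left : Adm k (fun l => (k : ℂ) - l) := (const _).sub right

end Adm

/-- The exponential `e^{-κxη}`. -/
noncomputable def ex (κ x η : ℝ) : ℂ := exp ((-κ * x * η : ℝ) : ℂ)

lemma norm_ex_le {κ x η : ℝ} (hη : 0 ≤ κ * η) (hx : 0 ≤ x) : ‖ex κ x η‖ ≤ 1 := by
  rw [ex, Complex.norm_exp_ofReal, Real.exp_le_one_iff]
  nlinarith

lemma ex_zero (κ x : ℝ) : ex κ x 0 = 1 := by simp [ex]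

lemma continuous_ex (κ x : ℝ) : Continuous (ex κ x) := by unfold ex; fun_prop

lemma hasDerivAt_ex (κ x η : ℝ) : HasDerivAt (ex κ x) (-κ * x * ex κ x η) η := by
  have h : HasDerivAt (ex κ x) (exp ((-κ * x * η : ℝ) : ℂ) * ((-κ * x * 1 : ℝ) : ℂ)) η :=
    (((hasDerivAt_id η).const_mul (-κ * x)).ofReal_comp).cexp
  refine h.congr_deriv ?_
  rw [ex, mul_one]
  push_cast
  ring

/-- Products of transforms at frequency `k` are integrable against kernels of polynomial growth. -/
def Good (φ : ℝ → ℝ → ℂ) (τ k : ℝ) : Prop :=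
  ∀ K, Adm k K → Integrable (fun l => K l * φ (k - l) τ * φ l τ)

/-- Countably many polynomial weights dominate all admissible kernels, so a single null set of
frequencies serves every kernel at once. -/
lemma IsProfile.ae_good {S : Set ℝ} {φ : ℝ × ℝ → ℝ} {φh : ℝ → ℝ → ℂ} (h : IsProfile S φ φh)
    {τ : ℝ} (hτ : τ ∈ S) : ∀ᵐ k : ℝ, Good φh τ k := by
  have hm := h.meas τ hτ
  have hi : ∀ n : ℕ, Integrable (fun k => (1 + |k|) ^ n * ‖φh k τ‖) := fun n => by
    obtain ⟨g, hg, hb⟩ := h.weighted_bound n 0 (by norm_num)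
    refine hg.mono' ((Measurable.aestronglyMeasurable (by fun_prop)).mul hm.norm) ?_
    filter_upwards [hb] with k hk
    have := hk τ hτ
    rw [iteratedDeriv_zero] at this
    rwa [Real.norm_of_nonneg (by positivity)]
  have key : ∀ᵐ k : ℝ, ∀ n : ℕ, Integrable (fun l => ((1 + |k - l|) ^ n * ‖φh (k - l) τ‖)
      * ((1 + |l|) ^ n * ‖φh l τ‖)) :=
    ae_all_iff.2 fun n => (convolution_integrable (hi n) (hi n)).1
  filter_upwards [key] with k hk K hK
  obtain ⟨C, n, hC, hb⟩ := hK.bound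
  refine ((hk n).const_mul C).mono' ((hK.meas.aestronglyMeasurable.mul
    (hm.comp_quasiMeasurePreserving (quasiMeasurePreserving_sub_left volume k))).mul hm)
    (ae_of_all _ fun l => ?_)
  rw [norm_mul, norm_mul]
  calc _ ≤ (C * ((1 + |k - l|) * (1 + |l|)) ^ n) * ‖φh (k - l) τ‖ * ‖φh l τ‖ := by
        gcongr; exact hb l
    _ = _ := by rw [mul_pow]; ring

section Quad
variable {φ : ℝ → ℝ → ℂ} {k τ : ℝ}

/-- The product `φ(k - l)φ(l)` is invariant under `l ↦ k - l`, so only the symmetric part of a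
kernel counts. The identities between different convolutions are reduced in this way, through
`quad_relation`, to pointwise identities between kernels. -/
lemma quad_reflect (K : ℝ → ℂ) : quad φ K k τ = quad φ (fun l => K (k - l)) k τ := by
  rw [quad, quad, ← integral_sub_left_eq_self _ volume k]
  congr 1
  funext l
  rw [sub_sub_cancel]
  ring

lemma quad_eq_zero_of_antisymm {K : ℝ → ℂ} (h : ∀ l, K l + K (k - l) = 0) : quad φ K k τ = 0 := by
  have h1 := quad_reflect (φ := φ) (k := k) (τ := τ) K
  have h2 : quad φ (fun l => K (k - l)) k τ = -quad φ K k τ := by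
    rw [quad, quad, ← integral_neg]
    congr 1
    funext l
    linear_combination (φ (k - l) τ * φ l τ) * h l
  rw [h2] at h1
  linear_combination h1 / 2

lemma quad_const_mul (c : ℂ) (K : ℝ → ℂ) : quad φ (fun l => c * K l) k τ = c * quad φ K k τ := by
  rw [quad, quad, ← integral_const_mul]
  congr 1
  funext l
  ring

lemma quad_add (hg : Good φ τ k) {K K' : ℝ → ℂ} (h : Adm k K) (h' : Adm k K') :
    quad φ (fun l => K l + K' l) k τ = quad φ K k τ + quad φ K' k τ := by
  rw [quad, quad, quad, ← integral_add (hg K h) (hg K' h')]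
  congr 1
  funext l
  ring

lemma quad_sub (hg : Good φ τ k) {K K' : ℝ → ℂ} (h : Adm k K) (h' : Adm k K') :
    quad φ (fun l => K l - K' l) k τ = quad φ K k τ - quad φ K' k τ := by
  rw [quad, quad, quad, ← integral_sub (hg K h) (hg K' h')]
  congr 1
  funext l
  ring

/-- A linear combination of convolutions vanishes if the symmetric part of its kernel does. -/
lemma quad_relation (hg : Good φ τ k) {n : ℕ} (c : Fin n → ℂ) (K : Fin n → ℝ → ℂ)
    (hK : ∀ i, Adm k (K i)) (h : ∀ l, ∑ i, c i * K i l + ∑ i, c i * K i (k - l) = 0) :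
    ∑ i, c i * quad φ (K i) k τ = 0 := by
  rw [← quad_eq_zero_of_antisymm (φ := φ) (τ := τ) h]
  simp only [quad]
  rw [show (fun l => (∑ i, c i * K i l) * φ (k - l) τ * φ l τ)
    = fun l => ∑ i, c i * (K i l * φ (k - l) τ * φ l τ) from funext fun l => by
      rw [Finset.sum_mul, Finset.sum_mul]
      exact Finset.sum_congr rfl fun i _ => by ring,
    integral_finsetSum _ fun i _ => (hg _ (hK i)).const_mul _]
  exact Finset.sum_congr rfl fun i _ => (integral_const_mul _ _).symm

/-- A convolution with kernel `c(l) e^{-κ α(l) η}`. -/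
noncomputable def expQuad (φ : ℝ → ℝ → ℂ) (k τ κ : ℝ) (α : ℝ → ℝ) (c : ℝ → ℂ) (η : ℝ) : ℂ :=
  quad φ (fun l => c l * ex κ (α l) η) k τ

variable {κ : ℝ} {α : ℝ → ℝ} {c : ℝ → ℂ}

lemma Adm.mul_ex {η : ℝ} (hη : 0 ≤ κ * η) (hc : Adm k c) (hα : Measurable α) (h0 : ∀ l, 0 ≤ α l) :
    Adm k (fun l => c l * ex κ (α l) η) := by
  refine hc.mul ⟨by unfold ex; fun_prop, 1, 0, zero_le_one, fun l => ?_⟩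
  rw [pow_zero, mul_one]
  exact norm_ex_le hη (h0 l)

lemma norm_expQuad_le {η : ℝ} (hη : 0 ≤ κ * η) (hg : Good φ τ k) (hc : Adm k c) (h0 : ∀ l, 0 ≤ α l) :
    ‖expQuad φ k τ κ α c η‖ ≤ ∫ l, ‖c l * φ (k - l) τ * φ l τ‖ := by
  refine norm_integral_le_of_norm_le (hg c hc).norm (ae_of_all _ fun l => ?_)
  rw [norm_mul, norm_mul, norm_mul, norm_mul, norm_mul]
  have := norm_ex_le hη (h0 l)
  have h1 : ‖c l‖ * ‖ex κ (α l) η‖ ≤ ‖c l‖ := mul_le_of_le_one_right (norm_nonneg _) this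
  gcongr

lemma continuousOn_expQuad (hg : Good φ τ k) (hc : Adm k c) (hα : Measurable α)
    (h0 : ∀ l, 0 ≤ α l) : ContinuousOn (expQuad φ k τ κ α c) {η | 0 ≤ κ * η} := by
  refine continuousOn_of_dominated (bound := fun l => ‖c l * φ (k - l) τ * φ l τ‖)
    (fun η hη => (hg _ (hc.mul_ex hη hα h0)).aestronglyMeasurable) (fun η hη => ?_) (hg c hc).norm ?_
  · refine ae_of_all _ fun l => ?_
    rw [norm_mul, norm_mul, norm_mul, norm_mul, norm_mul]
    have h1 : ‖c l‖ * ‖ex κ (α l) η‖ ≤ ‖c l‖ :=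
      mul_le_of_le_one_right (norm_nonneg _) (norm_ex_le hη (h0 l))
    gcongr
  · refine ae_of_all _ fun l => ?_
    have := continuous_ex κ (α l)
    exact Continuous.continuousOn (by fun_prop)

/-- Differentiation brings down `-κ α(l)`, which is again a kernel of polynomial growth and hence
integrable against the transforms. -/
lemma hasDerivAt_expQuad {η : ℝ} (hη : 0 < κ * η) (hg : Good φ τ k) (hc : Adm k c)
    (hα : Adm k (fun l => (α l : ℂ))) (h0 : ∀ l, 0 ≤ α l) :
    HasDerivAt (expQuad φ k τ κ α c) (expQuad φ k τ κ α (fun l => -κ * α l * c l) η) η := by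
  have hαm : Measurable α := Complex.measurable_re.comp hα.meas
  have hc' : Adm k (fun l => -κ * α l * c l) := ((Adm.const (-κ)).mul hα).mul hc
  have hO : {y | 0 < κ * y} ∈ 𝓝 η := (isOpen_lt continuous_const (by fun_prop)).mem_nhds hη
  refine (hasDerivAt_integral_of_dominated_loc_of_deriv_le (s := {y | 0 < κ * y})
    (F' := fun y l => -κ * α l * c l * ex κ (α l) y * φ (k - l) τ * φ l τ)
    (bound := fun l => ‖-κ * α l * c l * φ (k - l) τ * φ l τ‖) hO ?_ (hg _ (hc.mul_ex hη.le hαm h0))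
    (hg _ (hc'.mul_ex hη.le hαm h0)).aestronglyMeasurable ?_ (hg _ hc').norm ?_).2
  · filter_upwards [hO] with y hy using (hg _ (hc.mul_ex (le_of_lt hy) hαm h0)).aestronglyMeasurable
  · refine ae_of_all _ fun l y hy => ?_
    rw [norm_mul, norm_mul, norm_mul _ (ex _ _ _), norm_mul _ (φ l τ), norm_mul _ (φ (k - l) τ)]
    have h1 : ‖-κ * α l * c l‖ * ‖ex κ (α l) y‖ ≤ ‖-κ * α l * c l‖ :=
      mul_le_of_le_one_right (norm_nonneg _) (norm_ex_le (le_of_lt hy) (h0 l))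
    gcongr
  · refine ae_of_all _ fun l y _ => ?_
    refine ((((hasDerivAt_ex κ (α l) y).const_mul (c l)).mul_const (φ (k - l) τ)).mul_const
      (φ l τ)).congr_deriv ?_
    ring

end Quad

/-- Duhamel's formula on the half-line. -/
lemma duhamel {A F : ℝ → ℂ} {μ C : ℝ} (hA : ContinuousOn A (Ici 0)) (hF : ContinuousOn F (Ici 0))
    (hd : ∀ η, 0 < η → HasDerivAt A (-μ * A η + F η) η)
    (hb : ∀ η, 0 ≤ η → ‖A η‖ ≤ C ∧ ‖F η‖ ≤ C) :
    (∀ η, 0 ≤ η → A η = exp (-μ * η) * (A 0 + ∫ y in (0 : ℝ)..η, F y * exp (μ * y))) ∧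
    (μ < 0 → A 0 = -∫ y in Ioi (0 : ℝ), F y * exp (μ * y)) := by
  have he : Continuous fun y : ℝ => exp (μ * y) := by fun_prop
  have hd' : ∀ η, 0 < η → HasDerivAt (fun η => A η * exp (μ * η)) (F η * exp (μ * η)) η := by
    intro η hη
    have h : HasDerivAt (fun y : ℝ => exp (μ * y)) (exp (μ * η) * (μ * ((1 : ℝ) : ℂ))) η :=
      (((hasDerivAt_id η).ofReal_comp).const_mul (μ : ℂ)).cexp
    refine ((hd η hη).mul h).congr_deriv ?_
    push_cast
    ring
  have hc : ContinuousOn (fun η : ℝ => A η * exp (μ * η)) (Ici 0) := hA.mul he.continuousOn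
  have hcF : ContinuousOn (fun η : ℝ => F η * exp (μ * η)) (Ici 0) := hF.mul he.continuousOn
  refine ⟨fun η hη => ?_, fun hμ => ?_⟩
  · rw [intervalIntegral.integral_eq_sub_of_hasDerivAt_of_le hη
      (f := fun η => A η * exp (μ * η)) (hc.mono Icc_subset_Ici_self) (fun y hy => hd' y hy.1)
      (hcF.mono (by rw [uIcc_of_le hη]; exact Icc_subset_Ici_self)).intervalIntegrable]
    simp only [Complex.ofReal_zero, mul_zero, Complex.exp_zero, mul_one]
    rw [add_sub_cancel, mul_left_comm, ← Complex.exp_add, neg_mul, neg_add_cancel, Complex.exp_zero,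
      mul_one]
  -- For `μ < 0` the homogeneous solution `e^{-μη}` grows. Boundedness of `A` makes `A e^{μη}` tend
  -- to zero, which fixes `A 0`.
  · have hne : ∀ y : ℝ, ‖exp ((μ : ℂ) * y)‖ = Real.exp (μ * y) := fun y => by
      rw [← Complex.ofReal_mul, Complex.norm_exp_ofReal]
    have hlim : Tendsto (fun η : ℝ => A η * exp (μ * η)) atTop (𝓝 0) := by
      have l1 : Tendsto (fun η : ℝ => C * Real.exp (μ * η)) atTop (𝓝 0) := by
        have : Tendsto (fun η : ℝ => μ * η) atTop atBot := tendsto_id.const_mul_atTop_of_neg hμ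
        simpa using (Real.tendsto_exp_atBot.comp this).const_mul C
      refine squeeze_zero_norm' ?_ l1
      filter_upwards [eventually_ge_atTop 0] with η hη
      rw [norm_mul, hne]
      gcongr
      exact (hb η hη).1
    have hint : IntegrableOn (fun η : ℝ => F η * exp (μ * η)) (Ioi 0) := by
      have h1 : IntegrableOn (fun y : ℝ => C * Real.exp (μ * y)) (Ioi 0) := by
        have := (integrableOn_exp_mul_Ioi hμ 0).const_mul C
        exact this
      refine h1.mono' ((hcF.mono Ioi_subset_Ici_self).aestronglyMeasurable measurableSet_Ioi) ?_
      refine (ae_restrict_iff' measurableSet_Ioi).2 (ae_of_all _ fun y hy => ?_)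
      rw [norm_mul, hne]
      gcongr
      exact (hb y (le_of_lt hy)).2
    rw [integral_Ioi_of_hasDerivAt_of_tendsto (hc 0 self_mem_Ici) (fun y hy => hd' y hy) hint hlim]
    simp

/-! ## The second order terms in the plasma -/

/-- Bounded continuous functions on `D`. -/
def BddOn (D : Set ℝ) (f : ℝ → ℂ) : Prop := ContinuousOn f D ∧ ∃ C, ∀ η ∈ D, ‖f η‖ ≤ C

namespace BddOn
variable {D : Set ℝ} {f g : ℝ → ℂ}

lemma add (hf : BddOn D f) (hg : BddOn D g) : BddOn D (fun η => f η + g η) := by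
  obtain ⟨C, hC⟩ := hf.2
  obtain ⟨C', hC'⟩ := hg.2
  exact ⟨hf.1.add hg.1, C + C', fun η hη => (norm_add_le _ _).trans (add_le_add (hC η hη) (hC' η hη))⟩

lemma const_mul (hf : BddOn D f) (c : ℂ) : BddOn D (fun η => c * f η) := by
  obtain ⟨C, hC⟩ := hf.2
  refine ⟨continuousOn_const.mul hf.1, ‖c‖ * C, fun η hη => ?_⟩
  rw [norm_mul]
  exact mul_le_mul_of_nonneg_left (hC η hη) (norm_nonneg _)

lemma sub (hf : BddOn D f) (hg : BddOn D g) : BddOn D (fun η => f η - g η) := by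
  simpa [sub_eq_add_neg] using hf.add (hg.const_mul (-1))

lemma expQuad {φ : ℝ → ℝ → ℂ} {k τ κ : ℝ} {α : ℝ → ℝ} {c : ℝ → ℂ} (hD : ∀ η ∈ D, 0 ≤ κ * η)
    (hg : Good φ τ k) (hc : Adm k c) (hα : Measurable α) (h0 : ∀ l, 0 ≤ α l) :
    BddOn D (expQuad φ k τ κ α c) :=
  ⟨(continuousOn_expQuad hg hc hα h0).mono fun η hη => hD η hη,
    _, fun η hη => norm_expQuad_le (hD η hη) hg hc h0⟩

lemma ex {κ x : ℝ} (hD : ∀ η ∈ D, 0 ≤ κ * η) (hx : 0 ≤ x) : BddOn D (ex κ x) :=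
  ⟨(continuous_ex κ x).continuousOn, 1, fun η hη => norm_ex_le (hD η hη) hx⟩

end BddOn

section Plasma
variable {p : Params} {φ ψ : ℝ → ℝ → ℂ} {φ₁ φ₂ : ℝ × ℝ → ℝ} {k τ : ℝ}

lemma ex_eq (x η : ℝ) : ex 1 x η = exp (-x * η) := by simp [ex]

lemma ex_mul (x y η : ℝ) : ex 1 x η * ex 1 y η = ex 1 (x + y) η := by
  rw [ex_eq, ex_eq, ex_eq, ← Complex.exp_add]
  congr 1
  push_cast
  ring

lemma sign_mul_selfC (k : ℝ) : (Real.sign k : ℂ) * k = (|k| : ℝ) := by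
  rw [← Complex.ofReal_mul, sign_mul_self]

lemma sign_mul_absC (k : ℝ) : (Real.sign k : ℂ) * (|k| : ℝ) = k := by
  rw [← Complex.ofReal_mul, sign_mul_abs]

lemma abs_sqC (k : ℝ) : ((|k| : ℝ) : ℂ) ^ 2 = (k : ℂ) ^ 2 := by
  rw [← Complex.ofReal_pow, sq_abs, Complex.ofReal_pow]

lemma conv_modeN_eq (hg : Good φ τ k) {κ η : ℝ} (hη : 0 ≤ κ * η) (a b : ℝ) :
    conv (fun k _ τ => φ k τ) (modeNHat κ a b φ) k η τ
      = a * κ ^ 2 * expQuad φ k τ κ (fun l => |l|) (fun l => (l : ℂ) ^ 2) η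
        - b * κ * I * expQuad φ k τ κ (fun l => |l|) (fun l => (l : ℂ) * (|l| : ℝ)) η := by
  have h1 : Adm k fun l => (l : ℂ) ^ 2 * ex κ |l| η :=
    (Adm.right.pow 2).mul_ex hη (by fun_prop) fun l => abs_nonneg l
  have h2 : Adm k fun l => (l : ℂ) * (|l| : ℝ) * ex κ |l| η :=
    (Adm.right.mul Adm.abs_right).mul_ex hη (by fun_prop) fun l => abs_nonneg l
  rw [expQuad, expQuad, ← quad_const_mul, ← quad_const_mul,
    ← quad_sub hg ((Adm.const _).mul h1) ((Adm.const _).mul h2), conv, quad]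
  congr 1
  funext l
  have := abs_sqC l
  simp only [modeNHat, hker, ex, pow_zero, pow_one, one_mul, mul_one]
  push_cast
  linear_combination (a * κ ^ 2 * exp (-κ * (|l| : ℝ) * η) * φ l τ * φ (k - l) τ) * this

lemma conv_pressure_eq (hg : Good φ τ k) {η : ℝ} (hη : 0 ≤ η) :
    conv (fun k η τ => hker 1 0 0 1 k η * φ k τ) (fun k η τ => hker 1 0 0 1 k η * φ k τ) k η τ
      + conv (fun k η τ => hker 1 0 1 0 k η * φ k τ) (fun k η τ => hker 1 0 1 0 k η * φ k τ) k η τ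
      = expQuad φ k τ 1 (fun l => |k - l| + |l|)
        (fun l => (|k - l| : ℝ) * (|l| : ℝ) - ((k : ℂ) - l) * l) η := by
  have hη' : 0 ≤ 1 * η := by simpa using hη
  have hs : ∀ l : ℝ, 0 ≤ |k - l| + |l| := fun l => by positivity
  have h1 : Adm k fun l => (|k - l| : ℝ) * (|l| : ℝ) * ex 1 (|k - l| + |l|) η :=
    (Adm.abs_left.mul Adm.abs_right).mul_ex hη' (by fun_prop) hs
  have h2 : Adm k fun l => ((k : ℂ) - l) * l * ex 1 (|k - l| + |l|) η :=
    (Adm.left.mul Adm.right).mul_ex hη' (by fun_prop) hs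
  have e1 : conv (fun k η τ => hker 1 0 0 1 k η * φ k τ) (fun k η τ => hker 1 0 0 1 k η * φ k τ) k η τ
      = quad φ (fun l => (|k - l| : ℝ) * (|l| : ℝ) * ex 1 (|k - l| + |l|) η) k τ := by
    rw [conv, quad]
    congr 1
    funext l
    rw [← ex_mul]
    simp only [hker, ex, pow_zero, pow_one, one_mul, mul_one]
    push_cast
    ring
  have e2 : conv (fun k η τ => hker 1 0 1 0 k η * φ k τ) (fun k η τ => hker 1 0 1 0 k η * φ k τ) k η τ
      = -quad φ (fun l => ((k : ℂ) - l) * l * ex 1 (|k - l| + |l|) η) k τ := by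
    rw [conv, quad, ← integral_neg]
    congr 1
    funext l
    rw [← ex_mul]
    simp only [hker, ex, pow_zero, pow_one, one_mul, mul_one]
    push_cast
    linear_combination ((k - l) * l * exp (-1 * (|k - l| : ℝ) * η) * exp (-1 * (|l| : ℝ) * η) *
      φ (k - l) τ * φ l τ) * Complex.I_sq
  rw [e1, e2, ← sub_eq_add_neg, ← quad_sub hg h1 h2, expQuad]
  congr 1
  funext l
  ring

lemma quad_abs_eq : (∫ l : ℝ, φ (k - l) τ * ((|l| : ℝ) * φ l τ))
    = quad φ (fun l => ((|l| : ℝ) : ℂ)) k τ := by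
  rw [quad]
  congr 1
  funext l
  ring

/-- The closed form sorted by rate of decay: `|l|` from the product of `φ₁` with a normal
derivative, `|k|` from the modes and the slow response, `|k - l| + |l|` from the quadratic pressure.
-/
lemma model_U2h_eq (hg : Good φ τ k) {η : ℝ} (hη : 0 ≤ η) (i : Fin 5) :
    (model p φ₁ φ₂ φ ψ).U2h i k η τ
      = p.plasmaEta i * expQuad φ k τ 1 (fun l => |l|) (fun l => (l : ℂ) ^ 2) η
        - p.plasmaTheta i * I * expQuad φ k τ 1 (fun l => |l|) (fun l => (l : ℂ) * (|l| : ℝ)) η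
        + (-p.plasmaEta i * (|k| : ℝ) + p.plasmaTheta i * I * k) * ex 1 |k| η
          * (ψ k τ + quad φ (fun l => ((|l| : ℝ) : ℂ)) k τ)
        + (-p.slow1 i * I * Real.sign k + Params.slow2 i) * ex 1 |k| η * deriv (φ k) τ
        + p.pressure i * expQuad φ k τ 1 (fun l => |k - l| + |l|)
          (fun l => (|k - l| : ℝ) * (|l| : ℝ) - ((k : ℂ) - l) * l) η := by
  simp only [model]
  rw [conv_modeN_eq hg (by simpa using hη), conv_pressure_eq hg hη]
  simp only [modeHat, omegaHat, quad_abs_eq, tauHat, hker, ex, pow_zero, pow_one, one_mul, mul_one]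
  push_cast
  ring

/-- The kernels in the source of the second order equations. -/
lemma phat_eq (hg : Good φ τ k) {η : ℝ} (hη : 0 ≤ η) :
    phat p φ k η τ =
      ![-(p.w * (|k| : ℝ) * ex 1 |k| η * deriv (φ k) τ) - I * p.d * expQuad φ k τ 1
          (fun l => |k - l| + |l|) (fun l => (|k - l| : ℝ) * l * ((|k - l| : ℝ) - (|l| : ℝ))) η,
        -(I * p.w * k * ex 1 |k| η * deriv (φ k) τ)
          + p.d * (expQuad φ k τ 1 (fun l => |k - l| + |l|) (fun l => ((k : ℂ) - l) * l * (|l| : ℝ)) η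
            - expQuad φ k τ 1 (fun l => |l|) (fun l => ((k : ℂ) - l) * l * (|l| : ℝ)) η)
          - p.d * expQuad φ k τ 1 (fun l => |k - l| + |l|) (fun l => (|k - l| : ℝ) * (l : ℂ) ^ 2) η,
        p.B0 * (|k| : ℝ) * ex 1 |k| η * deriv (φ k) τ,
        I * p.B0 * k * ex 1 |k| η * deriv (φ k) τ,
        -(I * p.w * expQuad φ k τ 1 (fun l => |l|) (fun l => ((k : ℂ) - l) * (l : ℂ) ^ 2) η)] := by
  have hη' : 0 ≤ 1 * η := by simpa using hη
  have hK : Adm k fun l => ((k : ℂ) - l) * l * (|l| : ℝ) := (Adm.left.mul Adm.right).mul Adm.abs_right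
  rw [phat, expQuad, expQuad, expQuad, expQuad, expQuad, ← quad_sub hg
    (hK.mul_ex hη' (by fun_prop) fun l => by positivity)
    (hK.mul_ex hη' (by fun_prop) fun l => abs_nonneg l)]
  simp only [ex_eq, mul_sub, Complex.ofReal_add]

/-- The coefficients of the vectors `R` and `R̄`, for `δ = 1` and `δ = -1`. -/
noncomputable def modal (p : Params) (φ ψ : ℝ → ℝ → ℂ) (δ k τ η : ℝ) : ℂ :=
  1 / 2 * expQuad φ k τ 1 (fun l => |l|) (fun l => (l : ℂ) ^ 2) η
    + δ / 2 * expQuad φ k τ 1 (fun l => |l|) (fun l => (l : ℂ) * (|l| : ℝ)) η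
    + (-((|k| : ℝ) + δ * k) / 2 * (ψ k τ + quad φ (fun l => ((|l| : ℝ) : ℂ)) k τ)
      + (-I * Real.sign k * p.w / p.d + δ / (2 * I * p.w)) * deriv (φ k) τ) * ex 1 |k| η
    - 1 / 4 * expQuad φ k τ 1 (fun l => |k - l| + |l|)
      (fun l => (|k - l| : ℝ) * (|l| : ℝ) - ((k : ℂ) - l) * l) η

/-- The source of the equation for `modal`. -/
noncomputable def modalSource (p : Params) (φ : ℝ → ℝ → ℂ) (δ k τ η : ℝ) : ℂ :=
  1 / 2 * expQuad φ k τ 1 (fun l => |l|) (fun l => ((k : ℂ) - l) * l * (|l| : ℝ)) η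
    + δ / 2 * expQuad φ k τ 1 (fun l => |l|) (fun l => ((k : ℂ) - l) * (l : ℂ) ^ 2) η
    + δ / 2 * expQuad φ k τ 1 (fun l => |k - l| + |l|)
      (fun l => (|k - l| : ℝ) * l * ((|k - l| : ℝ) - (|l| : ℝ))) η
    - 1 / 2 * expQuad φ k τ 1 (fun l => |k - l| + |l|) (fun l => ((k : ℂ) - l) * l * (|l| : ℝ)) η
    + 1 / 2 * expQuad φ k τ 1 (fun l => |k - l| + |l|) (fun l => (|k - l| : ℝ) * (l : ℂ) ^ 2) η
    + δ * (p.w ^ 2 + p.B0 ^ 2) / (2 * I * p.d * p.w) * ((|k| : ℝ) - δ * k) * deriv (φ k) τ * ex 1 |k| η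

/-- The convolutions are treated as indeterminates, after which the claim is algebraic. The sign `δ`
lets one source describe both `L` and its conjugate. -/
lemma dot_L (hd : p.d ≠ 0) (hw : p.w ≠ 0) (hg : Good φ τ k) {η : ℝ} (hη : 0 ≤ η) :
    dotProduct (L p) (phat p φ k η τ) = modalSource p φ 1 k τ η ∧
    dotProduct (Lbar p) (phat p φ k η τ) = modalSource p φ (-1) k τ η := by
  have hdc : (p.d : ℂ) ≠ 0 := by exact_mod_cast hd
  have hwc : (p.w : ℂ) ≠ 0 := by exact_mod_cast hw
  have hI := Complex.I_ne_zero
  rw [phat_eq hg hη]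
  simp only [modalSource]
  generalize expQuad φ k τ 1 (fun l => |k - l| + |l|)
    (fun l => (|k - l| : ℝ) * l * ((|k - l| : ℝ) - (|l| : ℝ))) η = B₁
  generalize expQuad φ k τ 1 (fun l => |k - l| + |l|) (fun l => ((k : ℂ) - l) * l * (|l| : ℝ)) η = B₂
  generalize expQuad φ k τ 1 (fun l => |l|) (fun l => ((k : ℂ) - l) * l * (|l| : ℝ)) η = B₃
  generalize expQuad φ k τ 1 (fun l => |k - l| + |l|) (fun l => (|k - l| : ℝ) * (l : ℂ) ^ 2) η = B₄
  generalize expQuad φ k τ 1 (fun l => |l|) (fun l => ((k : ℂ) - l) * (l : ℂ) ^ 2) η = B₅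
  constructor
  · simp [dotProduct, Fin.sum_univ_five, L, R]
    field_simp
    ring_nf
    simp only [Complex.I_pow_three, Complex.I_pow_four]
    ring_nf
    simp only [Complex.I_sq]
    ring
  · simp [dotProduct, Fin.sum_univ_five, Lbar, L, R]
    field_simp
    simp only [map_ofNat]
    ring_nf
    simp only [Complex.I_pow_three, Complex.I_pow_four]
    ring_nf
    simp only [Complex.I_sq]
    ring

/-- The vector `S` contributes nothing to `v₂` and `q`, so the coefficients can be read off from `v₂
= iw(a - b)` and `q = d(a + b)`. -/
lemma modal_eq (hd : p.d ≠ 0) (hw : p.w ≠ 0) (hg : Good φ τ k) {η : ℝ} (hη : 0 ≤ η) :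
    modal p φ ψ 1 k τ η = 1 / 2 * ((model p φ₁ φ₂ φ ψ).U2h 4 k η τ / p.d
      + (model p φ₁ φ₂ φ ψ).U2h 1 k η τ / (I * p.w)) ∧
    modal p φ ψ (-1) k τ η = 1 / 2 * ((model p φ₁ φ₂ φ ψ).U2h 4 k η τ / p.d
      - (model p φ₁ φ₂ φ ψ).U2h 1 k η τ / (I * p.w)) := by
  have hdc : (p.d : ℂ) ≠ 0 := by exact_mod_cast hd
  have hwc : (p.w : ℂ) ≠ 0 := by exact_mod_cast hw
  have hI := Complex.I_ne_zero
  rw [model_U2h_eq hg hη, model_U2h_eq hg hη]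
  simp only [modal]
  generalize expQuad φ k τ 1 (fun l => |k - l| + |l|) _ η = A₃
  generalize expQuad φ k τ 1 (fun l => |l|) (fun l => (l : ℂ) ^ 2) η = A₁
  generalize expQuad φ k τ 1 (fun l => |l|) _ η = A₂
  generalize quad φ _ k τ = A₀
  constructor
  · simp [Params.plasmaEta, Params.plasmaTheta, Params.slow1, Params.slow2, Params.pressure]
    field_simp
    ring_nf
    simp only [Complex.I_sq]
    ring
  · simp [Params.plasmaEta, Params.plasmaTheta, Params.slow1, Params.slow2, Params.pressure]
    field_simp
    ring_nf

lemma bddOn_modal (hg : Good φ τ k) (δ : ℝ) : BddOn (Ici 0) (modal p φ ψ δ k τ) ∧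
    BddOn (Ici 0) (modalSource p φ δ k τ) := by
  have a1 : Adm k fun l => (l : ℂ) ^ 2 := Adm.right.pow 2
  have a2 : Adm k fun l => (l : ℂ) * (|l| : ℝ) := Adm.right.mul Adm.abs_right
  have a3 : Adm k fun l => (|k - l| : ℝ) * (|l| : ℝ) - ((k : ℂ) - l) * l :=
    (Adm.abs_left.mul Adm.abs_right).sub (Adm.left.mul Adm.right)
  have b1 : Adm k fun l => (|k - l| : ℝ) * l * ((|k - l| : ℝ) - (|l| : ℝ) : ℂ) :=
    (Adm.abs_left.mul Adm.right).mul (Adm.abs_left.sub Adm.abs_right)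
  have b2 : Adm k fun l => ((k : ℂ) - l) * l * (|l| : ℝ) := (Adm.left.mul Adm.right).mul Adm.abs_right
  have b4 : Adm k fun l => (|k - l| : ℝ) * (l : ℂ) ^ 2 := Adm.abs_left.mul (Adm.right.pow 2)
  have b5 : Adm k fun l => ((k : ℂ) - l) * (l : ℂ) ^ 2 := Adm.left.mul (Adm.right.pow 2)
  have E1 := fun {c : ℝ → ℂ} (hc : Adm k c) => BddOn.expQuad plasma_domain hg hc (α := fun l => |l|)
    (by fun_prop) fun l => abs_nonneg l
  have E2 := fun {c : ℝ → ℂ} (hc : Adm k c) => BddOn.expQuad plasma_domain hg hc (α := fun l => |k - l| + |l|)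
    (by fun_prop) fun l => by positivity
  have E0 := BddOn.ex plasma_domain (abs_nonneg k)
  exact ⟨((((E1 a1).const_mul _).add ((E1 a2).const_mul _)).add (E0.const_mul _)).sub
      ((E2 a3).const_mul _),
    (((((E1 b2).const_mul _).add ((E1 b5).const_mul _)).add ((E2 b1).const_mul _)).sub
      ((E2 b2).const_mul _)).add ((E2 b4).const_mul _) |>.add (E0.const_mul _)⟩

/-- `modal` is an explicit solution of the scalar equation whose Duhamel solutions define `acoef`
and `bcoef`. The three rates of decay are compared separately, the two kinds of convolution after
symmetrization. -/
lemma hasDerivAt_modal (hd : p.d ≠ 0) (hw : p.w ≠ 0) (hg : Good φ τ k) {δ : ℝ} (hδ : δ ^ 2 = 1)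
    {η : ℝ} (hη : 0 < η) : HasDerivAt (modal p φ ψ δ k τ)
      (-((δ * k : ℝ) : ℂ) * modal p φ ψ δ k τ η + modalSource p φ δ k τ η) η := by
  have hη' : 0 < 1 * η := by simpa using hη
  have hdc : (p.d : ℂ) ≠ 0 := by exact_mod_cast hd
  have hwc : (p.w : ℂ) ≠ 0 := by exact_mod_cast hw
  have hδ' : (δ : ℂ) ^ 2 = 1 := by exact_mod_cast hδ
  have edc : (p.d : ℂ) = p.w ^ 2 - p.B0 ^ 2 := by rw [Params.d]; push_cast; ring
  have a1 : Adm k fun l => (l : ℂ) ^ 2 := Adm.right.pow 2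
  have a2 : Adm k fun l => (l : ℂ) * (|l| : ℝ) := Adm.right.mul Adm.abs_right
  have a3 : Adm k fun l => (|k - l| : ℝ) * (|l| : ℝ) - ((k : ℂ) - l) * l :=
    (Adm.abs_left.mul Adm.abs_right).sub (Adm.left.mul Adm.right)
  have b1 : Adm k fun l => (|k - l| : ℝ) * l * ((|k - l| : ℝ) - (|l| : ℝ) : ℂ) :=
    (Adm.abs_left.mul Adm.right).mul (Adm.abs_left.sub Adm.abs_right)
  have b2 : Adm k fun l => ((k : ℂ) - l) * l * (|l| : ℝ) := (Adm.left.mul Adm.right).mul Adm.abs_right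
  have b4 : Adm k fun l => (|k - l| : ℝ) * (l : ℂ) ^ 2 := Adm.abs_left.mul (Adm.right.pow 2)
  have b5 : Adm k fun l => ((k : ℂ) - l) * (l : ℂ) ^ 2 := Adm.left.mul (Adm.right.pow 2)
  have s1 : Adm k fun l => ((|l| : ℝ) : ℂ) := Adm.abs_right
  have s2 : Adm k fun l => ((|k - l| + |l| : ℝ) : ℂ) := by
    simpa only [Complex.ofReal_add] using Adm.abs_left.add Adm.abs_right
  have h2 : ∀ l : ℝ, 0 ≤ |k - l| + |l| := fun l => by positivity
  have D1 := hasDerivAt_expQuad hη' hg a1 s1 fun l => abs_nonneg l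
  have D2 := hasDerivAt_expQuad hη' hg a2 s1 fun l => abs_nonneg l
  have D3 := hasDerivAt_expQuad hη' hg a3 s2 h2
  refine (((((D1.const_mul (1 / 2)).add (D2.const_mul (δ / 2 : ℂ))).add
    ((hasDerivAt_ex 1 |k| η).const_mul _)).sub (D3.const_mul (1 / 4)))).congr_deriv ?_
  have A1 := fun {c : ℝ → ℂ} (hc : Adm k c) => hc.mul_ex hη'.le (α := fun l => |l|)
    (by fun_prop) fun l => abs_nonneg l
  have A2 := fun {c : ℝ → ℂ} (hc : Adm k c) => hc.mul_ex hη'.le (α := fun l => |k - l| + |l|)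
    (by fun_prop) h2
  -- The kernels with the single exponential `e^{-|l|η}`.
  have e1 := quad_relation hg ![1 / 2, δ / 2, δ * k / 2, k / 2, -1 / 2, -δ / 2]
    ![fun l => -(1 : ℝ) * (|l| : ℝ) * (l : ℂ) ^ 2 * ex 1 |l| η,
      fun l => -(1 : ℝ) * (|l| : ℝ) * ((l : ℂ) * (|l| : ℝ)) * ex 1 |l| η,
      fun l => (l : ℂ) ^ 2 * ex 1 |l| η,
      fun l => (l : ℂ) * (|l| : ℝ) * ex 1 |l| η,
      fun l => ((k : ℂ) - l) * l * (|l| : ℝ) * ex 1 |l| η,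
      fun l => ((k : ℂ) - l) * (l : ℂ) ^ 2 * ex 1 |l| η] (by
        intro i
        fin_cases i
        · exact A1 (((Adm.const _).mul s1).mul a1)
        · exact A1 (((Adm.const _).mul s1).mul a2)
        · exact A1 a1
        · exact A1 a2
        · exact A1 b2
        · exact A1 b5) (fun l => by
        have q1 := abs_sqC l
        have q2 := abs_sqC (k - l)
        simp [Fin.sum_univ_succ]
        push_cast at q2
        linear_combination (-(δ : ℂ) / 2 * l * ex 1 |l| η) * q1
          + (-(δ : ℂ) / 2 * (k - l) * ex 1 |k - l| η) * q2)
  -- The kernels with the symmetric exponential `e^{-(|k-l|+|l|)η}`.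
  have e2 := quad_relation hg ![-1 / 4, -δ * k / 4, -δ / 2, 1 / 2, -1 / 2]
    ![fun l => -(1 : ℝ) * ((|k - l| + |l| : ℝ) : ℂ) * ((|k - l| : ℝ) * (|l| : ℝ) - ((k : ℂ) - l) * l)
        * ex 1 (|k - l| + |l|) η,
      fun l => ((|k - l| : ℝ) * (|l| : ℝ) - ((k : ℂ) - l) * l) * ex 1 (|k - l| + |l|) η,
      fun l => (|k - l| : ℝ) * l * ((|k - l| : ℝ) - (|l| : ℝ)) * ex 1 (|k - l| + |l|) η,
      fun l => ((k : ℂ) - l) * l * (|l| : ℝ) * ex 1 (|k - l| + |l|) η,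
      fun l => (|k - l| : ℝ) * (l : ℂ) ^ 2 * ex 1 (|k - l| + |l|) η] (by
        intro i
        fin_cases i
        · exact A2 (((Adm.const _).mul s2).mul a3)
        · exact A2 a3
        · exact A2 b1
        · exact A2 b2
        · exact A2 b4) (fun l => by
        have q1 := abs_sqC l
        have q2 := abs_sqC (k - l)
        simp [Fin.sum_univ_succ, add_comm |l| |k - l|]
        push_cast at q2
        linear_combination (ex 1 (|k - l| + |l|) η * (-(δ : ℂ) / 2 * l + (|l| : ℝ) / 2)) * q2
          + (ex 1 (|k - l| + |l|) η * (-(δ : ℂ) / 2 * (k - l) + (|k - l| : ℝ) / 2)) * q1)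
  simp only [Fin.sum_univ_six, Fin.sum_univ_five, Matrix.cons_val] at e1 e2
  have hs1 := sign_mul_selfC k
  have hs2 := sign_mul_absC k
  have hk2 := abs_sqC k
  have h1 : (Real.sign k : ℂ) * (δ * k - (|k| : ℝ)) = δ * ((|k| : ℝ) - δ * k) := by
    linear_combination (δ : ℂ) * hs1 - hs2 + k * hδ'
  have h3 : -I * Real.sign k * p.w / p.d + δ / (2 * I * p.w)
      = (2 * Real.sign k * p.w ^ 2 + δ * p.d) / (2 * I * p.d * p.w) := by
    have hI := Complex.I_ne_zero
    field_simp
    linear_combination (-2 * p.w ^ 2 * (Real.sign k : ℂ)) * Complex.I_sq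
  -- The coefficient of `e^{-|k|η}φ_τ`. The factor `|k| - δk` vanishes when `e^{-|k|η}` is the
  -- homogeneous solution `e^{-δkη}`, so no resonance occurs in the plasma.
  have h4 : (-I * Real.sign k * p.w / p.d + δ / (2 * I * p.w)) * (δ * k - (|k| : ℝ))
      = δ * (p.w ^ 2 + p.B0 ^ 2) / (2 * I * p.d * p.w) * ((|k| : ℝ) - δ * k) := by
    rw [h3, div_mul_eq_mul_div, div_mul_eq_mul_div]
    congr 1
    linear_combination 2 * (p.w : ℂ) ^ 2 * h1 + δ * (δ * k - (|k| : ℝ)) * edc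
  simp only [modal, modalSource, expQuad]
  push_cast at e1 e2 ⊢
  linear_combination e1 + e2 + deriv (φ k) τ * ex 1 |k| η * h4
    + 1 / 2 * (ψ k τ + quad φ (fun l => ((|l| : ℝ) : ℂ)) k τ) * ex 1 |k| η * (hk2 - k ^ 2 * hδ')
    + k / 2 * quad φ (fun l => (l : ℂ) * (|l| : ℝ) * ex 1 |l| η) k τ * hδ'

/-- The values on the interface. -/
lemma modal_boundary (hw : p.w ≠ 0) (hg : Good φ τ k) :
    modal p φ ψ 1 k τ 0 - modal p φ ψ (-1) k τ 0 = r1hat p φ k τ / (I * p.w) - k * ψ k τ := by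
  have hwc : (p.w : ℂ) ≠ 0 := by exact_mod_cast hw
  have hI := Complex.I_ne_zero
  -- The combined kernel `|k - l| l - (k - l)|l|` is antisymmetric under `l ↦ k - l`.
  have e := quad_relation hg ![1, -(k : ℂ), 1]
    ![fun l => (l : ℂ) * (|l| : ℝ), fun l => ((|l| : ℝ) : ℂ), fun l => (|k - l| : ℝ) * (l : ℂ)] (by
      intro i
      fin_cases i
      · exact Adm.right.mul Adm.abs_right
      · exact Adm.abs_right
      · exact Adm.abs_left.mul Adm.right) (fun l => by
      simp [Fin.sum_univ_succ]
      ring)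
  simp only [Fin.sum_univ_three, Matrix.cons_val] at e
  simp only [modal, expQuad, ex_zero, mul_one, r1hat]
  field_simp
  push_cast
  linear_combination (8 * I * p.w) * e

/-- Both sides obey Duhamel's formula, so only their values at `η = 0` have to be compared. One of
them is forced by boundedness, according to the sign of `k`; the other follows from the kinematic
relation `modal_boundary`. -/
lemma coef_eq (hd : p.d ≠ 0) (hw : p.w ≠ 0) (hg : Good φ τ k) (hk : k ≠ 0) {η : ℝ} (hη : 0 ≤ η) :
    acoef p φ ψ k η τ = modal p φ ψ 1 k τ η ∧ bcoef p φ ψ k η τ = modal p φ ψ (-1) k τ η := by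
  have key : ∀ δ : ℝ, δ ^ 2 = 1 → (∀ η, 0 ≤ η → modal p φ ψ δ k τ η = exp (-((δ * k : ℝ) : ℂ) * η) *
      (modal p φ ψ δ k τ 0 + ∫ y in (0 : ℝ)..η, modalSource p φ δ k τ y * exp (((δ * k : ℝ) : ℂ) * y))) ∧
      (δ * k < 0 → modal p φ ψ δ k τ 0
        = -∫ y in Ioi (0 : ℝ), modalSource p φ δ k τ y * exp (((δ * k : ℝ) : ℂ) * y)) := fun δ hδ => by
    obtain ⟨m1, m2⟩ := bddOn_modal (p := p) (ψ := ψ) hg δ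
    obtain ⟨C₁, hC₁⟩ := m1.2
    obtain ⟨C₂, hC₂⟩ := m2.2
    exact duhamel (C := max C₁ C₂) m1.1 m2.1 (fun η hη => hasDerivAt_modal hd hw hg hδ hη)
      fun η hη => ⟨(hC₁ η hη).trans (le_max_left _ _), (hC₂ η hη).trans (le_max_right _ _)⟩
  obtain ⟨f1, g1⟩ := key 1 (by norm_num)
  obtain ⟨f2, g2⟩ := key (-1) (by norm_num)
  have hb := modal_boundary (ψ := ψ) hw hg
  have i1 : ∀ y ∈ Ioi (0 : ℝ), modalSource p φ 1 k τ y = dotProduct (L p) (phat p φ k y τ) :=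
    fun y hy => (dot_L hd hw hg (le_of_lt hy)).1.symm
  have i2 : ∀ y ∈ Ioi (0 : ℝ), modalSource p φ (-1) k τ y = dotProduct (Lbar p) (phat p φ k y τ) :=
    fun y hy => (dot_L hd hw hg (le_of_lt hy)).2.symm
  have hdA : k < 0 → decayA p φ k τ = modal p φ ψ 1 k τ 0 := fun h => by
    rw [g1 (by simpa using h), decayA, setIntegral_congr_fun measurableSet_Ioi fun y hy => by
      rw [← i1 y hy]]
    simp
  have hdB : 0 < k → decayB p φ k τ = modal p φ ψ (-1) k τ 0 := fun h => by
    rw [g2 (by simpa using h), decayB, setIntegral_congr_fun measurableSet_Ioi fun y hy => by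
      rw [← i2 y hy]]
    simp
  have h0 : a0 p φ ψ k τ = modal p φ ψ 1 k τ 0 ∧ b0 p φ ψ k τ = modal p φ ψ (-1) k τ 0 := by
    rcases lt_or_gt_of_ne hk with h | h
    · rw [a0, b0, if_neg h.not_gt, if_neg h.not_gt, hdA h]
      exact ⟨rfl, by linear_combination hb⟩
    · rw [a0, b0, if_pos h, if_pos h, hdB h]
      exact ⟨by linear_combination -hb, rfl⟩
  constructor
  · rw [acoef, f1 η hη, h0.1, intervalIntegral.integral_congr_Ioo_of_le hη fun y hy => by
      rw [← i1 y hy.1]]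
    simp
  · rw [bcoef, f2 η hη, h0.2, intervalIntegral.integral_congr_Ioo_of_le hη fun y hy => by
      rw [← i2 y hy.1]]
    simp

/-- The second order plasma terms are given by the formulas. -/
lemma model_U2h_eq_U2hat (hd : p.d ≠ 0) (hw : p.w ≠ 0) (hg : Good φ τ k) (hk : k ≠ 0) {η : ℝ}
    (hη : 0 ≤ η) (i : Fin 5) : (model p φ₁ φ₂ φ ψ).U2h i k η τ = U2hat p φ ψ i k η τ := by
  have hdc : (p.d : ℂ) ≠ 0 := by exact_mod_cast hd
  have hwc : (p.w : ℂ) ≠ 0 := by exact_mod_cast hw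
  have hkc : (k : ℂ) ≠ 0 := by exact_mod_cast hk
  have hI := Complex.I_ne_zero
  have edc : (p.d : ℂ) = p.w ^ 2 - p.B0 ^ 2 := by rw [Params.d]; push_cast; ring
  have hη' : 0 ≤ 1 * η := by simpa using hη
  have hs1 := sign_mul_selfC k
  -- After symmetrization the convolution in the first component of `phat` is `-k/2` times the one
  -- in the quadratic pressure.
  have e1 := quad_relation hg ![(k : ℂ) / 2, 1]
    ![fun l => ((|k - l| : ℝ) * (|l| : ℝ) - ((k : ℂ) - l) * l) * ex 1 (|k - l| + |l|) η,
      fun l => (|k - l| : ℝ) * l * ((|k - l| : ℝ) - (|l| : ℝ)) * ex 1 (|k - l| + |l|) η] (by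
        intro i
        fin_cases i
        · exact ((Adm.abs_left.mul Adm.abs_right).sub (Adm.left.mul Adm.right)).mul_ex hη'
            (by fun_prop) fun l => by positivity
        · exact ((Adm.abs_left.mul Adm.right).mul (Adm.abs_left.sub Adm.abs_right)).mul_ex hη'
            (by fun_prop) fun l => by positivity) (fun l => by
        have q1 := abs_sqC l
        have q2 := abs_sqC (k - l)
        simp [Fin.sum_univ_succ, add_comm |l| |k - l|]
        push_cast at q2
        linear_combination ex 1 (|k - l| + |l|) η * (l * q2 + (k - l) * q1))
  simp only [Fin.sum_univ_two, Matrix.cons_val] at e1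
  obtain ⟨h1, h2⟩ := coef_eq (ψ := ψ) hd hw hg hk hη
  rw [U2hat, h1, h2]
  obtain ⟨m1, m2⟩ := modal_eq (φ₁ := φ₁) (φ₂ := φ₂) (ψ := ψ) hd hw hg hη
  -- Components `1` and `4` merely invert `modal_eq`; the others require the explicit convolutions.
  have hi : i = 1 ∨ i = 4 ∨ i = 0 ∨ i = 2 ∨ i = 3 := by fin_cases i <;> simp
  rcases hi with rfl | rfl | rfl | rfl | rfl
  · rw [m1, m2]
    simp [Svec, R, Rbar]
    field_simp
    ring
  · rw [m1, m2]
    simp [Svec, R, Rbar]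
    field_simp
    ring
  all_goals
    simp only [modal, Svec, model_U2h_eq hg hη]
    rw [phat_eq hg hη]
    simp [dotProduct, Fin.sum_univ_five, L1, L3, L4, R, Rbar, Params.plasmaEta, Params.plasmaTheta,
      Params.slow1, Params.slow2, Params.pressure]
    simp only [expQuad] at e1 ⊢
    generalize quad φ (fun l => ((|k - l| : ℝ) * (|l| : ℝ) - ((k : ℂ) - l) * l) *
      ex 1 (|k - l| + |l|) η) k τ = B₁ at e1 ⊢
    generalize quad φ (fun l => (|k - l| : ℝ) * l * ((|k - l| : ℝ) - (|l| : ℝ)) *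
      ex 1 (|k - l| + |l|) η) k τ = B₂ at e1 ⊢
    generalize quad φ (fun l => (l : ℂ) ^ 2 * ex 1 |l| η) k τ = A₁
    generalize quad φ (fun l => (l : ℂ) * (|l| : ℝ) * ex 1 |l| η) k τ = A₂
    generalize quad φ _ k τ = A₀
    field_simp
  · linear_combination (8 * I * p.w * p.d) * e1
      + deriv (φ k) τ * ex 1 |k| η * ((8 * p.d - 16 * p.w ^ 2) * hs1 + 8 * (|k| : ℝ) * edc)
      + (deriv (φ k) τ * ex 1 |k| η * (-8 * Real.sign k * p.d * k - 8 * (|k| : ℝ) * (p.w ^ 2 + p.B0 ^ 2)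
        + 4 * k * (4 * p.w ^ 2 * Real.sign k + p.d)) - 8 * I * p.w * p.d * B₂) * Complex.I_sq
  · linear_combination -(8 * I * p.w * p.d * p.B0) * e1
      + deriv (φ k) τ * ex 1 |k| η * (16 * p.B0 * p.w ^ 2) * hs1
      - p.B0 * (deriv (φ k) τ * ex 1 |k| η * (-16 * p.w ^ 2 * (|k| : ℝ)
        + 4 * k * (4 * p.w ^ 2 * Real.sign k + p.d)) - 8 * I * p.w * p.d * B₂) * Complex.I_sq
  · linear_combination -(p.B0 * deriv (φ k) τ * ex 1 |k| η * -4 * p.d) * Complex.I_sq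

/-- The first order plasma terms are given by the formulas. -/
lemma model_U1h_eq_U1hat (hk : k ≠ 0) (η : ℝ) (i : Fin 5) :
    (model p φ₁ φ₂ φ ψ).U1h i k η τ = U1hat p φ i k η τ := by
  simp only [model, modeHat, hker, U1hat]
  rcases lt_or_gt_of_ne hk with h | h
  · rw [if_neg h.not_gt, abs_of_neg h]
    fin_cases i <;> simp [R, Rbar, Params.plasmaEta, Params.plasmaTheta] <;> ring
  · rw [if_pos h, abs_of_pos h]
    fin_cases i <;> simp [R, Params.plasmaEta, Params.plasmaTheta] <;> ring

end Plasma

/-! ## The second order terms in vacuum -/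

/-- Green's representation on the half-line `η ≤ 0`. -/
lemma green_representation {h h₁ h₂ : ℝ → ℂ} {κ : ℝ} (hκ : 0 < κ) (b : BddOn (Iic 0) h)
    (b₁ : BddOn (Iic 0) h₁) (b₂ : BddOn (Iic 0) h₂) (d : ∀ y, y < 0 → HasDerivAt h (h₁ y) y)
    (d₁ : ∀ y, y < 0 → HasDerivAt h₁ (h₂ y) y) {η : ℝ} (hη : η ≤ 0) :
    ∫ y in Iio (0 : ℝ), exp ((-κ * |η - y| : ℝ) : ℂ) * (κ ^ 2 * h y - h₂ y)
      = 2 * κ * h η - exp ((κ * η : ℝ) : ℂ) * (κ * h 0 + h₁ 0) := by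
  have hexp : ∀ (c y : ℝ), HasDerivAt (fun y : ℝ => exp ((c * (y - η) : ℝ) : ℂ))
      (c * exp ((c * (y - η) : ℝ) : ℂ)) y := fun c y => by
    have : HasDerivAt (fun y : ℝ => exp ((c * (y - η) : ℝ) : ℂ))
      (exp ((c * (y - η) : ℝ) : ℂ) * ((c * 1 : ℝ) : ℂ)) y :=
      ((((hasDerivAt_id y).sub_const η).const_mul c).ofReal_comp).cexp
    refine this.congr_deriv ?_
    push_cast
    ring
  have hcexp : ∀ c : ℝ, Continuous (fun y : ℝ => exp ((c * (y - η) : ℝ) : ℂ)) := fun c => by fun_prop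
  have bF : BddOn (Iic 0) (fun y => κ ^ 2 * h y - h₂ y) := (b.const_mul (κ ^ 2)).sub b₂
  have bA : BddOn (Iic 0) (fun y => κ * h y - h₁ y) := (b.const_mul κ).sub b₁
  have bB : BddOn (Iic 0) (fun y => κ * h y + h₁ y) := (b.const_mul κ).add b₁
  have hsub : Iic η ⊆ Iic 0 := Iic_subset_Iic.2 hη
  have hint : IntegrableOn (fun y => exp ((κ * (y - η) : ℝ) : ℂ) * (κ ^ 2 * h y - h₂ y)) (Iic η) := by
    obtain ⟨C, hC⟩ := bF.2
    have h1 : IntegrableOn (fun y : ℝ => Real.exp (κ * y) * (Real.exp (-(κ * η)) * C)) (Iic η) :=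
      (integrableOn_exp_mul_Iic hκ η).mul_const _
    refine h1.mono' (((hcexp κ).continuousOn.mul (bF.1.mono hsub)).aestronglyMeasurable
      measurableSet_Iic) ((ae_restrict_iff' measurableSet_Iic).2 (ae_of_all _ fun y hy => ?_))
    rw [norm_mul, Complex.norm_exp_ofReal, ← mul_assoc, ← Real.exp_add,
      show κ * y + -(κ * η) = κ * (y - η) by ring]
    exact mul_le_mul_of_nonneg_left (hC y (hsub hy)) (Real.exp_nonneg _)
  have hlim : Tendsto (fun y => exp ((κ * (y - η) : ℝ) : ℂ) * (κ * h y - h₁ y)) atBot (𝓝 0) := by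
    obtain ⟨C, hC⟩ := bA.2
    have l1 : Tendsto (fun y : ℝ => Real.exp (κ * (y - η)) * C) atBot (𝓝 0) := by
      have : Tendsto (fun y : ℝ => κ * (y - η)) atBot atBot :=
        (tendsto_atBot_add_const_right _ (-η) tendsto_id).const_mul_atBot hκ
      simpa using (Real.tendsto_exp_atBot.comp this).mul_const C
    refine squeeze_zero_norm' ?_ l1
    filter_upwards [eventually_le_atBot 0] with y hy
    rw [norm_mul, Complex.norm_exp_ofReal]
    exact mul_le_mul_of_nonneg_left (hC y hy) (Real.exp_nonneg _)
  -- The kernel is smooth on either side of `y = η`, and each part has an explicit antiderivative.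
  -- The values `h₁ η` from the two sides cancel, while the values `κ h η` add up.
  have i1 : ∫ y in Iic η, exp ((-κ * |η - y| : ℝ) : ℂ) * (κ ^ 2 * h y - h₂ y) = κ * h η - h₁ η := by
    rw [setIntegral_congr_fun (g := fun y => exp ((κ * (y - η) : ℝ) : ℂ) * (κ ^ 2 * h y - h₂ y))
      measurableSet_Iic fun y (hy : y ≤ η) => by
        beta_reduce
        rw [abs_of_nonneg (sub_nonneg.2 hy), show -κ * (η - y) = κ * (y - η) by ring],
      integral_Iic_of_hasDerivAt_of_tendsto (f := fun y => exp ((κ * (y - η) : ℝ) : ℂ) *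
        (κ * h y - h₁ y)) (((hcexp κ).continuousOn.mul (bA.1.mono hsub)) η self_mem_Iic)
        (fun y hy => ?_) hint hlim]
    · simp
    · have hy0 : y < 0 := lt_of_lt_of_le hy hη
      refine ((hexp κ y).mul (((d y hy0).const_mul (κ : ℂ)).sub (d₁ y hy0))).congr_deriv ?_
      simp only [Pi.sub_apply]
      ring
  have hi : IntervalIntegrable (fun y => exp ((-κ * (y - η) : ℝ) : ℂ) * (κ ^ 2 * h y - h₂ y))
      volume η 0 := ((hcexp (-κ)).continuousOn.mul
    (bF.1.mono (by rw [uIcc_of_le hη]; exact Icc_subset_Iic_self))).intervalIntegrable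
  have i2 : ∫ y in η..0, exp ((-κ * |η - y| : ℝ) : ℂ) * (κ ^ 2 * h y - h₂ y)
      = κ * h η + h₁ η - exp ((κ * η : ℝ) : ℂ) * (κ * h 0 + h₁ 0) := by
    rw [intervalIntegral.integral_congr_Ioo_of_le (g := fun y => exp ((-κ * (y - η) : ℝ) : ℂ) *
      (κ ^ 2 * h y - h₂ y)) hη fun y hy => by
        beta_reduce
        rw [abs_sub_comm, abs_of_nonneg (sub_nonneg.2 hy.1.le)],
      intervalIntegral.integral_eq_sub_of_hasDerivAt_of_le hη
      (f := fun y => -(exp ((-κ * (y - η) : ℝ) : ℂ) * (κ * h y + h₁ y)))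
      (((hcexp (-κ)).continuousOn.mul (bB.1.mono Icc_subset_Iic_self)).neg) (fun y hy => ?_)
      hi]
    · simp
      ring
    · refine ((hexp (-κ) y).mul (((d y hy.2).const_mul (κ : ℂ)).add (d₁ y hy.2))).neg.congr_deriv ?_
      simp only [Pi.add_apply]
      push_cast
      ring
  have hc2 : IntegrableOn (fun y => exp ((-κ * |η - y| : ℝ) : ℂ) * (κ ^ 2 * h y - h₂ y)) (Ioc η 0) := by
    refine (ContinuousOn.integrableOn_Icc (ContinuousOn.mul (Continuous.continuousOn (by fun_prop))
      (bF.1.mono Icc_subset_Iic_self))).mono_set Ioc_subset_Icc_self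
  have hc1 : IntegrableOn (fun y => exp ((-κ * |η - y| : ℝ) : ℂ) * (κ ^ 2 * h y - h₂ y)) (Iic η) :=
    hint.congr_fun (fun y (hy : y ≤ η) => by
      beta_reduce
      rw [abs_of_nonneg (sub_nonneg.2 hy), show -κ * (η - y) = κ * (y - η) by ring]) measurableSet_Iic
  rw [← integral_Iic_eq_integral_Iio, ← Iic_union_Ioc_eq_Iic hη, setIntegral_union
    (Iic_disjoint_Ioc le_rfl) measurableSet_Ioc hc1 hc2, i1, ← intervalIntegral.integral_of_le hη, i2]
  ring

section Vacuum
variable {p : Params} {φ ψ : ℝ → ℝ → ℂ} {φ₁ φ₂ : ℝ × ℝ → ℝ} {k τ : ℝ}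

/-- The `n`-th derivative of the convolution with kernel `ℓ|ℓ|e^{σ|ℓ|η}`. -/
noncomputable def vacuumQuad (p : Params) (φ : ℝ → ℝ → ℂ) (k τ : ℝ) (n : ℕ) (η : ℝ) : ℂ :=
  expQuad φ k τ (-p.sigma) (fun l => |l|) (fun l => (p.sigma * (|l| : ℝ) : ℂ) ^ n * (l * (|l| : ℝ))) η

/-- The `n`-th derivative of a particular solution of the second order equations. -/
noncomputable def particular (p : Params) (φ : ℝ → ℝ → ℂ) (k τ : ℝ) (n : ℕ) (η : ℝ) : ℂ :=
  -(p.nu ^ 2 * p.lam * p.H0 / p.sigma * (|k| : ℝ) * deriv (φ k) τ) *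
    ((p.sigma * (|k| : ℝ) : ℂ) ^ n * (η * ex (-p.sigma) |k| η)
      + n * (p.sigma * (|k| : ℝ) : ℂ) ^ (n - 1) * ex (-p.sigma) |k| η)
  + -(I * p.sigma * p.H0) * vacuumQuad p φ k τ n η

lemma exp_eq_ex (x η : ℝ) : exp (p.sigma * x * η) = ex (-p.sigma) x η := by simp [ex]

lemma adm_particular (n : ℕ) :
    Adm k (fun l => (p.sigma * (|l| : ℝ) : ℂ) ^ n * (l * (|l| : ℝ))) :=
  (((Adm.const _).mul Adm.abs_right).pow n).mul (Adm.right.mul Adm.abs_right)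

lemma bddOn_mul_ex {κ x : ℝ} (h : 0 < κ * x) : BddOn (Iic 0) (fun η => η * ex (-κ) x η) := by
  refine ⟨(Complex.continuous_ofReal.mul (continuous_ex _ _)).continuousOn, (κ * x)⁻¹,
    fun η hη => ?_⟩
  have hη' : η ≤ 0 := hη
  rw [norm_mul, Complex.norm_real, ex, Complex.norm_exp_ofReal, Real.norm_eq_abs, abs_of_nonpos hη',
    neg_neg, ← one_div, le_div_iff₀ h]
  have h1 := Real.add_one_le_exp (-(κ * x * η))
  have h2 := Real.exp_pos (κ * x * η)
  have h3 : Real.exp (-(κ * x * η)) * Real.exp (κ * x * η) = 1 := by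
    rw [← Real.exp_add, neg_add_cancel, Real.exp_zero]
  nlinarith

lemma bddOn_particular (hσ : 0 < p.sigma) (hg : Good φ τ k) (hk : k ≠ 0) (n : ℕ) :
    BddOn (Iic 0) (particular p φ k τ n) := by
  have hk' := abs_pos.2 hk
  exact ((((bddOn_mul_ex (mul_pos hσ hk')).const_mul _).add
    ((BddOn.ex (vacuum_domain hσ) hk'.le).const_mul _)).const_mul _).add
    ((BddOn.expQuad (vacuum_domain hσ) hg (adm_particular n) (by fun_prop)
      fun l => abs_nonneg l).const_mul _)

lemma hasDerivAt_particular (hσ : 0 < p.sigma) (hg : Good φ τ k) (n : ℕ) {η : ℝ}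
    (hη : η < 0) : HasDerivAt (particular p φ k τ n) (particular p φ k τ (n + 1) η) η := by
  have hE := hasDerivAt_ex (-p.sigma) |k| η
  have hη' : 0 < -p.sigma * η := by nlinarith
  have hD := hasDerivAt_expQuad (α := fun l => |l|) hη' hg (adm_particular (p := p) n) Adm.abs_right
    fun l => abs_nonneg l
  have hI : HasDerivAt (fun y : ℝ => (y : ℂ)) 1 η := by simpa using (hasDerivAt_id η).ofReal_comp
  refine (((((hI.mul hE).const_mul _).add (hE.const_mul _)).const_mul _).add
    (hD.const_mul _)).congr_deriv ?_
  -- For `n = 0` the truncated exponent `n - 1` is harmless because of the factor `n`.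
  have hn : (n : ℂ) * (p.sigma * (|k| : ℝ) : ℂ) ^ (n - 1) * (p.sigma * (|k| : ℝ))
      = n * (p.sigma * (|k| : ℝ) : ℂ) ^ n := by
    cases n with
    | zero => simp
    | succ n => rw [Nat.add_sub_cancel, pow_succ]; ring
  have hq : expQuad φ k τ (-p.sigma) (fun l => |l|) (fun l => -((-p.sigma : ℝ) : ℂ) * (|l| : ℝ) *
      ((p.sigma * (|l| : ℝ) : ℂ) ^ n * (l * (|l| : ℝ)))) η = vacuumQuad p φ k τ (n + 1) η := by
    rw [vacuumQuad]
    congr 1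
    funext l
    push_cast
    ring
  rw [hq, particular, Nat.add_sub_cancel]
  push_cast
  linear_combination -(p.nu ^ 2 * p.lam * p.H0 / p.sigma * (|k| : ℝ) * deriv (φ k) τ) *
    ex (-p.sigma) |k| η * hn

lemma vacuumQuad_sub (hσ : 0 < p.sigma) (hg : Good φ τ k) (n : ℕ) {η : ℝ} (hη : η ≤ 0) :
    (p.sigma * (|k| : ℝ) : ℂ) ^ 2 * vacuumQuad p φ k τ n η - vacuumQuad p φ k τ (n + 2) η
      = p.sigma ^ (n + 2) * quad φ (fun l => ((k : ℂ) ^ 2 - (l : ℂ) ^ 2) * (l * (|l| : ℝ) ^ (n + 1)) *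
        ex (-p.sigma) |l| η) k τ := by
  have h := fun n => (adm_particular (p := p) (k := k) n).mul_ex (α := fun l => |l|)
    (vacuum_domain hσ η hη) (by fun_prop) fun l => abs_nonneg l
  rw [vacuumQuad, vacuumQuad, expQuad, expQuad, ← quad_const_mul, ← quad_const_mul,
    ← quad_sub hg ((Adm.const _).mul (h n)) (h (n + 2))]
  congr 1
  funext l
  linear_combination p.sigma ^ (n + 2) * (|l| : ℝ) ^ (n + 1) * l * ex (-p.sigma) |l| η *
    (abs_sqC k - abs_sqC l)

/-- `particular` is chosen so that `σ²k² - ∂_η²` maps it to `Q`: its term with the factor `η` yields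
the resonant part, and on the kernel `l|l|e^{σ|l|η}` the operator acts as multiplication by `σ²(k² -
l²)`. -/
lemma Q_eq (hσ : 0 < p.sigma) (hg : Good φ τ k) {η : ℝ} (hη : η ≤ 0) :
    Q p φ k η τ = (p.sigma * (|k| : ℝ) : ℂ) ^ 2 * particular p φ k τ 0 η - particular p φ k τ 2 η := by
  have h := vacuumQuad_sub (φ := φ) hσ hg 0 hη
  have hσc : (p.sigma : ℂ) ≠ 0 := by exact_mod_cast hσ.ne'
  have e : quad φ (fun l => (k ^ 2 - l ^ 2) * l * |l| * exp (p.sigma * |l| * η)) k τ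
      = quad φ (fun l => ((k : ℂ) ^ 2 - (l : ℂ) ^ 2) * (l * (|l| : ℝ) ^ (0 + 1)) *
        ex (-p.sigma) |l| η) k τ := by
    congr 1; funext l; rw [exp_eq_ex]; ring
  rw [← e] at h
  rw [Q, exp_eq_ex]
  simp only [particular]
  generalize quad φ _ k τ = Z at h ⊢
  push_cast
  field_simp
  linear_combination (p.sigma * p.H0 * I) * h
    - (2 * p.nu ^ 2 * p.lam * p.H0 * ex (-p.sigma) |k| η * deriv (φ k) τ) * abs_sqC k

/-- The same relation differentiated once, which shifts the index of `particular` by one. -/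
lemma dQ_eq (hσ : 0 < p.sigma) (hg : Good φ τ k) {η : ℝ} (hη : η ≤ 0) :
    dQ p φ k η τ = (p.sigma * (|k| : ℝ) : ℂ) ^ 2 * particular p φ k τ 1 η - particular p φ k τ 3 η := by
  have h := vacuumQuad_sub (φ := φ) hσ hg 1 hη
  have hσc : (p.sigma : ℂ) ≠ 0 := by exact_mod_cast hσ.ne'
  have e : quad φ (fun l => (k ^ 2 - l ^ 2) * l ^ 3 * exp (p.sigma * |l| * η)) k τ
      = quad φ (fun l => ((k : ℂ) ^ 2 - (l : ℂ) ^ 2) * (l * (|l| : ℝ) ^ (1 + 1)) *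
        ex (-p.sigma) |l| η) k τ := by
    congr 1
    funext l
    rw [exp_eq_ex]
    linear_combination -(k ^ 2 - l ^ 2) * l * ex (-p.sigma) |l| η * abs_sqC l
  rw [← e] at h
  rw [dQ, exp_eq_ex]
  simp only [particular]
  generalize quad φ _ k τ = Z at h ⊢
  push_cast
  field_simp
  linear_combination (p.H0 * I) * h
    - (2 * p.nu ^ 2 * p.lam * p.H0 * (|k| : ℝ) * ex (-p.sigma) |k| η * deriv (φ k) τ) * abs_sqC k

/-- For a source of the form `κ²h - h''` the Green integral is `2κh` minus a boundary term, so no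
integral in `y` remains. -/
lemma green_eq (hσ : 0 < p.sigma) (hg : Good φ τ k) (hk : k ≠ 0) (n : ℕ) {F : ℝ → ℂ}
    (hF : ∀ y, y ≤ 0 → F y = (p.sigma * (|k| : ℝ) : ℂ) ^ 2 * particular p φ k τ n y
      - particular p φ k τ (n + 2) y) {η : ℝ} (hη : η ≤ 0) :
    green p F k η = 2 * (p.sigma * (|k| : ℝ)) * particular p φ k τ n η
      - ex (-p.sigma) |k| η * ((p.sigma * (|k| : ℝ)) * particular p φ k τ n 0
        + particular p φ k τ (n + 1) 0) := by
  have h := green_representation (κ := p.sigma * |k|) (mul_pos hσ (abs_pos.2 hk))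
    (bddOn_particular hσ hg hk n) (bddOn_particular hσ hg hk (n + 1))
    (bddOn_particular hσ hg hk (n + 2)) (fun y hy => hasDerivAt_particular hσ hg n hy)
    (fun y hy => hasDerivAt_particular hσ hg (n + 1) hy) hη
  have e' : exp ((p.sigma * |k| * η : ℝ) : ℂ) = ex (-p.sigma) |k| η := by simp [ex]
  rw [e'] at h
  push_cast at h
  rw [← h, green]
  refine setIntegral_congr_fun measurableSet_Iio fun y hy => ?_
  rw [hF y (le_of_lt hy)]
  simp

lemma model_V2h_eq (hg : Good φ τ k) (hσ : 0 < p.sigma) {η : ℝ} (hη : η ≤ 0) (i : Fin 3) :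
    (model p φ₁ φ₂ φ ψ).V2h i k η τ
      = p.vacuumEta i * p.sigma ^ 2 *
          expQuad φ k τ (-p.sigma) (fun l => |l|) (fun l => (l : ℂ) ^ 2) η
        + p.vacuumTheta i * p.sigma * I *
          expQuad φ k τ (-p.sigma) (fun l => |l|) (fun l => (l : ℂ) * (|l| : ℝ)) η
        + (p.vacuumEta i * (p.sigma * (|k| : ℝ)) + p.vacuumTheta i * I * k) * ex (-p.sigma) |k| η
          * (ψ k τ - p.sigma * quad φ (fun l => ((|l| : ℝ) : ℂ)) k τ)
        + (-p.slowV1 i * I * Real.sign k + p.slowV2 i * η * I * k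
          + p.slowV3 i * η * (p.sigma * (|k| : ℝ)) + p.slowV4 i) * ex (-p.sigma) |k| η
          * deriv (φ k) τ := by
  simp only [model]
  rw [conv_modeN_eq hg (vacuum_domain hσ η hη)]
  simp only [modeHat, omegaHat, quad_abs_eq, tauHat, hker, ex, pow_zero, pow_one, one_mul, mul_one]
  push_cast
  ring

/-- The second order vacuum terms are given by the formulas. -/
lemma model_V2h_eq_V2hat (hσ : 0 < p.sigma) (hg : Good φ τ k) (hk : k ≠ 0) {η : ℝ}
    (hη : η ≤ 0) (i : Fin 3) : (model p φ₁ φ₂ φ ψ).V2h i k η τ = V2hat p φ ψ i k η τ := by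
  have hσc : (p.sigma : ℂ) ≠ 0 := by exact_mod_cast hσ.ne'
  have hkc : (k : ℂ) ≠ 0 := by exact_mod_cast hk
  have hac : ((|k| : ℝ) : ℂ) ≠ 0 := by exact_mod_cast (abs_pos.2 hk).ne'
  have hI := Complex.I_ne_zero
  have hη' := vacuum_domain hσ η hη
  have hs1 := sign_mul_selfC k
  have g0 := green_eq hσ hg hk 0 (fun y hy => Q_eq hσ hg hy) hη
  have g00 := green_eq hσ hg hk 0 (fun y hy => Q_eq hσ hg hy) le_rfl
  have g1 := green_eq hσ hg hk 1 (fun y hy => dQ_eq hσ hg hy) hη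
  have q0 := Q_eq (φ := φ) hσ hg le_rfl
  have e := quad_relation hg ![1, -(k : ℂ), 1]
    ![fun l => (l : ℂ) * (|l| : ℝ), fun l => ((|l| : ℝ) : ℂ), fun l => (|k - l| : ℝ) * (l : ℂ)] (by
      intro i
      fin_cases i
      · exact Adm.right.mul Adm.abs_right
      · exact Adm.abs_right
      · exact Adm.abs_left.mul Adm.right) (fun l => by
      simp [Fin.sum_univ_succ]
      ring)
  -- From `(k - l)l² + l|l|² = k l²`: the explicit convolution in the formula for `H₁` and the
  -- derivative of the particular solution combine into the convolution of the closed form.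
  have e3 : quad φ (fun l => (k - l) * l ^ 2 * exp (p.sigma * |l| * η)) k τ * p.sigma
      + vacuumQuad p φ k τ 1 η
      = p.sigma * k * expQuad φ k τ (-p.sigma) (fun l => |l|) (fun l => (l : ℂ) ^ 2) η := by
    simp only [exp_eq_ex]
    rw [vacuumQuad, expQuad, expQuad, mul_comm _ (p.sigma : ℂ), ← quad_const_mul, ← quad_const_mul,
      ← quad_add hg ((Adm.const _).mul ((Adm.left.mul (Adm.right.pow 2)).mul_ex hη' (by fun_prop)
        fun l => abs_nonneg l)) ((adm_particular 1).mul_ex hη' (by fun_prop) fun l => abs_nonneg l)]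
    congr 1
    funext l
    linear_combination p.sigma * l * ex (-p.sigma) |l| η * abs_sqC l
  have e0 : expQuad φ k τ (-p.sigma) (fun l => |l|) (fun l => (l : ℂ) * (|l| : ℝ)) η
      = vacuumQuad p φ k τ 0 η := by
    rw [vacuumQuad]
    simp only [pow_zero, one_mul]
  have e00 : quad φ (fun l => (l : ℂ) * (|l| : ℝ)) k τ = vacuumQuad p φ k τ 0 0 := by
    simp only [vacuumQuad, expQuad, pow_zero, one_mul, ex_zero, mul_one]
  simp only [Fin.sum_univ_three, Matrix.cons_val] at e
  rw [e00] at e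
  rw [ex_zero] at g00
  rw [model_V2h_eq hg hσ hη, e0]
  simp only [V2hat, Acoef, r3hat, g0, g00, g1, q0, exp_eq_ex] at e3 ⊢
  generalize expQuad φ k τ (-p.sigma) _ _ η = A₁ at e3 ⊢
  generalize quad φ (fun l => (k - l) * l ^ 2 * ex (-p.sigma) |l| η) k τ = A₂ at e3 ⊢
  generalize quad φ (fun l => ((|l| : ℝ) : ℂ)) k τ = A₃ at e ⊢
  generalize quad φ (fun l => (|k - l| : ℝ) * (l : ℂ)) k τ = A₄ at e ⊢
  simp only [particular, ex_zero]
  fin_cases i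
  · simp [Params.vacuumEta, Params.vacuumTheta, Params.slowV1, Params.slowV2, Params.slowV3, Params.slowV4]
    field_simp
    linear_combination p.H0 * ex (-p.sigma) |k| η * (p.sigma ^ 3 * (|k| : ℝ) * I * A₄ * 2 + p.sigma ^ 3 * (|k| : ℝ) * I * vacuumQuad p φ k τ 0 0
        - (|k| : ℝ) * p.nu ^ 2 * p.lam * deriv (φ k) τ - p.sigma ^ 2 * I * vacuumQuad p φ k τ 1 0
        - p.sigma ^ 2 * (|k| : ℝ) * ψ k τ * I * k * 2)
        * (Real.sign k * k * Complex.I_sq - hs1)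
      + 2 * p.H0 * (|k| : ℝ) * p.nu ^ 2 * p.lam * deriv (φ k) τ * ex (-p.sigma) |k| η *
        ((Real.sign k * k + p.sigma * η * k ^ 2) * Complex.I_sq - hs1 + p.sigma * η * abs_sqC k)
      + 2 * p.H0 * (|k| : ℝ) * I * p.sigma ^ 2 * (e3 - (|k| : ℝ) * p.sigma * ex (-p.sigma) |k| η * e)
  · simp [Params.vacuumEta, Params.vacuumTheta, Params.slowV1, Params.slowV2, Params.slowV3, Params.slowV4]
    field_simp
    linear_combination 2 * p.H0 * p.sigma ^ 3 * I * (|k| : ℝ) * ex (-p.sigma) |k| η * e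
  · simp [Params.vacuumEta, Params.vacuumTheta, Params.slowV1, Params.slowV2, Params.slowV3, Params.slowV4]
    field_simp
    linear_combination
      -(2 * p.nu * p.lam * p.H0 * p.sigma ^ 3 * I * (|k| : ℝ) * ex (-p.sigma) |k| η) * e

/-- The first order vacuum terms are given by the formulas. -/
lemma model_V1h_eq_V1hat (η : ℝ) (i : Fin 3) :
    (model p φ₁ φ₂ φ ψ).V1h i k η τ = V1hat p φ i k η τ := by
  simp only [model, modeHat, hker, V1hat]
  fin_cases i <;> simp [Params.vacuumEta, Params.vacuumTheta] <;> ring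

end Vacuum

/-! ## The amplitude equation -/

/-- For each pattern of signs `|k| + |k - l| + |l|` divides the numerator, so the kernel is a
quadratic expression in the frequencies and their absolute values. If the denominator vanishes, both
frequencies are zero and so are both sides. -/
lemma kernel_symm (k l : ℝ) : kernel (k - l) l
    = -(l ^ 2 + (k - l) ^ 2 - |k| * |l| - |k| * |k - l| - (|k - l| * |l| - (k - l) * l)) / 2 := by
  rw [kernel, sub_add_cancel]
  rcases eq_or_ne (|k| + |k - l| + |l|) 0 with h | h
  · have h1 : l = 0 := abs_eq_zero.1 (by linarith [abs_nonneg k, abs_nonneg (k - l), abs_nonneg l])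
    have h2 : k = 0 := abs_eq_zero.1 (by linarith [abs_nonneg k, abs_nonneg (k - l), abs_nonneg l])
    simp [h1, h2]
  · rw [div_eq_iff h]
    obtain ⟨m, rfl⟩ : ∃ m, k = m + l := ⟨k - l, by ring⟩
    rw [add_sub_cancel_right]
    rcases abs_cases m with ⟨h1, _⟩ | ⟨h1, _⟩ <;> rcases abs_cases l with ⟨h2, _⟩ | ⟨h2, _⟩ <;>
      rcases abs_cases (m + l) with ⟨h3, _⟩ | ⟨h3, _⟩ <;> rw [h1, h2, h3] <;>
      first
      | ring1
      | (exfalso; linarith)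

lemma adm_kernel (k : ℝ) : Adm k (fun l => (kernel (k - l) l : ℂ)) := by
  have a := Adm.right (k := k)
  have b := Adm.left (k := k)
  have aa := Adm.abs_right (k := k)
  have bb := Adm.abs_left (k := k)
  have h := (Adm.const (k := k) (-1 / 2)).mul (((((a.pow 2).add (b.pow 2)).sub
    ((Adm.const ((|k| : ℝ) : ℂ)).mul aa)).sub ((Adm.const ((|k| : ℝ) : ℂ)).mul bb)).sub
    ((bb.mul aa).sub (b.mul a)))
  convert h using 1
  funext l
  rw [kernel_symm]
  push_cast
  ring

section Amplitude
variable {p : Params} {φ ψ : ℝ → ℝ → ℂ} {φ₁ φ₂ : ℝ × ℝ → ℝ} {k τ : ℝ}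

/-- This combination of convolutions arises on both sides of the interface, and its symmetric part
is `-Λ`. -/
lemma quad_kernel (hg : Good φ τ k) :
    quad φ (fun l => (l : ℂ) ^ 2) k τ - (|k| : ℝ) * quad φ (fun l => ((|l| : ℝ) : ℂ)) k τ
      - (quad φ (fun l => (|k - l| : ℝ) * (|l| : ℝ)) k τ
        - quad φ (fun l => ((k : ℂ) - l) * l) k τ) / 2
      = -quad φ (fun l => (kernel (k - l) l : ℂ)) k τ := by
  have e := quad_relation hg ![1, -((|k| : ℝ) : ℂ), -1 / 2, 1 / 2, 1]
    ![fun l => (l : ℂ) ^ 2, fun l => ((|l| : ℝ) : ℂ), fun l => (|k - l| : ℝ) * (|l| : ℝ),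
      fun l => ((k : ℂ) - l) * l, fun l => (kernel (k - l) l : ℂ)] (by
      intro i
      fin_cases i
      · exact Adm.right.pow 2
      · exact Adm.abs_right
      · exact Adm.abs_left.mul Adm.abs_right
      · exact Adm.left.mul Adm.right
      · exact adm_kernel k) (fun l => by
      have h1 := kernel_symm k l
      have h2 := kernel_symm k (k - l)
      rw [sub_sub_cancel] at h2
      simp only [Fin.sum_univ_five, Matrix.cons_val, sub_sub_cancel, h1, h2]
      push_cast
      ring)
  simp only [Fin.sum_univ_five, Matrix.cons_val] at e
  linear_combination e

/-- The transform of the second order jump of the pressure. -/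
noncomputable def pressureHat (X : Terms) (p : Params) (k η τ : ℝ) : ℂ :=
  X.U2h 4 k η τ + ((-p.H0 : ℝ) * X.V2h 0 k η τ
    + ((-1 / 2 : ℝ) * (conv (X.V1h 0) (X.V1h 0) k η τ
      + (conv (X.V1h 1) (X.V1h 1) k η τ + (-1 : ℝ) * conv (X.V1h 2) (X.V1h 2) k η τ))))

lemma modeHat_eq (κ a b : ℝ) (k η τ : ℝ) :
    modeHat κ a b φ k η τ = (-a * κ * (|k| : ℝ) + b * I * k) * φ k τ * ex κ |k| η := by
  simp only [modeHat, hker, ex, pow_zero, pow_one, one_mul, mul_one]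
  push_cast
  ring

/-- The plasma contributes `d` times the combination of `quad_kernel`, the vacuum `H₀²σ² = dσ` times
the same combination, whence the factor `1 + σ`. The terms in `ψ` cancel by the dispersion relation,
so the second order profile remains free. The coefficients of `φ̂_τ` are `2w` from the plasma and
`H₀²ν²λ/σ` from vacuum, with sum `cd`. -/
lemma pressureHat_model (hσ : 0 < p.sigma) (hσ2 : p.sigma ^ 2 = 1 - p.nu ^ 2 * p.lam ^ 2)
    (hroot : p.d = p.H0 ^ 2 * p.sigma) (hd : p.d ≠ 0) (hg : Good φ τ k) (hk : k ≠ 0) :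
    pressureHat (model p φ₁ φ₂ φ ψ) p k 0 τ = -I * Real.sign k * p.d *
      (p.c * deriv (φ k) τ + I * (-(1 + p.sigma) : ℝ) * Real.sign k *
        quad φ (fun l => (kernel (k - l) l : ℂ)) k τ) := by
  have hσc : (p.sigma : ℂ) ≠ 0 := by exact_mod_cast hσ.ne'
  have hdc : (p.d : ℂ) ≠ 0 := by exact_mod_cast hd
  have hroot' : (p.d : ℂ) = p.H0 ^ 2 * p.sigma := by rw [hroot]; push_cast; ring
  have hσ2' : (p.sigma : ℂ) ^ 2 = 1 - p.nu ^ 2 * p.lam ^ 2 := by exact_mod_cast hσ2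
  have hs : (Real.sign k : ℂ) ^ 2 = 1 := by
    rcases lt_or_gt_of_ne hk with h | h
    · simp [Real.sign_of_neg h]
    · simp [Real.sign_of_pos h]
  have hI : (I : ℂ) ^ 2 = -1 := Complex.I_sq
  have hH : (p.H0 : ℂ) ^ 2 = p.d / p.sigma := by rw [hroot']; field_simp
  have hc : (p.c * p.d : ℂ) = 2 * p.w + p.H0 ^ 2 * p.nu ^ 2 * p.lam / p.sigma := by
    rw [hH, Params.c]
    push_cast
    field_simp
  have hK := quad_kernel hg
  have c0 : conv ((model p φ₁ φ₂ φ ψ).V1h 0) ((model p φ₁ φ₂ φ ψ).V1h 0) k 0 τ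
      = (p.H0 * p.sigma) ^ 2 * quad φ (fun l => (|k - l| : ℝ) * (|l| : ℝ)) k τ := by
    rw [← quad_const_mul, conv, quad]
    congr 1
    funext l
    simp [model, modeHat_eq, Params.vacuumEta, Params.vacuumTheta, ex_zero]
    ring
  have c1 : conv ((model p φ₁ φ₂ φ ψ).V1h 1) ((model p φ₁ φ₂ φ ψ).V1h 1) k 0 τ
      = -(p.H0 : ℂ) ^ 2 * quad φ (fun l => ((k : ℂ) - l) * l) k τ := by
    rw [← quad_const_mul, conv, quad]
    congr 1
    funext l
    simp [model, modeHat_eq, Params.vacuumEta, Params.vacuumTheta, ex_zero]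
    linear_combination (p.H0 : ℂ) ^ 2 * (k - l) * l * φ (k - l) τ * φ l τ * hI
  have c2 : conv ((model p φ₁ φ₂ φ ψ).V1h 2) ((model p φ₁ φ₂ φ ψ).V1h 2) k 0 τ
      = -(p.nu * p.lam * p.H0 : ℂ) ^ 2 * quad φ (fun l => ((k : ℂ) - l) * l) k τ := by
    rw [← quad_const_mul, conv, quad]
    congr 1
    funext l
    simp [model, modeHat_eq, Params.vacuumEta, Params.vacuumTheta, ex_zero]
    linear_combination (p.nu * p.lam * p.H0 : ℂ) ^ 2 * (k - l) * l * φ (k - l) τ * φ l τ * hI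
  have hp : expQuad φ k τ 1 (fun l => |k - l| + |l|)
      (fun l => (|k - l| : ℝ) * (|l| : ℝ) - ((k : ℂ) - l) * l) 0
      = quad φ (fun l => (|k - l| : ℝ) * (|l| : ℝ)) k τ - quad φ (fun l => ((k : ℂ) - l) * l) k τ := by
    simp only [expQuad, ex_zero, mul_one]
    rw [quad_sub hg (Adm.abs_left.mul Adm.abs_right) (Adm.left.mul Adm.right)]
  rw [pressureHat, c0, c1, c2, model_U2h_eq hg le_rfl, model_V2h_eq hg hσ le_rfl, hp]
  simp only [expQuad, ex_zero, mul_one]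
  generalize quad φ (fun l => (l : ℂ) * (|l| : ℝ)) k τ = Z
  generalize quad φ (fun l => (l : ℂ) ^ 2) k τ = A at hK ⊢
  generalize quad φ (fun l => ((|l| : ℝ) : ℂ)) k τ = B at hK ⊢
  generalize quad φ (fun l => (|k - l| : ℝ) * (|l| : ℝ)) k τ = C at hK ⊢
  generalize quad φ (fun l => ((k : ℂ) - l) * l) k τ = D at hK ⊢
  generalize quad φ _ k τ = E at hK ⊢
  simp [Params.plasmaEta, Params.plasmaTheta, Params.slow1, Params.slow2, Params.pressure,
    Params.vacuumEta, Params.vacuumTheta, Params.slowV1, Params.slowV2, Params.slowV3,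
    Params.slowV4]
  linear_combination p.d * (1 + p.sigma) * hK
    - (p.sigma * A + (|k| : ℝ) * (ψ k τ - p.sigma * B) - p.sigma * (C - D) / 2) * hroot'
    - p.H0 ^ 2 * D / 2 * hσ2' + I * Real.sign k * deriv (φ k) τ * hc
    - p.d * (1 + p.sigma) * E * (Real.sign k ^ 2 * hI - hs)

/-- With `D = {0}` the interior is empty and the requirements on derivatives are void, so the
calculus of products applies directly to boundary values. -/
lemma pressureHat_repr (hσ : 0 < p.sigma) {S : Set ℝ} (hS : IsOpen S) (h₁ : IsProfile S φ₁ φ)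
    (h₂ : IsProfile S φ₂ ψ) : IsField {0} S
      (fun z => (model p φ₁ φ₂ φ ψ).jump2 p (z.1, z.2.2) 1)
      (pressureHat (model p φ₁ φ₂ φ ψ) p) := by
  have hU := (isField_model_U2 (p := p) hS h₁ h₂ 4).mono (D' := {0}) (by simp)
  have hV := (isField_model_V2 (p := p) hσ hS h₁ h₂ 0).mono (D' := {0}) (by simp)
  have h1 := fun i => (isField_mode (vacuum_domain hσ) hS h₁.isField (p.vacuumEta i)
    (p.vacuumTheta i)).mono (D' := {0}) (by simp)
  have key := hU.add ((hV.const_mul (-p.H0)).add ((((h1 0).mul (h1 0) hS).add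
    (((h1 1).mul (h1 1) hS).add (((h1 2).mul (h1 2) hS).const_mul (-1)) hS) hS).const_mul (-1 / 2)) hS) hS
  exact key.congr_fun fun θ η hη τ hτ => by
      obtain rfl : η = 0 := hη
      simp only [Terms.jump2, Matrix.cons_val]
      change (model p φ₁ φ₂ φ ψ).U2 4 _ - _ * (model p φ₁ φ₂ φ ψ).V2 0 _ - (mode _ _ _ _ _ ^ 2
        + mode _ _ _ _ _ ^ 2 - mode _ _ _ _ _ ^ 2) / 2 = _
      ring

/-- For `k ≠ 0` the factor `-i sgn(k) d` can be divided out. Necessity then uses uniqueness of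
Fourier integrals, sufficiency the Fourier representation of the jump. -/
lemma jump_pressure_iff (hσ : 0 < p.sigma) (hσ2 : p.sigma ^ 2 = 1 - p.nu ^ 2 * p.lam ^ 2)
    (hroot : p.d = p.H0 ^ 2 * p.sigma) (hd : p.d ≠ 0) {S : Set ℝ} (hS : IsOpen S)
    (h₁ : IsProfile S φ₁ φ) (h₂ : IsProfile S φ₂ ψ) :
    (∀ y : ℝ × ℝ, y.2 ∈ S → (model p φ₁ φ₂ φ ψ).jump2 p y 1 = 0) ↔
      AmplitudeEq p.c (-(1 + p.sigma)) S φ := by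
  have hF := pressureHat_repr hσ hS h₁ h₂
  have key : ∀ τ ∈ S, ∀ᵐ k : ℝ, (pressureHat (model p φ₁ φ₂ φ ψ) p k 0 τ = 0 ↔
      p.c * deriv (φ k) τ + I * (-(1 + p.sigma) : ℝ) * Real.sign k *
        quad φ (fun l => (kernel (k - l) l : ℂ)) k τ = 0) := fun τ hτ => by
    filter_upwards [h₁.ae_good hτ, Measure.ae_ne volume 0] with k hg hk
    rw [pressureHat_model hσ hσ2 hroot hd hg hk, mul_eq_zero, or_iff_right]
    have hs : Real.sign k ≠ 0 := by rwa [Ne, Real.sign_eq_zero_iff]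
    simp [hs, hd]
  constructor
  · intro h τ hτ
    have h0 := ae_eq_zero_of_fourier (hF.toWave.integrable (mem_singleton 0) hτ) fun θ => by
      rw [← hF.repr θ 0 rfl τ hτ, h (θ, τ) hτ, Complex.ofReal_zero]
    filter_upwards [h0, key τ hτ] with k hk hk'
    exact hk'.1 hk
  · intro h y hy
    have h0 := hF.repr y.1 0 rfl y.2 hy
    rw [integral_eq_zero_of_ae (by
      filter_upwards [h y.2 hy, key y.2 hy] with k hk hk'
      rw [hk'.2 hk, zero_mul, Pi.zero_apply])] at h0
    exact_mod_cast h0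

end Amplitude

/-! ## Decay in the normal variable -/

section Decay
variable {p : Params} {φ ψ : ℝ → ℝ → ℂ} {φ₁ φ₂ : ℝ × ℝ → ℝ} {k τ κ : ℝ} {F : Filter ℝ}

lemma tendsto_ex {x : ℝ} (hx : 0 < x) (hF : Tendsto (fun η => κ * η) F atTop) :
    Tendsto (ex κ x) F (𝓝 0) := by
  rw [tendsto_zero_iff_norm_tendsto_zero]
  have h : Tendsto (fun η => Real.exp (-(x * (κ * η)))) F (𝓝 0) :=
    Real.tendsto_exp_neg_atTop_nhds_zero.comp (hF.const_mul_atTop hx)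
  refine h.congr fun η => ?_
  rw [ex, Complex.norm_exp_ofReal]
  ring_nf

lemma tendsto_mul_ex {x : ℝ} (hx : 0 < x) (hκ : κ ≠ 0) (hF : Tendsto (fun η => κ * η) F atTop) :
    Tendsto (fun η => η * ex κ x η) F (𝓝 0) := by
  rw [tendsto_zero_iff_norm_tendsto_zero]
  have h := ((Real.tendsto_pow_mul_exp_neg_atTop_nhds_zero 1).comp (hF.const_mul_atTop hx)).norm.const_mul
    (|x * κ|⁻¹)
  rw [norm_zero, mul_zero] at h
  refine h.congr fun η => ?_
  have hxκ : |x * κ| ≠ 0 := by simp [hx.ne', hκ]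
  rw [norm_mul, ex, Complex.norm_exp_ofReal, Complex.norm_real, Function.comp_apply, norm_mul, pow_one,
    ← mul_assoc x, norm_mul, Real.norm_eq_abs (x * κ), ← mul_assoc, ← mul_assoc,
    inv_mul_cancel₀ hxκ, one_mul, Real.norm_of_nonneg (Real.exp_nonneg _)]
  ring_nf

/-- The rates `α` may come arbitrarily close to zero, so no exponential decay is claimed; positivity
at almost every `l` and domination suffice. -/
lemma tendsto_expQuad [F.IsCountablyGenerated] {α : ℝ → ℝ} {c : ℝ → ℂ} (hg : Good φ τ k)
    (hc : Adm k c) (hα : Measurable α) (h0 : ∀ l, 0 ≤ α l) (h1 : ∀ᵐ l, 0 < α l)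
    (hF : Tendsto (fun η => κ * η) F atTop) : Tendsto (expQuad φ k τ κ α c) F (𝓝 0) := by
  have he := hF.eventually_ge_atTop 0
  have : Tendsto (expQuad φ k τ κ α c) F (𝓝 (∫ l : ℝ, (0 : ℂ))) := by
    refine tendsto_integral_filter_of_dominated_convergence (fun l => ‖c l * φ (k - l) τ * φ l τ‖)
      ?_ ?_ (hg c hc).norm ?_
    · filter_upwards [he] with η hη using (hg _ (hc.mul_ex hη hα h0)).aestronglyMeasurable
    · filter_upwards [he] with η hη
      refine ae_of_all _ fun l => ?_
      rw [norm_mul, norm_mul, norm_mul, norm_mul, norm_mul]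
      have h1 : ‖c l‖ * ‖ex κ (α l) η‖ ≤ ‖c l‖ :=
        mul_le_of_le_one_right (norm_nonneg _) (norm_ex_le hη (h0 l))
      gcongr
    · filter_upwards [h1] with l hl
      have := (((tendsto_ex hl hF).const_mul (c l)).mul_const (φ (k - l) τ)).mul_const (φ l τ)
      simpa using this
  simpa using this

lemma ae_abs_pos : ∀ᵐ l : ℝ, 0 < |l| := by
  filter_upwards [Measure.ae_ne volume (0 : ℝ)] with l hl using abs_pos.2 hl

lemma tendsto_model_U (hg : Good φ τ k) (hk : k ≠ 0) (i : Fin 5) :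
    Tendsto (fun η => (model p φ₁ φ₂ φ ψ).U1h i k η τ) atTop (𝓝 0) ∧
    Tendsto (fun η => (model p φ₁ φ₂ φ ψ).U2h i k η τ) atTop (𝓝 0) := by
  have hF : Tendsto (fun η : ℝ => 1 * η) atTop atTop := by
    simp only [one_mul]
    exact tendsto_id
  have hE := tendsto_ex (abs_pos.2 hk) hF
  constructor
  · simp only [model, modeHat_eq]
    simpa using hE.const_mul _
  · have A := fun {c : ℝ → ℂ} (hc : Adm k c) => tendsto_expQuad (α := fun l => |l|) hg hc (by fun_prop)
      (fun l => abs_nonneg l) ae_abs_pos hF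
    have B := tendsto_expQuad (α := fun l => |k - l| + |l|) hg
      ((Adm.abs_left.mul Adm.abs_right).sub (Adm.left.mul Adm.right)) (by fun_prop)
      (fun l => by positivity) (ae_abs_pos.mono fun l hl => by positivity) hF
    have key := (((((A (Adm.right.pow 2)).const_mul (p.plasmaEta i : ℂ)).sub
      ((A (Adm.right.mul Adm.abs_right)).const_mul (p.plasmaTheta i * I))).add
      ((hE.const_mul (-p.plasmaEta i * (|k| : ℝ) + p.plasmaTheta i * I * k)).mul_const
        (ψ k τ + quad φ (fun l => ((|l| : ℝ) : ℂ)) k τ))).add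
      ((hE.const_mul (-p.slow1 i * I * Real.sign k + Params.slow2 i)).mul_const (deriv (φ k) τ))).add
      (B.const_mul (p.pressure i : ℂ))
    simp only [mul_zero, zero_mul, add_zero, sub_zero] at key
    refine key.congr' ?_
    filter_upwards [eventually_ge_atTop 0] with η hη
    rw [model_U2h_eq hg hη]

lemma tendsto_model_V (hσ : 0 < p.sigma) (hg : Good φ τ k) (hk : k ≠ 0) (i : Fin 3) :
    Tendsto (fun η => (model p φ₁ φ₂ φ ψ).V1h i k η τ) atBot (𝓝 0) ∧
    Tendsto (fun η => (model p φ₁ φ₂ φ ψ).V2h i k η τ) atBot (𝓝 0) := by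
  have hF : Tendsto (fun η : ℝ => -p.sigma * η) atBot atTop :=
    tendsto_id.const_mul_atBot_of_neg (by linarith)
  have hE := tendsto_ex (abs_pos.2 hk) hF
  have hE' := tendsto_mul_ex (abs_pos.2 hk) (by linarith : -p.sigma ≠ 0) hF
  constructor
  · simp only [model, modeHat_eq]
    simpa using hE.const_mul _
  · have A := fun {c : ℝ → ℂ} (hc : Adm k c) => tendsto_expQuad (α := fun l => |l|) hg hc (by fun_prop)
      (fun l => abs_nonneg l) ae_abs_pos hF
    have key := (((((A (Adm.right.pow 2)).const_mul (p.vacuumEta i * p.sigma ^ 2 : ℂ)).add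
      ((A (Adm.right.mul Adm.abs_right)).const_mul (p.vacuumTheta i * p.sigma * I))).add
      ((hE.const_mul (p.vacuumEta i * (p.sigma * (|k| : ℝ)) + p.vacuumTheta i * I * k)).mul_const
        (ψ k τ - p.sigma * quad φ (fun l => ((|l| : ℝ) : ℂ)) k τ))).add
      ((hE.const_mul (-p.slowV1 i * I * Real.sign k + p.slowV4 i)).mul_const (deriv (φ k) τ))).add
      ((hE'.const_mul (p.slowV2 i * I * k + p.slowV3 i * (p.sigma * (|k| : ℝ)))).mul_const (deriv (φ k) τ))
    simp only [mul_zero, zero_mul, add_zero] at key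
    refine key.congr' ?_
    filter_upwards [eventually_le_atBot 0] with η hη
    rw [model_V2h_eq hg hσ hη]
    ring

end Decay

/-! ## Necessity and sufficiency of the amplitude equation -/

section Main
variable {p : Params} {S : Set ℝ}

lemma sigma_pos (hnu : 0 < p.nu) (hlam : p.nu * |p.lam| < 1) :
    0 < p.sigma ∧ p.sigma ^ 2 = 1 - p.nu ^ 2 * p.lam ^ 2 := by
  have h0 : 0 ≤ p.nu * |p.lam| := by positivity
  have h : 0 < 1 - p.nu ^ 2 * p.lam ^ 2 := by
    rw [← sq_abs p.lam]
    nlinarith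
  exact ⟨Real.sqrt_pos.2 h, Real.sq_sqrt h.le⟩

lemma d_pos (hH : p.H0 ≠ 0) (hσ : 0 < p.sigma) (hroot : p.d = p.H0 ^ 2 * p.sigma) : 0 < p.d := by
  rw [hroot]
  positivity

lemma w_ne_zero (hd : 0 < p.d) : p.w ≠ 0 := fun h => by
  rw [Params.d, h] at hd
  nlinarith [sq_nonneg p.B0]

lemma hasForm_model (hσ : 0 < p.sigma) (hd : p.d ≠ 0) (hw : p.w ≠ 0) {φ₁ φ₂ : ℝ × ℝ → ℝ}
    {φh ψh : ℝ → ℝ → ℂ} (h₁ : IsProfile S φ₁ φh) : (model p φ₁ φ₂ φh ψh).HasForm p S := by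
  refine fun τ hτ => ⟨fun η hη => ?_, fun η hη => ?_⟩
  · filter_upwards [h₁.ae_good hτ, Measure.ae_ne volume 0] with k hg hk i
    exact ⟨model_U1h_eq_U1hat hk η i, model_U2h_eq_U2hat hd hw hg hk hη i⟩
  · filter_upwards [h₁.ae_good hτ, Measure.ae_ne volume 0] with k hg hk i
    exact ⟨model_V1h_eq_V1hat η i, model_V2h_eq_V2hat hσ hg hk hη i⟩

/-- The closed form built on the profiles of `X` meets the demands of `terms_unique` with no
condition on the profiles. Thus `X` agrees with it, and the pressure condition inherited from `X` is
the amplitude equation. -/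
lemma form_of_vanish (hσ : 0 < p.sigma) (hσ2 : p.sigma ^ 2 = 1 - p.nu ^ 2 * p.lam ^ 2)
    (hroot : p.d = p.H0 ^ 2 * p.sigma) (hd : p.d ≠ 0) (hw : p.w ≠ 0) (hS : IsOpen S) {X : Terms}
    (hX : X.Regular S) (hv : X.Vanish p S) :
    X.HasForm p S ∧ AmplitudeEq p.c (-(1 + p.sigma)) S X.phi1h := by
  have hY := regular_model (p := p) hσ hS hX.phi1 hX.phi2
  obtain ⟨hu, hj⟩ := terms_unique hσ hσ2 hd hw hS hX hY rfl rfl hv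
    (fun z hη hτ => ⟨model_plasma1 hS hX.phi1 hη hτ, model_plasma2 hS hX.phi1 hX.phi2 hη hτ⟩)
    (fun z hη hτ => ⟨model_vacuum1 hσ hσ2 hS hX.phi1 hη hτ,
      model_vacuum2 hσ hσ2 hS hX.phi1 hX.phi2 hη hτ⟩)
    (fun y hy => ⟨model_jump1 hroot hS hX.phi1 hy,
      fun j hj => model_jump2 hσ hS hX.phi1 hX.phi2 hy j hj⟩)
  refine ⟨fun τ hτ => ?_, (jump_pressure_iff hσ hσ2 hroot hd hS hX.phi1 hX.phi2).1 fun y hy => ?_⟩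
  · obtain ⟨f1, f2⟩ := hasForm_model (φ₂ := X.phi2) (ψh := X.phi2h) hσ hd hw hX.phi1 τ hτ
    obtain ⟨u1, u2⟩ := hu τ hτ
    refine ⟨fun η hη => ?_, fun η hη => ?_⟩
    · filter_upwards [f1 η hη, u1] with k hk hk' i
      exact ⟨(hk' η hη i).1.trans (hk i).1, (hk' η hη i).2.trans (hk i).2⟩
    · filter_upwards [f2 η hη, u2] with k hk hk' i
      exact ⟨(hk' η hη i).1.trans (hk i).1, (hk' η hη i).2.trans (hk i).2⟩
  · rw [hj y hy, Pi.zero_apply]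

lemma vanish_model (hσ : 0 < p.sigma) (hσ2 : p.sigma ^ 2 = 1 - p.nu ^ 2 * p.lam ^ 2)
    (hroot : p.d = p.H0 ^ 2 * p.sigma) (hd : p.d ≠ 0) (hS : IsOpen S) {φ₁ φ₂ : ℝ × ℝ → ℝ}
    {φh ψh : ℝ → ℝ → ℂ} (h₁ : IsProfile S φ₁ φh) (h₂ : IsProfile S φ₂ ψh)
    (h : AmplitudeEq p.c (-(1 + p.sigma)) S φh) : (model p φ₁ φ₂ φh ψh).Vanish p S where
  plasma z hη hτ := ⟨model_plasma1 hS h₁ hη hτ, model_plasma2 hS h₁ h₂ hη hτ⟩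
  vacuum z hη hτ := ⟨model_vacuum1 hσ hσ2 hS h₁ hη hτ, model_vacuum2 hσ hσ2 hS h₁ h₂ hη hτ⟩
  jump y hy := ⟨model_jump1 hroot hS h₁ hy, funext fun j => by
    rcases eq_or_ne j 1 with rfl | hj
    · exact (jump_pressure_iff hσ hσ2 hroot hd hS h₁ h₂).2 h y hy
    · exact model_jump2 hσ hS h₁ h₂ hy j hj⟩

lemma solves_model (hσ : 0 < p.sigma) (hσ2 : p.sigma ^ 2 = 1 - p.nu ^ 2 * p.lam ^ 2)
    (hroot : p.d = p.H0 ^ 2 * p.sigma) (hd : p.d ≠ 0) (hS : IsOpen S) {φ₁ φ₂ : ℝ × ℝ → ℝ}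
    {φh ψh : ℝ → ℝ → ℂ} (h₁ : IsProfile S φ₁ φh) (h₂ : IsProfile S φ₂ ψh)
    (h : AmplitudeEq p.c (-(1 + p.sigma)) S φh) :
    SolvesAsymptotically p S ((model p φ₁ φ₂ φh ψh).truncU p) ((model p φ₁ φ₂ φh ψh).truncV p)
      (model p φ₁ φ₂ φh ψh).truncPhi := by
  have hU : ∀ i, ∀ τ ∈ S, ∀ᵐ k : ℝ, _ := fun i τ hτ =>
    (h₁.ae_good hτ).mp ((Measure.ae_ne volume 0).mono fun k hk hg =>
      tendsto_model_U (p := p) (φ₁ := φ₁) (φ₂ := φ₂) (ψ := ψh) hg hk i)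
  have hV : ∀ i, ∀ τ ∈ S, ∀ᵐ k : ℝ, _ := fun i τ hτ =>
    (h₁.ae_good hτ).mp ((Measure.ae_ne volume 0).mono fun k hk hg =>
      tendsto_model_V (p := p) (φ₁ := φ₁) (φ₂ := φ₂) (ψ := ψh) hσ hg hk i)
  exact solves_of_vanish hS (regular_model hσ hS h₁ h₂) (vanish_model hσ hσ2 hroot hd hS h₁ h₂ h)
    (fun i τ hτ => (hU i τ hτ).mono fun k hk => hk.1) (fun i τ hτ => (hU i τ hτ).mono fun k hk => hk.2)
    (fun i τ hτ => (hV i τ hτ).mono fun k hk => hk.1) (fun i τ hτ => (hV i τ hτ).mono fun k hk => hk.2)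

lemma interface_expansion (hS : IsOpen S) {X : Terms} (hX : X.Regular S)
    {U : ℝ → Fin 5 → ℝ × ℝ × ℝ → ℝ} {V : ℝ → Fin 3 → ℝ × ℝ × ℝ → ℝ} {φ : ℝ → ℝ × ℝ → ℝ}
    (hE : HasExpansion p S U V φ X) :
    ∃ C : ℝ, ∃ ε₀ > 0, ∀ ε : ℝ, 0 < ε → ε < ε₀ → ∀ t x₁ : ℝ, ε * t ∈ S →
      |interface p.lam ε (φ ε) (t, x₁) - ε * X.phi1 (x₁ - p.lam * t, ε * t)| ≤ C * ε ^ 2 := by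
  obtain ⟨C, ε₀, h0, h⟩ := hE
  obtain ⟨C', hC', hb⟩ := hX.phi2.bound_fderiv hS
  -- The remainder `Cε²` of the profile is at most `|C| ε₀ ε`, and `C'` bounds the second order
  -- profile; the factor `ε` of the interface supplies the second power.
  refine ⟨|C| * ε₀ + C', ε₀, h0, fun ε hε hε' t x₁ ht => ?_⟩
  have h1 := (h ε hε hε').2.2.1 (x₁ - p.lam * t, ε * t) ht
  have h2 := (hb (x₁ - p.lam * t, ε * t) ht).1
  simp only [Terms.truncPhi] at h1
  rw [interface, ← mul_sub, abs_mul, abs_of_pos hε]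
  have h3 : |φ ε (x₁ - p.lam * t, ε * t) - X.phi1 (x₁ - p.lam * t, ε * t)| ≤ (|C| * ε₀ + C') * ε := by
    calc _ = |(φ ε (x₁ - p.lam * t, ε * t) - (X.phi1 (x₁ - p.lam * t, ε * t)
          + ε * X.phi2 (x₁ - p.lam * t, ε * t))) + ε * X.phi2 (x₁ - p.lam * t, ε * t)| := by
          congr 1; ring
      _ ≤ C * ε ^ 2 + ε * C' := (abs_add_le _ _).trans (add_le_add h1 (by
          rw [abs_mul, abs_of_pos hε]; gcongr))
      _ ≤ (|C| * ε₀ + C') * ε := by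
          have : C * ε ^ 2 ≤ |C| * ε₀ * ε := by
            rw [sq, ← mul_assoc]
            gcongr
            exact le_abs_self C
          linarith
  calc _ ≤ ε * ((|C| * ε₀ + C') * ε) := by gcongr
    _ = _ := by ring

end Main

/-! ## The sine integral -/

/-- The integrand of the Laplace representation of `π/2 - ∫₀ˣ sinc`. -/
noncomputable def sineKernel (x t : ℝ) : ℝ :=
  Real.exp (-(x * t)) * (Real.cos x + t * Real.sin x) * (1 + t ^ 2)⁻¹

lemma continuous_sineKernel_right (x : ℝ) : Continuous (sineKernel x) := by
  unfold sineKernel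
  exact (Continuous.mul (by fun_prop) (by fun_prop)).mul
    (Continuous.inv₀ (by fun_prop) fun t => by positivity)

/-- The growth of the factor `t` is compensated uniformly in `x` by `|sin x| ≤ x` and `x t e^{-xt} ≤
1`. -/
lemma norm_sineKernel_le {x t : ℝ} (hx : 0 ≤ x) (ht : 0 ≤ t) :
    ‖sineKernel x t‖ ≤ 2 * (1 + t ^ 2)⁻¹ := by
  have h1 : Real.exp (-(x * t)) ≤ 1 := Real.exp_le_one_iff.2 (by nlinarith)
  have h2 : x * t * Real.exp (-(x * t)) ≤ 1 := by
    rw [Real.exp_neg, ← div_eq_mul_inv, div_le_one (Real.exp_pos _)]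
    linarith [Real.add_one_le_exp (x * t)]
  have h3 : |Real.sin x| ≤ x := Real.abs_sin_le_abs.trans_eq (abs_of_nonneg hx)
  have h4 := Real.abs_cos_le_one x
  have h0 := Real.exp_pos (-(x * t))
  rw [sineKernel, norm_mul, norm_mul, Real.norm_of_nonneg h0.le,
    Real.norm_of_nonneg (by positivity : (0 : ℝ) ≤ (1 + t ^ 2)⁻¹)]
  refine mul_le_mul_of_nonneg_right ?_ (by positivity)
  calc _ ≤ Real.exp (-(x * t)) * (|Real.cos x| + t * |Real.sin x|) := by
        gcongr
        refine (abs_add_le _ _).trans_eq ?_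
        rw [abs_mul, abs_of_nonneg ht]
    _ ≤ Real.exp (-(x * t)) * (1 + t * x) := by gcongr
    _ ≤ 2 := by nlinarith

lemma integrable_sineBound : IntegrableOn (fun t : ℝ => 2 * (1 + t ^ 2)⁻¹) (Ioi 0) :=
  (integrable_inv_one_add_sq.const_mul 2).integrableOn

lemma sineKernel_bound {x : ℝ} (hx : 0 ≤ x) :
    ∀ᵐ t ∂(volume.restrict (Ioi (0 : ℝ))), ‖sineKernel x t‖ ≤ 2 * (1 + t ^ 2)⁻¹ :=
  (ae_restrict_iff' measurableSet_Ioi).2 (ae_of_all _ fun _ ht => norm_sineKernel_le hx (le_of_lt ht))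

lemma integrableOn_sineKernel {x : ℝ} (hx : 0 ≤ x) : IntegrableOn (sineKernel x) (Ioi 0) :=
  integrable_sineBound.mono' (continuous_sineKernel_right x).aestronglyMeasurable (sineKernel_bound hx)

/-- Differentiation in `x` removes the factor `1/(1 + t²)` and leaves `-e^{-xt} sin x`, whose
integral in `t` is `-sin x / x`. -/
lemma hasDerivAt_integral_sineKernel {x : ℝ} (hx : 0 < x) :
    HasDerivAt (fun x => ∫ t in Ioi (0 : ℝ), sineKernel x t) (-Real.sinc x) x := by
  have hE : IntegrableOn (fun t : ℝ => Real.exp (-(x / 2) * t)) (Ioi 0) :=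
    integrableOn_exp_mul_Ioi (by linarith) 0
  have hO : Ioi (x / 2) ∈ 𝓝 x := Ioi_mem_nhds (by linarith)
  have key := (hasDerivAt_integral_of_dominated_loc_of_deriv_le (μ := volume.restrict (Ioi 0))
    (s := Ioi (x / 2)) (F := sineKernel) (F' := fun y t => -Real.exp (-y * t) * Real.sin y) hO
    (Eventually.of_forall fun y => (continuous_sineKernel_right y).aestronglyMeasurable)
    (integrableOn_sineKernel hx.le) (Continuous.aestronglyMeasurable (by fun_prop))
    (bound := fun t => Real.exp (-(x / 2) * t)) ?_ hE ?_).2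
  · refine key.congr_deriv ?_
    rw [integral_mul_const, integral_neg, integral_exp_mul_Ioi (by linarith),
      Real.sinc_of_ne_zero hx.ne']
    simp
    field_simp
  · refine (ae_restrict_iff' measurableSet_Ioi).2 (ae_of_all _ fun t (ht : 0 < t) y (hy : x / 2 < y) => ?_)
    rw [norm_mul, norm_neg, Real.norm_of_nonneg (Real.exp_nonneg _)]
    calc _ ≤ Real.exp (-y * t) * 1 := by
          gcongr; exact Real.abs_sin_le_one y
      _ ≤ _ := by rw [mul_one]; exact Real.exp_le_exp.2 (by nlinarith)
  · refine ae_of_all _ fun t y _ => ?_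
    have h1 : HasDerivAt (fun y => Real.exp (-(y * t))) (Real.exp (-(y * t)) * (-(1 * t))) y :=
      (((hasDerivAt_id y).mul_const t).neg).exp
    have h2 := (Real.hasDerivAt_cos y).add ((Real.hasDerivAt_sin y).const_mul t)
    have h3 := (h1.mul h2).mul_const ((1 + t ^ 2)⁻¹)
    refine HasDerivAt.congr_deriv (f := fun y => sineKernel y t) h3 ?_
    have : (1 + t ^ 2) ≠ 0 := by positivity
    simp only [Pi.add_apply]
    field_simp
    ring

lemma continuousOn_integral_sineKernel :
    ContinuousOn (fun x => ∫ t in Ioi (0 : ℝ), sineKernel x t) (Ici 0) := by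
  refine continuousOn_of_dominated (bound := fun t => 2 * (1 + t ^ 2)⁻¹)
    (fun x _ => (continuous_sineKernel_right x).aestronglyMeasurable)
    (fun x hx => sineKernel_bound hx) integrable_sineBound (ae_of_all _ fun t => ?_)
  unfold sineKernel
  exact Continuous.continuousOn (by fun_prop)

lemma tendsto_integral_sineKernel :
    Tendsto (fun x => ∫ t in Ioi (0 : ℝ), sineKernel x t) atTop (𝓝 0) := by
  have : Tendsto (fun x => ∫ t in Ioi (0 : ℝ), sineKernel x t) atTop
      (𝓝 (∫ t in Ioi (0 : ℝ), (0 : ℝ))) := by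
    refine tendsto_integral_filter_of_dominated_convergence (fun t => 2 * (1 + t ^ 2)⁻¹)
      (Eventually.of_forall fun x => (continuous_sineKernel_right x).aestronglyMeasurable)
      ((eventually_ge_atTop 0).mono fun x hx => sineKernel_bound hx) integrable_sineBound
      ((ae_restrict_iff' measurableSet_Ioi).2 (ae_of_all _ fun t (ht : 0 < t) => ?_))
    have h1 : Tendsto (fun x => (1 + t) * Real.exp (-(x * t))) atTop (𝓝 0) := by
      have := (Real.tendsto_exp_neg_atTop_nhds_zero.comp
        (tendsto_id.atTop_mul_const ht)).const_mul (1 + t)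
      rw [mul_zero] at this
      exact this
    refine squeeze_zero_norm (fun x => ?_) h1
    have h2 : (1 + t ^ 2)⁻¹ ≤ 1 := inv_le_one_of_one_le₀ (by nlinarith)
    have h3 : |Real.cos x + t * Real.sin x| ≤ 1 + t := by
      refine (abs_add_le _ _).trans (add_le_add (Real.abs_cos_le_one x) ?_)
      rw [abs_mul, abs_of_pos ht]
      exact mul_le_of_le_one_right ht.le (Real.abs_sin_le_one x)
    rw [sineKernel, norm_mul, norm_mul, Real.norm_of_nonneg (Real.exp_nonneg _),
      Real.norm_of_nonneg (by positivity : (0 : ℝ) ≤ (1 + t ^ 2)⁻¹), Real.norm_eq_abs]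
    calc _ ≤ Real.exp (-(x * t)) * (1 + t) * 1 := by gcongr
      _ = _ := by ring
  simpa using this

/-- The sine integral. -/
noncomputable def sineIntegral (x : ℝ) : ℝ := ∫ u in (0 : ℝ)..x, Real.sinc u

/-- Both sides have the same derivative, and at `x = 0` the Laplace integral equals the integral of
`1/(1 + t²)`, that is `π/2`. The conditionally convergent integral is thereby expressed through an
absolutely convergent one. -/
lemma sineIntegral_eq {x : ℝ} (hx : 0 ≤ x) :
    sineIntegral x = Real.pi / 2 - ∫ t in Ioi (0 : ℝ), sineKernel x t := by
  have h0 : ∫ t in Ioi (0 : ℝ), sineKernel 0 t = Real.pi / 2 := by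
    simp [sineKernel]
  rw [sineIntegral, intervalIntegral.integral_eq_sub_of_hasDerivAt_of_le hx
    (f := fun x => -∫ t in Ioi (0 : ℝ), sineKernel x t)
    (continuousOn_integral_sineKernel.mono Icc_subset_Ici_self).neg
    (fun y hy => (hasDerivAt_integral_sineKernel hy.1).neg.congr_deriv (neg_neg _))
    (Real.continuous_sinc.intervalIntegrable _ _), h0]
  ring

lemma sineIntegral_neg (x : ℝ) : sineIntegral (-x) = -sineIntegral x := by
  rw [sineIntegral, sineIntegral, ← neg_zero, ← intervalIntegral.integral_comp_neg,
    intervalIntegral.integral_symm]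
  simp [Real.sinc_neg]

/-- The Laplace integral is at most `2 · π/2`, and `π/2` is added to it. Only uniformity in `x`
matters: the bound dominates all truncations of the principal value. -/
lemma abs_sineIntegral_le (x : ℝ) : |sineIntegral x| ≤ 3 * Real.pi / 2 := by
  have key : ∀ x, 0 ≤ x → |sineIntegral x| ≤ 3 * Real.pi / 2 := fun x hx => by
    have h : |∫ t in Ioi (0 : ℝ), sineKernel x t| ≤ ∫ t in Ioi (0 : ℝ), 2 * (1 + t ^ 2)⁻¹ :=
      norm_integral_le_of_norm_le integrable_sineBound (sineKernel_bound hx)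
    rw [integral_const_mul, integral_Ioi_inv_one_add_sq, Real.arctan_zero] at h
    rw [sineIntegral_eq hx]
    have := Real.pi_pos
    have h' := abs_le.1 h
    rw [abs_le]
    constructor <;> linarith
  rcases le_total 0 x with h | h
  · exact key x h
  · rw [← abs_neg, ← sineIntegral_neg]
    exact key (-x) (by linarith)

lemma tendsto_sineIntegral : Tendsto sineIntegral atTop (𝓝 (Real.pi / 2)) := by
  have := tendsto_integral_sineKernel.const_sub (Real.pi / 2)
  rw [sub_zero] at this
  exact this.congr' ((eventually_ge_atTop 0).mono fun x hx => (sineIntegral_eq hx).symm)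

lemma continuous_sineIntegral : Continuous sineIntegral :=
  intervalIntegral.continuous_primitive (fun _ _ => Real.continuous_sinc.intervalIntegrable _ _) 0

/-! ## The Hilbert transform of a Fourier integral -/

lemma setOf_abs_eq_union {r R : ℝ} (hr : 0 < r) :
    {u : ℝ | r < |u| ∧ |u| < R} = Neg.neg ⁻¹' Ioo r R ∪ Ioo r R := by
  ext u
  simp only [mem_ofPred_eq, mem_union, mem_preimage, mem_Ioo]
  rcases abs_cases u with ⟨h, _⟩ | ⟨h, _⟩ <;> rw [h] <;> constructor
  · exact fun h => Or.inr h
  · rintro (h | h) <;> constructor <;> linarith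
  · exact fun h => Or.inl h
  · rintro (h | h) <;> constructor <;> linarith

/-- Pairing `u` with `-u` cancels the cosine and leaves `-2i sin(ku)/u` on `(r, R)`. -/
lemma integral_truncated_exp {r R : ℝ} (hr : 0 < r) (hR : r ≤ R) (k : ℝ) :
    ∫ u in {u : ℝ | r < |u| ∧ |u| < R}, exp (-(I * k * u)) / u
      = -(2 * I) * ((sineIntegral (k * R) - sineIntegral (k * r) : ℝ) : ℂ) := by
  have hi : IntegrableOn (fun u : ℝ => exp (-(I * k * u)) / u) (Ioo r R) := by
    refine (ContinuousOn.integrableOn_Icc (ContinuousOn.div (Continuous.continuousOn (by fun_prop))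
      (Complex.continuous_ofReal.continuousOn) fun u hu => ?_)).mono_set Ioo_subset_Icc_self
    exact_mod_cast (hr.trans_le hu.1).ne'
  have hi' : IntegrableOn (fun u : ℝ => exp (I * k * u) / -u) (Ioo r R) := by
    refine (ContinuousOn.integrableOn_Icc (ContinuousOn.div (Continuous.continuousOn (by fun_prop))
      (Complex.continuous_ofReal.continuousOn.neg) fun u hu => ?_)).mono_set Ioo_subset_Icc_self
    change -(u : ℂ) ≠ 0
    rw [neg_ne_zero]
    exact_mod_cast (hr.trans_le hu.1).ne'
  have hmp : MeasurePreserving (Neg.neg : ℝ → ℝ) := Measure.measurePreserving_neg volume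
  have hme : MeasurableEmbedding (Neg.neg : ℝ → ℝ) := (MeasurableEquiv.neg ℝ).measurableEmbedding
  have e1 : ∫ u in Neg.neg ⁻¹' Ioo r R, exp (-(I * k * u)) / u
      = ∫ u in Ioo r R, exp (I * k * u) / -u := by
    rw [← hmp.setIntegral_preimage_emb hme]
    simp
  have hi'' : IntegrableOn (fun u : ℝ => exp (-(I * k * u)) / u) (Neg.neg ⁻¹' Ioo r R) := by
    rw [← hmp.integrableOn_comp_preimage hme] at hi'
    refine hi'.congr (ae_of_all _ fun u => ?_)
    simp
  rw [setOf_abs_eq_union hr, setIntegral_union ?_ measurableSet_Ioo hi'' hi, e1, ← integral_add hi' hi,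
    ← integral_Ioc_eq_integral_Ioo, ← intervalIntegral.integral_of_le hR, sineIntegral, sineIntegral,
    intervalIntegral.integral_interval_sub_left (Real.continuous_sinc.intervalIntegrable _ _)
      (Real.continuous_sinc.intervalIntegrable _ _),
    ← intervalIntegral.mul_integral_comp_mul_left, ← intervalIntegral.integral_const_mul,
    ← intervalIntegral.integral_ofReal, ← intervalIntegral.integral_const_mul]
  · refine intervalIntegral.integral_congr fun u hu => ?_
    have hu0 : 0 < u := by
      rw [uIcc_of_le hR] at hu
      exact hr.trans_le hu.1
    have huc : (u : ℂ) ≠ 0 := by exact_mod_cast hu0.ne'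
    have hs : k * Real.sinc (k * u) = Real.sin (k * u) / u := by
      rcases eq_or_ne k 0 with rfl | hk
      · simp
      · rw [Real.sinc_of_ne_zero (mul_ne_zero hk hu0.ne')]
        field_simp
    rw [hs]
    push_cast
    rw [Complex.sin, div_neg, ← neg_div, ← add_div, show I * (k : ℂ) * u = k * u * I by ring,
      show -((k : ℂ) * u) * I = -(k * u * I) by ring]
    field_simp
    linear_combination (exp (-(k * u * I)) - exp (k * u * I)) * Complex.I_sq
  · rw [Set.disjoint_left]
    intro u h1 h2
    have h3 : r < -u := h1.1
    have h4 : r < u := h2.1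
    linarith

/-- The inner truncation disappears by continuity at `0`; the outer one gives the Dirichlet
integral, with the sign of `k` by oddness. -/
lemma tendsto_truncated_sineIntegral (k : ℝ) :
    Tendsto (fun r : ℝ × ℝ => sineIntegral (k * r.2) - sineIntegral (k * r.1)) (𝓝[>] 0 ×ˢ atTop)
      (𝓝 (Real.pi / 2 * Real.sign k)) := by
  have h1 : Tendsto (fun r : ℝ => sineIntegral (k * r)) (𝓝[>] 0) (𝓝 0) := by
    have : Continuous fun r : ℝ => sineIntegral (k * r) := continuous_sineIntegral.comp (by fun_prop)
    have h := this.tendsto 0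
    simp only [mul_zero, sineIntegral, intervalIntegral.integral_same] at h
    exact h.mono_left nhdsWithin_le_nhds
  have h2 : Tendsto (fun r : ℝ => sineIntegral (k * r)) atTop (𝓝 (Real.pi / 2 * Real.sign k)) := by
    rcases lt_trichotomy k 0 with h | h | h
    · have := (tendsto_sineIntegral.comp (tendsto_id.const_mul_atTop (neg_pos.2 h))).neg
      rw [Real.sign_of_neg h, mul_neg_one]
      refine this.congr fun r => ?_
      simp [sineIntegral_neg]
    · simp [h, sineIntegral]
    · rw [Real.sign_of_pos h, mul_one]
      exact tendsto_sineIntegral.comp (tendsto_id.const_mul_atTop h)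
  have := (h2.comp tendsto_snd).sub (h1.comp tendsto_fst)
  rw [sub_zero] at this
  exact this

/-- The Hilbert transform has the symbol `-i sgn k`. -/
lemma isHilbertTransform_of_fourier {f g : ℝ → ℝ} {a : ℝ → ℂ} (ha : Integrable a)
    (hf : ∀ x : ℝ, (f x : ℂ) = ∫ k : ℝ, a k * exp (I * k * x))
    (hg : ∀ x : ℝ, (g x : ℂ) = ∫ k : ℝ, -(I * Real.sign k) * a k * exp (I * k * x)) :
    IsHilbertTransform f g := by
  intro x
  have hpi : (Real.pi : ℂ) ≠ 0 := by exact_mod_cast Real.pi_ne_zero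
  have hev : ∀ᶠ r : ℝ × ℝ in 𝓝[>] 0 ×ˢ atTop, 0 < r.1 ∧ r.1 ≤ r.2 := by
    have h1 : ∀ᶠ r : ℝ in 𝓝[>] 0, 0 < r ∧ r < 1 := by
      filter_upwards [Ioo_mem_nhdsGT (zero_lt_one (α := ℝ))] with r hr using hr
    filter_upwards [h1.prod_mk (eventually_ge_atTop (1 : ℝ))] with r hr
    exact ⟨hr.1.1, hr.1.2.le.trans hr.2⟩
  have main : ∀ r : ℝ × ℝ, 0 < r.1 → r.1 ≤ r.2 →
      ((Real.pi⁻¹ * ∫ y in {y : ℝ | r.1 < |x - y| ∧ |x - y| < r.2}, f y / (x - y) : ℝ) : ℂ)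
        = ∫ k : ℝ, a k * exp (I * k * x) *
          (-(2 * I) / Real.pi * ((sineIntegral (k * r.2) - sineIntegral (k * r.1) : ℝ) : ℂ)) := by
    rintro ⟨r, R⟩ (hr : 0 < r) (hR : r ≤ R)
    dsimp only
    set A : Set ℝ := {y : ℝ | r < |x - y| ∧ |x - y| < R} with hA
    have hAm : MeasurableSet A := by
      have : A = {y : ℝ | r < |x - y|} ∩ {y : ℝ | |x - y| < R} := by
        ext y
        simp [hA]
      rw [this]
      exact (measurableSet_lt measurable_const (by fun_prop)).inter
        (measurableSet_lt (by fun_prop) measurable_const)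
    have hAf : volume A < ⊤ := by
      refine lt_of_le_of_lt (measure_mono (t := Icc (x - R) (x + R)) fun y hy => ?_) measure_Icc_lt_top
      have := abs_lt.1 hy.2
      constructor <;> linarith
    -- The truncated set has finite measure and `|x - y| > r` on it, so Fubini applies with the
    -- bound `r⁻¹|a k|`.
    have hint : Integrable (Function.uncurry fun (y k : ℝ) => a k * exp (I * k * y) / ((x : ℂ) - y))
        ((volume.restrict A).prod volume) := by
      have hfin : IsFiniteMeasure (volume.restrict A) := ⟨by rwa [Measure.restrict_apply_univ]⟩
      have hb : Integrable (fun z : ℝ × ℝ => r⁻¹ * ‖a z.2‖) ((volume.restrict A).prod volume) :=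
        (ha.norm.comp_snd _).const_mul _
      refine hb.mono' ?_ ?_
      · have h1 : AEStronglyMeasurable (fun z : ℝ × ℝ => a z.2) ((volume.restrict A).prod volume) :=
          ha.aestronglyMeasurable.comp_snd
        have h2 : Measurable fun z : ℝ × ℝ => exp (I * z.2 * z.1) / ((x : ℂ) - z.1) := by fun_prop
        refine (h1.mul h2.aestronglyMeasurable).congr (ae_of_all _ fun z => ?_)
        simp [Function.uncurry, mul_div_assoc]
      · have : ∀ᵐ z : ℝ × ℝ ∂((volume.restrict A).prod (volume : Measure ℝ)), z.1 ∈ A :=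
          Measure.quasiMeasurePreserving_fst.ae (ae_restrict_mem hAm)
        filter_upwards [this] with z hz
        rw [Function.uncurry, norm_div, norm_mul, norm_exp_I_mul, mul_one, ← Complex.ofReal_sub,
          Complex.norm_real, Real.norm_eq_abs, div_eq_inv_mul]
        have : |x - z.1|⁻¹ ≤ r⁻¹ := inv_anti₀ hr hz.1.le
        gcongr
    rw [Complex.ofReal_mul, ← integral_complex_ofReal]
    have e1 : ∫ y in A, ((f y / (x - y) : ℝ) : ℂ)
        = ∫ y in A, ∫ k : ℝ, a k * exp (I * k * y) / ((x : ℂ) - y) := by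
      congr 1
      funext y
      rw [integral_div, ← hf]
      push_cast
      rfl
    rw [e1, integral_integral_swap hint, ← integral_const_mul]
    congr 1
    funext k
    have e2 : ∫ y in A, a k * exp (I * k * y) / ((x : ℂ) - y)
        = a k * exp (I * k * x) * ∫ u in {u : ℝ | r < |u| ∧ |u| < R}, exp (-(I * k * u)) / u := by
      have hmp : MeasurePreserving (fun y : ℝ => x - y) :=
        Measure.measurePreserving_sub_left volume x
      have hme : MeasurableEmbedding (fun y : ℝ => x - y) :=
        (MeasurableEquiv.subLeft x).measurableEmbedding
      have hpre : (fun y : ℝ => x - y) ⁻¹' {u : ℝ | r < |u| ∧ |u| < R} = A := rfl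
      rw [← integral_const_mul, ← hmp.setIntegral_preimage_emb hme
        (fun u : ℝ => a k * exp (I * k * x) * (exp (-(I * k * u)) / u)), hpre]
      refine setIntegral_congr_fun hAm fun y _ => ?_
      rw [mul_assoc (a k), mul_div_assoc', ← Complex.exp_add]
      push_cast
      rw [mul_div_assoc]
      congr 4
      ring
    rw [e2, integral_truncated_exp hr hR]
    push_cast
    field_simp
  have hlim : Tendsto (fun r : ℝ × ℝ => ∫ k : ℝ, a k * exp (I * k * x) *
      (-(2 * I) / Real.pi * ((sineIntegral (k * r.2) - sineIntegral (k * r.1) : ℝ) : ℂ)))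
      (𝓝[>] 0 ×ˢ atTop) (𝓝 (g x : ℂ)) := by
    have hm := fun c : ℝ => (Complex.continuous_ofReal.comp
      (continuous_sineIntegral.comp (continuous_mul_const c))).measurable
    rw [hg]
    -- The uniform bound on the sine integral makes a multiple of `‖a‖` a dominating function for
    -- all truncations.
    refine tendsto_integral_filter_of_dominated_convergence
      (fun k => ‖a k‖ * (2 / Real.pi * (3 * Real.pi))) ?_ ?_ (ha.norm.mul_const _) ?_
    · refine Eventually.of_forall fun r => (ha.aestronglyMeasurable.mul
        (Measurable.aestronglyMeasurable (by fun_prop))).mul (Measurable.aestronglyMeasurable ?_)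
      have := continuous_sineIntegral
      exact Continuous.measurable (by fun_prop)
    · refine Eventually.of_forall fun r => ae_of_all _ fun k => ?_
      rw [norm_mul, norm_mul, norm_exp_I_mul, mul_one, norm_mul, Complex.norm_real]
      have h1 : ‖-(2 * I) / (Real.pi : ℂ)‖ = 2 / Real.pi := by
        simp [abs_of_pos Real.pi_pos]
      have h2 : ‖sineIntegral (k * r.2) - sineIntegral (k * r.1)‖ ≤ 3 * Real.pi := by
        refine (norm_sub_le _ _).trans ?_
        have := abs_sineIntegral_le (k * r.2)
        have := abs_sineIntegral_le (k * r.1)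
        simp only [Real.norm_eq_abs]
        linarith
      rw [h1]
      gcongr
    · refine ae_of_all _ fun k => ?_
      have h1 := (Complex.continuous_ofReal.tendsto _).comp (tendsto_truncated_sineIntegral k)
      have h2 := (h1.const_mul (-(2 * I) / (Real.pi : ℂ))).const_mul (a k * exp (I * k * x))
      have e : a k * exp (I * k * x) * (-(2 * I) / (Real.pi : ℂ) * ((Real.pi / 2 * Real.sign k : ℝ) : ℂ))
          = -(I * Real.sign k) * a k * exp (I * k * x) := by
        push_cast
        field_simp
      rw [e] at h2
      exact h2
  have hre := (Complex.continuous_re.tendsto _).comp hlim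
  rw [Complex.ofReal_re] at hre
  refine hre.congr' ?_
  filter_upwards [hev] with r hr
  rw [Function.comp_apply, ← main r hr.1 hr.2, Complex.ofReal_re]

lemma IsHilbertTransform.unique {f g g' : ℝ → ℝ} (h : IsHilbertTransform f g)
    (h' : IsHilbertTransform f g') : g = g' :=
  funext fun x => tendsto_nhds_unique (h x) (h' x)

/-! ## Normal forms of the amplitude equation -/

/-- The substitution `τ = -(c/ρ)s` multiplies the equation by `-1/ρ`, and it is invertible because
`c ≠ 0`. -/
lemma amplitudeEq_rescale {c ρ : ℝ} (hρ : 0 < ρ) (hc : c ≠ 0) (S : Set ℝ) (φ : ℝ → ℝ → ℂ) :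
    AmplitudeEq c (-ρ) S φ ↔
      AmplitudeEq 1 1 {s | -(c / ρ * s) ∈ S} (fun k s => φ k (-(c / ρ * s))) := by
  have hρc : (ρ : ℂ) ≠ 0 := by exact_mod_cast hρ.ne'
  have key : ∀ s k, ((1 : ℝ) * deriv (fun s => φ k (-(c / ρ * s))) s + I * (1 : ℝ) * Real.sign k *
        quad (fun k s => φ k (-(c / ρ * s))) (fun l => (kernel (k - l) l : ℂ)) k s = 0 ↔
      c * deriv (φ k) (-(c / ρ * s)) + I * (-ρ : ℝ) * Real.sign k *
        quad φ (fun l => (kernel (k - l) l : ℂ)) k (-(c / ρ * s)) = 0) := fun s k => by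
    have h : deriv (fun s => φ k (-(c / ρ * s))) s = -(c / ρ) * deriv (φ k) (-(c / ρ * s)) := by
      have := deriv_comp_mul_left (-(c / ρ)) (φ k) s
      simp only [neg_mul, neg_smul, Complex.real_smul] at this
      push_cast at this
      rw [this]
      ring
    have hq : quad (fun k s => φ k (-(c / ρ * s))) (fun l => (kernel (k - l) l : ℂ)) k s
        = quad φ (fun l => (kernel (k - l) l : ℂ)) k (-(c / ρ * s)) := rfl
    rw [h, hq, ← mul_right_inj' (neg_ne_zero.2 hρc), mul_zero]
    push_cast
    field_simp
    constructor <;> intro h <;> linear_combination h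
  constructor
  · intro h s hs
    filter_upwards [h _ hs] with k hk using (key s k).2 hk
  · intro h τ hτ
    have e : -(c / ρ * -(ρ / c * τ)) = τ := by field_simp
    have hs : -(ρ / c * τ) ∈ {s | -(c / ρ * s) ∈ S} := by
      rw [mem_ofPred_eq, e]
      exact hτ
    filter_upwards [h _ hs] with k hk
    have := (key _ k).1 hk
    rwa [e] at this

/-! ### Derivatives and Hilbert transforms of fields on the line -/

section Line
variable {S : Set ℝ} {f : ℝ × ℝ × ℝ → ℝ} {fh : ℝ → ℝ → ℝ → ℂ}

/-- With `κ = 0` the exponential is `1`, so `hker` supplies ordinary multipliers in `θ` for all `η`.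
-/
lemma zero_domain : ∀ η ∈ (univ : Set ℝ), 0 ≤ 0 * η := fun η _ => by rw [zero_mul]

/-- The derivative in `θ` of a field. -/
noncomputable def fieldDeriv (fh : ℝ → ℝ → ℝ → ℂ) : ℝ × ℝ × ℝ → ℝ := lift (hker 0 0 1 0) fh

/-- The Hilbert transform in `θ` of a field. -/
noncomputable def fieldHilbert (fh : ℝ → ℝ → ℝ → ℂ) : ℝ × ℝ × ℝ → ℝ := lift (hker 0 1 0 0) fh

lemma hker_deriv (k η : ℝ) : hker 0 0 1 0 k η = I * k := by simp [hker]

lemma hker_hilbert (k η : ℝ) : hker 0 1 0 0 k η = -(I * Real.sign k) := by simp [hker]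

lemma IsField.fieldDeriv (hf : IsField univ S f fh) (hS : IsOpen S) :
    IsField univ S (fieldDeriv fh) (fun k η τ => hker 0 0 1 0 k η * fh k η τ) :=
  hf.lift hS (isMultiplier_hker zero_domain 0 1 0)

lemma IsField.fieldHilbert (hf : IsField univ S f fh) (hS : IsOpen S) :
    IsField univ S (fieldHilbert fh) (fun k η τ => hker 0 1 0 0 k η * fh k η τ) :=
  hf.lift hS (isMultiplier_hker zero_domain 1 0 0)

lemma IsField.hasDerivAt_line (hf : IsField univ S f fh) (hS : IsOpen S) {τ : ℝ} (hτ : τ ∈ S) (x : ℝ) :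
    HasDerivAt (fun x => f (x, 0, τ)) (PlasmaVacuum.fieldDeriv fh (x, 0, τ)) x := by
  have h1 := (hf.toWave.differentiableAt hS (z := (x, 0, τ)) (by simp) hτ).hasFDerivAt
  have h2 : HasDerivAt (fun x : ℝ => (x, (0 : ℝ), τ)) (1, 0, 0) x :=
    (hasDerivAt_id x).prodMk (hasDerivAt_const x _)
  have h3 := h1.comp_hasDerivAt x h2
  refine h3.congr_deriv ?_
  have e1 := hf.toWave.dTh_eq hS (θ := x) (η := 0) (by simp) hτ
  have e2 := (hf.fieldDeriv hS).repr x 0 (mem_univ _) τ hτ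
  simp only [hker_deriv] at e2
  rw [← e2] at e1
  exact_mod_cast e1

lemma IsField.contDiff_line (hf : IsField univ S f fh) (hS : IsOpen S) {τ : ℝ} (hτ : τ ∈ S) :
    ContDiff ℝ 2 (fun x => f (x, 0, τ)) ∧ ∀ x, iteratedDeriv 2 (fun x => f (x, 0, τ)) x
      = PlasmaVacuum.fieldDeriv (fun k η τ => hker 0 0 1 0 k η * fh k η τ) (x, 0, τ) := by
  have f1 := hf.fieldDeriv hS
  have f2 := f1.fieldDeriv hS
  have d0 : deriv (fun x => f (x, 0, τ)) = fun x => PlasmaVacuum.fieldDeriv fh (x, 0, τ) :=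
    funext fun x => (hf.hasDerivAt_line hS hτ x).deriv
  have d1 : deriv (fun x => PlasmaVacuum.fieldDeriv fh (x, 0, τ)) = _ :=
    funext fun x => (f1.hasDerivAt_line hS hτ x).deriv
  constructor
  · rw [show (2 : WithTop ℕ∞) = 1 + 1 by norm_num, contDiff_succ_iff_deriv]
    refine ⟨fun x => (hf.hasDerivAt_line hS hτ x).differentiableAt, by simp, ?_⟩
    rw [d0, contDiff_one_iff_deriv]
    refine ⟨fun x => (f1.hasDerivAt_line hS hτ x).differentiableAt, ?_⟩
    rw [d1]
    exact continuous_iff_continuousAt.2 fun x => (f2.hasDerivAt_line hS hτ x).continuousAt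
  · intro x
    rw [iteratedDeriv_succ, iteratedDeriv_one, d0, d1]

lemma IsField.isHilbertTransform (hf : IsField univ S f fh) (hS : IsOpen S) {τ : ℝ} (hτ : τ ∈ S) :
    IsHilbertTransform (fun x => f (x, 0, τ)) (fun x => PlasmaVacuum.fieldHilbert fh (x, 0, τ)) := by
  refine isHilbertTransform_of_fourier (hf.toWave.integrable (mem_univ 0) hτ)
    (fun x => hf.repr x 0 (mem_univ _) τ hτ) fun x => ?_
  have := (hf.fieldHilbert hS).repr x 0 (mem_univ _) τ hτ
  simpa only [hker_hilbert] using this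

end Line

/-! ### The amplitude equation in the space variable -/

section Hilbert
variable {S : Set ℝ} {φ₁ : ℝ × ℝ → ℝ} {φh : ℝ → ℝ → ℂ}

/-- The transform of `Φ²`, where `Φ` is the Hilbert transform of `φ`. -/
noncomputable def squareHat (φh : ℝ → ℝ → ℂ) : ℝ → ℝ → ℝ → ℂ :=
  conv (fun k η τ => hker 0 1 0 0 k η * φh k τ) (fun k η τ => hker 0 1 0 0 k η * φh k τ)

/-- The transform of `ρ φ_τ + ½ H[Φ²]_xx + Φ φ_xx`. -/
noncomputable def hilbertHat (ρ : ℝ) (φh : ℝ → ℝ → ℂ) (k η τ : ℝ) : ℂ :=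
  (ρ : ℝ) * deriv (φh k) τ + ((1 / 2 : ℝ) * (hker 0 0 1 0 k η * (hker 0 0 1 0 k η *
      (hker 0 1 0 0 k η * squareHat φh k η τ)))
    + conv (fun k η τ => hker 0 1 0 0 k η * φh k τ)
      (fun k η τ => hker 0 0 1 0 k η * (hker 0 0 1 0 k η * φh k τ)) k η τ)

lemma isField_hilbert (h : IsProfile S φ₁ φh) (hS : IsOpen S) (ρ : ℝ) :
    IsField univ S (fun z => ρ * dTa (fun z => φ₁ (z.1, z.2.2)) z
      + (1 / 2 * fieldDeriv (fun k η τ => hker 0 0 1 0 k η * (hker 0 1 0 0 k η * squareHat φh k η τ)) z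
        + fieldHilbert (fun k _ τ => φh k τ) z
          * fieldDeriv (fun k η τ => hker 0 0 1 0 k η * φh k τ) z)) (hilbertHat ρ φh) := by
  have f0 := h.isField
  have fΦ := f0.fieldHilbert hS
  have fΨ := (((fΦ.mul fΦ hS).fieldHilbert hS).fieldDeriv hS).fieldDeriv hS
  exact ((h.isField_deriv hS).const_mul ρ).add
    ((fΨ.const_mul (1 / 2)).add (fΦ.mul ((f0.fieldDeriv hS).fieldDeriv hS) hS) hS) hS

lemma adm_sign (k : ℝ) : Adm k (fun l => (Real.sign l : ℂ)) ∧ Adm k (fun l => (Real.sign (k - l) : ℂ)) := by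
  have := measurable_sign
  have h : ∀ x y : ℝ, ‖(Real.sign x : ℂ)‖ ≤ (1 + |k - y|) * (1 + |y|) := fun x y => by
    rw [Complex.norm_real]
    exact (abs_sign_le x).trans (one_le_weight k y)
  exact ⟨Adm.of_le (by fun_prop) fun l => h l l, Adm.of_le (by fun_prop) fun l => h (k - l) l⟩

/-- By `kernel_symm` each term is quadratic once the signs of `k - l`, `l` and `k` are fixed, and
the identity is checked for each possible pattern. -/
lemma sign_kernel (k l : ℝ) : Real.sign (k - l) * l ^ 2 + Real.sign l * (k - l) ^ 2
    - k * |k| * Real.sign (k - l) * Real.sign l + 2 * (Real.sign k * kernel (k - l) l) = 0 := by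
  rw [kernel_symm]
  obtain ⟨m, rfl⟩ : ∃ m, k = m + l := ⟨k - l, by ring⟩
  rw [add_sub_cancel_right]
  rcases lt_trichotomy m 0 with h1 | rfl | h1
  rotate_left
  · rw [zero_add, abs_mul_abs_self]
    simp
    ring_nf
    simp
  all_goals
    rcases lt_trichotomy l 0 with h2 | rfl | h2
    rotate_left
    · rw [add_zero, abs_mul_abs_self]
      simp
      ring_nf
      simp
    all_goals
      rcases lt_trichotomy (m + l) 0 with h3 | h3 | h3 <;>
      first
      | (exfalso; linarith)
      | (simp only [h1, h2, h3, Real.sign_of_neg, Real.sign_of_pos, Real.sign_zero, abs_of_neg,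
          abs_of_pos, abs_zero]
         first
         | ring1
         | (obtain rfl : m = -l := by linarith
            ring1))

/-- The symmetrized symbol of `½ℍ[Φ²]_xx + Φφ_xx` is turned into `-i sgn(k)Λ` by `sign_kernel`. -/
lemma hilbertHat_eq {τ k : ℝ} (hg : Good φh τ k) (ρ : ℝ) (η : ℝ) :
    hilbertHat ρ φh k η τ
      = ρ * deriv (φh k) τ - I * Real.sign k * quad φh (fun l => (kernel (k - l) l : ℂ)) k τ := by
  obtain ⟨s1, s2⟩ := adm_sign k
  have e := quad_relation hg ![1, -((k * |k| : ℝ) : ℂ) / 2, (Real.sign k : ℂ)]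
    ![fun l => (Real.sign (k - l) : ℂ) * (l : ℂ) ^ 2, fun l => (Real.sign (k - l) : ℂ) * Real.sign l,
      fun l => (kernel (k - l) l : ℂ)] (by
      intro i
      fin_cases i
      · exact s2.mul (Adm.right.pow 2)
      · exact s2.mul s1
      · exact adm_kernel k) (fun l => by
      have h1 := sign_kernel k l
      have h2 := kernel_symm k l
      have h3 := kernel_symm k (k - l)
      rw [sub_sub_cancel] at h3
      have h4 : kernel l (k - l) = kernel (k - l) l := by rw [h2, h3]; ring
      have h1' := congrArg (fun x : ℝ => (x : ℂ)) h1
      simp only [Fin.sum_univ_three, Matrix.cons_val, sub_sub_cancel, h4]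
      push_cast at h1' ⊢
      linear_combination h1')
  simp only [Fin.sum_univ_three, Matrix.cons_val] at e
  have hc1 : squareHat φh k η τ = -quad φh (fun l => (Real.sign (k - l) : ℂ) * Real.sign l) k τ := by
    rw [squareHat, conv, quad, ← integral_neg]
    congr 1
    funext l
    rw [hker_hilbert, hker_hilbert]
    linear_combination (Real.sign (k - l) * Real.sign l * φh (k - l) τ * φh l τ : ℂ) * Complex.I_sq
  have hc2 : conv (fun k η τ => hker 0 1 0 0 k η * φh k τ)
      (fun k η τ => hker 0 0 1 0 k η * (hker 0 0 1 0 k η * φh k τ)) k η τ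
      = I * quad φh (fun l => (Real.sign (k - l) : ℂ) * (l : ℂ) ^ 2) k τ := by
    rw [← quad_const_mul, conv, quad]
    congr 1
    funext l
    rw [hker_hilbert, hker_deriv]
    linear_combination (-I * Real.sign (k - l) * l ^ 2 * φh (k - l) τ * φh l τ : ℂ) * Complex.I_sq
  have hs := sign_mul_selfC k
  rw [hilbertHat, hc1, hc2, hker_deriv, hker_hilbert]
  push_cast at e ⊢
  generalize quad φh (fun l => (Real.sign (k - l) : ℂ) * Real.sign l) k τ = A at e ⊢
  linear_combination I * e + I * k ^ 2 * Real.sign k * A / 2 * Complex.I_sq - I * k * A / 2 * hs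

lemma profile_time_deriv (h : IsProfile S φ₁ φh) (hS : IsOpen S) (ρ : ℝ) {s : ℝ} (hs : ρ * s ∈ S)
    (x : ℝ) : HasDerivAt (fun r => φ₁ (x, ρ * r))
      (ρ * dTa (fun z => φ₁ (z.1, z.2.2)) (x, 0, ρ * s)) s := by
  have h1 := (h.differentiableAt hS (y := (x, ρ * s)) hs).hasFDerivAt
  have h2 : HasDerivAt (fun r : ℝ => (x, ρ * r)) (0, ρ) s :=
    (hasDerivAt_const s x).prodMk (by simpa using (hasDerivAt_id s).const_mul ρ)
  refine (h1.comp_hasDerivAt s h2).congr_deriv ?_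
  have e : ((0 : ℝ), ρ) = ρ • ((0 : ℝ), (1 : ℝ)) := by simp
  rw [(h.hasPd hS (z := (x, 0, ρ * s)) hs).2.2.2, pTa, e, map_smul, smul_eq_mul]

/-- The amplitude equation in the space variable. -/
lemma hilbertEq_iff (h : IsProfile S φ₁ φh) (hS : IsOpen S) (ρ : ℝ) :
    HilbertEq {s | ρ * s ∈ S} (fun z => φ₁ (z.1, ρ * z.2)) ↔
      ∀ s, ρ * s ∈ S → ∀ᵐ k : ℝ, ρ * deriv (φh k) (ρ * s)
        - I * Real.sign k * quad φh (fun l => (kernel (k - l) l : ℂ)) k (ρ * s) = 0 := by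
  have f0 := h.isField
  have fΦ := f0.fieldHilbert hS
  have fP : IsField univ S _ (squareHat φh) := fΦ.mul fΦ hS
  have fΨ := fP.fieldHilbert hS
  have fE := isField_hilbert h hS ρ
  have hΦ := fun s (hs : ρ * s ∈ S) => f0.isHilbertTransform hS hs
  have hΨ : ∀ s (hs : ρ * s ∈ S), IsHilbertTransform
      (fun x => fieldHilbert (fun k _ τ => φh k τ) (x, 0, ρ * s) ^ 2)
      (fun x => fieldHilbert (squareHat φh) (x, 0, ρ * s)) := fun s hs => by
    simpa only [sq] using fP.isHilbertTransform hS hs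
  have key : ∀ s, ρ * s ∈ S → ((∀ x : ℝ, deriv (fun r => φ₁ (x, ρ * r)) s
      + 1 / 2 * iteratedDeriv 2 (fun y => fieldHilbert (squareHat φh) (y, 0, ρ * s)) x
      + fieldHilbert (fun k _ τ => φh k τ) (x, 0, ρ * s)
        * iteratedDeriv 2 (fun y => φ₁ (y, ρ * s)) x = 0) ↔ ∀ᵐ k : ℝ, ρ * deriv (φh k) (ρ * s)
        - I * Real.sign k * quad φh (fun l => (kernel (k - l) l : ℂ)) k (ρ * s) = 0) := fun s hs => by
    have e : ∀ x : ℝ, deriv (fun r => φ₁ (x, ρ * r)) s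
        + 1 / 2 * iteratedDeriv 2 (fun y => fieldHilbert (squareHat φh) (y, 0, ρ * s)) x
        + fieldHilbert (fun k _ τ => φh k τ) (x, 0, ρ * s)
          * iteratedDeriv 2 (fun y => φ₁ (y, ρ * s)) x = _ := fun x => by
      rw [(profile_time_deriv h hS ρ hs x).deriv, (fΨ.contDiff_line hS hs).2 x,
        (f0.contDiff_line hS hs).2 x, add_assoc]
    simp only [e]
    have hr := fun x => fE.repr x 0 (mem_univ _) (ρ * s) hs
    constructor
    · intro h0
      have := ae_eq_zero_of_fourier (fE.toWave.integrable (mem_univ 0) hs) fun θ => by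
        rw [← hr θ, h0 θ, Complex.ofReal_zero]
      filter_upwards [this, h.ae_good hs] with k hk hg
      rwa [hilbertHat_eq hg] at hk
    · intro h0 x
      have h1 := hr x
      rw [integral_eq_zero_of_ae (by
        filter_upwards [h0, h.ae_good hs] with k hk hg
        rw [hilbertHat_eq hg, hk, zero_mul, Pi.zero_apply])] at h1
      exact_mod_cast h1
  constructor
  · rintro ⟨Φ, Ψ, hE⟩ s hs
    obtain ⟨a1, a2, -, -, a3⟩ := hE s hs
    -- Principal values are unique, so the functions in `HilbertEq` must be the transforms
    -- constructed from multipliers.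
    have u1 := a1.unique (hΦ s hs)
    have u1' : ∀ x, Φ (x, s) = fieldHilbert (fun k _ τ => φh k τ) (x, 0, ρ * s) := fun x => congrFun u1 x
    simp only [u1'] at a2
    have u2 : (fun x => Ψ (x, s)) = _ := a2.unique (hΨ s hs)
    refine (key s hs).1 fun x => ?_
    have := (a3 x).2
    rwa [u2, u1' x] at this
  · intro h0
    refine ⟨fun z => fieldHilbert (fun k _ τ => φh k τ) (z.1, 0, ρ * z.2),
      fun z => fieldHilbert (squareHat φh) (z.1, 0, ρ * z.2), fun s hs => ⟨hΦ s hs, hΨ s hs,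
      (f0.contDiff_line hS hs).1, (fΨ.contDiff_line hS hs).1, fun x =>
      ⟨(profile_time_deriv h hS ρ hs x).differentiableAt, (key s hs).2 (h0 s hs) x⟩⟩⟩

lemma amplitudeEq_iff_hilbertEq {c ρ : ℝ} (hρ : 0 < ρ) (hc : c ≠ 0) (h : IsProfile S φ₁ φh)
    (hS : IsOpen S) : AmplitudeEq c (-ρ) S φh ↔
      HilbertEq {s | c / ρ * s ∈ S} (fun z => φ₁ (z.1, c / ρ * z.2)) := by
  have hρc : (ρ : ℂ) ≠ 0 := by exact_mod_cast hρ.ne'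
  rw [hilbertEq_iff h hS]
  have key : ∀ τ k, (c * deriv (φh k) τ + I * (-ρ : ℝ) * Real.sign k *
        quad φh (fun l => (kernel (k - l) l : ℂ)) k τ = 0 ↔ (c / ρ : ℝ) * deriv (φh k) τ
        - I * Real.sign k * quad φh (fun l => (kernel (k - l) l : ℂ)) k τ = 0) := fun τ k => by
    have e : (c / ρ : ℝ) * deriv (φh k) τ
        - I * Real.sign k * quad φh (fun l => (kernel (k - l) l : ℂ)) k τ
        = (c * deriv (φh k) τ + I * (-ρ : ℝ) * Real.sign k *
          quad φh (fun l => (kernel (k - l) l : ℂ)) k τ) / ρ := by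
      push_cast
      field_simp
      ring
    rw [e, div_eq_zero_iff, or_iff_left hρc]
  constructor
  · intro h0 s hs
    filter_upwards [h0 _ hs] with k hk using (key _ k).1 hk
  · intro h0 τ hτ
    have e : c / ρ * (ρ / c * τ) = τ := by field_simp
    have := h0 (ρ / c * τ) (by rwa [e])
    rw [e] at this
    filter_upwards [this] with k hk using (key _ k).2 hk

end Hilbert

end PlasmaVacuum


/-! ### The theorem -/

open PlasmaVacuum
theorem theorem5p1 (p : Params) (hnu : 0 < p.nu) (hH : p.H0 ≠ 0)
    (hroot : p.d = p.H0 ^ 2 * p.sigma) (hlam : p.nu * |p.lam| < 1)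
    (a b : ℝ) (hab : a < b) :
    -- every solution with a two-term expansion has the stated terms, interface and profile
    (∀ (X : Terms) (U : ℝ → Fin 5 → ℝ × ℝ × ℝ → ℝ) (V : ℝ → Fin 3 → ℝ × ℝ × ℝ → ℝ)
        (φ : ℝ → ℝ × ℝ → ℝ),
      X.Regular (Set.Ioo a b) →
      HasExpansion p (Set.Ioo a b) U V φ X →
      SolvesAsymptotically p (Set.Ioo a b) U V φ →
        X.HasForm p (Set.Ioo a b) ∧
        AmplitudeEq p.c (-(1 + p.sigma)) (Set.Ioo a b) X.phi1h ∧
        ∃ C : ℝ, ∃ ε₀ > 0, ∀ ε : ℝ, 0 < ε → ε < ε₀ → ∀ t x₁ : ℝ, ε * t ∈ Set.Ioo a b →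
          |interface p.lam ε (φ ε) (t, x₁) - ε * X.phi1 (x₁ - p.lam * t, ε * t)| ≤ C * ε ^ 2) ∧
    -- every solution of the amplitude equation, with any second order profile, gives an expansion
    (∀ (φ₁ φ₂ : ℝ × ℝ → ℝ) (φ₁h φ₂h : ℝ → ℝ → ℂ),
      IsProfile (Set.Ioo a b) φ₁ φ₁h → IsProfile (Set.Ioo a b) φ₂ φ₂h →
      AmplitudeEq p.c (-(1 + p.sigma)) (Set.Ioo a b) φ₁h →
        ∃ X : Terms, X.phi1 = φ₁ ∧ X.phi2 = φ₂ ∧ X.phi1h = φ₁h ∧ X.phi2h = φ₂h ∧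
          X.Regular (Set.Ioo a b) ∧ X.HasForm p (Set.Ioo a b) ∧
          SolvesAsymptotically p (Set.Ioo a b) (X.truncU p) (X.truncV p) X.truncPhi) ∧
    -- normal forms of the amplitude equation after rescaling time
    (p.c ≠ 0 → ∀ (φ₁ : ℝ × ℝ → ℝ) (φ₁h : ℝ → ℝ → ℂ), IsProfile (Set.Ioo a b) φ₁ φ₁h →
      (AmplitudeEq p.c (-(1 + p.sigma)) (Set.Ioo a b) φ₁h ↔
        AmplitudeEq 1 1 {s | -(p.c / (1 + p.sigma) * s) ∈ Set.Ioo a b}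
          (fun k s => φ₁h k (-(p.c / (1 + p.sigma) * s)))) ∧
      (AmplitudeEq p.c (-(1 + p.sigma)) (Set.Ioo a b) φ₁h ↔
        HilbertEq {s | p.c / (1 + p.sigma) * s ∈ Set.Ioo a b}
          (fun z => φ₁ (z.1, p.c / (1 + p.sigma) * z.2)))) := by
  obtain ⟨hσ, hσ2⟩ := sigma_pos hnu hlam
  have hd := d_pos hH hσ hroot
  have hw := w_ne_zero hd
  have hS : IsOpen (Set.Ioo a b) := isOpen_Ioo
  refine ⟨fun X U V φ hX hE hs => ?_, fun φ₁ φ₂ φ₁h φ₂h h₁ h₂ h => ?_, fun hc φ₁ φ₁h h₁ => ⟨?_, ?_⟩⟩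
  · obtain ⟨hF, hA⟩ := form_of_vanish hσ hσ2 hroot hd.ne' hw hS hX (vanish_of_solves hS hX hE hs)
    exact ⟨hF, hA, interface_expansion hS hX hE⟩
  · exact ⟨model p φ₁ φ₂ φ₁h φ₂h, rfl, rfl, rfl, rfl, regular_model hσ hS h₁ h₂,
      hasForm_model hσ hd.ne' hw h₁, solves_model hσ hσ2 hroot hd.ne' hS h₁ h₂ h⟩
  · exact amplitudeEq_rescale (by linarith) hc _ _
  · exact amplitudeEq_iff_hilbertEq (by linarith) hc h₁ hS
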